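/- Let $N\ge 2$, let $2-N<b<a$ be real, and let $W(x)=\frac{|x|^a}{a}-\frac{|x|^b}{b}$ on $\mathbb R^N$, with the convention that $|x|^c/c$ means $\log|x|$ when $c=0$. Let $$\omega(r,\eta)=-\frac1{\sigma_N}\int_{\partial B(0,1)}\nabla W(re_1-\eta y)\cdot e_1\,d\sigma(y),$$ where $\sigma_N$ is the area of the unit sphere; let $\mathbb R_+=(0,\infty)$, $\mathcal D=\{(r,r):r>0\}$, and let $\delta_R$ be the uniform probability measure on $\partial B(0,R)$. A probability measure $\mu$ is a steady state of $\partial_t\mu+\mathrm{div}(\mu v)=0$, $v=-\nabla W*\mu$, if $\nabla W*\mu$ is well defined and vanishes on $\mathrm{supp}\,\mu$. For a radial probability measure $\mu$ on $\mathbb R^N$, $\hat\mu$ denotes the law of $|x|$ under $\mu$; the radial form of the equation is $\partial_t\hat\mu+\partial_r(\hat\mu\hat v)=0$, $\hat v(t,r)=\int\omega(r,\eta)\,d\hat\mu_t(\eta)$, in the sense of distributions on $(0,\infty)\times(0,\infty)$. For $p\ge1$, $d_p$ is the Monge–Kantorovich distance of order $p$. Put $$R_{ab}=\frac12\left(\frac{\beta\left(\frac{b+N-1}2,\frac{N-1}2\right)}{\beta\left(\frac{a+N-1}2,\frac{N-1}2\right)}\right)^{\frac1{a-b}},\qquad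 b^*=\frac{3a-Na-10+7N-N^2}{a+N-3}\quad(a\neq 3-N).$$ Then $R_{ab}>0$, and for $R>0$ the shell $\delta_R$ is a steady state if and only if $R=R_{ab}$. Moreover: (i) If $b\le 3-N$, then $\omega\in C(\mathbb R_+^2)\cap C^1(\mathbb R_+^2\setminus\mathcal D)$ and, for every $R>0$, $\partial_1\omega(r,\eta)\to+\infty$ as $(r,\eta)\to(R,R)$ with $r\ne\eta$. (ii) If $3-N<b<b^*$, then $\omega\in C^1(\mathbb R_+^2)$ and $\partial_1\omega(R_{ab},R_{ab})>0$. (iii) If $a>3-N$ and $b>b^*$, then $\omega\in C^1(\mathbb R_+^2)$, $\partial_1\omega(R_{ab},R_{ab})<0$ and $(\partial_1\omega+\partial_2\omega)(R_{ab},R_{ab})<0$. Instability. Assume $b\le 3-N$ or $b<b^*$, and let $1\le p\le\infty$. Then no weakly continuous curve $(\mu_t)_{t\ge0}$ of radial probability measures with densities in $L^p$ and with supports bounded uniformly on bounded time intervals, solving the radial equation, converges weakly as measures to $\delta_{R_{ab}}$ as $t\to\infty$. Stability. Assume $a>3-N$ and $b>b^*$, and write $R=R_{ab}$. Call a solution $(\mu_t)_{t\ge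 0}$ of the radial equation regular if the $\mu_t$ are radial probability measures with finite second moment, $t\mapsto\mu_t$ is locally absolutely continuous for $d_2$, $\hat v(t,\cdot)$ is defined by convergent integrals and $\int_0^T\!\int|\hat v|^2d\hat\mu_t\,dt<\infty$ for all $T$, $t\mapsto\int r\,d\hat\mu_t$ is locally absolutely continuous with derivative $\int\hat v\,d\hat\mu_t$ for a.e. $t$, and, whenever $\hat\mu_0$ has compact support, so has every $\hat\mu_t$, and $r_1(t)=\min\mathrm{supp}\,\hat\mu_t$, $r_2(t)=\max\mathrm{supp}\,\hat\mu_t$ are locally absolutely continuous with $r_i'(t)=\hat v(t,r_i(t))$ for a.e. $t$. (a) There is $\varepsilon>0$ such that for every regular solution with $\mathrm{supp}\,\hat\mu_0\subset[R-\varepsilon,R+\varepsilon]$ and every $0<\gamma<-\max\{\partial_1\omega(R,R),(\partial_1\omega+\partial_2\omega)(R,R)\}$ there is $C$ with $d_2(\hat\mu_t,\delta_{\{R\}})\le Ce^{-\gamma t}$ for all $t\ge0$, where $\delta_{\{R\}}$ is the Dirac mass at the point $R\in\mathbb R$. (b) Suppose moreover that $\alpha\ge1$ and $\lambda>0$ are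 such that $\omega(\cdot,R)>0$ on $(0,R)$, $\omega(\cdot,R)<0$ on $(R,\infty)$, $\partial_1\omega(0,R)>0$, and, for all $r,\eta>0$: $\omega(r,\eta)\le\frac1\lambda-\lambda r^\alpha$ if $|\eta-R|\le\lambda$; $|\partial_1\omega(r,\eta)|\le\frac1\lambda(1+\eta^\alpha)$ if $r\le\lambda$; $|\omega(r,\eta)|\le\frac1\lambda(1+r^\alpha)(1+\eta^\alpha)$. Then there is $\varepsilon>0$ such that $d_\alpha(\hat\mu_t,\delta_{\{R\}})\to0$ as $t\to\infty$ for every regular solution with $\hat\mu_0(\{0\})=0$ and $d_\alpha(\hat\mu_0,\delta_{\{R\}})<\varepsilon$ for which, for every $\xi\in(0,1)$, the pseudo-inverse $\varphi(t,\xi)=\inf\{r\ge0:\hat\mu_t([0,r])\ge\xi\}$ is locally absolutely continuous in $t$ with $\partial_t\varphi(t,\xi)=\hat v(t,\varphi(t,\xi))$ for a.e. $t$. -/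

import Mathlib

open MeasureTheory Set Filter Topology
open scoped ENNReal BoundedContinuousFunction

namespace RadialShell

noncomputable section

/-! ### Potential, kernel, shells, steady states -/

/-- `r ^ c / c`, with the usual convention that this is `log r` for `c = 0`
(in every case the derivative is `r ^ (c - 1)`). -/
def powerTerm (c r : ℝ) : ℝ := if c = 0 then Real.log r else r ^ c / c

/-- The power-law potential `W(x) = |x|^a / a - |x|^b / b` on `ℝ^N`. -/
def powerPotential (N : ℕ) (a b : ℝ) (x : EuclideanSpace ℝ (Fin N)) : ℝ :=
  powerTerm a ‖x‖ - powerTerm b ‖x‖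

/-- Surface measure on the unit sphere of `ℝ^N`. -/
def sphereMeasure (N : ℕ) : Measure (Metric.sphere (0 : EuclideanSpace ℝ (Fin N)) 1) :=
  (volume : Measure (EuclideanSpace ℝ (Fin N))).toSphere

/-- The area of the unit sphere of `ℝ^N`. -/
def sphereArea (N : ℕ) : ℝ := (sphereMeasure N).real univ

/-- The first vector of the canonical basis of `ℝ^N`. -/
def e₁ (N : ℕ) : EuclideanSpace ℝ (Fin N) :=
  WithLp.toLp 2 (fun i : Fin N => if (i : ℕ) = 0 then (1 : ℝ) else 0)

/-- The kernel `ω(r, η) = -(1 / σ_N) ∫_{∂B(0,1)} ∇W(r e₁ - η y) · e₁ dσ(y)`. -/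
def kernel (N : ℕ) (W : EuclideanSpace ℝ (Fin N) → ℝ) (r η : ℝ) : ℝ :=
  -((sphereArea N)⁻¹ * ∫ y : Metric.sphere (0 : EuclideanSpace ℝ (Fin N)) 1,
      inner ℝ (gradient W (r • e₁ N - η • (y : EuclideanSpace ℝ (Fin N)))) (e₁ N)
        ∂(sphereMeasure N))

/-- `∂₁ω(r, η)`. -/
def partial₁ (ω : ℝ → ℝ → ℝ) (r η : ℝ) : ℝ := deriv (fun s => ω s η) r

/-- `∂₂ω(r, η)`. -/
def partial₂ (ω : ℝ → ℝ → ℝ) (r η : ℝ) : ℝ := deriv (fun s => ω r s) η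

/-- The open quadrant `(0, ∞) × (0, ∞)`. -/
def quadrant : Set (ℝ × ℝ) := Ioi 0 ×ˢ Ioi 0

/-- The diagonal of the plane. -/
def diag : Set (ℝ × ℝ) := {q | q.1 = q.2}

/-- The spherical shell `δ_R`: the uniform probability measure on `∂B(0, R)`. -/
def shell (N : ℕ) (R : ℝ) : Measure (EuclideanSpace ℝ (Fin N)) :=
  (ENNReal.ofReal (sphereArea N))⁻¹ •
    (sphereMeasure N).map (fun y : Metric.sphere (0 : EuclideanSpace ℝ (Fin N)) 1 =>
      R • (y : EuclideanSpace ℝ (Fin N)))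

/-- `μ` is a steady state of `∂_t μ + div (μ v) = 0`, `v = -∇W * μ`: the velocity field is
well defined and vanishes at every point of the support of `μ`. -/
def IsSteadyState {N : ℕ} (W : EuclideanSpace ℝ (Fin N) → ℝ)
    (μ : Measure (EuclideanSpace ℝ (Fin N))) : Prop :=
  ∀ x ∈ μ.support, Integrable (fun y => gradient W (x - y)) μ ∧
    -(∫ y, gradient W (x - y) ∂μ) = 0

/-- The radius `R_ab`. -/
def shellRadius (N : ℕ) (a b : ℝ) : ℝ :=
  1 / 2 * (ProbabilityTheory.beta ((b + N - 1) / 2) (((N : ℝ) - 1) / 2) /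
    ProbabilityTheory.beta ((a + N - 1) / 2) (((N : ℝ) - 1) / 2)) ^ (1 / (a - b))

/-- The critical exponent `b*(a, N)`. -/
def criticalExponent (N : ℕ) (a : ℝ) : ℝ :=
  (3 * a - N * a - 10 + 7 * N - (N : ℝ) ^ 2) / (a + N - 3)

/-! ### Radial solutions -/

/-- Invariance under all linear isometries. -/
def IsRadial {N : ℕ} (μ : Measure (EuclideanSpace ℝ (Fin N))) : Prop :=
  ∀ g : EuclideanSpace ℝ (Fin N) ≃ₗᵢ[ℝ] EuclideanSpace ℝ (Fin N), μ.map g = μ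

/-- The law of `|x|` under `μ`, as a measure on `ℝ` carried by `[0, ∞)`. -/
def radialPart {N : ℕ} (μ : Measure (EuclideanSpace ℝ (Fin N))) : Measure ℝ :=
  μ.map (fun x => ‖x‖)

/-- The radial velocity at `r` generated by a measure `ν` of radii: `∫ ω(r, η) dν(η)`. -/
def radialVelocity (ω : ℝ → ℝ → ℝ) (ν : Measure ℝ) (r : ℝ) : ℝ := ∫ η, ω r η ∂ν

/-- The radial parts of `μ_t` satisfy `∂_t ν + ∂_r (ν v) = 0`, `v = ∫ ω(·, η) dν_t(η)`, in the
sense of distributions on `(0, ∞) × (0, ∞)` (time × radius). -/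
def SolvesRadialEquation {N : ℕ} (ω : ℝ → ℝ → ℝ)
    (μ : ℝ → Measure (EuclideanSpace ℝ (Fin N))) : Prop :=
  ∀ φ : ℝ × ℝ → ℝ, ContDiff ℝ (⊤ : ℕ∞) φ → HasCompactSupport φ →
    tsupport φ ⊆ Ioi 0 ×ˢ Ioi 0 →
    ∫ t in Ioi (0 : ℝ), ∫ r, (fderiv ℝ φ (t, r) (1, 0) +
      radialVelocity ω (radialPart (μ t)) r * fderiv ℝ φ (t, r) (0, 1)) ∂(radialPart (μ t)) = 0

/-- A global radially symmetric `L^p` solution: a weakly continuous curve of radial probability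
measures with densities in `L^p` and compact supports (uniformly on bounded time intervals),
satisfying the radial equation in the sense of distributions. -/
structure IsRadialLpSolution {N : ℕ} (ω : ℝ → ℝ → ℝ) (p : ℝ≥0∞)
    (μ : ℝ → Measure (EuclideanSpace ℝ (Fin N))) : Prop where
  isProbabilityMeasure : ∀ t, 0 ≤ t → IsProbabilityMeasure (μ t)
  isRadial : ∀ t, 0 ≤ t → IsRadial (μ t)
  density : ∀ t, 0 ≤ t → ∃ ρ : EuclideanSpace ℝ (Fin N) → ℝ, (∀ x, 0 ≤ ρ x) ∧
    MemLp ρ p volume ∧ μ t = volume.withDensity (fun x => ENNReal.ofReal (ρ x))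
  compactSupport : ∀ T, 0 < T → ∃ M : ℝ, ∀ t ∈ Icc 0 T, μ t (Metric.closedBall 0 M)ᶜ = 0
  continuous : ∀ f : EuclideanSpace ℝ (Fin N) →ᵇ ℝ,
    ContinuousOn (fun t => ∫ x, f x ∂(μ t)) (Ici 0)
  equation : SolvesRadialEquation ω μ

/-- Weak convergence as measures, `μ_t ⇀ ν` as `t → ∞`. -/
def ConvergesWeakly {N : ℕ} (μ : ℝ → Measure (EuclideanSpace ℝ (Fin N)))
    (ν : Measure (EuclideanSpace ℝ (Fin N))) : Prop :=
  ∀ f : EuclideanSpace ℝ (Fin N) →ᵇ ℝ,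
    Tendsto (fun t => ∫ x, f x ∂(μ t)) atTop (𝓝 (∫ x, f x ∂ν))

/-- Fattening instability of `δ_R`: no radial `L^p` solution converges weakly to it. -/
def IsUnstableShell (N : ℕ) (W : EuclideanSpace ℝ (Fin N) → ℝ) (R : ℝ) : Prop :=
  ∀ p : ℝ≥0∞, 1 ≤ p → ∀ μ : ℝ → Measure (EuclideanSpace ℝ (Fin N)),
    IsRadialLpSolution (kernel N W) p μ → ¬ ConvergesWeakly μ (shell N R)

/-- The transport distance `d_p`, `1 ≤ p < ∞`: infimum over couplings. -/
def transportDist {X : Type*} [MeasurableSpace X] [PseudoEMetricSpace X] (p : ℝ)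
    (μ ν : Measure X) : ℝ≥0∞ :=
  (⨅ π : {π : Measure (X × X) // π.map Prod.fst = μ ∧ π.map Prod.snd = ν},
    ∫⁻ z, edist z.1 z.2 ^ p ∂π.1) ^ (1 / p)

/-- The function `f` is absolutely continuous on every `[0, T]`, and
`f'(t) = F t` for almost every `t > 0`. -/
def SolvesODE (f F : ℝ → ℝ) : Prop :=
  (∀ T, 0 < T → AbsolutelyContinuousOnInterval f 0 T) ∧
    ∀ᵐ t ∂(volume.restrict (Ioi (0 : ℝ))), HasDerivAt f (F t) t

/-- Radial solutions with minimal regularity: curves of radial probability measures with finite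
second moment, absolutely continuous for `d_2`, with square integrable velocity, solving the radial
equation in the sense of distributions, whose mean radius obeys the expected evolution law, and
such that, for compactly supported initial data, the extreme radii of the support follow the
velocity field. -/
structure IsRegularRadialSolution {N : ℕ} (ω : ℝ → ℝ → ℝ)
    (μ : ℝ → Measure (EuclideanSpace ℝ (Fin N))) : Prop where
  isProbabilityMeasure : ∀ t, 0 ≤ t → IsProbabilityMeasure (μ t)
  isRadial : ∀ t, 0 ≤ t → IsRadial (μ t)
  secondMoment : ∀ t, 0 ≤ t → Integrable (fun x => ‖x‖ ^ 2) (μ t)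
  absolutelyContinuous : ∀ T, 0 < T → ∃ m : ℝ → ℝ, IntervalIntegrable m volume 0 T ∧
    ∀ s t, 0 ≤ s → s ≤ t → t ≤ T →
      transportDist 2 (μ s) (μ t) ≤ ENNReal.ofReal (∫ τ in s..t, m τ)
  velocity_integrable : ∀ t, 0 ≤ t → ∀ r, 0 < r → Integrable (fun η => ω r η) (radialPart (μ t))
  velocity_sq : ∀ T, 0 < T → ∫⁻ t in Ioc 0 T, ∫⁻ r,
    ENNReal.ofReal (radialVelocity ω (radialPart (μ t)) r ^ 2) ∂(radialPart (μ t)) < ⊤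
  equation : SolvesRadialEquation ω μ
  mean : SolvesODE (fun t => ∫ r, r ∂(radialPart (μ t)))
    (fun t => ∫ r, radialVelocity ω (radialPart (μ t)) r ∂(radialPart (μ t)))
  extremes : IsCompact (radialPart (μ 0)).support →
    (∀ t, 0 ≤ t → IsCompact (radialPart (μ t)).support) ∧
    SolvesODE (fun t => sInf (radialPart (μ t)).support)
      (fun t => radialVelocity ω (radialPart (μ t)) (sInf (radialPart (μ t)).support)) ∧
    SolvesODE (fun t => sSup (radialPart (μ t)).support)
      (fun t => radialVelocity ω (radialPart (μ t)) (sSup (radialPart (μ t)).support))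

/-- Pseudo-inverse of the distribution function of a measure on `[0, ∞)`. -/
def pseudoInverse (ν : Measure ℝ) (ξ : ℝ) : ℝ :=
  sInf {r : ℝ | 0 ≤ r ∧ ENNReal.ofReal ξ ≤ ν (Icc 0 r)}

/-- The pseudo-inverse `φ(t, ξ)` of the distribution function of the radial part of `μ_t` satisfies
`∂_t φ(t, ξ) = v(t, φ(t, ξ))`. -/
def PseudoInverseEquation {N : ℕ} (ω : ℝ → ℝ → ℝ)
    (μ : ℝ → Measure (EuclideanSpace ℝ (Fin N))) : Prop :=
  ∀ ξ ∈ Ioo (0 : ℝ) 1, SolvesODE (fun t => pseudoInverse (radialPart (μ t)) ξ)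
    (fun t => radialVelocity ω (radialPart (μ t)) (pseudoInverse (radialPart (μ t)) ξ))

/-- Radial perturbations supported near `∂B(0, R)` return to `δ_R` exponentially fast. -/
def IsExpStableShell (N : ℕ) (W : EuclideanSpace ℝ (Fin N) → ℝ) (R : ℝ) : Prop :=
  ∃ ε : ℝ, 0 < ε ∧ ∀ μ : ℝ → Measure (EuclideanSpace ℝ (Fin N)),
    IsRegularRadialSolution (kernel N W) μ →
    (radialPart (μ 0)).support ⊆ Icc (R - ε) (R + ε) →
    ∀ γ : ℝ, 0 < γ →
      γ < -max (partial₁ (kernel N W) R R)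
        (partial₁ (kernel N W) R R + partial₂ (kernel N W) R R) →
      ∃ C : ℝ, ∀ t, 0 ≤ t →
        transportDist 2 (radialPart (μ t)) (Measure.dirac R) ≤
          ENNReal.ofReal (C * Real.exp (-γ * t))

/-- Confinement by the velocity field of `δ_R` and long-range controls on the kernel. -/
structure ConfinementControls (ω : ℝ → ℝ → ℝ) (R α lam : ℝ) : Prop where
  inside : ∀ r ∈ Ioo 0 R, 0 < ω r R
  outside : ∀ r ∈ Ioi R, ω r R < 0
  origin : 0 < partial₁ ω 0 R
  upper : ∀ r, 0 < r → ∀ η, 0 < η → η ∈ Icc (R - lam) (R + lam) →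
    ω r η ≤ 1 / lam - lam * r ^ α
  derivative : ∀ r ∈ Ioc 0 lam, ∀ η, 0 < η → |partial₁ ω r η| ≤ 1 / lam * (1 + η ^ α)
  growth : ∀ r, 0 < r → ∀ η, 0 < η → |ω r η| ≤ 1 / lam * (1 + r ^ α) * (1 + η ^ α)

/-- Stability of `δ_R` in `d_α` for radial perturbations that may have tails. -/
def IsStableShell (N : ℕ) (W : EuclideanSpace ℝ (Fin N) → ℝ) (R α : ℝ) : Prop :=
  ∃ ε : ℝ, 0 < ε ∧ ∀ μ : ℝ → Measure (EuclideanSpace ℝ (Fin N)),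
    IsRegularRadialSolution (kernel N W) μ → PseudoInverseEquation (kernel N W) μ →
    radialPart (μ 0) {0} = 0 →
    transportDist α (radialPart (μ 0)) (Measure.dirac R) < ENNReal.ofReal ε →
    Tendsto (fun t => transportDist α (radialPart (μ t)) (Measure.dirac R)) atTop (𝓝 0)

end

end RadialShell

namespace RadialShell

noncomputable section

/-! ### Integration over the unit sphere -/

section Sphere

set_option linter.unusedSectionVars false

variable {E : Type*} [NormedAddCommGroup E] [InnerProductSpace ℝ E] [FiniteDimensional ℝ E]
  [MeasurableSpace E] [BorelSpace E]

/-- A linear isometry acting on the unit sphere. -/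
def sphereMap (g : E ≃ₗᵢ[ℝ] E) (y : Metric.sphere (0 : E) 1) : Metric.sphere (0 : E) 1 :=
  ⟨g y, by simp⟩

theorem continuous_sphereMap (g : E ≃ₗᵢ[ℝ] E) : Continuous (sphereMap g) :=
  (g.continuous.comp continuous_subtype_val).subtype_mk _

open scoped Pointwise in
theorem toSphere_map_sphereMap (g : E ≃ₗᵢ[ℝ] E) :
    (volume : Measure E).toSphere.map (sphereMap g) = (volume : Measure E).toSphere := by
  ext s hs
  have hg := (continuous_sphereMap g).measurable
  rw [Measure.map_apply hg hs, Measure.toSphere_apply' _ (hg hs), Measure.toSphere_apply' _ hs]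
  congr 1
  rw [← g.measurePreserving.measure_preimage_emb g.toHomeomorph.measurableEmbedding
    (Ioo (0 : ℝ) 1 • (Subtype.val '' s))]
  congr 1
  ext x
  simp only [Set.mem_smul, mem_image, mem_preimage]
  constructor
  · rintro ⟨t, ht, -, ⟨y, hy, rfl⟩, rfl⟩
    exact ⟨t, ht, _, ⟨_, hy, rfl⟩, by simp [sphereMap]⟩
  · rintro ⟨t, ht, -, ⟨y, hy, rfl⟩, h⟩
    refine ⟨t, ht, _, ⟨sphereMap g.symm y, ?_, rfl⟩, ?_⟩
    · convert! hy
      ext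
      simp [sphereMap]
    · apply g.injective
      simp [sphereMap, ← h]

theorem measurePreserving_sphereMap (g : E ≃ₗᵢ[ℝ] E) :
    MeasurePreserving (sphereMap g) (volume : Measure E).toSphere (volume : Measure E).toSphere :=
  ⟨(continuous_sphereMap g).measurable, toSphere_map_sphereMap g⟩

theorem measurableEmbedding_sphereMap (g : E ≃ₗᵢ[ℝ] E) : MeasurableEmbedding (sphereMap g) :=
  (continuous_sphereMap g).measurableEmbedding fun _ _ h =>
    Subtype.ext (g.injective (congrArg Subtype.val h))

theorem integral_comp_sphereMap {F : Type*} [NormedAddCommGroup F] [NormedSpace ℝ F]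
    (g : E ≃ₗᵢ[ℝ] E) (f : Metric.sphere (0 : E) 1 → F) :
    ∫ y, f (sphereMap g y) ∂(volume : Measure E).toSphere =
      ∫ y, f y ∂(volume : Measure E).toSphere :=
  (measurePreserving_sphereMap g).integral_comp (measurableEmbedding_sphereMap g) f

theorem lintegral_fun_norm [Nontrivial E] {f : ℝ → ℝ≥0∞} (hf : Measurable f) :
    ∫⁻ x : E, f ‖x‖ = (volume : Measure E).toSphere univ *
      ∫⁻ s in Ioi (0 : ℝ), ENNReal.ofReal (s ^ (Module.finrank ℝ E - 1)) * f s := by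
  calc ∫⁻ x : E, f ‖x‖ = ∫⁻ x : ({(0 : E)}ᶜ : Set E), f ‖x.1‖ ∂((volume : Measure E).comap (↑)) := by
        rw [lintegral_subtype_comap (measurableSet_singleton _).compl (fun x : E => f ‖x‖),
          restrict_compl_singleton]
    _ = ∫⁻ x, f x.2 ∂(volume : Measure E).toSphere.prod (.volumeIoiPow (Module.finrank ℝ E - 1)) := by
        simpa using (volume : Measure E).measurePreserving_homeomorphUnitSphereProd.lintegral_comp_emb
          (Homeomorph.measurableEmbedding _) (f ∘ Subtype.val ∘ Prod.snd)
    _ = (volume : Measure E).toSphere univ *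
        ∫⁻ s, f s ∂(Measure.volumeIoiPow (Module.finrank ℝ E - 1)) := by
        rw [lintegral_prod _ (by fun_prop)]
        simp [mul_comm]
    _ = _ := by
        rw [Measure.volumeIoiPow, lintegral_withDensity_eq_lintegral_mul _ (by fun_prop) (by fun_prop)]
        rw [← lintegral_subtype_comap measurableSet_Ioi
          (fun s : ℝ => ENNReal.ofReal (s ^ (Module.finrank ℝ E - 1)) * f s)]
        rfl

end Sphere

/-- The splitting `ℝ^(n+1) ≃ ℝ × ℝ^n` along the first coordinate preserves Lebesgue measure. -/
theorem measurePreserving_split (n : ℕ) :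
    MeasurePreserving (fun x : EuclideanSpace ℝ (Fin (n + 1)) =>
      ((x 0, WithLp.toLp 2 (fun i : Fin n => x i.succ)) : ℝ × EuclideanSpace ℝ (Fin n))) := by
  have h1 := PiLp.volume_preserving_ofLp (Fin (n + 1))
  have h2 := volume_preserving_piFinSuccAbove (fun _ : Fin (n + 1) => ℝ) 0
  have h3 : MeasurePreserving (Prod.map id (WithLp.toLp 2) : ℝ × (Fin n → ℝ) → ℝ × EuclideanSpace ℝ (Fin n)) :=
    (MeasurePreserving.id _).prod (PiLp.volume_preserving_toLp (Fin n))
  exact h3.comp (h2.comp h1)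

theorem lintegral_split (n : ℕ) {f : ℝ → ℝ → ℝ≥0∞} (hf : Measurable (Function.uncurry f)) :
    ∫⁻ x : EuclideanSpace ℝ (Fin (n + 2)), f (x 0) ‖x‖ =
      (volume : Measure (EuclideanSpace ℝ (Fin (n + 1)))).toSphere univ *
        ∫⁻ t : ℝ, ∫⁻ s in Ioi (0 : ℝ), ENNReal.ofReal (s ^ n) * f t (√(t ^ 2 + s ^ 2)) := by
  have h := (measurePreserving_split (n + 1)).lintegral_comp
    (f := fun q => f q.1 (√(q.1 ^ 2 + ‖q.2‖ ^ 2))) (by fun_prop)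
  have h0 : ∀ x : EuclideanSpace ℝ (Fin (n + 2)),
      ‖x‖ = √(x 0 ^ 2 + ‖(WithLp.toLp 2 (fun i : Fin (n + 1) => x i.succ) :
        EuclideanSpace ℝ (Fin (n + 1)))‖ ^ 2) := by
    intro x
    rw [EuclideanSpace.norm_sq_eq, EuclideanSpace.norm_eq, Fin.sum_univ_succ]
    simp
  simp_rw [← h0] at h
  rw [h, Measure.volume_eq_prod, lintegral_prod _ (by fun_prop), ← lintegral_const_mul]
  · refine lintegral_congr fun t => ?_
    have := lintegral_fun_norm (E := EuclideanSpace ℝ (Fin (n + 1)))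
      (f := fun s => f t (√(t ^ 2 + s ^ 2))) (by fun_prop)
    simpa using this
  · have : Measurable (Function.uncurry fun (t s : ℝ) =>
      ENNReal.ofReal (s ^ n) * f t (√(t ^ 2 + s ^ 2))) := by
      simp only [Function.uncurry_def]
      fun_prop
    exact this.lintegral_prod_right'

theorem lintegral_half_plane (n : ℕ) {S : Set ℝ} (hS : MeasurableSet S) :
    ∫⁻ t : ℝ, ∫⁻ s in Ioi (0 : ℝ), ENNReal.ofReal (s ^ n) *
        ({q : ℝ × ℝ | 0 < q.2 ∧ q.2 < 1 ∧ q.1 / q.2 ∈ S}.indicator 1 (t, √(t ^ 2 + s ^ 2)) : ℝ≥0∞) =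
      (∫⁻ r in Ioo (0 : ℝ) 1, ENNReal.ofReal (r ^ (n + 1))) *
        ∫⁻ θ in Ioo 0 Real.pi, ENNReal.ofReal (Real.sin θ ^ n) * S.indicator 1 (Real.cos θ) := by
  set T : Set (ℝ × ℝ) := {q : ℝ × ℝ | 0 < q.2 ∧ q.2 < 1 ∧ q.1 / q.2 ∈ S} with hT
  have hTm : MeasurableSet T := by
    refine (measurableSet_lt measurable_const measurable_snd).inter
      ((measurableSet_lt measurable_snd measurable_const).inter ?_)
    exact (measurable_fst.div measurable_snd) hS
  have hTi : Measurable (T.indicator (1 : ℝ × ℝ → ℝ≥0∞)) := measurable_one.indicator hTm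
  set F : ℝ × ℝ → ℝ≥0∞ := fun p => (Ioi (0 : ℝ)).indicator (fun s => ENNReal.ofReal (s ^ n) *
        (T.indicator 1 (p.1, √(p.1 ^ 2 + s ^ 2)) : ℝ≥0∞)) p.2 with hF
  have hFm : Measurable F := by
    have : F = (univ ×ˢ Ioi (0 : ℝ)).indicator (fun p => ENNReal.ofReal (p.2 ^ n) *
        (T.indicator 1 (p.1, √(p.1 ^ 2 + p.2 ^ 2)) : ℝ≥0∞)) := by
      ext p
      simp [hF, indicator]
    rw [this]
    refine Measurable.indicator ?_ (MeasurableSet.univ.prod measurableSet_Ioi)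
    exact (by fun_prop : Measurable fun p : ℝ × ℝ => ENNReal.ofReal (p.2 ^ n)).mul
      (hTi.comp (by fun_prop : Measurable fun p : ℝ × ℝ => (p.1, √(p.1 ^ 2 + p.2 ^ 2))))
  have h1 : ∫⁻ t : ℝ, ∫⁻ s in Ioi (0 : ℝ), ENNReal.ofReal (s ^ n) *
        (T.indicator 1 (t, √(t ^ 2 + s ^ 2)) : ℝ≥0∞) = ∫⁻ p, F p := by
    rw [Measure.volume_eq_prod, lintegral_prod _ hFm.aemeasurable]
    refine lintegral_congr fun t => ?_
    rw [← lintegral_indicator measurableSet_Ioi]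
  rw [h1, ← lintegral_comp_polarCoord_symm, polarCoord_target, Measure.volume_eq_prod,
    ← Measure.prod_restrict, ← lintegral_mul_const _ (by fun_prop),
    lintegral_prod _ (by
      have : Measurable (fun p : ℝ × ℝ => F (polarCoord.symm p)) :=
        hFm.comp continuous_polarCoord_symm.measurable
      exact ((by fun_prop : Measurable fun p : ℝ × ℝ => ENNReal.ofReal p.1).mul this).aemeasurable)]
  have hsub : Ioo (0 : ℝ) 1 ⊆ Ioi 0 := fun x hx => hx.1
  rw [← lintegral_indicator measurableSet_Ioi, ← lintegral_indicator measurableSet_Ioo]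
  refine lintegral_congr fun r => ?_
  by_cases hr : 0 < r
  swap
  · rw [indicator_of_notMem (by simpa using hr), indicator_of_notMem (by simp [hr])]
  rw [indicator_of_mem (show r ∈ Ioi 0 from hr)]
  by_cases hr1 : r < 1
  · rw [indicator_of_mem (show r ∈ Ioo 0 1 from ⟨hr, hr1⟩), ← lintegral_const_mul _ (by
      exact (by fun_prop : Measurable fun θ : ℝ => ENNReal.ofReal (Real.sin θ ^ n)).mul
        ((measurable_one.indicator hS).comp Real.measurable_cos))]
    rw [← lintegral_indicator measurableSet_Ioo, ← lintegral_indicator measurableSet_Ioo]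
    refine lintegral_congr fun θ => ?_
    by_cases hθ : θ ∈ Ioo 0 Real.pi
    · have hs := Real.sin_pos_of_mem_Ioo hθ
      have hθ' : θ ∈ Ioo (-Real.pi) Real.pi := ⟨by linarith [hθ.1, Real.pi_pos], hθ.2⟩
      rw [indicator_of_mem hθ, indicator_of_mem hθ']
      simp only [hF, polarCoord_symm_apply, smul_eq_mul]
      rw [indicator_of_mem (show r * Real.sin θ ∈ Ioi 0 by simp only [mem_Ioi]; positivity)]
      have : √((r * Real.cos θ) ^ 2 + (r * Real.sin θ) ^ 2) = r := by
        rw [show (r * Real.cos θ) ^ 2 + (r * Real.sin θ) ^ 2 =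
          r ^ 2 * (Real.sin θ ^ 2 + Real.cos θ ^ 2) by ring, Real.sin_sq_add_cos_sq, mul_one,
          Real.sqrt_sq hr.le]
      rw [this]
      have h3 : (T.indicator 1 (r * Real.cos θ, r) : ℝ≥0∞) = S.indicator 1 (Real.cos θ) := by
        have hmem : (r * Real.cos θ, r) ∈ T ↔ Real.cos θ ∈ S := by
          rw [hT, mem_ofPred_eq]
          simp [hr, hr1, hr.ne']
        by_cases h : Real.cos θ ∈ S
        · rw [indicator_of_mem h, indicator_of_mem (hmem.2 h)]; rfl
        · rw [indicator_of_notMem h, indicator_of_notMem (fun h' => h (hmem.1 h'))]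
      rw [h3, ← mul_assoc, ← mul_assoc, ← ENNReal.ofReal_mul hr.le,
        ← ENNReal.ofReal_mul (by positivity)]
      congr 2
      ring
    · rw [indicator_of_notMem hθ]
      by_cases hθ' : θ ∈ Ioo (-Real.pi) Real.pi
      · rw [indicator_of_mem hθ']
        have hθ0 : θ ≤ 0 := by
          by_contra h
          exact hθ ⟨not_le.1 h, hθ'.2⟩
        have hs : Real.sin θ ≤ 0 := Real.sin_nonpos_of_nonpos_of_neg_pi_le hθ0 hθ'.1.le
        simp only [hF, polarCoord_symm_apply, smul_eq_mul]
        rw [indicator_of_notMem, mul_zero]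
        simp only [mem_Ioi, not_lt]
        exact mul_nonpos_of_nonneg_of_nonpos hr.le hs
      · rw [indicator_of_notMem hθ']
  · rw [indicator_of_notMem (fun h => hr1 h.2)]
    refine (lintegral_congr fun θ => ?_).trans lintegral_zero
    simp only [hF, polarCoord_symm_apply, smul_eq_mul]
    have : √((r * Real.cos θ) ^ 2 + (r * Real.sin θ) ^ 2) = r := by
      rw [show (r * Real.cos θ) ^ 2 + (r * Real.sin θ) ^ 2 =
        r ^ 2 * (Real.sin θ ^ 2 + Real.cos θ ^ 2) by ring, Real.sin_sq_add_cos_sq, mul_one,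
        Real.sqrt_sq hr.le]
    have hmem : (r * Real.cos θ, r) ∉ T := fun h => hr1 h.2.1
    simp [indicator, this, hmem]

open scoped Pointwise in
/-- The law of the first coordinate under the surface measure of the unit sphere of `ℝ^(n+2)`,
up to a constant. -/
theorem exists_map_sphereMeasure (n : ℕ) : ∃ C : ℝ≥0∞, C ≠ 0 ∧ C ≠ ⊤ ∧
    (sphereMeasure (n + 2)).map (fun y : Metric.sphere (0 : EuclideanSpace ℝ (Fin (n + 2))) 1 =>
      (y : EuclideanSpace ℝ (Fin (n + 2))) 0) =
      C • ((volume.restrict (Ioo 0 Real.pi)).withDensity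
        (fun θ => ENNReal.ofReal (Real.sin θ ^ n))).map Real.cos := by
  have hC : (∫⁻ r in Ioo (0 : ℝ) 1, ENNReal.ofReal (r ^ (n + 1))) =
      ENNReal.ofReal (1 / (n + 2)) := by
    rw [Measure.restrict_congr_set Ioo_ae_eq_Ioc,
      ← ofReal_integral_eq_lintegral_ofReal (intervalIntegral.intervalIntegrable_pow _).1,
      ← intervalIntegral.integral_of_le zero_le_one]
    · simp; ring_nf
    · filter_upwards [ae_restrict_mem measurableSet_Ioc] with y hy
      exact pow_nonneg hy.1.le _
  set C := (Module.finrank ℝ (EuclideanSpace ℝ (Fin (n + 2))) : ℝ≥0∞) *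
    ((volume : Measure (EuclideanSpace ℝ (Fin (n + 1)))).toSphere univ *
      ∫⁻ r in Ioo (0 : ℝ) 1, ENNReal.ofReal (r ^ (n + 1))) with hCdef
  refine ⟨C, ?_, ?_, ?_⟩
  · rw [hCdef, hC]
    simp only [ne_eq, mul_eq_zero, not_or, Nat.cast_eq_zero, finrank_euclideanSpace,
      Fintype.card_fin, ENNReal.ofReal_eq_zero, not_le, Measure.measure_univ_eq_zero]
    exact ⟨by omega, Measure.toSphere_ne_zero _, by positivity⟩
  · rw [hCdef, hC]
    exact ENNReal.mul_ne_top (by simp) (ENNReal.mul_ne_top (measure_ne_top _ _) (by simp))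
  · ext S hS
    have hm : Measurable (fun y : Metric.sphere (0 : EuclideanSpace ℝ (Fin (n + 2))) 1 =>
      (y : EuclideanSpace ℝ (Fin (n + 2))) 0) := by fun_prop
    rw [Measure.map_apply hm hS, sphereMeasure, Measure.toSphere_apply' _ (hm hS)]
    rw [Measure.smul_apply, Measure.map_apply Real.measurable_cos hS,
      withDensity_apply _ (Real.measurable_cos hS)]
    have h1 := lintegral_half_plane n hS
    have hTm : MeasurableSet {q : ℝ × ℝ | 0 < q.2 ∧ q.2 < 1 ∧ q.1 / q.2 ∈ S} := by
      refine (measurableSet_lt measurable_const measurable_snd).inter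
        ((measurableSet_lt measurable_snd measurable_const).inter ?_)
      exact (measurable_fst.div measurable_snd) hS
    have h2 := lintegral_split n (f := fun t s =>
      ({q : ℝ × ℝ | 0 < q.2 ∧ q.2 < 1 ∧ q.1 / q.2 ∈ S}.indicator 1 (t, s) : ℝ≥0∞))
      (measurable_one.indicator hTm)
    rw [h1] at h2
    have h3 : (Ioo (0 : ℝ) 1 • (Subtype.val '' ((fun y : Metric.sphere (0 : EuclideanSpace ℝ (Fin (n + 2))) 1 =>
      (y : EuclideanSpace ℝ (Fin (n + 2))) 0) ⁻¹' S)) : Set (EuclideanSpace ℝ (Fin (n + 2)))) =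
        (fun x => (x 0, ‖x‖)) ⁻¹' {q : ℝ × ℝ | 0 < q.2 ∧ q.2 < 1 ∧ q.1 / q.2 ∈ S} := by
      ext x
      simp only [Set.mem_smul, mem_image, mem_preimage, mem_ofPred_eq]
      constructor
      · rintro ⟨t, ht, -, ⟨y, hy, rfl⟩, rfl⟩
        have : ‖t • (y : EuclideanSpace ℝ (Fin (n + 2)))‖ = t := by
          simp [norm_smul, abs_of_pos ht.1]
        rw [this]
        refine ⟨ht.1, ht.2, ?_⟩
        simpa [ht.1.ne'] using hy
      · rintro ⟨hx0, hx1, hx⟩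
        refine ⟨‖x‖, ⟨hx0, hx1⟩, _, ⟨⟨‖x‖⁻¹ • x, ?_⟩, ?_, rfl⟩, ?_⟩
        · simp [norm_smul, hx0.ne']
        · simpa [div_eq_inv_mul] using hx
        · simp [smul_smul, hx0.ne']
    rw [h3, ← lintegral_indicator_one
      ((by fun_prop : Measurable fun x : EuclideanSpace ℝ (Fin (n + 2)) => (x 0, ‖x‖)) hTm)]
    have h4 : ∫⁻ θ in Ioo 0 Real.pi, ENNReal.ofReal (Real.sin θ ^ n) * S.indicator 1 (Real.cos θ) =
        ∫⁻ θ in Real.cos ⁻¹' S, ENNReal.ofReal (Real.sin θ ^ n) ∂volume.restrict (Ioo 0 Real.pi) := by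
      rw [← lintegral_indicator (Real.measurable_cos hS)]
      refine lintegral_congr fun θ => ?_
      by_cases h : Real.cos θ ∈ S <;> simp [indicator, h]
    rw [h4] at h2
    rw [hCdef, smul_eq_mul, mul_assoc, mul_assoc]
    congr 1

end

end RadialShell

namespace RadialShell

noncomputable section

/-- `|r e₁ - η y|²` for a point `y` of the unit sphere at angle `θ` from `e₁`. -/
def distSq (r η θ : ℝ) : ℝ := r ^ 2 - 2 * r * η * Real.cos θ + η ^ 2

/-- The angular integral `∫ |r e₁ - η y|^(c-2) (r e₁ - η y) · e₁`. -/
def radialInt (n : ℕ) (c r η : ℝ) : ℝ :=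
  ∫ θ in Ioo 0 Real.pi, distSq r η θ ^ (c / 2 - 1) * (r - η * Real.cos θ) * Real.sin θ ^ n

/-- The angular integral `∫ |r e₁ - η y|^e`. -/
def distInt (n : ℕ) (e r η : ℝ) : ℝ :=
  ∫ θ in Ioo 0 Real.pi, distSq r η θ ^ (e / 2) * Real.sin θ ^ n

/-- `∫_0^π sin^n`. -/
def sinInt (n : ℕ) : ℝ := ∫ θ in Ioo 0 Real.pi, Real.sin θ ^ n

theorem distSq_eq_add (r η θ : ℝ) :
    distSq r η θ = (r - η * Real.cos θ) ^ 2 + (η * Real.sin θ) ^ 2 := by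
  have := Real.sin_sq_add_cos_sq θ
  simp only [distSq]
  linear_combination (-η ^ 2) * this

theorem distSq_eq_add' (r η θ : ℝ) :
    distSq r η θ = (η - r * Real.cos θ) ^ 2 + (r * Real.sin θ) ^ 2 := by
  have := Real.sin_sq_add_cos_sq θ
  simp only [distSq]
  linear_combination (-r ^ 2) * this

theorem distSq_nonneg (r η θ : ℝ) : 0 ≤ distSq r η θ := by
  rw [distSq_eq_add]; positivity

theorem sinInt_pos (n : ℕ) : 0 < sinInt n := by
  rw [sinInt, ← integral_Ioc_eq_integral_Ioo,
    ← intervalIntegral.integral_of_le Real.pi_pos.le]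
  exact integral_sin_pow_pos n

theorem integrableOn_sin_pow (n : ℕ) :
    IntegrableOn (fun θ => Real.sin θ ^ n) (Ioo 0 Real.pi) := by
  have : Continuous (fun θ => Real.sin θ ^ n) := by fun_prop
  exact (this.integrableOn_Icc (a := 0) (b := Real.pi)).mono_set Ioo_subset_Icc_self

theorem integrable_sphere_iff {n : ℕ} {C : ℝ≥0∞} (hC0 : C ≠ 0) (hCt : C ≠ ⊤)
    (hC : (sphereMeasure (n + 2)).map (fun y : Metric.sphere (0 : EuclideanSpace ℝ (Fin (n + 2))) 1 =>
      (y : EuclideanSpace ℝ (Fin (n + 2))) 0) =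
      C • ((volume.restrict (Ioo 0 Real.pi)).withDensity
        (fun θ => ENNReal.ofReal (Real.sin θ ^ n))).map Real.cos)
    {f : ℝ → ℝ} (hf : Measurable f) :
    Integrable (fun y : Metric.sphere (0 : EuclideanSpace ℝ (Fin (n + 2))) 1 =>
      f ((y : EuclideanSpace ℝ (Fin (n + 2))) 0)) (sphereMeasure (n + 2)) ↔
    IntegrableOn (fun θ => f (Real.cos θ) * Real.sin θ ^ n) (Ioo 0 Real.pi) := by
  have hm : Measurable (fun y : Metric.sphere (0 : EuclideanSpace ℝ (Fin (n + 2))) 1 =>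
    (y : EuclideanSpace ℝ (Fin (n + 2))) 0) := by fun_prop
  have h1 := integrable_map_measure (μ := sphereMeasure (n + 2)) (g := f)
    hf.aestronglyMeasurable hm.aemeasurable
  simp only [Function.comp_def] at h1
  rw [← h1, hC, integrable_smul_measure hC0 hCt, integrable_map_measure
    hf.aestronglyMeasurable Real.measurable_cos.aemeasurable,
    integrable_withDensity_iff (by fun_prop) (by simp)]
  refine integrable_congr ?_
  filter_upwards [ae_restrict_mem measurableSet_Ioo] with θ hθ
  have := pow_nonneg (Real.sin_pos_of_mem_Ioo hθ).le n
  simp [ENNReal.toReal_ofReal this]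

theorem integral_sphere {n : ℕ} {C : ℝ≥0∞}
    (hC : (sphereMeasure (n + 2)).map (fun y : Metric.sphere (0 : EuclideanSpace ℝ (Fin (n + 2))) 1 =>
      (y : EuclideanSpace ℝ (Fin (n + 2))) 0) =
      C • ((volume.restrict (Ioo 0 Real.pi)).withDensity
        (fun θ => ENNReal.ofReal (Real.sin θ ^ n))).map Real.cos)
    {f : ℝ → ℝ} (hf : Measurable f) :
    ∫ y : Metric.sphere (0 : EuclideanSpace ℝ (Fin (n + 2))) 1,
      f ((y : EuclideanSpace ℝ (Fin (n + 2))) 0) ∂(sphereMeasure (n + 2)) =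
    C.toReal * ∫ θ in Ioo 0 Real.pi, f (Real.cos θ) * Real.sin θ ^ n := by
  have hm : Measurable (fun y : Metric.sphere (0 : EuclideanSpace ℝ (Fin (n + 2))) 1 =>
    (y : EuclideanSpace ℝ (Fin (n + 2))) 0) := by fun_prop
  have h1 := integral_map (μ := sphereMeasure (n + 2)) (f := f) hm.aemeasurable
    hf.aestronglyMeasurable
  rw [← h1, hC, integral_smul_measure, integral_map Real.measurable_cos.aemeasurable
    hf.aestronglyMeasurable, integral_withDensity_eq_integral_toReal_smul (by fun_prop) (by simp),
    smul_eq_mul]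
  congr 1
  refine setIntegral_congr_fun measurableSet_Ioo fun θ hθ => ?_
  have := pow_nonneg (Real.sin_pos_of_mem_Ioo hθ).le n
  simp [ENNReal.toReal_ofReal this, mul_comm]

theorem sphereArea_eq {n : ℕ} {C : ℝ≥0∞}
    (hC : (sphereMeasure (n + 2)).map (fun y : Metric.sphere (0 : EuclideanSpace ℝ (Fin (n + 2))) 1 =>
      (y : EuclideanSpace ℝ (Fin (n + 2))) 0) =
      C • ((volume.restrict (Ioo 0 Real.pi)).withDensity
        (fun θ => ENNReal.ofReal (Real.sin θ ^ n))).map Real.cos) :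
    sphereArea (n + 2) = C.toReal * sinInt n := by
  have := integral_sphere hC (f := fun _ => 1) measurable_const
  simpa [sphereArea, sinInt] using this

theorem sphereArea_pos (n : ℕ) : 0 < sphereArea (n + 2) := by
  obtain ⟨C, hC0, hCt, hC⟩ := exists_map_sphereMeasure n
  rw [sphereArea_eq hC]
  exact mul_pos (ENNReal.toReal_pos hC0 hCt) (sinInt_pos n)

/-- The point of the unit sphere lying over a prescribed first coordinate is negligible. -/
theorem ae_sphere_ne (n : ℕ) (s : ℝ) :
    ∀ᵐ y : Metric.sphere (0 : EuclideanSpace ℝ (Fin (n + 2))) 1 ∂(sphereMeasure (n + 2)),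
      (y : EuclideanSpace ℝ (Fin (n + 2))) 0 ≠ s := by
  obtain ⟨C, hC0, hCt, hC⟩ := exists_map_sphereMeasure n
  have hm : Measurable (fun y : Metric.sphere (0 : EuclideanSpace ℝ (Fin (n + 2))) 1 =>
    (y : EuclideanSpace ℝ (Fin (n + 2))) 0) := by fun_prop
  have h : (sphereMeasure (n + 2)).map (fun y : Metric.sphere (0 : EuclideanSpace ℝ (Fin (n + 2))) 1 =>
      (y : EuclideanSpace ℝ (Fin (n + 2))) 0) {s} = 0 := by
    rw [hC, Measure.smul_apply, Measure.map_apply Real.measurable_cos (measurableSet_singleton s)]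
    have : (volume.restrict (Ioo 0 Real.pi)) (Real.cos ⁻¹' {s}) = 0 := by
      rw [Measure.restrict_apply (Real.measurable_cos (measurableSet_singleton s))]
      refine Set.Subsingleton.measure_zero ?_ _
      rintro x ⟨hx, hx'⟩ y ⟨hy, hy'⟩
      exact Real.injOn_cos ⟨hx'.1.le, hx'.2.le⟩ ⟨hy'.1.le, hy'.2.le⟩ (by simp_all)
    rw [withDensity_absolutelyContinuous _ _ this, smul_zero]
  rw [Measure.map_apply hm (measurableSet_singleton s)] at h
  rw [ae_iff]
  convert h using 2
  ext y
  simp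

/-! ### The gradient of the power-law potential -/

theorem hasDerivAt_powerTerm {c r : ℝ} (hr : 0 < r) :
    HasDerivAt (powerTerm c) (r ^ (c - 1)) r := by
  by_cases hc : c = 0
  · have : powerTerm c = Real.log := by ext; simp [powerTerm, hc]
    rw [this, hc, zero_sub, Real.rpow_neg_one]
    exact Real.hasDerivAt_log hr.ne'
  · have : powerTerm c = fun r => r ^ c / c := by ext; simp [powerTerm, hc]
    rw [this]
    have h := (Real.hasDerivAt_rpow_const (x := r) (p := c) (Or.inl hr.ne')).div_const c
    rwa [mul_div_assoc, mul_comm, div_mul_cancel₀ _ hc] at h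

theorem hasGradientAt_powerTerm_norm {N : ℕ} (c : ℝ) {x : EuclideanSpace ℝ (Fin N)} (hx : x ≠ 0) :
    HasGradientAt (fun x : EuclideanSpace ℝ (Fin N) => powerTerm c ‖x‖) (‖x‖ ^ (c - 2) • x) x := by
  have hn : 0 < ‖x‖ := norm_pos_iff.2 hx
  rw [hasGradientAt_iff_hasFDerivAt]
  have h1 : HasFDerivAt (fun x : EuclideanSpace ℝ (Fin N) => ‖x‖ ^ 2) _ x :=
    (hasStrictFDerivAt_norm_sq x).hasFDerivAt
  have h2 := h1.sqrt (by positivity)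
  simp only [Real.sqrt_sq (norm_nonneg _)] at h2
  have h3 := (hasDerivAt_powerTerm (c := c) hn).comp_hasFDerivAt x h2
  convert! h3 using 1
  ext y
  have : ‖x‖ ^ (c - 1) = ‖x‖ ^ (c - 2) * ‖x‖ := by
    rw [← Real.rpow_add_one hn.ne']; ring_nf
  simp [this]
  field_simp

theorem gradient_powerPotential {N : ℕ} (a b : ℝ) {x : EuclideanSpace ℝ (Fin N)} (hx : x ≠ 0) :
    gradient (powerPotential N a b) x = (‖x‖ ^ (a - 2) - ‖x‖ ^ (b - 2)) • x := by
  have ha := (hasGradientAt_iff_hasFDerivAt.1 (hasGradientAt_powerTerm_norm a hx))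
  have hb := (hasGradientAt_iff_hasFDerivAt.1 (hasGradientAt_powerTerm_norm b hx))
  refine HasGradientAt.gradient ?_
  rw [hasGradientAt_iff_hasFDerivAt, sub_smul, map_sub]
  exact ha.sub hb

theorem gradient_comp_isometry {N : ℕ} {W : EuclideanSpace ℝ (Fin N) → ℝ}
    (g : EuclideanSpace ℝ (Fin N) ≃ₗᵢ[ℝ] EuclideanSpace ℝ (Fin N)) (hW : ∀ x, W (g x) = W x)
    (x : EuclideanSpace ℝ (Fin N)) : gradient W (g x) = g (gradient W x) := by
  have hc : W ∘ g = W := funext hW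
  have h : fderiv ℝ (W ∘ g) x = (fderiv ℝ W (g x)).comp (g.toContinuousLinearEquiv : _ →L[ℝ] _) :=
    g.toContinuousLinearEquiv.comp_right_fderiv
  rw [hc] at h
  refine ext_inner_right ℝ fun z => ?_
  have e1 : inner ℝ (gradient W (g x)) z = fderiv ℝ W (g x) z := by
    simp [gradient]
  have e2 : inner ℝ (g (gradient W x)) z = fderiv ℝ W x (g.symm z) := by
    have := g.inner_map_map (gradient W x) (g.symm z)
    rw [g.apply_symm_apply] at this
    rw [this]
    simp [gradient]
  rw [e1, e2, h]
  simp

theorem powerPotential_isometry {N : ℕ} (a b : ℝ)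
    (g : EuclideanSpace ℝ (Fin N) ≃ₗᵢ[ℝ] EuclideanSpace ℝ (Fin N)) (x : EuclideanSpace ℝ (Fin N)) :
    powerPotential N a b (g x) = powerPotential N a b x := by
  simp [powerPotential]

theorem gradient_powerPotential_neg {N : ℕ} (a b : ℝ) (x : EuclideanSpace ℝ (Fin N)) :
    gradient (powerPotential N a b) (-x) = -gradient (powerPotential N a b) x :=
  gradient_comp_isometry (LinearIsometryEquiv.neg ℝ) (powerPotential_isometry a b _) x

/-! ### The kernel as a one-dimensional integral -/

theorem inner_e₁ (n : ℕ) (x : EuclideanSpace ℝ (Fin (n + 2))) : inner ℝ x (e₁ (n + 2)) = x 0 := by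
  rw [PiLp.inner_apply, Finset.sum_eq_single 0]
  · simp [e₁]
  · intro i _ hi
    have : (i : ℕ) ≠ 0 := fun h => hi (Fin.ext h)
    rw [show (e₁ (n + 2)).ofLp i = 0 by simp [e₁, hi]]
    simp
  · simp

theorem norm_e₁ (n : ℕ) : ‖e₁ (n + 2)‖ = 1 := by
  have := inner_e₁ n (e₁ (n + 2))
  rw [real_inner_self_eq_norm_sq] at this
  have h : ‖e₁ (n + 2)‖ ^ 2 = 1 := by rw [this]; simp [e₁]
  nlinarith [norm_nonneg (e₁ (n + 2))]

theorem norm_sq_sub_sphere (n : ℕ) (r η : ℝ)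
    (y : Metric.sphere (0 : EuclideanSpace ℝ (Fin (n + 2))) 1) :
    ‖r • e₁ (n + 2) - η • (y : EuclideanSpace ℝ (Fin (n + 2)))‖ ^ 2 =
      r ^ 2 - 2 * r * η * (y : EuclideanSpace ℝ (Fin (n + 2))) 0 + η ^ 2 := by
  rw [norm_sub_sq_real, norm_smul, norm_smul, inner_smul_left, inner_smul_right,
    real_inner_comm, inner_e₁, norm_e₁]
  simp
  ring

/-- The integrand of the kernel, as a function of the first coordinate. -/
def sphereIntegrand (a b r η s : ℝ) : ℝ :=
  ((r ^ 2 - 2 * r * η * s + η ^ 2) ^ (a / 2 - 1) - (r ^ 2 - 2 * r * η * s + η ^ 2) ^ (b / 2 - 1)) *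
    (r - η * s)

theorem measurable_sphereIntegrand (a b r η : ℝ) : Measurable (sphereIntegrand a b r η) := by
  unfold sphereIntegrand
  fun_prop

theorem inner_gradient_ae (n : ℕ) (a b : ℝ) {r η : ℝ} (h : (r, η) ≠ (0, 0)) :
    ∀ᵐ y : Metric.sphere (0 : EuclideanSpace ℝ (Fin (n + 2))) 1 ∂(sphereMeasure (n + 2)),
      r • e₁ (n + 2) - η • (y : EuclideanSpace ℝ (Fin (n + 2))) ≠ 0 ∧
      inner ℝ (gradient (powerPotential (n + 2) a b)
        (r • e₁ (n + 2) - η • (y : EuclideanSpace ℝ (Fin (n + 2))))) (e₁ (n + 2)) =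
      sphereIntegrand a b r η ((y : EuclideanSpace ℝ (Fin (n + 2))) 0) := by
  filter_upwards [ae_sphere_ne n (r / η)] with y hy
  have hx : r • e₁ (n + 2) - η • (y : EuclideanSpace ℝ (Fin (n + 2))) ≠ 0 := by
    intro h0
    have h1 : r - η * (y : EuclideanSpace ℝ (Fin (n + 2))) 0 = 0 := by
      have := congrArg (fun z => inner ℝ z (e₁ (n + 2))) h0
      simp only [inner_sub_left, inner_smul_left, inner_e₁] at this
      simpa [e₁] using this
    by_cases hη : η = 0
    · subst hη
      apply h
      simp at h1
      simp [h1]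
    · apply hy
      field_simp
      linarith
  refine ⟨hx, ?_⟩
  rw [gradient_powerPotential a b hx, inner_smul_left, inner_e₁]
  have hnn := norm_sq_sub_sphere n r η y
  have hpow : ∀ c : ℝ, ‖r • e₁ (n + 2) - η • (y : EuclideanSpace ℝ (Fin (n + 2)))‖ ^ (c - 2) =
      (r ^ 2 - 2 * r * η * (y : EuclideanSpace ℝ (Fin (n + 2))) 0 + η ^ 2) ^ (c / 2 - 1) := by
    intro c
    rw [← hnn, ← Real.rpow_natCast, ← Real.rpow_mul (norm_nonneg _)]
    congr 1
    push_cast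
    ring
  rw [hpow, hpow, sphereIntegrand]
  simp [e₁]

theorem kernel_eq_integral (n : ℕ) (a b : ℝ) {r η : ℝ} (h : (r, η) ≠ (0, 0)) :
    kernel (n + 2) (powerPotential (n + 2) a b) r η =
      -((sinInt n)⁻¹ * ∫ θ in Ioo 0 Real.pi,
        sphereIntegrand a b r η (Real.cos θ) * Real.sin θ ^ n) := by
  obtain ⟨C, hC0, hCt, hC⟩ := exists_map_sphereMeasure n
  have hC' := ENNReal.toReal_pos hC0 hCt
  have := sinInt_pos n
  rw [kernel, integral_congr_ae ((inner_gradient_ae n a b h).mono fun y hy => hy.2),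
    integral_sphere hC (measurable_sphereIntegrand a b r η), sphereArea_eq hC]
  field_simp

theorem kernel_zero_left (n : ℕ) (a b η : ℝ) :
    kernel (n + 2) (powerPotential (n + 2) a b) 0 η = 0 := by
  have h := integral_comp_sphereMap (E := EuclideanSpace ℝ (Fin (n + 2)))
    (LinearIsometryEquiv.neg ℝ)
    (fun y : Metric.sphere (0 : EuclideanSpace ℝ (Fin (n + 2))) 1 =>
      inner ℝ (gradient (powerPotential (n + 2) a b)
        ((0 : ℝ) • e₁ (n + 2) - η • (y : EuclideanSpace ℝ (Fin (n + 2))))) (e₁ (n + 2)))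
  have h2 : ∀ y : Metric.sphere (0 : EuclideanSpace ℝ (Fin (n + 2))) 1,
      gradient (powerPotential (n + 2) a b) ((0 : ℝ) • e₁ (n + 2) -
        η • (sphereMap (LinearIsometryEquiv.neg ℝ) y : EuclideanSpace ℝ (Fin (n + 2)))) =
      -gradient (powerPotential (n + 2) a b) ((0 : ℝ) • e₁ (n + 2) -
        η • (y : EuclideanSpace ℝ (Fin (n + 2)))) := by
    intro y
    rw [← gradient_powerPotential_neg]
    simp [sphereMap]
  simp_rw [h2, inner_neg_left, integral_neg] at h
  rw [kernel, sphereMeasure, self_eq_neg.1 h.symm]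
  simp

end

end RadialShell

namespace RadialShell

noncomputable section

/-! ### Domination of the angular integrands -/

theorem integrableOn_sin_rpow {q : ℝ} (hq : -1 < q) :
    IntegrableOn (fun θ => Real.sin θ ^ q) (Ioo 0 Real.pi) := by
  by_cases h0 : 0 ≤ q
  · have : Continuous (fun θ => Real.sin θ ^ q) := Real.continuous_sin.rpow_const fun _ => Or.inr h0
    exact (this.integrableOn_Icc (a := 0) (b := Real.pi)).mono_set Ioo_subset_Icc_self
  push Not at h0
  have hπ := Real.pi_pos
  have h1 : IntegrableOn (fun θ : ℝ => θ ^ q) (Ioo 0 Real.pi) :=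
    (intervalIntegral.intervalIntegrable_rpow' hq).1.mono_set Ioo_subset_Ioc_self
  have h2 : IntegrableOn (fun θ : ℝ => (Real.pi - θ) ^ q) (Ioo 0 Real.pi) := by
    have := ((intervalIntegral.intervalIntegrable_rpow' hq (a := 0) (b := Real.pi)).comp_sub_left
      Real.pi).symm
    simp only [sub_zero, sub_self] at this
    exact this.1.mono_set Ioo_subset_Ioc_self
  refine Integrable.mono' ((h1.add h2).const_mul ((2 / Real.pi) ^ q))
    (Real.measurable_sin.pow_const q).aestronglyMeasurable ?_
  filter_upwards [ae_restrict_mem measurableSet_Ioo] with θ hθ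
  have hs := Real.sin_pos_of_mem_Ioo hθ
  have hθ1 : 0 < θ := hθ.1
  have hθ2 : 0 < Real.pi - θ := by linarith [hθ.2]
  rw [Real.norm_of_nonneg (by positivity)]
  simp only [Pi.add_apply]
  rcases le_total θ (Real.pi / 2) with h | h
  · have := Real.mul_le_sin hθ1.le h
    calc Real.sin θ ^ q ≤ (2 / Real.pi * θ) ^ q :=
          Real.rpow_le_rpow_of_nonpos (by positivity) this h0.le
      _ = (2 / Real.pi) ^ q * θ ^ q := Real.mul_rpow (by positivity) hθ1.le
      _ ≤ _ := by gcongr; linarith [Real.rpow_nonneg hθ2.le q]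
  · have := Real.mul_le_sin hθ2.le (by linarith)
    rw [Real.sin_pi_sub] at this
    calc Real.sin θ ^ q ≤ (2 / Real.pi * (Real.pi - θ)) ^ q :=
          Real.rpow_le_rpow_of_nonpos (by positivity) this h0.le
      _ = (2 / Real.pi) ^ q * (Real.pi - θ) ^ q := Real.mul_rpow (by positivity) hθ2.le
      _ ≤ _ := by gcongr; linarith [Real.rpow_nonneg hθ1.le q]

theorem mul_sin_sq_le_distSq {r η : ℝ} (hr : 0 ≤ r) (hη : 0 ≤ η) (θ : ℝ) :
    r * η * Real.sin θ ^ 2 ≤ distSq r η θ := by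
  have h : distSq r η θ - r * η * Real.sin θ ^ 2 = (r - η) ^ 2 + r * η * (1 - Real.cos θ) ^ 2 := by
    simp only [distSq, Real.sin_sq]; ring
  nlinarith [mul_nonneg (mul_nonneg hr hη) (sq_nonneg (1 - Real.cos θ)), sq_nonneg (r - η)]

theorem distSq_le (r η θ : ℝ) : distSq r η θ ≤ (|r| + |η|) ^ 2 := by
  have h1 : -(r * η * Real.cos θ) ≤ |r| * |η| := by
    calc -(r * η * Real.cos θ) ≤ |r * η * Real.cos θ| := neg_le_abs _
      _ = |r| * |η| * |Real.cos θ| := by rw [abs_mul, abs_mul]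
      _ ≤ |r| * |η| * 1 := by gcongr; exact Real.abs_cos_le_one θ
      _ = _ := mul_one _
  simp only [distSq]
  nlinarith [sq_abs r, sq_abs η]

theorem le_distSq (r η θ : ℝ) : (|r| - |η|) ^ 2 ≤ distSq r η θ := by
  have h1 : r * η * Real.cos θ ≤ |r| * |η| := by
    calc r * η * Real.cos θ ≤ |r * η * Real.cos θ| := le_abs_self _
      _ = |r| * |η| * |Real.cos θ| := by rw [abs_mul, abs_mul]
      _ ≤ |r| * |η| * 1 := by gcongr; exact Real.abs_cos_le_one θ
      _ = _ := mul_one _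
  simp only [distSq]
  nlinarith [sq_abs r, sq_abs η]

/-- Near `q`, the integrand of `distInt n e` is dominated by a fixed integrable function. -/
def Dominated (n : ℕ) (e : ℝ) (q : ℝ × ℝ) : Prop :=
  ∃ s ∈ 𝓝 q, ∃ g : ℝ → ℝ, IntegrableOn g (Ioo 0 Real.pi) ∧ ∀ p ∈ s, ∀ θ ∈ Ioo 0 Real.pi,
    0 < distSq p.1 p.2 θ ∧ distSq p.1 p.2 θ ^ (e / 2) * Real.sin θ ^ n ≤ g θ

theorem Dominated.eventually {n : ℕ} {e : ℝ} {q : ℝ × ℝ} (h : Dominated n e q) :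
    ∀ᶠ p in 𝓝 q, Dominated n e p := by
  obtain ⟨s, hs, g, hg, hb⟩ := h
  filter_upwards [eventually_mem_nhds_iff.2 hs] with p hp
  exact ⟨s, hp, g, hg, hb⟩

theorem dominated_of_mem_quadrant {n : ℕ} {e : ℝ} (he : -1 < e + n) {q : ℝ × ℝ}
    (hq : q ∈ quadrant) : Dominated n e q := by
  have h1 : 0 < q.1 := hq.1
  have h2 : 0 < q.2 := hq.2
  refine ⟨Ioo (q.1 / 2) (2 * q.1) ×ˢ Ioo (q.2 / 2) (2 * q.2),
    prod_mem_nhds (Ioo_mem_nhds (by linarith) (by linarith))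
      (Ioo_mem_nhds (by linarith) (by linarith)), ?_⟩
  have hpos : ∀ p ∈ Ioo (q.1 / 2) (2 * q.1) ×ˢ Ioo (q.2 / 2) (2 * q.2), ∀ θ ∈ Ioo 0 Real.pi,
      q.1 / 2 * (q.2 / 2) * Real.sin θ ^ 2 ≤ distSq p.1 p.2 θ := by
    rintro p ⟨hp1, hp2⟩ θ hθ
    have h3 : 0 < p.1 := by linarith [hp1.1]
    have h4 : 0 < p.2 := by linarith [hp2.1]
    refine le_trans ?_ (mul_sin_sq_le_distSq h3.le h4.le θ)
    gcongr
    · exact hp1.1.le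
    · exact hp2.1.le
  rcases le_or_gt 0 e with h0 | h0
  · refine ⟨fun _ => ((2 * q.1 + 2 * q.2) ^ 2) ^ (e / 2), by simp, fun p hp θ hθ => ?_⟩
    have hs := Real.sin_pos_of_mem_Ioo hθ
    refine ⟨lt_of_lt_of_le (by positivity) (hpos p hp θ hθ), ?_⟩
    have h3 : 0 < p.1 := by linarith [hp.1.1]
    have h4 : 0 < p.2 := by linarith [hp.2.1]
    have hle : distSq p.1 p.2 θ ≤ (2 * q.1 + 2 * q.2) ^ 2 := by
      refine (distSq_le _ _ _).trans ?_
      rw [abs_of_pos h3, abs_of_pos h4]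
      gcongr
      · exact hp.1.2.le
      · exact hp.2.2.le
    calc distSq p.1 p.2 θ ^ (e / 2) * Real.sin θ ^ n
        ≤ ((2 * q.1 + 2 * q.2) ^ 2) ^ (e / 2) * 1 := by
          gcongr
          · exact distSq_nonneg _ _ _
          · exact pow_le_one₀ hs.le (Real.sin_le_one θ)
      _ = _ := mul_one _
  · refine ⟨fun θ => (q.1 / 2 * (q.2 / 2)) ^ (e / 2) * Real.sin θ ^ (e + n),
      (integrableOn_sin_rpow he).const_mul _, fun p hp θ hθ => ?_⟩
    have hs := Real.sin_pos_of_mem_Ioo hθ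
    refine ⟨lt_of_lt_of_le (by positivity) (hpos p hp θ hθ), ?_⟩
    calc distSq p.1 p.2 θ ^ (e / 2) * Real.sin θ ^ n
        ≤ (q.1 / 2 * (q.2 / 2) * Real.sin θ ^ 2) ^ (e / 2) * Real.sin θ ^ n := by
          gcongr ?_ * _
          exact Real.rpow_le_rpow_of_nonpos (by positivity) (hpos p hp θ hθ) (by linarith)
      _ = _ := by
          rw [Real.mul_rpow (by positivity) (by positivity), ← Real.rpow_natCast (Real.sin θ) 2,
            ← Real.rpow_mul hs.le, mul_assoc, ← Real.rpow_natCast (Real.sin θ) n,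
            ← Real.rpow_add hs]
          congr 3
          push_cast
          ring

theorem continuous_distSq : Continuous fun x : (ℝ × ℝ) × ℝ => distSq x.1.1 x.1.2 x.2 := by
  unfold distSq
  fun_prop

theorem dominated_of_abs_ne {n : ℕ} {e : ℝ} {q : ℝ × ℝ} (hq : |q.1| ≠ |q.2|) :
    Dominated n e q := by
  have hopen : IsOpen {p : ℝ × ℝ | |p.1| ≠ |p.2|} :=
    isOpen_ne_fun (by fun_prop) (by fun_prop)
  obtain ⟨s, hs, hsub, hcomp⟩ := local_compact_nhds (hopen.mem_nhds hq)
  have hpos : ∀ x ∈ s ×ˢ Icc 0 Real.pi, 0 < distSq x.1.1 x.1.2 x.2 := by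
    intro x hx
    have : |x.1.1| - |x.1.2| ≠ 0 := sub_ne_zero.2 (hsub hx.1)
    exact lt_of_lt_of_le (by positivity) (le_distSq _ _ _)
  have hcont : ContinuousOn (fun x : (ℝ × ℝ) × ℝ => distSq x.1.1 x.1.2 x.2 ^ (e / 2) *
      Real.sin x.2 ^ n) (s ×ˢ Icc 0 Real.pi) := by
    refine ContinuousOn.mul ?_ (by fun_prop)
    exact continuous_distSq.continuousOn.rpow_const fun x hx => Or.inl (hpos x hx).ne'
  obtain ⟨C, hC⟩ := (hcomp.prod isCompact_Icc).exists_bound_of_continuousOn hcont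
  exact ⟨s, hs, fun _ => C, by simp, fun p hp θ hθ =>
    ⟨hpos (p, θ) ⟨hp, Ioo_subset_Icc_self hθ⟩,
      (le_abs_self _).trans (hC (p, θ) ⟨hp, Ioo_subset_Icc_self hθ⟩)⟩⟩

theorem abs_sub_cos_le (r η θ : ℝ) : |r - η * Real.cos θ| ≤ distSq r η θ ^ (1 / 2 : ℝ) := by
  rw [← Real.sqrt_eq_rpow]
  refine Real.abs_le_sqrt ?_
  rw [distSq_eq_add]
  nlinarith [sq_nonneg (η * Real.sin θ)]

theorem abs_sub_cos_le' (r η θ : ℝ) : |η - r * Real.cos θ| ≤ distSq r η θ ^ (1 / 2 : ℝ) := by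
  rw [← Real.sqrt_eq_rpow]
  refine Real.abs_le_sqrt ?_
  rw [distSq_eq_add']
  nlinarith [sq_nonneg (r * Real.sin θ)]

theorem sin_pow_nonneg {n : ℕ} {θ : ℝ} (hθ : θ ∈ Ioo 0 Real.pi) : 0 ≤ Real.sin θ ^ n :=
  pow_nonneg (Real.sin_pos_of_mem_Ioo hθ).le n

/-- Continuity of an angular integral, for integrands controlled by a power of the distance. -/
theorem Dominated.continuousAt_integral {n : ℕ} {e : ℝ} {q : ℝ × ℝ} (h : Dominated n e q)
    {F : ℝ × ℝ → ℝ → ℝ} {C : ℝ} (hm : ∀ p, Measurable (F p))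
    (hb : ∀ p, ∀ θ ∈ Ioo 0 Real.pi, 0 < distSq p.1 p.2 θ →
      |F p θ| ≤ C * (distSq p.1 p.2 θ ^ (e / 2) * Real.sin θ ^ n))
    (hc : ∀ θ ∈ Ioo 0 Real.pi, 0 < distSq q.1 q.2 θ → ContinuousAt (fun p => F p θ) q) :
    ContinuousAt (fun p => ∫ θ in Ioo 0 Real.pi, F p θ) q := by
  obtain ⟨s, hs, g, hg, hd⟩ := h
  refine continuousAt_of_dominated (bound := fun θ => |C| * g θ)
    (.of_forall fun p => (hm p).aestronglyMeasurable) ?_ (hg.const_mul _) ?_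
  · filter_upwards [hs] with p hp
    filter_upwards [ae_restrict_mem measurableSet_Ioo] with θ hθ
    obtain ⟨h1, h2⟩ := hd p hp θ hθ
    refine (hb p θ hθ h1).trans ?_
    have h3 : 0 ≤ distSq p.1 p.2 θ ^ (e / 2) * Real.sin θ ^ n :=
      mul_nonneg (Real.rpow_nonneg h1.le _) (sin_pow_nonneg hθ)
    exact (mul_le_mul_of_nonneg_right (le_abs_self C) h3).trans
      (mul_le_mul_of_nonneg_left h2 (abs_nonneg C))
  · filter_upwards [ae_restrict_mem measurableSet_Ioo] with θ hθ
    exact hc θ hθ (hd q (mem_of_mem_nhds hs) θ hθ).1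

theorem Dominated.integrable {n : ℕ} {e : ℝ} {q : ℝ × ℝ} (h : Dominated n e q)
    {F : ℝ → ℝ} {C : ℝ} (hm : Measurable F)
    (hb : ∀ θ ∈ Ioo 0 Real.pi, 0 < distSq q.1 q.2 θ →
      |F θ| ≤ C * (distSq q.1 q.2 θ ^ (e / 2) * Real.sin θ ^ n)) :
    IntegrableOn F (Ioo 0 Real.pi) := by
  obtain ⟨s, hs, g, hg, hd⟩ := h
  refine Integrable.mono' (hg.const_mul |C|) hm.aestronglyMeasurable ?_
  filter_upwards [ae_restrict_mem measurableSet_Ioo] with θ hθ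
  obtain ⟨h1, h2⟩ := hd q (mem_of_mem_nhds hs) θ hθ
  refine (hb θ hθ h1).trans ?_
  have h3 : 0 ≤ distSq q.1 q.2 θ ^ (e / 2) * Real.sin θ ^ n :=
    mul_nonneg (Real.rpow_nonneg h1.le _) (sin_pow_nonneg hθ)
  exact (mul_le_mul_of_nonneg_right (le_abs_self C) h3).trans
    (mul_le_mul_of_nonneg_left h2 (abs_nonneg C))

/-- The angular integrand of `radialInt`. -/
def radialIntegrand (n : ℕ) (c : ℝ) (p : ℝ × ℝ) (θ : ℝ) : ℝ :=
  distSq p.1 p.2 θ ^ (c / 2 - 1) * (p.1 - p.2 * Real.cos θ) * Real.sin θ ^ n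

theorem measurable_distSq (r η : ℝ) : Measurable (distSq r η) := by
  unfold distSq
  fun_prop

theorem measurable_radialIntegrand (n : ℕ) (c : ℝ) (p : ℝ × ℝ) :
    Measurable (radialIntegrand n c p) := by
  unfold radialIntegrand
  have := measurable_distSq p.1 p.2
  fun_prop

theorem abs_radialIntegrand_le {n : ℕ} {c : ℝ} {p : ℝ × ℝ} {θ : ℝ} (hθ : θ ∈ Ioo 0 Real.pi)
    (h : 0 < distSq p.1 p.2 θ) :
    |radialIntegrand n c p θ| ≤ 1 * (distSq p.1 p.2 θ ^ ((c - 1) / 2) * Real.sin θ ^ n) := by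
  rw [radialIntegrand, abs_mul, abs_mul, abs_of_nonneg (sin_pow_nonneg hθ),
    abs_of_nonneg (Real.rpow_nonneg h.le _), one_mul]
  refine mul_le_mul_of_nonneg_right ?_ (sin_pow_nonneg hθ)
  calc _ ≤ distSq p.1 p.2 θ ^ (c / 2 - 1) * distSq p.1 p.2 θ ^ (1 / 2 : ℝ) := by
        gcongr; exact abs_sub_cos_le _ _ _
    _ = _ := by rw [← Real.rpow_add h]; ring_nf

theorem continuousAt_distSq_rpow {q : ℝ × ℝ} {θ : ℝ} (h : 0 < distSq q.1 q.2 θ) (k : ℝ) :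
    ContinuousAt (fun p : ℝ × ℝ => distSq p.1 p.2 θ ^ k) q := by
  refine ContinuousAt.rpow_const ?_ (Or.inl h.ne')
  exact (continuous_distSq.comp (by fun_prop : Continuous fun p : ℝ × ℝ => (p, θ))).continuousAt

theorem Dominated.continuousAt_radialInt {n : ℕ} {c : ℝ} {q : ℝ × ℝ}
    (h : Dominated n (c - 1) q) : ContinuousAt (fun p : ℝ × ℝ => radialInt n c p.1 p.2) q := by
  refine h.continuousAt_integral (F := radialIntegrand n c) (C := 1)
    (measurable_radialIntegrand n c) (fun p θ hθ h => abs_radialIntegrand_le hθ h) ?_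
  intro θ hθ hpos
  unfold radialIntegrand
  exact ((continuousAt_distSq_rpow hpos _).mul (by fun_prop)).mul continuousAt_const

/-! ### Differentiation of the angular integrals -/

/-- The derivative of `radialIntegrand` in the first variable. -/
def radialIntegrand₁ (n : ℕ) (c : ℝ) (p : ℝ × ℝ) (θ : ℝ) : ℝ :=
  (distSq p.1 p.2 θ ^ (c / 2 - 1) +
    (c - 2) * distSq p.1 p.2 θ ^ (c / 2 - 2) * (p.1 - p.2 * Real.cos θ) ^ 2) * Real.sin θ ^ n

/-- The derivative of `radialIntegrand` in the second variable. -/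
def radialIntegrand₂ (n : ℕ) (c : ℝ) (p : ℝ × ℝ) (θ : ℝ) : ℝ :=
  (-Real.cos θ * distSq p.1 p.2 θ ^ (c / 2 - 1) +
    (c - 2) * distSq p.1 p.2 θ ^ (c / 2 - 2) * (p.1 - p.2 * Real.cos θ) *
      (p.2 - p.1 * Real.cos θ)) * Real.sin θ ^ n

theorem measurable_radialIntegrand₁ (n : ℕ) (c : ℝ) (p : ℝ × ℝ) :
    Measurable (radialIntegrand₁ n c p) := by
  unfold radialIntegrand₁
  have := measurable_distSq p.1 p.2
  fun_prop

theorem measurable_radialIntegrand₂ (n : ℕ) (c : ℝ) (p : ℝ × ℝ) :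
    Measurable (radialIntegrand₂ n c p) := by
  unfold radialIntegrand₂
  have := measurable_distSq p.1 p.2
  fun_prop

theorem rpow_mul_abs_mul_le {A x y k : ℝ} (hA : 0 < A) (hx : |x| ≤ A ^ (1 / 2 : ℝ))
    (hy : |y| ≤ A ^ (1 / 2 : ℝ)) : A ^ (k - 1) * |x| * |y| ≤ A ^ k := by
  calc A ^ (k - 1) * |x| * |y| ≤ A ^ (k - 1) * A ^ (1 / 2 : ℝ) * A ^ (1 / 2 : ℝ) := by gcongr
    _ = A ^ k := by rw [← Real.rpow_add hA, ← Real.rpow_add hA]; ring_nf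

theorem abs_radialIntegrand₁_le {n : ℕ} {c : ℝ} {p : ℝ × ℝ} {θ : ℝ} (hθ : θ ∈ Ioo 0 Real.pi)
    (h : 0 < distSq p.1 p.2 θ) :
    |radialIntegrand₁ n c p θ| ≤
      (1 + |c - 2|) * (distSq p.1 p.2 θ ^ ((c - 2) / 2) * Real.sin θ ^ n) := by
  rw [radialIntegrand₁, abs_mul, abs_of_nonneg (sin_pow_nonneg hθ), ← mul_assoc]
  refine mul_le_mul_of_nonneg_right ?_ (sin_pow_nonneg hθ)
  refine (abs_add_le _ _).trans ?_
  have h1 := rpow_mul_abs_mul_le (k := c / 2 - 1) h (abs_sub_cos_le p.1 p.2 θ)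
    (abs_sub_cos_le p.1 p.2 θ)
  have hA := Real.rpow_nonneg h.le (c / 2 - 1 - 1)
  rw [abs_mul, abs_mul, abs_pow, abs_of_nonneg (Real.rpow_nonneg h.le _),
    abs_of_nonneg (Real.rpow_nonneg h.le _), show (c - 2) / 2 = c / 2 - 1 by ring,
    show c / 2 - 2 = c / 2 - 1 - 1 by ring, add_mul, one_mul, mul_assoc |c - 2|]
  gcongr
  rwa [sq, ← mul_assoc]

theorem abs_radialIntegrand₂_le {n : ℕ} {c : ℝ} {p : ℝ × ℝ} {θ : ℝ} (hθ : θ ∈ Ioo 0 Real.pi)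
    (h : 0 < distSq p.1 p.2 θ) :
    |radialIntegrand₂ n c p θ| ≤
      (1 + |c - 2|) * (distSq p.1 p.2 θ ^ ((c - 2) / 2) * Real.sin θ ^ n) := by
  rw [radialIntegrand₂, abs_mul, abs_of_nonneg (sin_pow_nonneg hθ), ← mul_assoc]
  refine mul_le_mul_of_nonneg_right ?_ (sin_pow_nonneg hθ)
  refine (abs_add_le _ _).trans ?_
  have h1 := rpow_mul_abs_mul_le (k := c / 2 - 1) h (abs_sub_cos_le p.1 p.2 θ)
    (abs_sub_cos_le' p.1 p.2 θ)
  have hA := Real.rpow_nonneg h.le (c / 2 - 1)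
  rw [abs_mul, abs_mul, abs_mul, abs_mul, abs_neg, abs_of_nonneg (Real.rpow_nonneg h.le _),
    abs_of_nonneg (Real.rpow_nonneg h.le _), show (c - 2) / 2 = c / 2 - 1 by ring,
    show c / 2 - 2 = c / 2 - 1 - 1 by ring, add_mul, mul_assoc |c - 2|, mul_assoc |c - 2|]
  gcongr
  exact Real.abs_cos_le_one θ

theorem hasFDerivAt_radialIntegrand {n : ℕ} {c : ℝ} {p : ℝ × ℝ} {θ : ℝ}
    (h : 0 < distSq p.1 p.2 θ) :
    HasFDerivAt (fun p => radialIntegrand n c p θ)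
      (radialIntegrand₁ n c p θ • ContinuousLinearMap.fst ℝ ℝ ℝ +
        radialIntegrand₂ n c p θ • ContinuousLinearMap.snd ℝ ℝ ℝ) p := by
  have hf : HasFDerivAt (fun p : ℝ × ℝ => p.1) (ContinuousLinearMap.fst ℝ ℝ ℝ) p := hasFDerivAt_fst
  have hs : HasFDerivAt (fun p : ℝ × ℝ => p.2) (ContinuousLinearMap.snd ℝ ℝ ℝ) p := hasFDerivAt_snd
  have hA : HasFDerivAt (fun p : ℝ × ℝ => distSq p.1 p.2 θ)
      ((2 * (p.1 - p.2 * Real.cos θ)) • ContinuousLinearMap.fst ℝ ℝ ℝ +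
        (2 * (p.2 - p.1 * Real.cos θ)) • ContinuousLinearMap.snd ℝ ℝ ℝ) p := by
    unfold distSq
    convert! ((hf.pow 2).sub (((hf.const_mul 2).mul hs).mul_const (Real.cos θ))).add (hs.pow 2)
      using 1
    ext <;> simp <;> ring
  have hx : HasFDerivAt (fun p : ℝ × ℝ => p.1 - p.2 * Real.cos θ)
      (ContinuousLinearMap.fst ℝ ℝ ℝ - Real.cos θ • ContinuousLinearMap.snd ℝ ℝ ℝ) p :=
    hf.sub (hs.mul_const (Real.cos θ))
  have hk := hA.rpow_const (p := c / 2 - 1) (Or.inl h.ne')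
  have := (hk.mul hx).mul_const (Real.sin θ ^ n)
  unfold radialIntegrand
  convert! this using 1
  have e1 : c / 2 - 2 = c / 2 - 1 - 1 := by ring
  ext <;> simp [radialIntegrand₁, radialIntegrand₂, e1] <;> ring

/-- `∂₁` of `radialInt`. -/
def radialInt₁ (n : ℕ) (c r η : ℝ) : ℝ := ∫ θ in Ioo 0 Real.pi, radialIntegrand₁ n c (r, η) θ

/-- `∂₂` of `radialInt`. -/
def radialInt₂ (n : ℕ) (c r η : ℝ) : ℝ := ∫ θ in Ioo 0 Real.pi, radialIntegrand₂ n c (r, η) θ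

theorem Dominated.integrable_radialIntegrand₁ {n : ℕ} {c : ℝ} {q : ℝ × ℝ}
    (h : Dominated n (c - 2) q) : IntegrableOn (radialIntegrand₁ n c q) (Ioo 0 Real.pi) :=
  h.integrable (measurable_radialIntegrand₁ n c q) fun _ hθ h0 => abs_radialIntegrand₁_le hθ h0

theorem Dominated.integrable_radialIntegrand₂ {n : ℕ} {c : ℝ} {q : ℝ × ℝ}
    (h : Dominated n (c - 2) q) : IntegrableOn (radialIntegrand₂ n c q) (Ioo 0 Real.pi) :=
  h.integrable (measurable_radialIntegrand₂ n c q) fun _ hθ h0 => abs_radialIntegrand₂_le hθ h0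

theorem Dominated.integrable_distSq {n : ℕ} {e : ℝ} {q : ℝ × ℝ} (h : Dominated n e q) :
    IntegrableOn (fun θ => distSq q.1 q.2 θ ^ (e / 2) * Real.sin θ ^ n) (Ioo 0 Real.pi) := by
  refine h.integrable (C := 1) ?_ fun θ hθ h0 => ?_
  · have := measurable_distSq q.1 q.2
    fun_prop
  · rw [one_mul, abs_of_nonneg (mul_nonneg (Real.rpow_nonneg h0.le _) (sin_pow_nonneg hθ))]

theorem Dominated.integrable_radialIntegrand {n : ℕ} {c : ℝ} {q : ℝ × ℝ}
    (h : Dominated n (c - 1) q) : IntegrableOn (radialIntegrand n c q) (Ioo 0 Real.pi) :=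
  h.integrable (measurable_radialIntegrand n c q) fun _ hθ h0 => abs_radialIntegrand_le hθ h0

theorem Dominated.add_one {n : ℕ} {c : ℝ} {q : ℝ × ℝ} (h : Dominated n (c - 2) q) :
    Dominated n (c - 1) q := by
  obtain ⟨s, hs, g, hg, hd⟩ := h
  refine ⟨s ∩ (Metric.ball q 1), inter_mem hs (Metric.ball_mem_nhds q one_pos),
    fun θ => (|q.1| + 1 + (|q.2| + 1)) * g θ, hg.const_mul _, fun p hp θ hθ => ?_⟩
  obtain ⟨h1, h2⟩ := hd p hp.1 θ hθ
  refine ⟨h1, ?_⟩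
  have hp2 := hp.2
  rw [Metric.mem_ball, Prod.dist_eq, max_lt_iff, Real.dist_eq, Real.dist_eq] at hp2
  have ha : |p.1| ≤ |q.1| + 1 := by
    have := abs_sub_abs_le_abs_sub p.1 q.1; linarith [hp2.1]
  have hb : |p.2| ≤ |q.2| + 1 := by
    have := abs_sub_abs_le_abs_sub p.2 q.2; linarith [hp2.2]
  have hs : distSq p.1 p.2 θ ^ (1 / 2 : ℝ) ≤ |q.1| + 1 + (|q.2| + 1) := by
    rw [← Real.sqrt_eq_rpow]
    refine (Real.sqrt_le_sqrt (distSq_le p.1 p.2 θ)).trans ?_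
    rw [Real.sqrt_sq (by positivity)]
    linarith
  have hn : 0 ≤ distSq p.1 p.2 θ ^ ((c - 2) / 2) * Real.sin θ ^ n :=
    mul_nonneg (Real.rpow_nonneg h1.le _) (sin_pow_nonneg hθ)
  calc distSq p.1 p.2 θ ^ ((c - 1) / 2) * Real.sin θ ^ n
      = distSq p.1 p.2 θ ^ (1 / 2 : ℝ) * (distSq p.1 p.2 θ ^ ((c - 2) / 2) * Real.sin θ ^ n) := by
        rw [← mul_assoc, ← Real.rpow_add h1]; ring_nf
    _ ≤ _ := mul_le_mul hs h2 hn (by positivity)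

theorem Dominated.hasFDerivAt_radialInt {n : ℕ} {c : ℝ} {q : ℝ × ℝ}
    (h : Dominated n (c - 2) q) :
    HasFDerivAt (fun p : ℝ × ℝ => radialInt n c p.1 p.2)
      (radialInt₁ n c q.1 q.2 • ContinuousLinearMap.fst ℝ ℝ ℝ +
        radialInt₂ n c q.1 q.2 • ContinuousLinearMap.snd ℝ ℝ ℝ) q := by
  have hintegr := h.add_one.integrable_radialIntegrand
  have hi1 := h.integrable_radialIntegrand₁
  have hi2 := h.integrable_radialIntegrand₂
  obtain ⟨s, hs, g, hg, hd⟩ := h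
  have key := hasFDerivAt_integral_of_dominated_of_fderiv_le (𝕜 := ℝ)
    (μ := volume.restrict (Ioo 0 Real.pi)) (F := radialIntegrand n c)
    (F' := fun p θ => radialIntegrand₁ n c p θ • ContinuousLinearMap.fst ℝ ℝ ℝ +
        radialIntegrand₂ n c p θ • ContinuousLinearMap.snd ℝ ℝ ℝ)
    (bound := fun θ => 2 * ((1 + |c - 2|) * g θ)) hs
    (.of_forall fun p => (measurable_radialIntegrand n c p).aestronglyMeasurable) hintegr
    (((measurable_radialIntegrand₁ n c q).smul_const _).add
      ((measurable_radialIntegrand₂ n c q).smul_const _)).aestronglyMeasurable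
    ?_ ((hg.const_mul _).const_mul _) ?_
  · convert! key using 1
    rw [integral_add (hi1.smul_const _) (hi2.smul_const _), integral_smul_const,
      integral_smul_const]
    rfl
  · filter_upwards [ae_restrict_mem measurableSet_Ioo] with θ hθ p hp
    obtain ⟨h1, h2⟩ := hd p hp θ hθ
    refine (norm_add_le _ _).trans ?_
    rw [norm_smul, norm_smul]
    have hn1 : ‖ContinuousLinearMap.fst ℝ ℝ ℝ‖ ≤ 1 := ContinuousLinearMap.norm_fst_le ..
    have hn2 : ‖ContinuousLinearMap.snd ℝ ℝ ℝ‖ ≤ 1 := ContinuousLinearMap.norm_snd_le ..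
    have b1 : ‖radialIntegrand₁ n c p θ‖ ≤ (1 + |c - 2|) * g θ :=
      (abs_radialIntegrand₁_le hθ h1).trans (by gcongr)
    have b2 : ‖radialIntegrand₂ n c p θ‖ ≤ (1 + |c - 2|) * g θ :=
      (abs_radialIntegrand₂_le hθ h1).trans (by gcongr)
    have b3 := mul_le_mul b1 hn1 (norm_nonneg _) ((norm_nonneg _).trans b1)
    have b4 := mul_le_mul b2 hn2 (norm_nonneg _) ((norm_nonneg _).trans b2)
    linarith
  · filter_upwards [ae_restrict_mem measurableSet_Ioo] with θ hθ p hp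
    exact hasFDerivAt_radialIntegrand (hd p hp θ hθ).1

theorem Dominated.continuousAt_radialInt₁ {n : ℕ} {c : ℝ} {q : ℝ × ℝ}
    (h : Dominated n (c - 2) q) : ContinuousAt (fun p : ℝ × ℝ => radialInt₁ n c p.1 p.2) q := by
  refine h.continuousAt_integral (F := radialIntegrand₁ n c)
    (measurable_radialIntegrand₁ n c) (fun p θ hθ h => abs_radialIntegrand₁_le hθ h) ?_
  intro θ hθ hpos
  unfold radialIntegrand₁
  have h1 := continuousAt_distSq_rpow hpos (c / 2 - 1)
  have h2 := continuousAt_distSq_rpow hpos (c / 2 - 2)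
  exact (h1.add ((continuousAt_const.mul h2).mul (by fun_prop))).mul continuousAt_const

theorem Dominated.continuousAt_radialInt₂ {n : ℕ} {c : ℝ} {q : ℝ × ℝ}
    (h : Dominated n (c - 2) q) : ContinuousAt (fun p : ℝ × ℝ => radialInt₂ n c p.1 p.2) q := by
  refine h.continuousAt_integral (F := radialIntegrand₂ n c)
    (measurable_radialIntegrand₂ n c) (fun p θ hθ h => abs_radialIntegrand₂_le hθ h) ?_
  intro θ hθ hpos
  unfold radialIntegrand₂
  have h1 := continuousAt_distSq_rpow hpos (c / 2 - 1)
  have h2 := continuousAt_distSq_rpow hpos (c / 2 - 2)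
  exact ((continuousAt_const.mul h1).add (((continuousAt_const.mul h2).mul (by fun_prop)).mul
    (by fun_prop))).mul continuousAt_const

theorem Dominated.contDiffAt_radialInt {n : ℕ} {c : ℝ} {q : ℝ × ℝ}
    (h : Dominated n (c - 2) q) :
    ContDiffAt ℝ 1 (fun p : ℝ × ℝ => radialInt n c p.1 p.2) q := by
  rw [contDiffAt_one_iff]
  refine ⟨fun p => radialInt₁ n c p.1 p.2 • ContinuousLinearMap.fst ℝ ℝ ℝ +
        radialInt₂ n c p.1 p.2 • ContinuousLinearMap.snd ℝ ℝ ℝ, _, h.eventually, ?_, ?_⟩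
  · intro p hp
    exact ((hp.continuousAt_radialInt₁.smul continuousAt_const).add
      (hp.continuousAt_radialInt₂.smul continuousAt_const)).continuousWithinAt
  · intro p hp
    exact Dominated.hasFDerivAt_radialInt hp

theorem Dominated.hasDerivAt_radialInt {n : ℕ} {c r η : ℝ} (h : Dominated n (c - 2) (r, η)) :
    HasDerivAt (fun s => radialInt n c s η) (radialInt₁ n c r η) r := by
  have h1 := h.hasFDerivAt_radialInt
  have h2 : HasDerivAt (fun s : ℝ => (s, η)) (1, 0) r :=
    (hasDerivAt_id r).prodMk (hasDerivAt_const r η)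
  convert! h1.comp_hasDerivAt r h2 using 1
  simp

/-! ### The radial divergence identity -/

theorem radialInt_identity {n : ℕ} {c r η : ℝ} (h : |r| ≠ |η|) :
    r * radialInt₁ n c r η + (n + 1) * radialInt n c r η = (c + n) * (r * distInt n (c - 2) r η) := by
  have hpos : ∀ θ, 0 < distSq r η θ := by
    intro θ
    have : |r| - |η| ≠ 0 := sub_ne_zero.2 h
    exact lt_of_lt_of_le (by positivity) (le_distSq _ _ _)
  set k := c / 2 - 1 with hk
  have hderiv : ∀ θ, HasDerivAt (fun θ => distSq r η θ ^ k * Real.sin θ ^ (n + 1))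
      (2 * r * η * Real.sin θ * k * distSq r η θ ^ (k - 1) * Real.sin θ ^ (n + 1) +
        distSq r η θ ^ k * ((n + 1) * Real.sin θ ^ n * Real.cos θ)) θ := by
    intro θ
    have h1 : HasDerivAt (distSq r η) (2 * r * η * Real.sin θ) θ := by
      unfold distSq
      convert! (((Real.hasDerivAt_cos θ).const_mul (2 * r * η)).const_sub (r ^ 2)).add_const (η ^ 2)
        using 1
      ring
    have h2 := h1.rpow_const (p := k) (Or.inl (hpos θ).ne')
    have h3 := (Real.hasDerivAt_sin θ).pow (n + 1)
    convert! h2.mul h3 using 1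
    simp
  have hcontA : Continuous (distSq r η) := by unfold distSq; fun_prop
  have hcp : ∀ j : ℝ, Continuous fun θ => distSq r η θ ^ j := fun j =>
    hcontA.rpow_const fun θ => Or.inl (hpos θ).ne'
  have hcont : Continuous (fun θ => 2 * r * η * Real.sin θ * k * distSq r η θ ^ (k - 1) *
      Real.sin θ ^ (n + 1) + distSq r η θ ^ k * ((n + 1) * Real.sin θ ^ n * Real.cos θ)) := by
    have := hcp k
    have := hcp (k - 1)
    fun_prop
  have hFTC := intervalIntegral.integral_eq_sub_of_hasDerivAt (a := 0) (b := Real.pi)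
    (fun θ _ => hderiv θ) (hcont.intervalIntegrable _ _)
  simp only [Real.sin_pi, Real.sin_zero, zero_pow (Nat.succ_ne_zero n), mul_zero, sub_zero] at hFTC
  rw [intervalIntegral.integral_of_le Real.pi_pos.le, integral_Ioc_eq_integral_Ioo] at hFTC
  have hD : ∀ e, Dominated n e (r, η) := fun e => dominated_of_abs_ne h
  have i1 := (hD (c - 2)).integrable_radialIntegrand₁
  have i2 := (hD (c - 1)).integrable_radialIntegrand
  have i3 := (hD (c - 2)).integrable_distSq
  have e1 : r * radialInt₁ n c r η + (n + 1) * radialInt n c r η -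
      (c + n) * (r * distInt n (c - 2) r η) = -η * ∫ θ in Ioo 0 Real.pi,
      (2 * r * η * Real.sin θ * k * distSq r η θ ^ (k - 1) *
      Real.sin θ ^ (n + 1) + distSq r η θ ^ k * ((n + 1) * Real.sin θ ^ n * Real.cos θ)) := by
    rw [radialInt₁, distInt, show radialInt n c r η =
      ∫ θ in Ioo 0 Real.pi, radialIntegrand n c (r, η) θ from rfl]
    simp only [← integral_const_mul]
    have i5 : Integrable (fun θ => r * radialIntegrand₁ n c (r, η) θ +
        (n + 1) * radialIntegrand n c (r, η) θ) (volume.restrict (Ioo 0 Real.pi)) :=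
      (i1.const_mul r).add (i2.const_mul (n + 1 : ℝ))
    have i6 : Integrable (fun θ => (c + n) * (r * (distSq r η θ ^ ((c - 2) / 2) * Real.sin θ ^ n)))
        (volume.restrict (Ioo 0 Real.pi)) := (i3.const_mul r).const_mul (c + n)
    rw [← integral_add (i1.const_mul _) (i2.const_mul _), ← integral_sub i5 i6]
    refine integral_congr_ae (.of_forall fun θ => ?_)
    have hA1 : distSq r η θ ^ k = distSq r η θ ^ (k - 1) * distSq r η θ := by
      rw [← Real.rpow_add_one (hpos θ).ne']; ring_nf
    have hx2 : (r - η * Real.cos θ) ^ 2 = distSq r η θ - (η * Real.sin θ) ^ 2 := by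
      rw [distSq_eq_add r η θ]; ring
    simp only [radialIntegrand₁, radialIntegrand, hx2, show c / 2 - 2 = k - 1 by rw [hk]; ring,
      show (c - 2) / 2 = k by rw [hk]; ring, ← hk, hA1]
    rw [show c = 2 * k + 2 by rw [hk]; ring]
    ring
  rw [hFTC, mul_zero, sub_eq_zero] at e1
  exact e1

end

end RadialShell

namespace RadialShell

noncomputable section

/-! ### Regularity of the kernel -/

theorem isOpen_quadrant : IsOpen quadrant := isOpen_Ioi.prod isOpen_Ioi

theorem distSq_pos_of_ne {r η : ℝ} (h : |r| ≠ |η|) (θ : ℝ) : 0 < distSq r η θ := by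
  have : |r| - |η| ≠ 0 := sub_ne_zero.2 h
  exact lt_of_lt_of_le (by positivity) (le_distSq _ _ _)

theorem Dominated.ne_zero {n : ℕ} {e : ℝ} {q : ℝ × ℝ} (h : Dominated n e q) : q ≠ (0, 0) := by
  obtain ⟨s, hs, g, -, hd⟩ := h
  rintro rfl
  have := (hd _ (mem_of_mem_nhds hs) (Real.pi / 2)
    ⟨by linarith [Real.pi_pos], by linarith [Real.pi_pos]⟩).1
  simp [distSq] at this

theorem Dominated.kernel_eq {n : ℕ} {a b : ℝ} {q : ℝ × ℝ} (ha : Dominated n (a - 1) q)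
    (hb : Dominated n (b - 1) q) :
    kernel (n + 2) (powerPotential (n + 2) a b) q.1 q.2 =
      (sinInt n)⁻¹ * (radialInt n b q.1 q.2 - radialInt n a q.1 q.2) := by
  rw [kernel_eq_integral n a b ha.ne_zero, ← mul_neg, ← integral_neg]
  congr 1
  change _ = (∫ θ in Ioo 0 Real.pi, radialIntegrand n b q θ) -
    ∫ θ in Ioo 0 Real.pi, radialIntegrand n a q θ
  rw [← integral_sub hb.integrable_radialIntegrand
    ha.integrable_radialIntegrand]
  refine integral_congr_ae (.of_forall fun θ => ?_)
  simp only [sphereIntegrand, radialIntegrand, distSq]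
  ring

section Kernel

variable {n : ℕ} {a b : ℝ}

/-- The power-law kernel in dimension `n + 2`. -/
abbrev pkernel (n : ℕ) (a b : ℝ) : ℝ → ℝ → ℝ := kernel (n + 2) (powerPotential (n + 2) a b)

theorem pkernel_eventuallyEq {q : ℝ × ℝ} (ha : Dominated n (a - 1) q)
    (hb : Dominated n (b - 1) q) :
    (Function.uncurry (pkernel n a b)) =ᶠ[𝓝 q] fun p =>
      (sinInt n)⁻¹ * (radialInt n b p.1 p.2 - radialInt n a p.1 p.2) := by
  filter_upwards [ha.eventually, hb.eventually] with p hpa hpb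
  exact hpa.kernel_eq hpb

theorem Dominated.continuousAt_pkernel {q : ℝ × ℝ} (ha : Dominated n (a - 1) q)
    (hb : Dominated n (b - 1) q) : ContinuousAt (Function.uncurry (pkernel n a b)) q := by
  refine ContinuousAt.congr ?_ (pkernel_eventuallyEq ha hb).symm
  exact continuousAt_const.mul (hb.continuousAt_radialInt.sub ha.continuousAt_radialInt)

theorem Dominated.contDiffAt_pkernel {q : ℝ × ℝ} (ha : Dominated n (a - 2) q)
    (hb : Dominated n (b - 2) q) : ContDiffAt ℝ 1 (Function.uncurry (pkernel n a b)) q := by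
  refine ContDiffAt.congr_of_eventuallyEq ?_ (pkernel_eventuallyEq ha.add_one hb.add_one)
  exact contDiffAt_const.mul (hb.contDiffAt_radialInt.sub ha.contDiffAt_radialInt)

theorem Dominated.hasFDerivAt_pkernel {q : ℝ × ℝ} (ha : Dominated n (a - 2) q)
    (hb : Dominated n (b - 2) q) : HasFDerivAt (Function.uncurry (pkernel n a b))
      (((sinInt n)⁻¹ * (radialInt₁ n b q.1 q.2 - radialInt₁ n a q.1 q.2)) •
          ContinuousLinearMap.fst ℝ ℝ ℝ +
        ((sinInt n)⁻¹ * (radialInt₂ n b q.1 q.2 - radialInt₂ n a q.1 q.2)) •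
          ContinuousLinearMap.snd ℝ ℝ ℝ) q := by
  refine HasFDerivAt.congr_of_eventuallyEq ?_ (pkernel_eventuallyEq ha.add_one hb.add_one)
  convert! (hb.hasFDerivAt_radialInt.sub ha.hasFDerivAt_radialInt).const_mul (sinInt n)⁻¹ using 1
  ext <;> simp

theorem Dominated.hasDerivAt_pkernel_left {r η : ℝ} (ha : Dominated n (a - 2) (r, η))
    (hb : Dominated n (b - 2) (r, η)) : HasDerivAt (fun s => pkernel n a b s η)
      ((sinInt n)⁻¹ * (radialInt₁ n b r η - radialInt₁ n a r η)) r := by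
  have h2 : HasDerivAt (fun s : ℝ => (s, η)) (1, 0) r :=
    (hasDerivAt_id r).prodMk (hasDerivAt_const r η)
  convert! (ha.hasFDerivAt_pkernel hb).comp_hasDerivAt r h2 using 1
  simp

theorem Dominated.hasDerivAt_pkernel_right {r η : ℝ} (ha : Dominated n (a - 2) (r, η))
    (hb : Dominated n (b - 2) (r, η)) : HasDerivAt (fun s => pkernel n a b r s)
      ((sinInt n)⁻¹ * (radialInt₂ n b r η - radialInt₂ n a r η)) η := by
  have h2 : HasDerivAt (fun s : ℝ => (r, s)) (0, 1) η :=
    (hasDerivAt_const η r).prodMk (hasDerivAt_id η)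
  convert! (ha.hasFDerivAt_pkernel hb).comp_hasDerivAt η h2 using 1
  simp

theorem Dominated.partial₁_pkernel {r η : ℝ} (ha : Dominated n (a - 2) (r, η))
    (hb : Dominated n (b - 2) (r, η)) : partial₁ (pkernel n a b) r η =
      (sinInt n)⁻¹ * (radialInt₁ n b r η - radialInt₁ n a r η) :=
  (ha.hasDerivAt_pkernel_left hb).deriv

theorem Dominated.partial₂_pkernel {r η : ℝ} (ha : Dominated n (a - 2) (r, η))
    (hb : Dominated n (b - 2) (r, η)) : partial₂ (pkernel n a b) r η =
      (sinInt n)⁻¹ * (radialInt₂ n b r η - radialInt₂ n a r η) :=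
  (ha.hasDerivAt_pkernel_right hb).deriv

theorem Dominated.hasFDerivAt_pkernel_partial {q : ℝ × ℝ} (ha : Dominated n (a - 2) q)
    (hb : Dominated n (b - 2) q) : HasFDerivAt (Function.uncurry (pkernel n a b))
      (partial₁ (pkernel n a b) q.1 q.2 • ContinuousLinearMap.fst ℝ ℝ ℝ +
        partial₂ (pkernel n a b) q.1 q.2 • ContinuousLinearMap.snd ℝ ℝ ℝ) q := by
  rw [ha.partial₁_pkernel hb, ha.partial₂_pkernel hb]
  exact ha.hasFDerivAt_pkernel hb

theorem dominated_sub_one {c : ℝ} (hc : -(n : ℝ) < c) {r η : ℝ} (hr : 0 < r) (hη : 0 ≤ η) :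
    Dominated n (c - 1) (r, η) := by
  rcases hη.eq_or_lt with rfl | h
  · exact dominated_of_abs_ne (by simpa using hr.ne')
  · exact dominated_of_mem_quadrant (by linarith) ⟨hr, h⟩

theorem continuousOn_pkernel (hb : -(n : ℝ) < b) (hab : b < a) :
    ContinuousOn (Function.uncurry (pkernel n a b)) (Ioi 0 ×ˢ Ici 0) := fun _ hq =>
  ((dominated_sub_one (hb.trans hab) hq.1 hq.2).continuousAt_pkernel
    (dominated_sub_one hb hq.1 hq.2)).continuousWithinAt

theorem contDiffOn_pkernel (hb : 1 - (n : ℝ) < b) (hab : b < a) :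
    ContDiffOn ℝ 1 (Function.uncurry (pkernel n a b)) quadrant := fun _ hq =>
  ((dominated_of_mem_quadrant (by linarith) hq).contDiffAt_pkernel
    (dominated_of_mem_quadrant (by linarith) hq)).contDiffWithinAt

theorem abs_ne_of_mem_quadrant_diff {q : ℝ × ℝ} (hq : q ∈ quadrant \ diag) :
    |q.1| ≠ |q.2| := by
  rw [abs_of_pos hq.1.1, abs_of_pos hq.1.2]
  exact hq.2

theorem contDiffOn_pkernel_off_diag (n : ℕ) (a b : ℝ) :
    ContDiffOn ℝ 1 (Function.uncurry (pkernel n a b)) (quadrant \ diag) := fun _ hq =>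
  ((dominated_of_abs_ne (abs_ne_of_mem_quadrant_diff hq)).contDiffAt_pkernel
    (dominated_of_abs_ne (abs_ne_of_mem_quadrant_diff hq))).contDiffWithinAt

/-! ### Sign of the kernel at large radii -/

theorem distInt_pos {e r η : ℝ} (h : |r| ≠ |η|) : 0 < distInt n e r η := by
  have hD : Dominated n e (r, η) := dominated_of_abs_ne h
  rw [distInt, setIntegral_pos_iff_support_of_nonneg_ae _ hD.integrable_distSq]
  · have : Ioo 0 Real.pi ⊆ (Function.support fun θ => distSq r η θ ^ (e / 2) * Real.sin θ ^ n) ∩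
        Ioo 0 Real.pi := fun θ hθ => ⟨(mul_pos (Real.rpow_pos_of_pos (distSq_pos_of_ne h θ) _)
          (pow_pos (Real.sin_pos_of_mem_Ioo hθ) n)).ne', hθ⟩
    refine lt_of_lt_of_le ?_ (measure_mono this)
    simp [Real.pi_pos]
  · filter_upwards [ae_restrict_mem measurableSet_Ioo] with θ hθ
    exact mul_nonneg (Real.rpow_nonneg (distSq_nonneg _ _ _) _) (sin_pow_nonneg hθ)

theorem hasDerivAt_pow_mul_radialInt {c r η : ℝ} (h : |r| ≠ |η|) :
    HasDerivAt (fun s => s ^ (n + 1) * radialInt n c s η)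
      (r ^ (n + 1) * ((c + n) * distInt n (c - 2) r η)) r := by
  have h1 := (hasDerivAt_pow (n + 1) r).mul
    (dominated_of_abs_ne (n := n) (e := c - 2) (q := (r, η)) h).hasDerivAt_radialInt
  convert! h1 using 1
  have h2 := radialInt_identity (n := n) (c := c) h
  simp only [Nat.add_sub_cancel, Nat.cast_add, Nat.cast_one]
  linear_combination (-(r ^ n)) * h2

theorem radialInt_pos {c r η : ℝ} (hc : -(n : ℝ) < c) (hr : 0 < r) (hη : 0 ≤ η) :
    0 < radialInt n c r η := by
  rcases le_or_gt η r with h | h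
  · have hD : Dominated n (c - 1) (r, η) := dominated_sub_one hc hr hη
    have hpos : ∀ θ ∈ Ioo 0 Real.pi, 0 < radialIntegrand n c (r, η) θ := by
      intro θ hθ
      have hs := Real.sin_pos_of_mem_Ioo hθ
      have hc1 : Real.cos θ < 1 := by
        nlinarith [Real.sin_sq_add_cos_sq θ, Real.cos_le_one θ]
      have hx : 0 < r - η * Real.cos θ := by
        rcases le_total (Real.cos θ) 0 with h0 | h0
        · nlinarith
        · nlinarith [mul_le_mul_of_nonneg_right h h0]
      have hA : 0 < distSq r η θ := by rw [distSq_eq_add]; positivity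
      exact mul_pos (mul_pos (Real.rpow_pos_of_pos hA _) hx) (pow_pos hs n)
    have : radialInt n c r η = ∫ θ in Ioo 0 Real.pi, radialIntegrand n c (r, η) θ := rfl
    rw [this, setIntegral_pos_iff_support_of_nonneg_ae _ hD.integrable_radialIntegrand]
    · refine lt_of_lt_of_le ?_ (measure_mono fun θ hθ => ⟨(hpos θ hθ).ne', hθ⟩)
      simp [Real.pi_pos]
    · filter_upwards [ae_restrict_mem measurableSet_Ioo] with θ hθ
      exact (hpos θ hθ).le
  · have hne : ∀ s ∈ Icc 0 r, |s| ≠ |η| := fun s hs => by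
      rw [abs_of_nonneg hs.1, abs_of_nonneg hη]
      exact (hs.2.trans_lt h).ne
    have hmono : StrictMonoOn (fun s => s ^ (n + 1) * radialInt n c s η) (Icc 0 r) := by
      refine strictMonoOn_of_deriv_pos (convex_Icc 0 r)
        (fun s hs => (hasDerivAt_pow_mul_radialInt (hne s hs)).continuousAt.continuousWithinAt) ?_
      intro s hs
      rw [interior_Icc] at hs
      have hs' := hne s (Ioo_subset_Icc_self hs)
      rw [(hasDerivAt_pow_mul_radialInt hs').deriv]
      exact mul_pos (pow_pos hs.1 _) (mul_pos (by linarith) (distInt_pos hs'))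
    have := hmono (left_mem_Icc.2 hr.le) (right_mem_Icc.2 hr.le) hr
    simp only [zero_pow (Nat.succ_ne_zero n), zero_mul] at this
    exact pos_of_mul_pos_right this (by positivity)

theorem radialInt_smul {c r η t : ℝ} (ht : 0 < t) :
    radialInt n c (t * r) (t * η) = t ^ (c - 1) * radialInt n c r η := by
  rw [radialInt, radialInt, ← integral_const_mul]
  refine integral_congr_ae (.of_forall fun θ => ?_)
  have h1 : distSq (t * r) (t * η) θ = t ^ 2 * distSq r η θ := by simp only [distSq]; ring
  have h2 : (t ^ 2 * distSq r η θ) ^ (c / 2 - 1) = t ^ (c - 2) * distSq r η θ ^ (c / 2 - 1) := by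
    rw [Real.mul_rpow (by positivity) (distSq_nonneg _ _ _), ← Real.rpow_natCast,
      ← Real.rpow_mul ht.le]
    congr 2
    push_cast
    ring
  have h3 : t ^ (c - 1) = t ^ (c - 2) * t := by
    rw [← Real.rpow_add_one ht.ne']; ring_nf
  simp only [h1, h2, h3]
  ring

theorem radialInt_le_of_far {r η : ℝ} (hb : -(n : ℝ) < b) (hab : b < a) (hr : 1 ≤ r)
    (hη : 2 * r ≤ η) : radialInt n b r η ≤ radialInt n a r η := by
  have hη0 : 0 ≤ η := by linarith
  have hne : ∀ s ∈ Icc 0 r, |s| ≠ |η| := fun s hs => by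
    rw [abs_of_nonneg hs.1, abs_of_nonneg hη0]
    exact (by linarith [hs.2] : s < η).ne
  have hd : ∀ s ∈ Icc 0 r, HasDerivAt
      (fun s => s ^ (n + 1) * radialInt n a s η - s ^ (n + 1) * radialInt n b s η)
      (s ^ (n + 1) * ((a + n) * distInt n (a - 2) s η) -
        s ^ (n + 1) * ((b + n) * distInt n (b - 2) s η)) s := fun s hs =>
    (hasDerivAt_pow_mul_radialInt (hne s hs)).sub (hasDerivAt_pow_mul_radialInt (hne s hs))
  have hmono : MonotoneOn
      (fun s => s ^ (n + 1) * radialInt n a s η - s ^ (n + 1) * radialInt n b s η) (Icc 0 r) := by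
    refine monotoneOn_of_deriv_nonneg (convex_Icc 0 r)
      (fun s hs => (hd s hs).continuousAt.continuousWithinAt)
      (fun s hs => (hd s (interior_subset hs)).differentiableAt.differentiableWithinAt) ?_
    intro s hs
    have hs := interior_subset hs
    rw [(hd s hs).deriv, ← mul_sub]
    refine mul_nonneg (pow_nonneg hs.1 _) (sub_nonneg.2 ?_)
    have hJ : distInt n (b - 2) s η ≤ distInt n (a - 2) s η := by
      have hDa : Dominated n (a - 2) (s, η) := dominated_of_abs_ne (hne s hs)
      have hDb : Dominated n (b - 2) (s, η) := dominated_of_abs_ne (hne s hs)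
      refine setIntegral_mono_on hDb.integrable_distSq hDa.integrable_distSq measurableSet_Ioo ?_
      intro θ hθ
      refine mul_le_mul_of_nonneg_right ?_ (sin_pow_nonneg hθ)
      refine Real.rpow_le_rpow_of_exponent_le ?_ (by linarith)
      refine le_trans ?_ (le_distSq s η θ)
      rw [abs_of_nonneg hs.1, abs_of_nonneg hη0]
      nlinarith [hs.2]
    exact mul_le_mul (by linarith) hJ (distInt_pos (hne s hs)).le (by linarith)
  have := hmono (left_mem_Icc.2 (by linarith)) (right_mem_Icc.2 (by linarith)) (by linarith)
  simp only [zero_pow (Nat.succ_ne_zero n), zero_mul, sub_zero, ← mul_sub] at this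
  have h2 : 0 < r ^ (n + 1) := by positivity
  exact sub_nonneg.1 (nonneg_of_mul_nonneg_right this h2)

theorem exists_pkernel_nonpos (hb : -(n : ℝ) < b) (hab : b < a) :
    ∃ K : ℝ, 0 < K ∧ ∀ r, K ≤ r → ∀ η, 0 ≤ η → pkernel n a b r η ≤ 0 := by
  have ha := hb.trans hab
  have hcont : ∀ c : ℝ, -(n : ℝ) < c → ContinuousOn (fun ρ => radialInt n c 1 ρ) (Icc 0 2) := by
    intro c hc ρ hρ
    have h1 := (dominated_sub_one hc one_pos hρ.1).continuousAt_radialInt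
    exact (h1.comp (f := fun ρ : ℝ => ((1 : ℝ), ρ)) (by fun_prop)).continuousWithinAt
  obtain ⟨ρ₀, hρ₀, hmin⟩ := isCompact_Icc.exists_isMinOn (nonempty_Icc.2 zero_le_two) (hcont a ha)
  obtain ⟨ρ₁, hρ₁, hmax⟩ := isCompact_Icc.exists_isMaxOn (nonempty_Icc.2 zero_le_two) (hcont b hb)
  have hm : 0 < radialInt n a 1 ρ₀ := radialInt_pos ha one_pos hρ₀.1
  have hM : 0 < radialInt n b 1 ρ₁ := radialInt_pos hb one_pos hρ₁.1
  obtain ⟨K, hK⟩ := ((tendsto_rpow_atTop (sub_pos.2 hab)).eventually_ge_atTop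
    (radialInt n b 1 ρ₁ / radialInt n a 1 ρ₀)).exists_forall_of_atTop
  refine ⟨max 1 K, by positivity, fun r hr η hη => ?_⟩
  have hr1 : 1 ≤ r := (le_max_left _ _).trans hr
  have hr0 : 0 < r := by linarith
  have heq := (dominated_sub_one ha hr0 hη).kernel_eq (dominated_sub_one hb hr0 hη)
  rw [pkernel, heq]
  refine mul_nonpos_of_nonneg_of_nonpos (inv_nonneg.2 (sinInt_pos n).le) (sub_nonpos.2 ?_)
  rcases le_total (2 * r) η with h | h
  · exact radialInt_le_of_far hb hab hr1 h
  · have hρ : η / r ∈ Icc (0 : ℝ) 2 := ⟨by positivity, by rw [div_le_iff₀ hr0]; exact h⟩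
    have hs : ∀ c, radialInt n c r η = r ^ (c - 1) * radialInt n c 1 (η / r) := by
      intro c
      rw [← radialInt_smul hr0, mul_one, mul_div_cancel₀ _ hr0.ne']
    have h1 := hK r ((le_max_right _ _).trans hr)
    rw [div_le_iff₀ hm] at h1
    have h2 : r ^ (a - 1) = r ^ (b - 1) * r ^ (a - b) := by
      rw [← Real.rpow_add hr0]; ring_nf
    show radialInt n b r η ≤ radialInt n a r η
    rw [hs a, hs b, h2, mul_assoc]
    gcongr
    calc radialInt n b 1 (η / r) ≤ radialInt n b 1 ρ₁ := hmax hρ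
      _ ≤ r ^ (a - b) * radialInt n a 1 ρ₀ := h1
      _ ≤ _ := by gcongr; exact hmin hρ

/-! ### Blow-up of the derivative at the diagonal -/

theorem exists_rpow_le (hb : -(n : ℝ) < b) (hab : b < a) (M : ℝ) :
    ∃ C : ℝ, 0 ≤ C ∧ ∀ A ∈ Ioc 0 M, (a + n) * A ^ (a / 2 - 1) ≤
      (b + n) / 2 * A ^ (b / 2 - 1) + C := by
  set A₀ : ℝ := ((b + n) / (2 * (a + n))) ^ (2 / (a - b)) with hA₀
  have hbn : 0 < b + n := by linarith
  have han : 0 < a + n := by linarith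
  have hab' : 0 < a - b := by linarith
  have hA₀pos : 0 < A₀ := by positivity
  have hcont : ContinuousOn (fun A : ℝ => (a + n) * A ^ (a / 2 - 1)) (Icc A₀ M) := by
    refine continuousOn_const.mul (continuousOn_id.rpow_const fun x hx => Or.inl ?_)
    exact (hA₀pos.trans_le hx.1).ne'
  obtain ⟨C, hC⟩ := isCompact_Icc.exists_bound_of_continuousOn hcont
  refine ⟨|C|, abs_nonneg C, fun A hA => ?_⟩
  have hApos : 0 < A := hA.1
  rcases le_or_gt A A₀ with h | h
  · have h1 : A ^ (a / 2 - 1) = A ^ (b / 2 - 1) * A ^ ((a - b) / 2) := by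
      rw [← Real.rpow_add hApos]; ring_nf
    have h2 : A ^ ((a - b) / 2) ≤ (b + n) / (2 * (a + n)) := by
      calc A ^ ((a - b) / 2) ≤ A₀ ^ ((a - b) / 2) := by gcongr
        _ = _ := by
          rw [hA₀, ← Real.rpow_mul (by positivity)]
          rw [show 2 / (a - b) * ((a - b) / 2) = 1 by field_simp, Real.rpow_one]
    have h3 : 0 < A ^ (b / 2 - 1) := by positivity
    calc (a + n) * A ^ (a / 2 - 1) = A ^ (b / 2 - 1) * ((a + n) * A ^ ((a - b) / 2)) := by
          rw [h1]; ring
      _ ≤ A ^ (b / 2 - 1) * ((a + n) * ((b + n) / (2 * (a + n)))) := by gcongr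
      _ = (b + n) / 2 * A ^ (b / 2 - 1) := by field_simp
      _ ≤ _ := by linarith [abs_nonneg C]
  · have h1 := hC A ⟨h.le, hA.2⟩
    have h2 : 0 ≤ (b + n) / 2 * A ^ (b / 2 - 1) := by positivity
    exact ((le_abs_self _).trans h1).trans ((le_abs_self C).trans (by linarith))

theorem log_le_distInt {R : ℝ} (hR : 0 < R) (hb' : b ≤ 1 - n) :
    ∃ k : ℝ, 0 < k ∧ ∀ r ∈ Ioo 0 (2 * R), ∀ η ∈ Ioo 0 (2 * R), r ≠ η → |r - η| ≤ 1 →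
      k * Real.log (1 / |r - η|) ≤ distInt n (b - 2) r η := by
  have hn : (0 : ℝ) ≤ n := n.cast_nonneg
  set k : ℝ := (1 + 4 * R ^ 2) ^ (b / 2 - 1) * (2 / Real.pi) ^ n with hk
  refine ⟨k, by positivity, fun r hr η hη hne hle => ?_⟩
  have hr0 : 0 < r := hr.1
  have hη0 : 0 < η := hη.1
  have habs : |r| ≠ |η| := by rwa [abs_of_pos hr0, abs_of_pos hη0]
  set δ := |r - η| with hδ
  have hδ0 : 0 < δ := abs_pos.2 (sub_ne_zero.2 hne)
  have hD : Dominated n (b - 2) (r, η) := dominated_of_abs_ne habs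
  have hsub : Ioc δ 1 ⊆ Ioo 0 Real.pi := fun θ hθ =>
    ⟨hδ0.trans hθ.1, hθ.2.trans_lt (by linarith [Real.pi_gt_three])⟩
  have hintegr : IntervalIntegrable (fun θ : ℝ => k * θ⁻¹) volume δ 1 := by
    refine (ContinuousOn.intervalIntegrable ?_)
    refine continuousOn_const.mul (continuousOn_id.inv₀ fun x hx => ?_)
    rw [uIcc_of_le hle] at hx
    exact (hδ0.trans_le hx.1).ne'
  calc k * Real.log (1 / δ) = ∫ θ in Ioc δ 1, k * θ⁻¹ := by
        rw [← intervalIntegral.integral_of_le hle, intervalIntegral.integral_const_mul,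
          integral_inv_of_pos hδ0 one_pos]
    _ ≤ ∫ θ in Ioc δ 1, distSq r η θ ^ ((b - 2) / 2) * Real.sin θ ^ n := by
        refine setIntegral_mono_on hintegr.1 (hD.integrable_distSq.mono_set hsub)
          measurableSet_Ioc fun θ hθ => ?_
        have hθ0 : 0 < θ := hδ0.trans hθ.1
        have h1 : distSq r η θ ≤ (1 + 4 * R ^ 2) * θ ^ 2 := by
          have e1 : distSq r η θ = (r - η) ^ 2 + 2 * (r * η) * (1 - Real.cos θ) := by
            simp only [distSq]; ring
          have e2 : (r - η) ^ 2 ≤ θ ^ 2 := by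
            rw [← sq_abs (r - η)]
            exact pow_le_pow_left₀ (abs_nonneg _) hθ.1.le 2
          have e3 : 1 - Real.cos θ ≤ θ ^ 2 / 2 := by linarith [Real.one_sub_sq_div_two_le_cos (x := θ)]
          have e4 : r * η ≤ (2 * R) * (2 * R) := mul_le_mul hr.2.le hη.2.le hη0.le (by linarith)
          have e5 : 2 * (r * η) * (1 - Real.cos θ) ≤ 2 * (r * η) * (θ ^ 2 / 2) := by gcongr
          nlinarith [sq_nonneg θ]
        have h2 : (1 + 4 * R ^ 2) ^ (b / 2 - 1) * (θ ^ 2) ^ (b / 2 - 1) ≤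
            distSq r η θ ^ ((b - 2) / 2) := by
          rw [← Real.mul_rpow (by positivity) (by positivity), show (b - 2) / 2 = b / 2 - 1 by ring]
          exact Real.rpow_le_rpow_of_nonpos (distSq_pos_of_ne habs θ) h1 (by linarith)
        have h3 : (2 / Real.pi * θ) ^ n ≤ Real.sin θ ^ n := by
          have := Real.mul_le_sin hθ0.le (by linarith [hθ.2, Real.pi_gt_three])
          gcongr
        have h4 : θ⁻¹ ≤ (θ ^ 2) ^ (b / 2 - 1) * θ ^ n := by
          rw [← Real.rpow_natCast θ 2, ← Real.rpow_mul hθ0.le, ← Real.rpow_natCast θ n,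
            ← Real.rpow_add hθ0, ← Real.rpow_neg_one]
          refine Real.rpow_le_rpow_of_exponent_ge hθ0 hθ.2 ?_
          push_cast
          linarith
        calc k * θ⁻¹ ≤ k * ((θ ^ 2) ^ (b / 2 - 1) * θ ^ n) := by gcongr
          _ = ((1 + 4 * R ^ 2) ^ (b / 2 - 1) * (θ ^ 2) ^ (b / 2 - 1)) * (2 / Real.pi * θ) ^ n := by
            rw [hk, mul_pow]; ring
          _ ≤ _ := mul_le_mul h2 h3 (by positivity) (Real.rpow_nonneg (distSq_nonneg _ _ _) _)
    _ ≤ _ := by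
        refine setIntegral_mono_set hD.integrable_distSq ?_ hsub.eventuallyLE
        filter_upwards [ae_restrict_mem measurableSet_Ioo] with θ hθ
        exact mul_nonneg (Real.rpow_nonneg (distSq_nonneg _ _ _) _) (sin_pow_nonneg hθ)

theorem partial₁_pkernel_ge {R : ℝ} (hR : 0 < R) (hb : -(n : ℝ) < b) (hab : b < a) :
    ∃ C : ℝ, ∀ᶠ q in 𝓝[diagᶜ] (R, R), (sinInt n)⁻¹ * ((b + n) / 2) * distInt n (b - 2) q.1 q.2 - C ≤
      partial₁ (pkernel n a b) q.1 q.2 := by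
  have ha := hb.trans hab
  obtain ⟨C, hC0, hC⟩ := exists_rpow_le hb hab ((4 * R) ^ 2)
  have hcont : ContinuousAt (Function.uncurry (pkernel n a b)) (R, R) :=
    (dominated_sub_one ha hR hR.le).continuousAt_pkernel (dominated_sub_one hb hR hR.le)
  have hcont2 : ContinuousAt (fun q : ℝ × ℝ => (n + 1) / q.1 * Function.uncurry (pkernel n a b) q)
      (R, R) := (continuousAt_const.div continuousAt_fst hR.ne').mul hcont
  set B := (n + 1) / R * Function.uncurry (pkernel n a b) (R, R) + 1 with hB
  have hev : ∀ᶠ q in 𝓝 (R, R), (n + 1) / q.1 * Function.uncurry (pkernel n a b) q < B :=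
    hcont2.eventually_lt_const (by simp [hB])
  refine ⟨(sinInt n)⁻¹ * (C * sinInt n) + B, ?_⟩
  have hbox : ∀ᶠ q : ℝ × ℝ in 𝓝 (R, R), q ∈ Ioo 0 (2 * R) ×ˢ Ioo 0 (2 * R) :=
    prod_mem_nhds (Ioo_mem_nhds hR (by linarith)) (Ioo_mem_nhds hR (by linarith))
  filter_upwards [nhdsWithin_le_nhds hev, nhdsWithin_le_nhds hbox, self_mem_nhdsWithin]
    with q hq1 hq2 hq3
  obtain ⟨r, η⟩ := q
  have hr0 : 0 < r := hq2.1.1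
  have hη0 : 0 < η := hq2.2.1
  have habs : |r| ≠ |η| := by rw [abs_of_pos hr0, abs_of_pos hη0]; exact hq3
  have hD : ∀ e, Dominated n e (r, η) := fun e => dominated_of_abs_ne habs
  have hZ := sinInt_pos n
  simp only
  rw [(hD (a - 2)).partial₁_pkernel (hD (b - 2))]
  have hk : pkernel n a b r η = (sinInt n)⁻¹ * (radialInt n b r η - radialInt n a r η) :=
    (hD (a - 1)).kernel_eq (hD (b - 1))
  have hq1' : (n + 1) / r * pkernel n a b r η < B := hq1
  have e : ∀ c, radialInt₁ n c r η = (c + n) * distInt n (c - 2) r η -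
      (n + 1) / r * radialInt n c r η := by
    intro c
    have := radialInt_identity (n := n) (c := c) habs
    field_simp
    linear_combination this
  have hJ : (a + n) * distInt n (a - 2) r η ≤
      (b + n) / 2 * distInt n (b - 2) r η + C * sinInt n := by
    rw [distInt, distInt, sinInt, ← integral_const_mul, ← integral_const_mul, ← integral_const_mul]
    have i1 := (hD (b - 2)).integrable_distSq.const_mul ((b + n) / 2)
    have i2 := (integrableOn_sin_pow n).const_mul C
    rw [← integral_add i1 i2]
    refine setIntegral_mono_on ((hD (a - 2)).integrable_distSq.const_mul _) (i1.add i2)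
      measurableSet_Ioo fun θ hθ => ?_
    have hA : distSq r η θ ∈ Ioc 0 ((4 * R) ^ 2) := by
      refine ⟨distSq_pos_of_ne habs θ, (distSq_le _ _ _).trans ?_⟩
      rw [abs_of_pos hr0, abs_of_pos hη0]
      have h1 := hq2.1.2
      have h2 := hq2.2.2
      simp only at h1 h2
      exact pow_le_pow_left₀ (by positivity) (by linarith) 2
    have h1 := mul_le_mul_of_nonneg_right (hC _ hA) (sin_pow_nonneg (n := n) hθ)
    rw [← mul_assoc, show (a - 2) / 2 = a / 2 - 1 by ring, show (b - 2) / 2 = b / 2 - 1 by ring]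
    linarith
  have hZ' : 0 < (sinInt n)⁻¹ := inv_pos.2 hZ
  have h5 : (sinInt n)⁻¹ * ((a + n) * distInt n (a - 2) r η) ≤
      (sinInt n)⁻¹ * ((b + n) / 2 * distInt n (b - 2) r η + C * sinInt n) := by gcongr
  rw [e a, e b]
  have h6 : (sinInt n)⁻¹ * ((b + n) * distInt n (b - 2) r η - (n + 1) / r * radialInt n b r η -
      ((a + n) * distInt n (a - 2) r η - (n + 1) / r * radialInt n a r η)) =
      (sinInt n)⁻¹ * ((b + n) * distInt n (b - 2) r η) -
      (sinInt n)⁻¹ * ((a + n) * distInt n (a - 2) r η) - (n + 1) / r * pkernel n a b r η := by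
    rw [hk]; ring
  rw [h6]
  linarith

theorem tendsto_partial₁_pkernel {R : ℝ} (hR : 0 < R) (hb : -(n : ℝ) < b) (hab : b < a)
    (hb' : b ≤ 1 - n) :
    Tendsto (fun q : ℝ × ℝ => partial₁ (pkernel n a b) q.1 q.2) (𝓝[diagᶜ] (R, R)) atTop := by
  obtain ⟨C, hC⟩ := partial₁_pkernel_ge hR hb hab
  obtain ⟨k, hk0, hk⟩ := log_le_distInt (n := n) (b := b) hR hb'
  have hZ' : 0 < (sinInt n)⁻¹ := inv_pos.2 (sinInt_pos n)
  have hbn : 0 < (b + n) / 2 := by linarith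
  have h0 : Tendsto (fun q : ℝ × ℝ => |q.1 - q.2|) (𝓝[diagᶜ] (R, R)) (𝓝[>] 0) := by
    rw [tendsto_nhdsWithin_iff]
    constructor
    · have : Continuous (fun q : ℝ × ℝ => |q.1 - q.2|) := by fun_prop
      have h := this.tendsto (R, R)
      simp only [sub_self, abs_zero] at h
      exact h.mono_left nhdsWithin_le_nhds
    · filter_upwards [self_mem_nhdsWithin] with q hq
      exact abs_pos.2 (sub_ne_zero.2 hq)
  have h1 : Tendsto (fun q : ℝ × ℝ => Real.log (1 / |q.1 - q.2|)) (𝓝[diagᶜ] (R, R)) atTop := by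
    simp_rw [one_div]
    exact Real.tendsto_log_atTop.comp (tendsto_inv_nhdsGT_zero.comp h0)
  have h2 : Tendsto (fun q : ℝ × ℝ => (sinInt n)⁻¹ * ((b + n) / 2) *
      (k * Real.log (1 / |q.1 - q.2|)) - C) (𝓝[diagᶜ] (R, R)) atTop := by
    refine tendsto_atTop_add_const_right _ _ ?_
    exact ((h1.const_mul_atTop hk0).const_mul_atTop (by positivity))
  refine tendsto_atTop_mono' _ ?_ h2
  have hbox : ∀ᶠ q : ℝ × ℝ in 𝓝 (R, R), q ∈ Ioo 0 (2 * R) ×ˢ Ioo 0 (2 * R) :=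
    prod_mem_nhds (Ioo_mem_nhds hR (by linarith)) (Ioo_mem_nhds hR (by linarith))
  have hle : ∀ᶠ q : ℝ × ℝ in 𝓝[diagᶜ] (R, R), |q.1 - q.2| < 1 :=
    (tendsto_nhdsWithin_iff.1 h0).1.eventually_lt_const one_pos
  filter_upwards [hC, nhdsWithin_le_nhds hbox, hle, self_mem_nhdsWithin] with q hq1 hq2 hq3 hq4
  refine le_trans ?_ hq1
  have := hk q.1 hq2.1 q.2 hq2.2 hq4 hq3.le
  gcongr

end Kernel

end

end RadialShell

namespace RadialShell

noncomputable section

/-! ### Values on the diagonal -/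

theorem integral_beta {p q : ℝ} (hp : 0 < p) (hq : 0 < q) :
    ∫ u in Ioo (0 : ℝ) 1, u ^ (p - 1) * (1 - u) ^ (q - 1) = ProbabilityTheory.beta p q := by
  rw [ProbabilityTheory.beta_eq_betaIntegralReal p q hp hq, Complex.betaIntegral,
    intervalIntegral.integral_of_le zero_le_one, integral_Ioc_eq_integral_Ioo]
  have : ∫ x in Ioo (0 : ℝ) 1, (x : ℂ) ^ ((p : ℂ) - 1) * (1 - (x : ℂ)) ^ ((q : ℂ) - 1) =
      ∫ x in Ioo (0 : ℝ) 1, ((x ^ (p - 1) * (1 - x) ^ (q - 1) : ℝ) : ℂ) := by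
    refine setIntegral_congr_fun measurableSet_Ioo fun x hx => ?_
    rw [Complex.ofReal_mul, Complex.ofReal_cpow hx.1.le, Complex.ofReal_cpow (by linarith [hx.2])]
    push_cast
    ring
  rw [this, integral_complex_ofReal, Complex.ofReal_re]

theorem beta_add_one_left {x m : ℝ} (hx : 0 < x) (hm : 0 < m) :
    (x + m) * ProbabilityTheory.beta (x + 1) m = x * ProbabilityTheory.beta x m := by
  have hg : 0 < Real.Gamma (x + m) := Real.Gamma_pos_of_pos (by positivity)
  have h1 : x + m ≠ 0 := by positivity
  rw [ProbabilityTheory.beta, ProbabilityTheory.beta, show x + 1 + m = x + m + 1 by ring,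
    Real.Gamma_add_one hx.ne', Real.Gamma_add_one h1]
  field_simp

theorem image_half_one_sub_cos :
    (fun θ => (1 - Real.cos θ) / 2) '' Ioo 0 Real.pi = Ioo 0 1 := by
  ext u
  constructor
  · rintro ⟨θ, hθ, rfl⟩
    have hs := Real.sin_pos_of_mem_Ioo hθ
    have := Real.sin_sq_add_cos_sq θ
    constructor <;> simp only <;> nlinarith
  · intro hu
    refine ⟨Real.arccos (1 - 2 * u), ⟨Real.arccos_pos.2 (by linarith [hu.1]), ?_⟩, ?_⟩
    · refine lt_of_le_of_ne (Real.arccos_le_pi _) fun h => ?_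
      rw [Real.arccos_eq_pi] at h
      linarith [hu.2]
    · simp only
      rw [Real.cos_arccos (by linarith [hu.2]) (by linarith [hu.1])]
      ring

theorem distInt_one_one {n : ℕ} {c : ℝ} (hc : -1 < c + n) :
    distInt n c 1 1 = 2 ^ (c + n) * ProbabilityTheory.beta ((c + n + 1) / 2) ((n + 1 : ℝ) / 2) := by
  have hn : (0 : ℝ) ≤ n := n.cast_nonneg
  rw [← integral_beta (by linarith) (by positivity), ← image_half_one_sub_cos,
    integral_image_eq_integral_abs_deriv_smul measurableSet_Ioo
      (f' := fun θ => Real.sin θ / 2) (fun θ _ => ?_) ?_, ← integral_const_mul, distInt]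
  · refine setIntegral_congr_fun measurableSet_Ioo fun θ hθ => ?_
    have hs := Real.sin_pos_of_mem_Ioo hθ
    have hsc := Real.sin_sq_add_cos_sq θ
    set u := (1 - Real.cos θ) / 2 with hu
    have hu0 : 0 < u := by rw [hu]; nlinarith
    have hu1 : 0 < 1 - u := by rw [hu]; nlinarith
    have hA : distSq 1 1 θ = 4 * u := by simp only [distSq, hu]; ring
    have hsin : Real.sin θ = 2 * (u ^ (1 / 2 : ℝ) * (1 - u) ^ (1 / 2 : ℝ)) := by
      rw [← Real.mul_rpow hu0.le hu1.le, ← Real.sqrt_eq_rpow, ← Real.sqrt_sq hs.le,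
        show Real.sin θ ^ 2 = 2 ^ 2 * (u * (1 - u)) by rw [hu]; nlinarith,
        Real.sqrt_mul (by positivity), Real.sqrt_sq zero_le_two]
    have h4 : (4 : ℝ) ^ (c / 2) = 2 ^ c := by
      rw [show (4 : ℝ) = 2 ^ (2 : ℝ) by norm_num, ← Real.rpow_mul zero_le_two]
      ring_nf
    simp only [smul_eq_mul]
    rw [abs_of_pos (by positivity), hA, Real.mul_rpow (by norm_num) hu0.le, h4,
      Real.rpow_add two_pos, Real.rpow_natCast]
    have e1 : u ^ (c / 2) * (u ^ (1 / 2 : ℝ)) ^ n = u ^ (1 / 2 : ℝ) * u ^ ((c + n + 1) / 2 - 1) := by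
      rw [← Real.rpow_natCast, ← Real.rpow_mul hu0.le, ← Real.rpow_add hu0, ← Real.rpow_add hu0]
      congr 1; ring
    have e2 : ((1 - u) ^ (1 / 2 : ℝ)) ^ n = (1 - u) ^ (1 / 2 : ℝ) * (1 - u) ^ ((n + 1 : ℝ) / 2 - 1) := by
      rw [← Real.rpow_natCast, ← Real.rpow_mul hu1.le, ← Real.rpow_add hu1]
      congr 1; ring
    rw [hsin, mul_pow, mul_pow]
    calc _ = 2 ^ c * 2 ^ n * (u ^ (c / 2) * (u ^ (1 / 2 : ℝ)) ^ n) * ((1 - u) ^ (1 / 2 : ℝ)) ^ n := by ring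
      _ = _ := by rw [e1, e2]; ring
  · intro x hx y hy h
    simp only at h
    exact Real.injOn_cos (Ioo_subset_Icc_self hx) (Ioo_subset_Icc_self hy) (by linarith)
  · have := ((Real.hasDerivAt_cos θ).const_sub 1).div_const 2
    simpa using this.hasDerivWithinAt

theorem distInt_one_one_pos {n : ℕ} {c : ℝ} (hc : -1 < c + n) : 0 < distInt n c 1 1 := by
  have hn : (0 : ℝ) ≤ n := n.cast_nonneg
  rw [distInt_one_one hc]
  have := ProbabilityTheory.beta_pos (α := (c + n + 1) / 2) (β := (n + 1 : ℝ) / 2)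
    (by linarith) (by positivity)
  positivity

theorem distInt_recurrence {n : ℕ} {c : ℝ} (hc : 1 < c + n) :
    4 * (c + n - 1) * distInt n (c - 2) 1 1 = (c + 2 * n) * distInt n c 1 1 := by
  have hn : (0 : ℝ) ≤ n := n.cast_nonneg
  have h := beta_add_one_left (x := (c + n - 1) / 2) (m := (n + 1 : ℝ) / 2) (by linarith)
    (by positivity)
  rw [distInt_one_one (by linarith), distInt_one_one (by linarith)]
  have e1 : (c - 2 + n + 1) / 2 = (c + n - 1) / 2 := by ring
  have e2 : (c + n - 1) / 2 + 1 = (c + n + 1) / 2 := by ring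
  have e3 : (2 : ℝ) ^ (c + n) = 4 * 2 ^ (c - 2 + n) := by
    rw [show c + n = (c - 2 + n) + 2 by ring, Real.rpow_add two_pos]
    norm_num
    ring
  rw [e2] at h
  rw [e1, e3]
  linear_combination (-8 * 2 ^ (c - 2 + n)) * h

theorem distSq_diag (R θ : ℝ) : distSq R R θ = R ^ 2 * distSq 1 1 θ := by
  simp only [distSq]; ring

theorem distInt_diag {n : ℕ} {c R : ℝ} (hR : 0 < R) :
    distInt n c R R = R ^ c * distInt n c 1 1 := by
  rw [distInt, distInt, ← integral_const_mul]
  refine integral_congr_ae (.of_forall fun θ => ?_)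
  simp only
  rw [distSq_diag, Real.mul_rpow (by positivity) (distSq_nonneg _ _ _), ← Real.rpow_natCast,
    ← Real.rpow_mul hR.le, ← mul_assoc]
  congr 3
  push_cast
  ring

theorem sub_cos_diag {R θ : ℝ} (hR : 0 < R) : R - R * Real.cos θ = distSq R R θ / (2 * R) := by
  simp only [distSq]; field_simp; ring

theorem distSq_diag_pos {R θ : ℝ} (hR : 0 < R) (hθ : θ ∈ Ioo 0 Real.pi) : 0 < distSq R R θ := by
  have := Real.sin_pos_of_mem_Ioo hθ
  rw [distSq_eq_add]
  positivity

theorem radialInt_diag {n : ℕ} {c R : ℝ} (hR : 0 < R) :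
    radialInt n c R R = R ^ (c - 1) * (distInt n c 1 1 / 2) := by
  have h : radialInt n c R R = (2 * R)⁻¹ * distInt n c R R := by
    rw [radialInt, distInt, ← integral_const_mul]
    refine setIntegral_congr_fun measurableSet_Ioo fun θ hθ => ?_
    have hA := distSq_diag_pos hR hθ
    change distSq R R θ ^ (c / 2 - 1) * (R - R * Real.cos θ) * Real.sin θ ^ n =
      (2 * R)⁻¹ * (distSq R R θ ^ (c / 2) * Real.sin θ ^ n)
    rw [sub_cos_diag hR, show c / 2 - 1 = c / 2 + -1 by ring, Real.rpow_add hA, Real.rpow_neg_one]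
    field_simp
  rw [h, distInt_diag hR, Real.rpow_sub_one hR.ne']
  field_simp

theorem radialInt₁_diag {n : ℕ} {c R : ℝ} (hR : 0 < R) (hc : 1 < c + n) :
    radialInt₁ n c R R = R ^ (c - 2) * (distInt n c 1 1 / 4) *
      ((c + 2 * n) / (c + n - 1) + c - 2) := by
  have hD1 : Dominated n (c - 2) (R, R) := dominated_of_mem_quadrant (by linarith) ⟨hR, hR⟩
  have hD2 : Dominated n c (R, R) := dominated_of_mem_quadrant (by linarith) ⟨hR, hR⟩
  have h : radialInt₁ n c R R = distInt n (c - 2) R R + (c - 2) / (4 * R ^ 2) * distInt n c R R := by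
    rw [radialInt₁, distInt, distInt, ← integral_const_mul, ← integral_add hD1.integrable_distSq
      (hD2.integrable_distSq.const_mul _)]
    refine setIntegral_congr_fun measurableSet_Ioo fun θ hθ => ?_
    have hA := distSq_diag_pos hR hθ
    simp only [radialIntegrand₁]
    rw [sub_cos_diag hR, show (c - 2) / 2 = c / 2 - 1 by ring,
      show distSq R R θ ^ (c / 2) = distSq R R θ ^ (c / 2 - 2) * distSq R R θ ^ 2 by
        rw [← Real.rpow_natCast, ← Real.rpow_add hA]; congr 1; push_cast; ring]
    field_simp
    ring
  have hrec := distInt_recurrence hc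
  have hpos : 0 < c + n - 1 := by linarith
  have e : distInt n (c - 2) 1 1 = (c + 2 * n) / (c + n - 1) * (distInt n c 1 1 / 4) := by
    field_simp
    linear_combination hrec
  rw [h, distInt_diag hR, distInt_diag hR, e,
    show R ^ c = R ^ (c - 2) * R ^ 2 by
      rw [← Real.rpow_natCast, ← Real.rpow_add hR]; congr 1; push_cast; ring]
  field_simp
  ring

variable {n : ℕ} {a b : ℝ}

theorem pkernel_diag (hb : -(n : ℝ) < b) (hab : b < a) {R : ℝ} (hR : 0 < R) :
    pkernel n a b R R = (sinInt n)⁻¹ * (R ^ (b - 1) * (distInt n b 1 1 / 2) -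
      R ^ (a - 1) * (distInt n a 1 1 / 2)) := by
  have := (dominated_sub_one (hb.trans hab) hR hR.le).kernel_eq (dominated_sub_one hb hR hR.le)
  rw [pkernel, this, radialInt_diag hR, radialInt_diag hR]

theorem shellRadius_eq (hb : -(n : ℝ) < b) (hab : b < a) :
    shellRadius (n + 2) a b = (distInt n b 1 1 / distInt n a 1 1) ^ (1 / (a - b)) := by
  have hab' : 0 < a - b := by linarith
  have hn : (0 : ℝ) ≤ n := n.cast_nonneg
  have hβ : ∀ c, -(n : ℝ) < c → 0 < ProbabilityTheory.beta ((c + n + 1) / 2) ((n + 1 : ℝ) / 2) :=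
    fun c hc => ProbabilityTheory.beta_pos (by linarith) (by positivity)
  have hb1 := hβ b hb
  have ha1 := hβ a (hb.trans hab)
  rw [distInt_one_one (by linarith), distInt_one_one (by linarith), shellRadius]
  have e1 : ∀ c : ℝ, (c + ((n + 2 : ℕ) : ℝ) - 1) / 2 = (c + n + 1) / 2 := by
    intro c; push_cast; ring
  have e2 : (((n + 2 : ℕ) : ℝ) - 1) / 2 = (n + 1) / 2 := by push_cast; ring
  rw [e1, e1, e2, mul_div_mul_comm, ← Real.rpow_sub two_pos,
    Real.mul_rpow (by positivity) (by positivity), ← Real.rpow_mul zero_le_two,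
    show (b + n - (a + n)) * (1 / (a - b)) = -1 by field_simp; ring, Real.rpow_neg_one]
  norm_num

theorem shellRadius_pos (hb : -(n : ℝ) < b) (hab : b < a) : 0 < shellRadius (n + 2) a b := by
  rw [shellRadius_eq hb hab]
  have h1 := distInt_one_one_pos (n := n) (c := a) (by linarith)
  have h2 := distInt_one_one_pos (n := n) (c := b) (by linarith)
  positivity

theorem pkernel_diag_eq_zero_iff (hb : -(n : ℝ) < b) (hab : b < a) {R : ℝ} (hR : 0 < R) :
    pkernel n a b R R = 0 ↔ R = shellRadius (n + 2) a b := by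
  have h1 := distInt_one_one_pos (n := n) (c := a) (by linarith)
  have h2 := distInt_one_one_pos (n := n) (c := b) (by linarith)
  have hab' : 0 < a - b := by linarith
  have hZ := sinInt_pos n
  have e : R ^ (a - 1) = R ^ (b - 1) * R ^ (a - b) := by rw [← Real.rpow_add hR]; ring_nf
  have hRb : 0 < R ^ (b - 1) := by positivity
  have h3 : pkernel n a b R R = 0 ↔ R ^ (a - b) = distInt n b 1 1 / distInt n a 1 1 := by
    rw [pkernel_diag hb hab hR, mul_eq_zero, or_iff_right (inv_ne_zero hZ.ne'), e, eq_div_iff h1.ne']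
    constructor
    · intro h
      have : R ^ (b - 1) * (distInt n b 1 1 - R ^ (a - b) * distInt n a 1 1) = 0 := by linarith
      rcases mul_eq_zero.1 this with h | h
      · exact absurd h hRb.ne'
      · linarith
    · intro h
      linear_combination (-(R ^ (b - 1)) / 2) * h
  rw [h3, shellRadius_eq hb hab, one_div, Real.eq_rpow_inv hR.le (by positivity) hab'.ne']

theorem shellRadius_balance (hb : -(n : ℝ) < b) (hab : b < a) {R : ℝ}
    (hR : R = shellRadius (n + 2) a b) :
    R ^ b * distInt n b 1 1 = R ^ a * distInt n a 1 1 := by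
  have hR0 : 0 < R := hR ▸ shellRadius_pos hb hab
  have h := (pkernel_diag_eq_zero_iff hb hab hR0).2 hR
  rw [pkernel_diag hb hab hR0, mul_eq_zero, or_iff_right (inv_ne_zero (sinInt_pos n).ne'),
    Real.rpow_sub_one hR0.ne', Real.rpow_sub_one hR0.ne'] at h
  field_simp at h
  linarith

theorem partial₁_shellRadius (hb : 1 - (n : ℝ) < b) (hab : b < a) {R : ℝ}
    (hR : R = shellRadius (n + 2) a b) : ∃ Q : ℝ, 0 < Q ∧ partial₁ (pkernel n a b) R R =
      Q * ((a - b) * ((n + 1) - (a + n - 1) * (b + n - 1))) := by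
  have hn : (0 : ℝ) ≤ n := n.cast_nonneg
  have hb' : -(n : ℝ) < b := by linarith
  have hR0 : 0 < R := hR ▸ shellRadius_pos hb' hab
  have hbal := shellRadius_balance hb' hab hR
  have hDa : Dominated n (a - 2) (R, R) := dominated_of_mem_quadrant (by linarith) ⟨hR0, hR0⟩
  have hDb : Dominated n (b - 2) (R, R) := dominated_of_mem_quadrant (by linarith) ⟨hR0, hR0⟩
  have hZ := sinInt_pos n
  have hMb := distInt_one_one_pos (n := n) (c := b) (by linarith)
  have hu : 0 < a + n - 1 := by linarith
  have hv : 0 < b + n - 1 := by linarith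
  have e : ∀ c : ℝ, R ^ (c - 2) = R ^ c / R ^ 2 := by
    intro c
    rw [← Real.rpow_natCast, ← Real.rpow_sub hR0]; norm_cast
  refine ⟨(sinInt n)⁻¹ * (R ^ b * distInt n b 1 1 / (4 * R ^ 2)) /
    ((a + n - 1) * (b + n - 1)), by positivity, ?_⟩
  rw [hDa.partial₁_pkernel hDb, radialInt₁_diag hR0 (by linarith), radialInt₁_diag hR0 (by linarith),
    e, e, show R ^ a / R ^ 2 * (distInt n a 1 1 / 4) = R ^ b * distInt n b 1 1 / (4 * R ^ 2) by
      rw [hbal]; field_simp,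
    show R ^ b / R ^ 2 * (distInt n b 1 1 / 4) = R ^ b * distInt n b 1 1 / (4 * R ^ 2) by field_simp]
  field_simp
  ring

theorem partial_sum_shellRadius_neg (hb : 1 - (n : ℝ) < b) (hab : b < a) {R : ℝ}
    (hR : R = shellRadius (n + 2) a b) :
    partial₁ (pkernel n a b) R R + partial₂ (pkernel n a b) R R < 0 := by
  have hn : (0 : ℝ) ≤ n := n.cast_nonneg
  have hb' : -(n : ℝ) < b := by linarith
  have hR0 : 0 < R := hR ▸ shellRadius_pos hb' hab
  have hbal := shellRadius_balance hb' hab hR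
  have hDa : Dominated n (a - 2) (R, R) := dominated_of_mem_quadrant (by linarith) ⟨hR0, hR0⟩
  have hDb : Dominated n (b - 2) (R, R) := dominated_of_mem_quadrant (by linarith) ⟨hR0, hR0⟩
  have hZ := sinInt_pos n
  have hMb := distInt_one_one_pos (n := n) (c := b) (by linarith)
  have h2 : HasDerivAt (fun s : ℝ => (s, s)) (1, 1) R := (hasDerivAt_id R).prodMk (hasDerivAt_id R)
  have h3 : HasDerivAt (fun s => pkernel n a b s s)
      (partial₁ (pkernel n a b) R R + partial₂ (pkernel n a b) R R) R := by
    have h1 := hDa.hasFDerivAt_pkernel_partial hDb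
    convert! HasFDerivAt.comp_hasDerivAt (f := fun s : ℝ => (s, s)) R h1 h2 using 1
    simp
  have h4 : HasDerivAt (fun s : ℝ => (sinInt n)⁻¹ * (s ^ (b - 1) * (distInt n b 1 1 / 2) -
      s ^ (a - 1) * (distInt n a 1 1 / 2))) ((sinInt n)⁻¹ *
      ((b - 1) * R ^ (b - 1 - 1) * (distInt n b 1 1 / 2) -
      (a - 1) * R ^ (a - 1 - 1) * (distInt n a 1 1 / 2))) R :=
    (((Real.hasDerivAt_rpow_const (Or.inl hR0.ne')).mul_const _).sub
      ((Real.hasDerivAt_rpow_const (Or.inl hR0.ne')).mul_const _)).const_mul _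
  have h5 : (fun s => pkernel n a b s s) =ᶠ[𝓝 R] (fun s : ℝ => (sinInt n)⁻¹ *
      (s ^ (b - 1) * (distInt n b 1 1 / 2) - s ^ (a - 1) * (distInt n a 1 1 / 2))) := by
    filter_upwards [Ioi_mem_nhds hR0] with s hs
    exact pkernel_diag hb' hab hs
  rw [h3.unique (h4.congr_of_eventuallyEq h5)]
  have e : ∀ c : ℝ, R ^ (c - 1 - 1) = R ^ c / R ^ 2 := by
    intro c
    rw [← Real.rpow_natCast, ← Real.rpow_sub hR0]; congr 1; push_cast; ring
  rw [e, e]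
  have h6 : (b - 1) * (R ^ b / R ^ 2) * (distInt n b 1 1 / 2) -
      (a - 1) * (R ^ a / R ^ 2) * (distInt n a 1 1 / 2) =
      -((a - b) * (R ^ b * distInt n b 1 1 / (2 * R ^ 2))) := by
    field_simp
    linear_combination (a - 1) * hbal
  rw [h6, mul_neg, neg_lt_zero]
  have : 0 < a - b := by linarith
  positivity

theorem criticalExponent_eq (hu : 0 < a + n - 1) :
    criticalExponent (n + 2) a = (n + 1) / (a + n - 1) + 1 - n := by
  have h : a + ((n + 2 : ℕ) : ℝ) - 3 = a + n - 1 := by push_cast; ring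
  rw [criticalExponent, h]
  push_cast
  field_simp
  ring

theorem lt_criticalExponent_iff (hu : 0 < a + n - 1) :
    b < criticalExponent (n + 2) a ↔ (a + n - 1) * (b + n - 1) < n + 1 := by
  rw [criticalExponent_eq hu, show (b < (n + 1) / (a + n - 1) + 1 - n) ↔
    (b + n - 1 < (n + 1) / (a + n - 1)) by constructor <;> intro h <;> linarith, lt_div_iff₀ hu,
    mul_comm]

theorem criticalExponent_lt_iff (hu : 0 < a + n - 1) :
    criticalExponent (n + 2) a < b ↔ n + 1 < (a + n - 1) * (b + n - 1) := by
  rw [criticalExponent_eq hu, show ((n + 1) / (a + n - 1) + 1 - n < b) ↔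
    ((n + 1) / (a + n - 1) < b + n - 1) by constructor <;> intro h <;> linarith, div_lt_iff₀ hu,
    mul_comm]

theorem lt_of_criticalExponent_lt (hu : 1 - (n : ℝ) < a) (h : criticalExponent (n + 2) a < b) :
    1 - (n : ℝ) < b := by
  have hn : (0 : ℝ) ≤ n := n.cast_nonneg
  have hu' : 0 < a + n - 1 := by linarith
  rw [criticalExponent_lt_iff hu'] at h
  have := pos_of_mul_pos_right (by linarith : 0 < (a + n - 1) * (b + n - 1)) hu'.le
  linarith

theorem partial₁_shellRadius_pos (hb : 1 - (n : ℝ) < b) (hab : b < a) {R : ℝ}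
    (hR : R = shellRadius (n + 2) a b) (h : b < criticalExponent (n + 2) a) :
    0 < partial₁ (pkernel n a b) R R := by
  obtain ⟨Q, hQ, he⟩ := partial₁_shellRadius hb hab hR
  rw [lt_criticalExponent_iff (by linarith)] at h
  rw [he]
  exact mul_pos hQ (mul_pos (by linarith) (by linarith))

theorem partial₁_shellRadius_neg (hb : 1 - (n : ℝ) < b) (hab : b < a) {R : ℝ}
    (hR : R = shellRadius (n + 2) a b) (h : criticalExponent (n + 2) a < b) :
    partial₁ (pkernel n a b) R R < 0 := by
  obtain ⟨Q, hQ, he⟩ := partial₁_shellRadius hb hab hR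
  rw [criticalExponent_lt_iff (by linarith)] at h
  rw [he]
  exact mul_neg_of_pos_of_neg hQ (mul_neg_of_pos_of_neg (by linarith) (by linarith))

end

end RadialShell

namespace RadialShell

noncomputable section

/-! ### Spherical shells as steady states -/

theorem measurableEmbedding_smul_sphere {n : ℕ} {R : ℝ} (hR : 0 < R) :
    MeasurableEmbedding (fun y : Metric.sphere (0 : EuclideanSpace ℝ (Fin (n + 2))) 1 =>
      R • (y : EuclideanSpace ℝ (Fin (n + 2)))) :=
  (by fun_prop : Continuous fun y : Metric.sphere (0 : EuclideanSpace ℝ (Fin (n + 2))) 1 =>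
      R • (y : EuclideanSpace ℝ (Fin (n + 2)))).measurableEmbedding fun _ _ h =>
    Subtype.ext (smul_right_injective _ hR.ne' h)

variable {n : ℕ} {R : ℝ} {F : Type*} [NormedAddCommGroup F] [NormedSpace ℝ F]

theorem integral_shell (hR : 0 < R) (f : EuclideanSpace ℝ (Fin (n + 2)) → F) :
    ∫ x, f x ∂(shell (n + 2) R) =
      (sphereArea (n + 2))⁻¹ • ∫ y : Metric.sphere (0 : EuclideanSpace ℝ (Fin (n + 2))) 1,
        f (R • (y : EuclideanSpace ℝ (Fin (n + 2)))) ∂(sphereMeasure (n + 2)) := by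
  rw [shell, integral_smul_measure, (measurableEmbedding_smul_sphere hR).integral_map,
    ENNReal.toReal_inv, ENNReal.toReal_ofReal (sphereArea_pos n).le]

theorem integrable_shell_iff {F : Type*} [NormedAddCommGroup F] (hR : 0 < R)
    (f : EuclideanSpace ℝ (Fin (n + 2)) → F) :
    Integrable f (shell (n + 2) R) ↔
      Integrable (fun y : Metric.sphere (0 : EuclideanSpace ℝ (Fin (n + 2))) 1 =>
        f (R • (y : EuclideanSpace ℝ (Fin (n + 2))))) (sphereMeasure (n + 2)) := by
  rw [shell, integrable_smul_measure (by simp) (by simp [sphereArea_pos n]),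
    (measurableEmbedding_smul_sphere hR).integrable_map_iff]
  rfl

theorem map_isometry_shell (hR : 0 < R)
    (g : EuclideanSpace ℝ (Fin (n + 2)) ≃ₗᵢ[ℝ] EuclideanSpace ℝ (Fin (n + 2))) :
    (shell (n + 2) R).map g = shell (n + 2) R := by
  rw [shell, Measure.map_smul, Measure.map_map g.continuous.measurable
    (measurableEmbedding_smul_sphere hR).measurable]
  congr 1
  have h : (g ∘ fun y : Metric.sphere (0 : EuclideanSpace ℝ (Fin (n + 2))) 1 =>
      R • (y : EuclideanSpace ℝ (Fin (n + 2)))) =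
      (fun y : Metric.sphere (0 : EuclideanSpace ℝ (Fin (n + 2))) 1 =>
      R • (y : EuclideanSpace ℝ (Fin (n + 2)))) ∘ sphereMap g := by
    ext y
    simp [sphereMap]
  rw [h, ← Measure.map_map (measurableEmbedding_smul_sphere hR).measurable
    (continuous_sphereMap g).measurable, sphereMeasure, toSphere_map_sphereMap]

theorem measurePreserving_isometry_shell (hR : 0 < R)
    (g : EuclideanSpace ℝ (Fin (n + 2)) ≃ₗᵢ[ℝ] EuclideanSpace ℝ (Fin (n + 2))) :
    MeasurePreserving g (shell (n + 2) R) (shell (n + 2) R) :=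
  ⟨g.continuous.measurable, map_isometry_shell hR g⟩

theorem integral_comp_isometry_shell (hR : 0 < R)
    (g : EuclideanSpace ℝ (Fin (n + 2)) ≃ₗᵢ[ℝ] EuclideanSpace ℝ (Fin (n + 2)))
    (f : EuclideanSpace ℝ (Fin (n + 2)) → F) :
    ∫ x, f (g x) ∂(shell (n + 2) R) = ∫ x, f x ∂(shell (n + 2) R) :=
  (measurePreserving_isometry_shell hR g).integral_comp g.toHomeomorph.measurableEmbedding f

theorem isProbabilityMeasure_shell (n : ℕ) (hR : 0 < R) : IsProbabilityMeasure (shell (n + 2) R) := by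
  constructor
  rw [shell, Measure.smul_apply, Measure.map_apply (measurableEmbedding_smul_sphere hR).measurable
    MeasurableSet.univ, preimage_univ, smul_eq_mul, sphereArea,
    ofReal_measureReal (by rw [sphereMeasure]; exact measure_ne_top _ _)]
  refine ENNReal.inv_mul_cancel ?_ ?_
  · rw [sphereMeasure, ne_eq, Measure.measure_univ_eq_zero]
    exact Measure.toSphere_ne_zero _
  · rw [sphereMeasure]; exact measure_ne_top _ _

theorem ae_norm_shell (hR : 0 < R) : ∀ᵐ x ∂(shell (n + 2) R), ‖x‖ = R := by
  have hm : MeasurableSet {x : EuclideanSpace ℝ (Fin (n + 2)) | ‖x‖ = R} :=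
    (isClosed_singleton (x := R)).preimage continuous_norm |>.measurableSet
  rw [shell]
  refine Measure.ae_smul_measure ?_ _
  rw [ae_map_iff (measurableEmbedding_smul_sphere hR).measurable.aemeasurable hm]
  filter_upwards with y
  simp [norm_smul, abs_of_pos hR]

theorem norm_of_mem_support_shell (hR : 0 < R) {x : EuclideanSpace ℝ (Fin (n + 2))}
    (hx : x ∈ (shell (n + 2) R).support) : ‖x‖ = R :=
  Measure.support_subset_of_isClosed
    ((isClosed_singleton (x := R)).preimage continuous_norm) (ae_norm_shell hR) hx

variable {a b : ℝ}

theorem integrable_gradient_shell (hb : -(n : ℝ) < b) (hab : b < a) (hR : 0 < R) :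
    Integrable (fun y => gradient (powerPotential (n + 2) a b) (R • e₁ (n + 2) - y))
      (shell (n + 2) R) := by
  rw [integrable_shell_iff hR]
  obtain ⟨C, hC0, hCt, hC⟩ := exists_map_sphereMeasure n
  set X : Metric.sphere (0 : EuclideanSpace ℝ (Fin (n + 2))) 1 → EuclideanSpace ℝ (Fin (n + 2)) :=
    fun y => R • e₁ (n + 2) - R • (y : EuclideanSpace ℝ (Fin (n + 2))) with hX
  have hXm : Measurable X := by fun_prop
  have hne := (inner_gradient_ae n a b (r := R) (η := R) (by simp [hR.ne'])).mono fun y hy => hy.1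
  have hpow : ∀ c : ℝ, -(n : ℝ) < c →
      Integrable (fun y => ‖X y‖ ^ (c - 2) • X y) (sphereMeasure (n + 2)) := by
    intro c hc
    have hD : Dominated n (c - 1) (R, R) := dominated_sub_one hc hR hR.le
    have hi := (integrable_sphere_iff hC0 hCt hC
      (f := fun s => (R ^ 2 - 2 * R * R * s + R ^ 2) ^ ((c - 1) / 2)) (by fun_prop)).2
      hD.integrable_distSq
    refine hi.mono' (((hXm.norm.pow_const _).smul hXm).aestronglyMeasurable) ?_
    filter_upwards [hne] with y hy
    have hpos : 0 < ‖X y‖ := norm_pos_iff.2 hy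
    rw [← norm_sq_sub_sphere n R R y, norm_smul, Real.norm_of_nonneg (by positivity),
      ← Real.rpow_natCast, ← Real.rpow_mul (norm_nonneg _)]
    change ‖X y‖ ^ (c - 2) * ‖X y‖ ≤ ‖X y‖ ^ _
    rw [← Real.rpow_add_one hpos.ne']
    refine le_of_eq ?_
    congr 1
    push_cast
    ring
  refine ((hpow a (hb.trans hab)).sub (hpow b hb)).congr ?_
  filter_upwards [hne] with y hy
  rw [gradient_powerPotential a b hy, sub_smul]
  rfl

theorem inner_integral_shell (hb : -(n : ℝ) < b) (hab : b < a) (hR : 0 < R) :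
    inner ℝ (∫ y, gradient (powerPotential (n + 2) a b) (R • e₁ (n + 2) - y) ∂(shell (n + 2) R))
      (e₁ (n + 2)) = -pkernel n a b R R := by
  rw [real_inner_comm, ← integral_inner (integrable_gradient_shell hb hab hR), integral_shell hR,
    pkernel, kernel, neg_neg, smul_eq_mul]
  simp_rw [real_inner_comm]

theorem integral_shell_eq_zero_iff (hb : -(n : ℝ) < b) (hab : b < a) (hR : 0 < R) :
    ∫ y, gradient (powerPotential (n + 2) a b) (R • e₁ (n + 2) - y) ∂(shell (n + 2) R) = 0 ↔
      pkernel n a b R R = 0 := by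
  have hin := inner_integral_shell hb hab hR
  set I := ∫ y, gradient (powerPotential (n + 2) a b) (R • e₁ (n + 2) - y) ∂(shell (n + 2) R)
    with hI
  constructor
  · intro h
    rw [h, inner_zero_left] at hin
    linarith
  · intro h
    rw [h, neg_zero] at hin
    set g := (Submodule.span ℝ {I})ᗮ.reflection with hg
    have hge : g (e₁ (n + 2)) = e₁ (n + 2) := by
      refine Submodule.reflection_mem_subspace_eq_self ?_
      rw [Submodule.mem_orthogonal_singleton_iff_inner_right]
      exact hin
    have hgI : g I = -I := Submodule.reflection_orthogonalComplement_singleton_eq_neg I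
    have h1 := integral_comp_isometry_shell hR g
      (fun y => gradient (powerPotential (n + 2) a b) (R • e₁ (n + 2) - y))
    have h2 : ∀ y, gradient (powerPotential (n + 2) a b) (R • e₁ (n + 2) - g y) =
        g (gradient (powerPotential (n + 2) a b) (R • e₁ (n + 2) - y)) := by
      intro y
      rw [← gradient_comp_isometry g (powerPotential_isometry a b g), map_sub, map_smul, hge]
    simp_rw [h2] at h1
    have h3 : ∫ y, g (gradient (powerPotential (n + 2) a b) (R • e₁ (n + 2) - y))
        ∂(shell (n + 2) R) = g I :=
      (g.toContinuousLinearEquiv.toContinuousLinearMap.integral_comp_comm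
        (integrable_gradient_shell hb hab hR))
    rw [h3, hgI, ← hI] at h1
    have h4 : (2 : ℝ) • I = 0 := by
      rw [two_smul]
      nth_rewrite 1 [← h1]
      exact neg_add_cancel I
    simpa using h4

theorem isSteadyState_shell_iff (hb : -(n : ℝ) < b) (hab : b < a) (hR : 0 < R) :
    IsSteadyState (powerPotential (n + 2) a b) (shell (n + 2) R) ↔
      R = shellRadius (n + 2) a b := by
  rw [← pkernel_diag_eq_zero_iff hb hab hR, ← integral_shell_eq_zero_iff hb hab hR]
  have key : ∀ x : EuclideanSpace ℝ (Fin (n + 2)), ‖x‖ = R →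
      Integrable (fun y => gradient (powerPotential (n + 2) a b) (x - y)) (shell (n + 2) R) ∧
      ∃ g : EuclideanSpace ℝ (Fin (n + 2)) ≃ₗᵢ[ℝ] EuclideanSpace ℝ (Fin (n + 2)),
        ∫ y, gradient (powerPotential (n + 2) a b) (x - y) ∂(shell (n + 2) R) =
        g (∫ y, gradient (powerPotential (n + 2) a b) (R • e₁ (n + 2) - y) ∂(shell (n + 2) R)) := by
    intro x hx
    set g := (Submodule.span ℝ {R • e₁ (n + 2) - x})ᗮ.reflection with hg
    have hgx : g (R • e₁ (n + 2)) = x := by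
      refine Submodule.reflection_sub ?_
      rw [norm_smul, norm_e₁, hx, Real.norm_of_nonneg hR.le, mul_one]
    have h2 : ∀ y, gradient (powerPotential (n + 2) a b) (x - g y) =
        g (gradient (powerPotential (n + 2) a b) (R • e₁ (n + 2) - y)) := by
      intro y
      rw [← gradient_comp_isometry g (powerPotential_isometry a b g), map_sub, hgx]
    have hintegr := integrable_gradient_shell hb hab hR
    refine ⟨?_, g, ?_⟩
    · rw [← (measurePreserving_isometry_shell hR g).integrable_comp_emb
        g.toHomeomorph.measurableEmbedding]
      simp only [Function.comp_def, h2]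
      exact g.toContinuousLinearEquiv.toContinuousLinearMap.integrable_comp hintegr
    · rw [← integral_comp_isometry_shell hR g]
      simp_rw [h2]
      exact g.toContinuousLinearEquiv.toContinuousLinearMap.integral_comp_comm hintegr
  constructor
  · intro h
    have := isProbabilityMeasure_shell n hR
    obtain ⟨x, hx⟩ := Measure.nonempty_support (IsProbabilityMeasure.ne_zero (shell (n + 2) R))
    obtain ⟨-, g, hg⟩ := key x (norm_of_mem_support_shell hR hx)
    have h1 := neg_eq_zero.1 (h x hx).2
    rw [hg] at h1
    simpa using h1
  · intro h x hx
    obtain ⟨hi, g, hg⟩ := key x (norm_of_mem_support_shell hR hx)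
    refine ⟨hi, ?_⟩
    rw [hg, h]
    simp

end

end RadialShell

namespace RadialShell

noncomputable section

/-! ### From distributional to classical derivatives -/

theorem exists_primitive_compactSupport {ψ : ℝ → ℝ} (hψ : ContDiff ℝ (⊤ : ℕ∞) ψ)
    (hc : HasCompactSupport ψ) (hs : tsupport ψ ⊆ Ioi 0) (hintegr : ∫ x, ψ x = 0) :
    ∃ θ : ℝ → ℝ, ContDiff ℝ (⊤ : ℕ∞) θ ∧ HasCompactSupport θ ∧ tsupport θ ⊆ Ioi 0 ∧
      ∀ x, HasDerivAt θ (ψ x) x := by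
  obtain ⟨m, L, hm, hmL, hsub⟩ : ∃ m L : ℝ, 0 < m ∧ m ≤ L ∧ tsupport ψ ⊆ Icc m L := by
    rcases (tsupport ψ).eq_empty_or_nonempty with h | h
    · exact ⟨1, 1, one_pos, le_rfl, by simp [h]⟩
    · have hK : IsCompact (tsupport ψ) := hc
      obtain ⟨m, hm, hm'⟩ := hK.exists_isLeast h
      obtain ⟨L, hL, hL'⟩ := hK.exists_isGreatest h
      exact ⟨m, L, hs hm, hm' hL, fun x hx => ⟨hm' hx, hL' hx⟩⟩
  have hzero : ∀ x, x ∉ Icc m L → ψ x = 0 := fun x hx =>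
    image_eq_zero_of_notMem_tsupport fun h => hx (hsub h)
  set θ : ℝ → ℝ := fun x => ∫ y in (0 : ℝ)..x, ψ y with hθ
  have hd : ∀ x, HasDerivAt θ (ψ x) x := fun x =>
    intervalIntegral.integral_hasDerivAt_right (hψ.continuous.intervalIntegrable _ _)
      (hψ.continuous.stronglyMeasurableAtFilter _ _) hψ.continuous.continuousAt
  have hθz : ∀ x, x ∉ Icc m L → θ x = 0 := by
    intro x hx
    rcases lt_or_ge x m with h | h
    · rw [hθ]
      refine (intervalIntegral.integral_congr (g := fun _ => (0 : ℝ)) fun y hy => ?_).trans (by simp)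
      refine hzero y fun hy' => ?_
      have := hy.2
      rw [mem_Icc] at hy'
      rcases le_max_iff.1 this with h1 | h1 <;> linarith
    · have hx' : L < x := by
        by_contra h'
        exact hx ⟨h, not_lt.1 h'⟩
      rw [hθ]
      simp only
      rw [intervalIntegral.integral_of_le (by linarith), ← hintegr]
      refine setIntegral_eq_integral_of_forall_compl_eq_zero fun y hy => hzero y fun hy' => hy ?_
      exact ⟨by linarith [hy'.1], by linarith [hy'.2]⟩
  have hsup : Function.support θ ⊆ Icc m L := fun x hx => by
    by_contra h
    exact hx (hθz x h)
  have htsup : tsupport θ ⊆ Icc m L := closure_minimal hsup isClosed_Icc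
  refine ⟨θ, ?_, HasCompactSupport.of_support_subset_isCompact isCompact_Icc hsup,
    htsup.trans fun x hx => hm.trans_le hx.1, hd⟩
  rw [contDiff_infty_iff_deriv]
  refine ⟨fun x => (hd x).differentiableAt, ?_⟩
  rwa [show deriv θ = ψ from funext fun x => (hd x).deriv]

theorem exists_bump_integral_one : ∃ ρ : ℝ → ℝ, ContDiff ℝ (⊤ : ℕ∞) ρ ∧ HasCompactSupport ρ ∧
    tsupport ρ ⊆ Ioi 0 ∧ ∫ x, ρ x = 1 := by
  let f : ContDiffBump (2 : ℝ) := ⟨1 / 2, 1, by norm_num, by norm_num⟩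
  refine ⟨f.normed volume, f.contDiff_normed, f.hasCompactSupport_normed, ?_, f.integral_normed⟩
  rw [f.tsupport_normed_eq]
  intro x hx
  rw [Metric.mem_closedBall, Real.dist_eq] at hx
  have := (abs_le.1 hx).1
  have h1 : f.rOut = 1 := rfl
  rw [h1] at this
  simp only [mem_Ioi]
  linarith

/-- If `G` is the derivative of `F` in the sense of distributions on `(0, ∞)` and both are continuous,
then it is the derivative in the classical sense. -/
theorem hasDerivAt_of_distribution {F G : ℝ → ℝ} (hF : ContinuousOn F (Ioi 0))
    (hG : ContinuousOn G (Ioi 0))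
    (h : ∀ θ : ℝ → ℝ, ContDiff ℝ (⊤ : ℕ∞) θ → HasCompactSupport θ → tsupport θ ⊆ Ioi 0 →
      ∫ t in Ioi (0 : ℝ), (deriv θ t * F t + θ t * G t) = 0) :
    ∀ t, 0 < t → HasDerivAt F (G t) t := by
  set Φ : ℝ → ℝ := fun t => ∫ s in (1 : ℝ)..t, G s with hΦ
  have hΦd : ∀ t, 0 < t → HasDerivAt Φ (G t) t := by
    intro t ht
    refine intervalIntegral.integral_hasDerivAt_right ?_ ?_ (hG.continuousAt (Ioi_mem_nhds ht))
    · refine (hG.mono fun x hx => ?_).intervalIntegrable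
      exact (lt_min one_pos ht).trans_le hx.1
    · exact hG.stronglyMeasurableAtFilter isOpen_Ioi t ht
  have hΦc : ContinuousOn Φ (Ioi 0) := fun t ht => (hΦd t ht).continuousAt.continuousWithinAt
  have hH : ∀ θ : ℝ → ℝ, ContDiff ℝ (⊤ : ℕ∞) θ → HasCompactSupport θ → tsupport θ ⊆ Ioi 0 →
      ∫ t in Ioi (0 : ℝ), deriv θ t * (F t - Φ t) = 0 := by
    intro θ hθ hθc hθs
    have hcont : ∀ (f g : ℝ → ℝ), Continuous f → tsupport f ⊆ Ioi 0 → HasCompactSupport f →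
        ContinuousOn g (Ioi 0) → Integrable (fun t => f t * g t) := by
      intro f g hf hfs hfc hg
      have hK : IsCompact (tsupport f) := hfc
      have h1 : IntegrableOn (fun t => f t * g t) (tsupport f) :=
        (hf.continuousOn.mul (hg.mono hfs)).integrableOn_compact hK
      refine (integrableOn_iff_integrable_of_support_subset ?_).1 h1
      intro x hx
      by_contra hx'
      exact hx (by simp [image_eq_zero_of_notMem_tsupport hx'])
    have hθd : Continuous (deriv θ) := hθ.continuous_deriv (by simp)
    have hsd : tsupport (deriv θ) ⊆ tsupport θ := tsupport_deriv_subset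
    have i1 := hcont (deriv θ) F hθd (hsd.trans hθs) hθc.deriv hF
    have i2 := hcont (deriv θ) Φ hθd (hsd.trans hθs) hθc.deriv hΦc
    have i3 := hcont θ G hθ.continuous hθs hθc hG
    have hparts : ∫ t in Ioi (0 : ℝ), (deriv θ t * Φ t + θ t * G t) = 0 := by
      have e : ∀ f g : ℝ → ℝ, tsupport f ⊆ Ioi 0 → ∀ t, t ∉ Ioi (0 : ℝ) → f t * g t = 0 :=
        fun f g hf t ht => by rw [image_eq_zero_of_notMem_tsupport fun h => ht (hf h), zero_mul]
      rw [setIntegral_eq_integral_of_forall_compl_eq_zero (fun t ht => by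
        rw [e _ _ (hsd.trans hθs) t ht, e _ _ hθs t ht, add_zero])]
      have hd : ∀ t, HasDerivAt (fun t => θ t * Φ t) (deriv θ t * Φ t + θ t * G t) t := by
        intro t
        by_cases ht : 0 < t
        · exact (hθ.differentiable (by simp) t).hasDerivAt.mul (hΦd t ht)
        · have ht' : t ∉ tsupport θ := fun h => ht (hθs h)
          have hev : θ =ᶠ[𝓝 t] 0 := notMem_tsupport_iff_eventuallyEq.1 ht'
          have h0 : deriv θ t * Φ t + θ t * G t = 0 := by
            rw [e _ _ (hsd.trans hθs) t ht, e _ _ hθs t ht, add_zero]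
          rw [h0]
          refine (hasDerivAt_const t (0 : ℝ)).congr_of_eventuallyEq ?_
          filter_upwards [hev] with x hx
          simp [hx]
      exact integral_eq_zero_of_hasDerivAt_of_integrable hd (i2.add i3)
        (hcont θ Φ hθ.continuous hθs hθc hΦc)
    have h1 := h θ hθ hθc hθs
    have hsub : ∫ t in Ioi (0 : ℝ), deriv θ t * (F t - Φ t) =
        (∫ t in Ioi (0 : ℝ), (deriv θ t * F t + θ t * G t)) -
          ∫ t in Ioi (0 : ℝ), (deriv θ t * Φ t + θ t * G t) := by
      have j1 : Integrable (fun t => deriv θ t * F t + θ t * G t) (volume.restrict (Ioi 0)) :=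
        (i1.add i3).integrableOn
      have j2 : Integrable (fun t => deriv θ t * Φ t + θ t * G t) (volume.restrict (Ioi 0)) :=
        (i2.add i3).integrableOn
      rw [← integral_sub j1 j2]
      refine integral_congr_ae (.of_forall fun t => ?_)
      simp only
      ring
    rw [hsub, h1, hparts, sub_zero]
  obtain ⟨ρ, hρ, hρc, hρs, hρ1⟩ := exists_bump_integral_one
  set c := ∫ t in Ioi (0 : ℝ), ρ t * (F t - Φ t) with hc
  have hHc : ContinuousOn (fun t => F t - Φ t) (Ioi 0) := hF.sub hΦc
  have hintegr : ∀ f : ℝ → ℝ, Continuous f → tsupport f ⊆ Ioi 0 → HasCompactSupport f →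
      ∀ g : ℝ → ℝ, ContinuousOn g (Ioi 0) → Integrable (fun t => f t * g t) := by
    intro f hf hfs hfc g hg
    have hK : IsCompact (tsupport f) := hfc
    have h1 : IntegrableOn (fun t => f t * g t) (tsupport f) :=
      (hf.continuousOn.mul (hg.mono hfs)).integrableOn_compact hK
    refine (integrableOn_iff_integrable_of_support_subset ?_).1 h1
    intro x hx
    by_contra hx'
    exact hx (by simp [image_eq_zero_of_notMem_tsupport hx'])
  have key : ∀ᵐ t, t ∈ Ioi (0 : ℝ) → F t - Φ t - c = 0 := by
    refine isOpen_Ioi.ae_eq_zero_of_integral_contDiff_smul_eq_zero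
      ((hHc.sub continuousOn_const).locallyIntegrableOn measurableSet_Ioi) ?_
    intro ψ hψ hψc hψs
    set I := ∫ x, ψ x with hI
    have hi1 : Integrable ψ := hψ.continuous.integrable_of_hasCompactSupport hψc
    have hi2 : Integrable ρ := hρ.continuous.integrable_of_hasCompactSupport hρc
    have hψ' : ContDiff ℝ (⊤ : ℕ∞) (fun x => ψ x - I * ρ x) := hψ.sub (contDiff_const.mul hρ)
    have hsup : Function.support (fun x => ψ x - I * ρ x) ⊆ tsupport ψ ∪ tsupport ρ := by
      intro x hx
      by_contra h'
      simp only [mem_union, not_or] at h'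
      exact hx (by simp [image_eq_zero_of_notMem_tsupport h'.1,
        image_eq_zero_of_notMem_tsupport h'.2])
    have hKu : IsCompact (tsupport ψ ∪ tsupport ρ) := IsCompact.union hψc hρc
    obtain ⟨θ, hθ, hθc, hθs, hθd⟩ := exists_primitive_compactSupport hψ'
      (HasCompactSupport.of_support_subset_isCompact hKu hsup)
      ((closure_minimal hsup hKu.isClosed).trans (union_subset hψs hρs)) (by
        rw [integral_sub hi1 (hi2.const_mul I), integral_const_mul, hρ1, mul_one, sub_self])
    have h1 := hH θ hθ hθc hθs
    simp_rw [fun t => (hθd t).deriv] at h1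
    have j1 := (hintegr ψ hψ.continuous hψs hψc _ hHc)
    have j2 := (hintegr ρ hρ.continuous hρs hρc _ hHc)
    have h2 : ∫ t in Ioi (0 : ℝ), (ψ t - I * ρ t) * (F t - Φ t) =
        (∫ t in Ioi (0 : ℝ), ψ t * (F t - Φ t)) - I * c := by
      rw [hc, ← integral_const_mul, ← integral_sub j1.integrableOn (j2.integrableOn.const_mul I)]
      refine integral_congr_ae (.of_forall fun t => ?_)
      simp only
      ring
    rw [h2] at h1
    have hψ0 : ∀ t, t ∉ Ioi (0 : ℝ) → ψ t = 0 := fun t ht =>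
      image_eq_zero_of_notMem_tsupport fun h => ht (hψs h)
    have h3 : ∫ t in Ioi (0 : ℝ), ψ t * (F t - Φ t) = ∫ t, ψ t * (F t - Φ t) :=
      setIntegral_eq_integral_of_forall_compl_eq_zero fun t ht => by rw [hψ0 t ht, zero_mul]
    rw [h3] at h1
    have h4 : ∫ t, ψ t • (F t - Φ t - c) = (∫ t, ψ t * (F t - Φ t)) - I * c := by
      rw [hI, ← integral_mul_const, ← integral_sub j1 (hi1.mul_const c)]
      refine integral_congr_ae (.of_forall fun t => ?_)
      simp only [smul_eq_mul]
      ring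
    rw [h4, h1]
  have hconst : EqOn (fun t => F t - Φ t) (fun _ => c) (Ioi 0) := by
    refine Measure.eqOn_open_of_ae_eq (μ := volume) ?_ isOpen_Ioi hHc continuousOn_const
    rw [EventuallyEq, ae_restrict_iff' measurableSet_Ioi]
    filter_upwards [key] with t ht h0
    linarith [ht h0]
  intro t ht
  refine ((hΦd t ht).const_add c).congr_of_eventuallyEq ?_
  filter_upwards [Ioi_mem_nhds ht] with s hs
  have := hconst hs
  simp only at this
  linarith

/-! ### Curves of measures solving the radial equation -/

/-- Weakly continuous curves of probability measures on `[0, ∞)`, with locally bounded supports,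
solving the radial equation in the sense of distributions. -/
structure RadialFlow (ω : ℝ → ℝ → ℝ) (P : ℝ → ProbabilityMeasure ℝ) : Prop where
  continuous : Continuous P
  support : ∀ T, ∃ M, ∀ t ∈ Icc 0 T, ∀ᵐ r ∂(P t : Measure ℝ), r ∈ Icc 0 M
  equation : ∀ φ : ℝ × ℝ → ℝ, ContDiff ℝ (⊤ : ℕ∞) φ → HasCompactSupport φ →
    tsupport φ ⊆ Ioi 0 ×ˢ Ioi 0 →
    ∫ t in Ioi (0 : ℝ), ∫ r, (fderiv ℝ φ (t, r) (1, 0) +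
      radialVelocity ω (P t) r * fderiv ℝ φ (t, r) (0, 1)) ∂(P t : Measure ℝ) = 0

/-- The kernel with both arguments clamped, as a bounded continuous function. -/
theorem exists_clamped_kernel {ω : ℝ → ℝ → ℝ}
    (hω : ContinuousOn (Function.uncurry ω) (Ioi 0 ×ˢ Ici 0)) {m L : ℝ} (hm : 0 < m) (hmL : m ≤ L) :
    ∃ g : (ℝ × ℝ) →ᵇ ℝ, ∀ r ∈ Icc m L, ∀ η ∈ Icc 0 L, g (r, η) = ω r η := by
  have hL : 0 ≤ L := by linarith
  set p : ℝ × ℝ → ℝ × ℝ := fun q => (projIcc m L hmL q.1, projIcc 0 L hL q.2) with hp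
  have hpc : Continuous p := by fun_prop
  have hpm : ∀ q, p q ∈ Icc m L ×ˢ Icc 0 L := fun q => ⟨Subtype.coe_prop _, Subtype.coe_prop _⟩
  have hsub : Icc m L ×ˢ Icc 0 L ⊆ Ioi (0 : ℝ) ×ˢ Ici (0 : ℝ) :=
    prod_mono (fun x hx => hm.trans_le hx.1) fun x hx => hx.1
  obtain ⟨C, hC⟩ := (isCompact_Icc.prod isCompact_Icc).exists_bound_of_continuousOn (hω.mono hsub)
  refine ⟨BoundedContinuousFunction.ofNormedAddCommGroup (fun q => Function.uncurry ω (p q))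
    (hω.comp_continuous hpc fun q => hsub (hpm q)) C fun q => hC _ (hpm q), fun r hr η hη => ?_⟩
  simp [hp, projIcc_of_mem hmL hr, projIcc_of_mem hL hη]

theorem continuous_integral_prod {P : ℝ → ProbabilityMeasure ℝ} (hP : Continuous P)
    (g : (ℝ × ℝ) →ᵇ ℝ) :
    Continuous fun t => ∫ q, g q ∂((P t : Measure ℝ).prod (P t : Measure ℝ)) := by
  have h : Continuous fun t => (P t).prod (P t) :=
    ProbabilityMeasure.continuous_prod.comp (hP.prodMk hP)
  rw [continuous_iff_continuousAt] at h ⊢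
  intro t
  exact (ProbabilityMeasure.tendsto_iff_forall_integral_tendsto.1 (h t)) g

theorem continuous_integral_of_bounded {P : ℝ → ProbabilityMeasure ℝ} (hP : Continuous P)
    (g : ℝ →ᵇ ℝ) : Continuous fun t => ∫ r, g r ∂(P t : Measure ℝ) := by
  rw [continuous_iff_continuousAt] at hP ⊢
  intro t
  exact (ProbabilityMeasure.tendsto_iff_forall_integral_tendsto.1 (hP t)) g

/-- The structure of a test function of the radius. -/
structure IsTest (χ : ℝ → ℝ) : Prop where
  contDiff : ContDiff ℝ (⊤ : ℕ∞) χ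
  compact : HasCompactSupport χ
  subset : tsupport χ ⊆ Ioi 0

theorem IsTest.exists_Icc {χ : ℝ → ℝ} (hχ : IsTest χ) (M : ℝ) :
    ∃ m L : ℝ, 0 < m ∧ m ≤ L ∧ M ≤ L ∧ tsupport χ ⊆ Icc m L := by
  rcases (tsupport χ).eq_empty_or_nonempty with h | h
  · exact ⟨1, max 1 M, one_pos, le_max_left _ _, le_max_right _ _, by simp [h]⟩
  · have hK : IsCompact (tsupport χ) := hχ.compact
    obtain ⟨m, hm, hm'⟩ := hK.exists_isLeast h
    obtain ⟨L, hL, hL'⟩ := hK.exists_isGreatest h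
    exact ⟨m, max L M, hχ.subset hm, (hm' hL).trans (le_max_left _ _), le_max_right _ _,
      fun x hx => ⟨hm' hx, (hL' hx).trans (le_max_left _ _)⟩⟩

theorem IsTest.bounded {χ : ℝ → ℝ} (hχ : IsTest χ) :
    ∃ g : ℝ →ᵇ ℝ, ∀ r, g r = χ r := by
  obtain ⟨C, hC⟩ := hχ.contDiff.continuous.bounded_above_of_compact_support hχ.compact
  exact ⟨BoundedContinuousFunction.ofNormedAddCommGroup χ hχ.contDiff.continuous C hC, fun _ => rfl⟩

theorem IsTest.exists_flux {ω : ℝ → ℝ → ℝ}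
    (hω : ContinuousOn (Function.uncurry ω) (Ioi 0 ×ˢ Ici 0)) {χ : ℝ → ℝ} (hχ : IsTest χ) (M : ℝ) :
    ∃ g : (ℝ × ℝ) →ᵇ ℝ, ∀ r, ∀ η ∈ Icc 0 M, g (r, η) = deriv χ r * ω r η := by
  obtain ⟨m, L, hm, hmL, hML, hsub⟩ := hχ.exists_Icc M
  obtain ⟨k, hk⟩ := exists_clamped_kernel hω hm hmL
  have hd : Continuous (deriv χ) := hχ.contDiff.continuous_deriv (by simp)
  obtain ⟨C, hC⟩ := hd.bounded_above_of_compact_support hχ.compact.deriv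
  refine ⟨BoundedContinuousFunction.ofNormedAddCommGroup (fun q => deriv χ q.1 * k q)
    (by have := k.continuous; fun_prop) (C * ‖k‖) fun q => ?_, fun r η hη => ?_⟩
  · rw [norm_mul]
    exact mul_le_mul (hC _) (k.norm_coe_le_norm q) (norm_nonneg _) ((norm_nonneg _).trans (hC q.1))
  · by_cases hr : r ∈ tsupport χ
    · simp [hk r (hsub hr) η ⟨hη.1, hη.2.trans hML⟩]
    · have : deriv χ r = 0 := image_eq_zero_of_notMem_tsupport fun h => hr (tsupport_deriv_subset h)
      simp [this]

theorem integral_flux {ω : ℝ → ℝ → ℝ} {μ : Measure ℝ} [IsProbabilityMeasure μ] {M : ℝ}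
    (hM : ∀ᵐ r ∂μ, r ∈ Icc 0 M) {χ : ℝ → ℝ} {g : (ℝ × ℝ) →ᵇ ℝ}
    (hg : ∀ r, ∀ η ∈ Icc 0 M, g (r, η) = deriv χ r * ω r η) :
    Integrable (fun r => radialVelocity ω μ r * deriv χ r) μ ∧
      ∫ r, radialVelocity ω μ r * deriv χ r ∂μ = ∫ q, g q ∂(μ.prod μ) := by
  have hintegr : Integrable g (μ.prod μ) := g.integrable _
  have h1 : ∀ r, ∫ η, g (r, η) ∂μ = radialVelocity ω μ r * deriv χ r := by
    intro r
    rw [radialVelocity, mul_comm, ← integral_const_mul]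
    refine integral_congr_ae ?_
    filter_upwards [hM] with η hη
    exact hg r η hη
  refine ⟨?_, ?_⟩
  · have := hintegr.integral_prod_left
    simpa only [h1] using this
  · rw [integral_prod _ hintegr]
    simp only [h1]

theorem RadialFlow.hasDerivAt {ω : ℝ → ℝ → ℝ} {P : ℝ → ProbabilityMeasure ℝ}
    (hP : RadialFlow ω P) (hω : ContinuousOn (Function.uncurry ω) (Ioi 0 ×ˢ Ici 0))
    {χ : ℝ → ℝ} (hχ : IsTest χ) {t : ℝ} (ht : 0 < t) :
    HasDerivAt (fun t => ∫ r, χ r ∂(P t : Measure ℝ))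
      (∫ r, radialVelocity ω (P t) r * deriv χ r ∂(P t : Measure ℝ)) t := by
  obtain ⟨gχ, hgχ⟩ := hχ.bounded
  have hF : Continuous (fun t => ∫ r, χ r ∂(P t : Measure ℝ)) := by
    simpa only [hgχ] using continuous_integral_of_bounded hP.continuous gχ
  have hG : ContinuousOn (fun t => ∫ r, radialVelocity ω (P t) r * deriv χ r ∂(P t : Measure ℝ))
      (Ioi 0) := by
    intro t ht
    obtain ⟨M, hM⟩ := hP.support (t + 1)
    obtain ⟨g, hg⟩ := hχ.exists_flux hω M
    refine ContinuousAt.continuousWithinAt ?_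
    refine (continuous_integral_prod hP.continuous g).continuousAt.congr ?_
    filter_upwards [Ioo_mem_nhds (show (0 : ℝ) < t from ht) (lt_add_one t)] with s hs
    exact (integral_flux (hM s ⟨hs.1.le, hs.2.le⟩) hg).2.symm
  refine hasDerivAt_of_distribution (G := fun t =>
    ∫ r, radialVelocity ω (P t) r * deriv χ r ∂(P t : Measure ℝ)) hF.continuousOn hG ?_ t ht
  intro θ hθ hθc hθs
  set φ : ℝ × ℝ → ℝ := fun q => θ q.1 * χ q.2 with hφ
  have hsup : Function.support φ ⊆ tsupport θ ×ˢ tsupport χ := by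
    intro q hq
    have hq' : θ q.1 * χ q.2 ≠ 0 := hq
    exact ⟨subset_tsupport _ (left_ne_zero_of_mul hq'), subset_tsupport _ (right_ne_zero_of_mul hq')⟩
  have hK : IsCompact (tsupport θ ×ˢ tsupport χ) := IsCompact.prod hθc hχ.compact
  have h := hP.equation φ
    ((hθ.comp contDiff_fst).mul (hχ.contDiff.comp contDiff_snd))
    (HasCompactSupport.of_support_subset_isCompact hK hsup)
    ((closure_minimal hsup hK.isClosed).trans (prod_mono hθs hχ.subset))
  have hd : ∀ t r : ℝ, fderiv ℝ φ (t, r) (1, 0) = deriv θ t * χ r ∧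
      fderiv ℝ φ (t, r) (0, 1) = θ t * deriv χ r := by
    intro t r
    have hf : HasFDerivAt (fun q : ℝ × ℝ => q.1) (ContinuousLinearMap.fst ℝ ℝ ℝ) (t, r) :=
      hasFDerivAt_fst
    have hs : HasFDerivAt (fun q : ℝ × ℝ => q.2) (ContinuousLinearMap.snd ℝ ℝ ℝ) (t, r) :=
      hasFDerivAt_snd
    have h1 : HasFDerivAt (fun q : ℝ × ℝ => θ q.1) (deriv θ t • ContinuousLinearMap.fst ℝ ℝ ℝ)
        (t, r) :=
      HasDerivAt.comp_hasFDerivAt (t, r) (hθ.differentiable (by simp) t).hasDerivAt hf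
    have h2 : HasFDerivAt (fun q : ℝ × ℝ => χ q.2) (deriv χ r • ContinuousLinearMap.snd ℝ ℝ ℝ)
        (t, r) :=
      HasDerivAt.comp_hasFDerivAt (t, r) (hχ.contDiff.differentiable (by simp) r).hasDerivAt hs
    have h3 := (h1.mul h2).fderiv
    rw [show fderiv ℝ φ (t, r) = _ from h3]
    constructor <;> simp [mul_comm]
  refine Eq.trans (setIntegral_congr_fun measurableSet_Ioi fun t ht => ?_) h
  obtain ⟨M, hM⟩ := hP.support t
  obtain ⟨g, hg⟩ := hχ.exists_flux hω M
  have hfl := integral_flux (hM t ⟨le_of_lt ht, le_rfl⟩) hg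
  have hχi : Integrable χ (P t : Measure ℝ) := by
    have := gχ.integrable (P t : Measure ℝ)
    simpa only [funext hgχ] using this
  simp only [hd]
  have e : ∀ r, deriv θ t * χ r + radialVelocity ω (P t) r * (θ t * deriv χ r) =
      deriv θ t * χ r + θ t * (radialVelocity ω (P t) r * deriv χ r) := fun r => by ring
  simp only [e]
  rw [integral_add (hχi.const_mul _) (hfl.1.const_mul _), integral_const_mul, integral_const_mul]

theorem RadialFlow.continuous_test {ω : ℝ → ℝ → ℝ} {P : ℝ → ProbabilityMeasure ℝ}
    (hP : RadialFlow ω P) {χ : ℝ → ℝ} (hχ : IsTest χ) :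
    Continuous (fun t => ∫ r, χ r ∂(P t : Measure ℝ)) := by
  obtain ⟨gχ, hgχ⟩ := hχ.bounded
  simpa only [hgχ] using continuous_integral_of_bounded hP.continuous gχ

end

end RadialShell

namespace RadialShell

noncomputable section

/-! ### Instability under a one-sided monotonicity of the kernel -/

theorem integrable_kernel {ω : ℝ → ℝ → ℝ}
    (hω : ContinuousOn (Function.uncurry ω) (Ioi 0 ×ˢ Ici 0)) {μ : Measure ℝ}
    [IsProbabilityMeasure μ] {M : ℝ} (hM : ∀ᵐ r ∂μ, r ∈ Icc 0 M) {r : ℝ} (hr : 0 < r) :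
    Integrable (ω r) μ := by
  obtain ⟨g, hg⟩ := exists_clamped_kernel hω hr (le_max_left r M)
  have h1 : Integrable (fun η => g (r, η)) μ :=
    (g.compContinuous ⟨fun η : ℝ => (r, η), by fun_prop⟩).integrable μ
  refine h1.congr ?_
  filter_upwards [hM] with η hη
  exact hg r ⟨le_rfl, le_max_left _ _⟩ η ⟨hη.1, hη.2.trans (le_max_right _ _)⟩

/-- The support of a flow stays in a fixed interval if the kernel is nonpositive far away. -/
theorem RadialFlow.support_uniform {ω : ℝ → ℝ → ℝ} {P : ℝ → ProbabilityMeasure ℝ}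
    (hP : RadialFlow ω P) (hω : ContinuousOn (Function.uncurry ω) (Ioi 0 ×ˢ Ici 0)) {K : ℝ}
    (hK : 0 < K) (hneg : ∀ r, K ≤ r → ∀ η, 0 ≤ η → ω r η ≤ 0) :
    ∃ L, ∀ t, 0 ≤ t → ∀ᵐ r ∂(P t : Measure ℝ), r ∈ Icc 0 L := by
  obtain ⟨M₀, hM₀⟩ := hP.support 0
  set L := max K M₀ with hL
  have hLpos : 0 < L := hK.trans_le (le_max_left _ _)
  refine ⟨L, fun t ht => ?_⟩
  obtain ⟨M₁, hM₁⟩ := hP.support t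
  set M := max M₁ L with hMdef
  have hM : ∀ s ∈ Icc 0 t, ∀ᵐ r ∂(P s : Measure ℝ), r ∈ Icc 0 M := fun s hs => by
    filter_upwards [hM₁ s hs] with r hr using ⟨hr.1, hr.2.trans (le_max_left _ _)⟩
  set χ : ℝ → ℝ := fun r => Real.smoothTransition (r - L) *
    (1 - Real.smoothTransition (r - M - 1)) with hχdef
  have hsup : Function.support χ ⊆ Icc L (M + 2) := by
    intro r hr
    have h := left_ne_zero_of_mul (show Real.smoothTransition (r - L) *
      (1 - Real.smoothTransition (r - M - 1)) ≠ 0 from hr)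
    have h' := right_ne_zero_of_mul (show Real.smoothTransition (r - L) *
      (1 - Real.smoothTransition (r - M - 1)) ≠ 0 from hr)
    constructor
    · by_contra hc
      exact h (Real.smoothTransition.zero_of_nonpos (by linarith))
    · by_contra hc
      exact h' (by rw [Real.smoothTransition.one_of_one_le (by linarith), sub_self])
  have hχ : IsTest χ := by
    refine ⟨?_, HasCompactSupport.of_support_subset_isCompact isCompact_Icc hsup,
      (closure_minimal hsup isClosed_Icc).trans fun x hx => hLpos.trans_le hx.1⟩
    exact (Real.smoothTransition.contDiff.comp (contDiff_id.sub contDiff_const)).mul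
      (contDiff_const.sub (Real.smoothTransition.contDiff.comp
        ((contDiff_id.sub contDiff_const).sub contDiff_const)))
  have heq : ∀ r, r < M + 1 → χ =ᶠ[𝓝 r] fun r => Real.smoothTransition (r - L) := by
    intro r hr
    filter_upwards [Iio_mem_nhds hr] with s hs
    rw [hχdef]
    simp only
    rw [Real.smoothTransition.zero_of_nonpos (x := s - M - 1) (by linarith [mem_Iio.1 hs]), sub_zero,
      mul_one]
  have hder : ∀ r, r < M + 1 → 0 ≤ deriv χ r ∧ (r < L → deriv χ r = 0) := by
    intro r hr
    rw [(heq r hr).deriv_eq]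
    constructor
    · exact Monotone.deriv_nonneg fun x y hxy =>
        Real.smoothTransition.monotone (sub_le_sub_right hxy L)
    · intro hrL
      have : (fun r => Real.smoothTransition (r - L)) =ᶠ[𝓝 r] fun _ => 0 := by
        filter_upwards [Iio_mem_nhds hrL] with s hs
        exact Real.smoothTransition.zero_of_nonpos (by linarith [mem_Iio.1 hs])
      rw [this.deriv_eq]
      simp
  have hanti : AntitoneOn (fun t => ∫ r, χ r ∂(P t : Measure ℝ)) (Icc 0 t) := by
    refine antitoneOn_of_deriv_nonpos (convex_Icc _ _) (hP.continuous_test hχ).continuousOn ?_ ?_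
    · rw [interior_Icc]
      exact fun s hs => (hP.hasDerivAt hω hχ hs.1).differentiableAt.differentiableWithinAt
    · rw [interior_Icc]
      intro s hs
      rw [(hP.hasDerivAt hω hχ hs.1).deriv]
      refine integral_nonpos_of_ae ?_
      filter_upwards [hM s ⟨hs.1.le, hs.2.le⟩] with r hr
      have hd := hder r (by linarith [hr.2])
      rcases lt_or_ge r L with h | h
      · simp [hd.2 h]
      · refine mul_nonpos_of_nonpos_of_nonneg (integral_nonpos_of_ae ?_) hd.1
        filter_upwards [hM s ⟨hs.1.le, hs.2.le⟩] with η hη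
        exact hneg r ((le_max_left _ _).trans h) η hη.1
  have h0 : ∫ r, χ r ∂(P 0 : Measure ℝ) = 0 := by
    refine integral_eq_zero_of_ae ?_
    filter_upwards [hM₀ 0 ⟨le_rfl, le_rfl⟩] with r hr
    have : r ≤ L := hr.2.trans (le_max_right _ _)
    simp [hχdef, Real.smoothTransition.zero_of_nonpos (x := r - L) (by linarith)]
  have hnn : ∀ r, 0 ≤ χ r := fun r => mul_nonneg (Real.smoothTransition.nonneg _)
    (by linarith [Real.smoothTransition.le_one (r - M - 1)])
  have ht0 : ∫ r, χ r ∂(P t : Measure ℝ) = 0 :=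
    le_antisymm (h0 ▸ hanti ⟨le_rfl, ht⟩ ⟨ht, le_rfl⟩ ht) (integral_nonneg hnn)
  obtain ⟨g, hg⟩ := hχ.bounded
  have hintegr : Integrable χ (P t : Measure ℝ) := by
    have := g.integrable (P t : Measure ℝ)
    simpa only [funext hg] using this
  have hz := (integral_eq_zero_iff_of_nonneg_ae (.of_forall hnn) hintegr).1 ht0
  filter_upwards [hz, hM t ⟨ht, le_rfl⟩] with r h1 h2
  refine ⟨h2.1, ?_⟩
  have h3 := (heq r (by linarith [h2.2])).eq_of_nhds
  rw [h1] at h3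
  have := Real.smoothTransition.zero_iff_nonpos.1 h3.symm
  linarith

/-- A cutoff equal to `1` exactly on `[R - δ, R + δ]`, and decreasing away from `R`. -/
theorem exists_cutoff {R δ ε : ℝ} (hδ : 0 < δ) (hδε : δ < ε) (hεR : ε < R) :
    ∃ χ : ℝ → ℝ, IsTest χ ∧ (∀ r, χ r ≤ 1) ∧ (∀ r, χ r = 1 ↔ |r - R| ≤ δ) ∧
      (∀ r, (r - R) * deriv χ r ≤ 0) ∧ (∀ r, |r - R| ≤ δ → deriv χ r = 0) ∧
      (∀ r, ε < |r - R| → deriv χ r = 0) := by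
  have hc : 0 < ε ^ 2 - δ ^ 2 := by nlinarith
  set u : ℝ → ℝ := fun r => ((r - R) ^ 2 - δ ^ 2) / (ε ^ 2 - δ ^ 2) with hu
  have hud : ∀ r, HasDerivAt u (2 * (r - R) / (ε ^ 2 - δ ^ 2)) r := by
    intro r
    have := (((hasDerivAt_id r).sub_const R).pow 2).sub_const (δ ^ 2)
    refine (this.div_const (ε ^ 2 - δ ^ 2)).congr_deriv ?_
    simp
  set χ : ℝ → ℝ := fun r => 1 - Real.smoothTransition (u r) with hχ
  have hsup : Function.support χ ⊆ Icc (R - ε) (R + ε) := by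
    intro r hr
    rw [← Real.closedBall_eq_Icc, Metric.mem_closedBall, Real.dist_eq]
    by_contra h
    refine hr ?_
    have : ε ^ 2 ≤ (r - R) ^ 2 := by
      rw [← sq_abs (r - R)]
      have := not_le.1 h
      gcongr
      linarith
    rw [hχ]
    simp only
    rw [Real.smoothTransition.one_of_one_le, sub_self]
    rw [hu]
    simp only
    rw [le_div_iff₀ hc]
    linarith
  have hd : ∀ r, HasDerivAt χ (-(deriv Real.smoothTransition (u r) *
      (2 * (r - R) / (ε ^ 2 - δ ^ 2)))) r := by
    intro r
    have h1 : HasDerivAt Real.smoothTransition (deriv Real.smoothTransition (u r)) (u r) :=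
      ((Real.smoothTransition.contDiff (n := 1)).differentiable (by simp) _).hasDerivAt
    exact (h1.comp r (hud r)).const_sub 1
  have hone : ∀ r, χ r = 1 ↔ |r - R| ≤ δ := by
    intro r
    rw [hχ]
    simp only
    rw [sub_eq_self, Real.smoothTransition.zero_iff_nonpos, hu]
    simp only
    rw [div_le_iff₀ hc, zero_mul, sub_nonpos, ← sq_abs (r - R), sq_le_sq, abs_abs, abs_of_pos hδ]
  have hle : ∀ r, χ r ≤ 1 := fun r => by
    have := Real.smoothTransition.nonneg (u r)
    simp only [hχ]
    linarith
  have hts : tsupport χ ⊆ Icc (R - ε) (R + ε) := closure_minimal hsup isClosed_Icc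
  refine ⟨χ, ⟨?_, HasCompactSupport.of_support_subset_isCompact isCompact_Icc hsup,
    hts.trans fun x hx => lt_of_lt_of_le (by linarith) hx.1⟩, hle, hone, ?_, ?_, ?_⟩
  · refine contDiff_const.sub (Real.smoothTransition.contDiff.comp ?_)
    exact (((contDiff_id.sub contDiff_const).pow 2).sub contDiff_const).div_const _
  · intro r
    rw [(hd r).deriv]
    have h1 : 0 ≤ deriv Real.smoothTransition (u r) :=
      Monotone.deriv_nonneg Real.smoothTransition.monotone
    have h2 : (r - R) * -(deriv Real.smoothTransition (u r) * (2 * (r - R) / (ε ^ 2 - δ ^ 2))) =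
      -(deriv Real.smoothTransition (u r) * (2 * (r - R) ^ 2 / (ε ^ 2 - δ ^ 2))) := by ring
    rw [h2, neg_nonpos]
    positivity
  · intro r hr
    refine IsLocalMax.deriv_eq_zero (.of_forall fun s => ?_)
    rw [(hone r).2 hr]
    exact hle s
  · intro r hr
    refine image_eq_zero_of_notMem_tsupport fun h => ?_
    have := hts (tsupport_deriv_subset h)
    rw [← Real.closedBall_eq_Icc, Metric.mem_closedBall, Real.dist_eq] at this
    linarith

/-- If the law of the radii converges to a point `R` which repels in the radial direction, then its
support shrinks around `R`. -/
theorem RadialFlow.eventually_support {ω : ℝ → ℝ → ℝ} {P : ℝ → ProbabilityMeasure ℝ}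
    (hP : RadialFlow ω P) (hω : ContinuousOn (Function.uncurry ω) (Ioi 0 ×ˢ Ici 0)) {L : ℝ}
    (hL : ∀ t, 0 ≤ t → ∀ᵐ r ∂(P t : Measure ℝ), r ∈ Icc 0 L) {R ε κ : ℝ} (hε : 0 < ε)
    (hεR : ε < R) (hκ : 0 < κ) (hRR : ω R R = 0)
    (hmono : ∀ r₁ ∈ Icc (R - ε) (R + ε), ∀ r₂ ∈ Icc (R - ε) (R + ε), ∀ η ∈ Icc (R - ε) (R + ε),
      r₁ ≤ r₂ → κ * (r₂ - r₁) ≤ ω r₂ η - ω r₁ η)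
    (hconv : ∀ g : ℝ →ᵇ ℝ, Tendsto (fun t => ∫ r, g r ∂(P t : Measure ℝ)) atTop (𝓝 (g R))) :
    ∃ T, 0 < T ∧ ∀ t, T ≤ t → ∀ᵐ r ∂(P t : Measure ℝ), |r - R| ≤ ε / 2 := by
  have hR : 0 < R := hε.trans hεR
  obtain ⟨χ, hχ, hle, hone, hsign, hzero, hzero'⟩ :=
    exists_cutoff (half_pos hε) (half_lt_self hε) hεR
  set L' := max L R with hL'
  have hsub : Icc (R - ε) (R + ε) ×ˢ Icc 0 L' ⊆ Ioi (0 : ℝ) ×ˢ Ici (0 : ℝ) :=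
    prod_mono (fun x hx => lt_of_lt_of_le (by linarith) hx.1) fun x hx => hx.1
  have hcpt : IsCompact (Icc (R - ε) (R + ε) ×ˢ Icc 0 L') := isCompact_Icc.prod isCompact_Icc
  obtain ⟨C, hC⟩ := hcpt.exists_bound_of_continuousOn (hω.mono hsub)
  have hRm : R ∈ Icc (R - ε) (R + ε) := ⟨by linarith, by linarith⟩
  have hRL : R ∈ Icc 0 L' := ⟨hR.le, le_max_right _ _⟩
  have hCnn : 0 ≤ C := (norm_nonneg _).trans (hC (R, R) ⟨hRm, hRL⟩)
  have huc := hcpt.uniformContinuousOn_of_continuous (hω.mono hsub)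
  obtain ⟨δ, hδ, hδ'⟩ := Metric.uniformContinuousOn_iff.1 huc (κ * (ε / 2) / 2) (by positivity)
  have hest : ∀ r ∈ Icc (R - ε) (R + ε), ∀ η ∈ Icc 0 L',
      |ω r η - ω r R| ≤ κ * (ε / 2) / 2 + 2 * C * min 1 (|η - R| / δ) := by
    intro r hr η hη
    have hmin : 0 ≤ min 1 (|η - R| / δ) := by positivity
    rcases lt_or_ge |η - R| δ with h | h
    · have := hδ' (r, η) ⟨hr, hη⟩ (r, R) ⟨hr, hRL⟩ (by
        rw [Prod.dist_eq, dist_self, Real.dist_eq]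
        simpa using h)
      rw [Real.dist_eq] at this
      have h2 : 0 ≤ 2 * C * min 1 (|η - R| / δ) := by positivity
      have h3 : |ω r η - ω r R| < κ * (ε / 2) / 2 := this
      linarith
    · rw [min_eq_left ((one_le_div hδ).2 h)]
      have h1 : |ω r η| ≤ C := hC (r, η) ⟨hr, hη⟩
      have h2 : |ω r R| ≤ C := hC (r, R) ⟨hr, hRL⟩
      have h3 := abs_sub (ω r η) (ω r R)
      have : 0 ≤ κ * (ε / 2) / 2 := by positivity
      linarith
  obtain ⟨g, hg⟩ : ∃ g : ℝ →ᵇ ℝ, ∀ η, g η = min 1 (|η - R| / δ) := by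
    refine ⟨BoundedContinuousFunction.ofNormedAddCommGroup (fun η => min 1 (|η - R| / δ))
      (by fun_prop) 1 fun η => ?_, fun _ => rfl⟩
    rw [Real.norm_of_nonneg (by positivity)]
    exact min_le_left _ _
  have hgt := hconv g
  rw [hg R] at hgt
  simp only [sub_self, abs_zero, zero_div, zero_le_one, min_eq_right] at hgt
  have hev : ∀ᶠ t in atTop, 2 * C * ∫ r, g r ∂(P t : Measure ℝ) < κ * (ε / 2) / 2 := by
    refine (hgt.const_mul (2 * C)).eventually (gt_mem_nhds ?_)
    rw [mul_zero]
    positivity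
  obtain ⟨T₀, hT₀⟩ := eventually_atTop.1 hev
  set T := max T₀ 1 with hT
  have hTpos : 0 < T := zero_lt_one.trans_le (le_max_right _ _)
  have hvel : ∀ t, T ≤ t → ∀ r, |r - R| ≤ ε → ε / 2 ≤ |r - R| →
      |radialVelocity ω (P t) r - ω r R| ≤ κ * (ε / 2) := by
    intro t ht r hr _
    have hrm : r ∈ Icc (R - ε) (R + ε) := by
      rw [← Real.closedBall_eq_Icc]; exact hr
    have hr0 : 0 < r := lt_of_lt_of_le (by linarith) hrm.1
    have ht0 : 0 ≤ t := hTpos.le.trans ht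
    have hi := integrable_kernel hω (hL t ht0) hr0
    have e1 : radialVelocity ω (P t) r - ω r R = ∫ η, (ω r η - ω r R) ∂(P t : Measure ℝ) := by
      rw [integral_sub hi (integrable_const _)]
      simp [radialVelocity]
    rw [e1]
    have h1 : ∀ᵐ η ∂(P t : Measure ℝ), ‖ω r η - ω r R‖ ≤ κ * (ε / 2) / 2 + 2 * C * g η := by
      filter_upwards [hL t ht0] with η hη
      rw [hg]
      exact hest r hrm η ⟨hη.1, hη.2.trans (le_max_left _ _)⟩
    have hgi : Integrable g (P t : Measure ℝ) := g.integrable _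
    have h2 := norm_integral_le_of_norm_le ((integrable_const _).add (hgi.const_mul (2 * C))) h1
    have h3 : ∫ η, (κ * (ε / 2) / 2 + 2 * C * g η) ∂(P t : Measure ℝ) =
        κ * (ε / 2) / 2 + 2 * C * ∫ η, g η ∂(P t : Measure ℝ) := by
      rw [integral_add (integrable_const _) (hgi.const_mul _), integral_const_mul]
      simp
    have h4 := hT₀ t ((le_max_left _ _).trans ht)
    have h5 : |∫ η, (ω r η - ω r R) ∂(P t : Measure ℝ)| ≤ κ * (ε / 2) / 2 +
      2 * C * ∫ η, g η ∂(P t : Measure ℝ) := by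
      rw [← h3]; exact h2
    linarith
  have hanti : AntitoneOn (fun t => ∫ r, χ r ∂(P t : Measure ℝ)) (Ici T) := by
    refine antitoneOn_of_deriv_nonpos (convex_Ici _) (hP.continuous_test hχ).continuousOn ?_ ?_
    · rw [interior_Ici]
      exact fun s hs => (hP.hasDerivAt hω hχ
        (hTpos.trans hs)).differentiableAt.differentiableWithinAt
    · rw [interior_Ici]
      intro s hs
      rw [(hP.hasDerivAt hω hχ (hTpos.trans hs)).deriv]
      refine integral_nonpos fun r => ?_
      simp only [Pi.zero_apply]
      rcases le_or_gt |r - R| (ε / 2) with h | h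
      · simp [hzero r h]
      rcases lt_or_ge ε |r - R| with h' | h'
      · simp [hzero' r h']
      have hrm : r ∈ Icc (R - ε) (R + ε) := by
        rw [← Real.closedBall_eq_Icc]; exact h'
      have hv := abs_le.1 (hvel s (le_of_lt hs) r h' h.le)
      have hs' := hsign r
      rcases le_total R r with hr | hr
      · rw [abs_of_nonneg (by linarith)] at h
        have h1 := hmono R hRm r hrm R hRm hr
        rw [hRR] at h1
        have h2 : 0 ≤ radialVelocity ω (P s) r := by nlinarith
        have h3 : deriv χ r ≤ 0 := by
          by_contra hc
          have := mul_pos (show 0 < r - R by linarith) (not_le.1 hc)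
          linarith
        exact mul_nonpos_of_nonneg_of_nonpos h2 h3
      · rw [abs_of_nonpos (by linarith)] at h
        have h1 := hmono r hrm R hRm R hRm hr
        rw [hRR] at h1
        have h2 : radialVelocity ω (P s) r ≤ 0 := by nlinarith
        have h3 : 0 ≤ deriv χ r := by
          by_contra hc
          have := mul_pos_of_neg_of_neg (show r - R < 0 by linarith) (not_le.1 hc)
          linarith
        exact mul_nonpos_of_nonpos_of_nonneg h2 h3
  obtain ⟨gχ, hgχ⟩ := hχ.bounded
  have hlim := hconv gχ
  simp only [hgχ] at hlim
  rw [(hone R).2 (by simp; linarith)] at hlim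
  refine ⟨T, hTpos, fun t ht => ?_⟩
  have hintegr : Integrable χ (P t : Measure ℝ) := by
    have := gχ.integrable (P t : Measure ℝ)
    simpa only [funext hgχ] using this
  have hge : 1 ≤ ∫ r, χ r ∂(P t : Measure ℝ) := by
    refine le_of_tendsto hlim ?_
    filter_upwards [eventually_ge_atTop t] with s hs
    exact hanti ht (ht.trans hs) hs
  have hint' : Integrable (fun r => 1 - χ r) (P t : Measure ℝ) := (integrable_const _).sub hintegr
  have hz : ∫ r, (1 - χ r) ∂(P t : Measure ℝ) = 0 := by
    refine le_antisymm ?_ (integral_nonneg fun r => by simp only [Pi.zero_apply]; linarith [hle r])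
    rw [integral_sub (integrable_const _) hintegr]
    simp
    linarith
  have := (integral_eq_zero_iff_of_nonneg_ae
    (.of_forall fun r => by simp only [Pi.zero_apply]; linarith [hle r]) hint').1 hz
  filter_upwards [this] with r hr
  refine (hone r).1 ?_
  simp only [Pi.zero_apply] at hr
  linarith

/-- A flow that converges to a radially repelling point is eventually a Dirac mass. -/
theorem RadialFlow.exists_atom {ω : ℝ → ℝ → ℝ} {P : ℝ → ProbabilityMeasure ℝ}
    (hP : RadialFlow ω P) (hω : ContinuousOn (Function.uncurry ω) (Ioi 0 ×ˢ Ici 0)) {L : ℝ}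
    (hL : ∀ t, 0 ≤ t → ∀ᵐ r ∂(P t : Measure ℝ), r ∈ Icc 0 L) {R ε κ : ℝ} (hε : 0 < ε)
    (hεR : ε < R) (hκ : 0 < κ) (hRR : ω R R = 0)
    (hmono : ∀ r₁ ∈ Icc (R - ε) (R + ε), ∀ r₂ ∈ Icc (R - ε) (R + ε), ∀ η ∈ Icc (R - ε) (R + ε),
      r₁ ≤ r₂ → κ * (r₂ - r₁) ≤ ω r₂ η - ω r₁ η)
    (hconv : ∀ g : ℝ →ᵇ ℝ, Tendsto (fun t => ∫ r, g r ∂(P t : Measure ℝ)) atTop (𝓝 (g R))) :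
    ∃ t m : ℝ, 0 ≤ t ∧ ∀ᵐ r ∂(P t : Measure ℝ), r = m := by
  obtain ⟨T, hT, hsupp⟩ := hP.eventually_support hω hL hε hεR hκ hRR hmono hconv
  obtain ⟨χ, hχ, -, hone, -, hzero, -⟩ :=
    exists_cutoff (half_pos hε) (half_lt_self hε) hεR
  have htest : ∀ j : ℕ, IsTest fun r => (r - R) ^ j * χ r := fun j => by
    refine ⟨((contDiff_id.sub contDiff_const).pow j).mul hχ.contDiff, hχ.compact.mul_left, ?_⟩
    exact (tsupport_mul_subset_right).trans hχ.subset
  have hder : ∀ j : ℕ, ∀ r, |r - R| ≤ ε / 2 →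
      deriv (fun r => (r - R) ^ j * χ r) r = j * (r - R) ^ (j - 1) := by
    intro j r hr
    have h1 := (((hasDerivAt_id r).sub_const R).pow j).mul
      (hχ.contDiff.differentiable (by simp) r).hasDerivAt
    refine (HasDerivAt.deriv h1).trans ?_
    simp [hzero r hr, (hone r).2 hr]
  set F : ℕ → ℝ → ℝ := fun j t => ∫ r, (r - R) ^ j * χ r ∂(P t : Measure ℝ) with hF
  set V : ℝ → ℝ := fun t => F 2 t - F 1 t ^ 2 with hV
  have hmom : ∀ t, T ≤ t → ∀ j, Integrable (fun r => (r - R) ^ j) (P t : Measure ℝ) ∧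
      F j t = ∫ r, (r - R) ^ j ∂(P t : Measure ℝ) := by
    intro t ht j
    have hae : (fun r => (r - R) ^ j * χ r) =ᵐ[(P t : Measure ℝ)] fun r => (r - R) ^ j := by
      filter_upwards [hsupp t ht] with r hr
      simp [(hone r).2 hr]
    obtain ⟨g, hg⟩ := (htest j).bounded
    have hintegr : Integrable (fun r => (r - R) ^ j * χ r) (P t : Measure ℝ) := by
      have := g.integrable (P t : Measure ℝ)
      simpa only [funext hg] using this
    exact ⟨hintegr.congr hae, integral_congr_ae hae⟩
  have hmean : ∀ t, T ≤ t → |F 1 t| ≤ ε / 2 := by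
    intro t ht
    rw [(hmom t ht 1).2]
    have := norm_integral_le_of_norm_le_const (μ := (P t : Measure ℝ)) (C := ε / 2)
      (f := fun r => (r - R) ^ 1) (by
        filter_upwards [hsupp t ht] with r hr
        simpa using hr)
    simpa using this
  have hVint : ∀ t, T ≤ t → Integrable (fun r => (r - R - F 1 t) ^ 2) (P t : Measure ℝ) ∧
      V t = ∫ r, (r - R - F 1 t) ^ 2 ∂(P t : Measure ℝ) := by
    intro t ht
    have e : (fun r => (r - R - F 1 t) ^ 2) =
        fun r => (r - R) ^ 2 - 2 * F 1 t * (r - R) ^ 1 + F 1 t ^ 2 := by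
      funext r; ring
    have i2 := (hmom t ht 2).1
    have i1 := ((hmom t ht 1).1.const_mul (2 * F 1 t))
    rw [e]
    refine ⟨(i2.sub i1).add (integrable_const _), ?_⟩
    have e1 : ∫ r, ((r - R) ^ 2 - 2 * F 1 t * (r - R) ^ 1 + F 1 t ^ 2) ∂(P t : Measure ℝ) =
        F 2 t - 2 * F 1 t * F 1 t + F 1 t ^ 2 := by
      have s1 : ∫ r, ((r - R) ^ 2 - 2 * F 1 t * (r - R) ^ 1 + F 1 t ^ 2) ∂(P t : Measure ℝ) =
        ∫ r, ((r - R) ^ 2 - 2 * F 1 t * (r - R) ^ 1) ∂(P t : Measure ℝ) +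
          ∫ _r, F 1 t ^ 2 ∂(P t : Measure ℝ) := integral_add (i2.sub i1) (integrable_const _)
      rw [s1, integral_sub i2 i1, integral_const_mul, ← (hmom t ht 1).2, ← (hmom t ht 2).2]
      simp
    rw [e1, hV]
    ring
  have hVd : ∀ t, T ≤ t → ∃ V', HasDerivAt V V' t ∧ 2 * κ * V t ≤ V' := by
    intro t ht
    have ht0 : 0 < t := hT.trans_le ht
    have d1 := hP.hasDerivAt hω (htest 1) ht0
    have d2 := hP.hasDerivAt hω (htest 2) ht0
    have d := d2.sub (d1.pow 2)
    refine ⟨_, d, ?_⟩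
    have hflux : ∀ j : ℕ, Integrable (fun r => radialVelocity ω (P t) r * (j * (r - R) ^ (j - 1)))
        (P t : Measure ℝ) ∧ ∫ r, radialVelocity ω (P t) r *
          deriv (fun r => (r - R) ^ j * χ r) r ∂(P t : Measure ℝ) =
        ∫ r, radialVelocity ω (P t) r * (j * (r - R) ^ (j - 1)) ∂(P t : Measure ℝ) := by
      intro j
      obtain ⟨g, hg⟩ := (htest j).exists_flux hω L
      have hae : (fun r => radialVelocity ω (P t) r * deriv (fun r => (r - R) ^ j * χ r) r)
          =ᵐ[(P t : Measure ℝ)] fun r => radialVelocity ω (P t) r * (j * (r - R) ^ (j - 1)) := by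
        filter_upwards [hsupp t ht] with r hr
        rw [hder j r hr]
      exact ⟨(integral_flux (hL t ht0.le) hg).1.congr hae, integral_congr_ae hae⟩
    set m := F 1 t with hm
    have i1 := (hflux 1).1
    have i2 := (hflux 2).1
    have e1 : ∫ r, radialVelocity ω (P t) r * deriv (fun r => (r - R) ^ 2 * χ r) r ∂(P t : Measure ℝ)
        - 2 * m * ∫ r, radialVelocity ω (P t) r * deriv (fun r => (r - R) ^ 1 * χ r) r
          ∂(P t : Measure ℝ) =
        2 * ∫ r, (r - R - m) * radialVelocity ω (P t) r ∂(P t : Measure ℝ) := by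
      rw [(hflux 1).2, (hflux 2).2, ← integral_const_mul (2 * m) (fun r =>
        radialVelocity ω (P t) r * (((1 : ℕ) : ℝ) * (r - R) ^ (1 - 1))),
        ← integral_sub i2 (i1.const_mul _),
        ← integral_const_mul 2 (fun r => (r - R - m) * radialVelocity ω (P t) r)]
      refine integral_congr_ae (.of_forall fun r => ?_)
      simp
      ring
    have e2 : (∫ r, radialVelocity ω (P t) r * deriv (fun r => (r - R) ^ 2 * χ r) r ∂(P t : Measure ℝ))
        - (2 : ℕ) * (∫ r, (r - R) ^ 1 * χ r ∂(P t : Measure ℝ)) ^ (2 - 1) *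
          (∫ r, radialVelocity ω (P t) r * deriv (fun r => (r - R) ^ 1 * χ r) r
          ∂(P t : Measure ℝ)) =
        2 * ∫ r, (r - R - m) * radialVelocity ω (P t) r ∂(P t : Measure ℝ) := by
      rw [← e1, hm, hF]
      norm_num
    refine le_of_le_of_eq ?_ e2.symm
    have hmm := abs_le.1 (hmean t ht)
    have hmR : R + m ∈ Icc (R - ε) (R + ε) := ⟨by linarith [hmm.1], by linarith [hmm.2]⟩
    have hm0 : 0 < R + m := lt_of_lt_of_le (by linarith) hmR.1
    have hpt : ∀ᵐ r ∂(P t : Measure ℝ), κ * (r - R - m) ^ 2 ≤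
        (r - R - m) * radialVelocity ω (P t) r - radialVelocity ω (P t) (R + m) * (r - R - m) := by
      filter_upwards [hsupp t ht] with r hr
      have hr' := abs_le.1 hr
      have hrm : r ∈ Icc (R - ε) (R + ε) := ⟨by linarith [hr'.1], by linarith [hr'.2]⟩
      have hr0 : 0 < r := lt_of_lt_of_le (by linarith) hrm.1
      have j1 := integrable_kernel hω (hL t ht0.le) hr0
      have j2 := integrable_kernel hω (hL t ht0.le) hm0
      have e3 : (r - R - m) * radialVelocity ω (P t) r -
          radialVelocity ω (P t) (R + m) * (r - R - m) =
          ∫ η, (r - R - m) * (ω r η - ω (R + m) η) ∂(P t : Measure ℝ) := by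
        rw [integral_const_mul, integral_sub j1 j2]
        simp only [radialVelocity]
        ring
      rw [e3]
      have e4 : κ * (r - R - m) ^ 2 = ∫ _η, κ * (r - R - m) ^ 2 ∂(P t : Measure ℝ) := by simp
      rw [e4]
      refine integral_mono_ae (integrable_const _) ((j1.sub j2).const_mul _) ?_
      filter_upwards [hsupp t ht] with η hη
      have hη' := abs_le.1 hη
      have hηm : η ∈ Icc (R - ε) (R + ε) := ⟨by linarith [hη'.1], by linarith [hη'.2]⟩
      rcases le_total (R + m) r with h | h
      · have h5 := hmono _ hmR _ hrm _ hηm h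
        have := mul_le_mul_of_nonneg_left h5 (show 0 ≤ r - R - m by linarith)
        nlinarith
      · have h5 := hmono _ hrm _ hmR _ hηm h
        have := mul_le_mul_of_nonneg_left h5 (show 0 ≤ R + m - r by linarith)
        nlinarith
    have iq : Integrable (fun r => r - R - m) (P t : Measure ℝ) := by
      have := (hmom t ht 1).1
      simp only [pow_one] at this
      exact this.sub (integrable_const _)
    have q0 : ∫ r, (r - R - m) ∂(P t : Measure ℝ) = 0 := by
      have h6 := hmom t ht 1
      simp only [pow_one] at h6
      rw [integral_sub h6.1 (integrable_const _), ← h6.2]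
      simp [hm]
    have iv : Integrable (fun r => (r - R - m) * radialVelocity ω (P t) r) (P t : Measure ℝ) := by
      have := (i2.const_mul (1 / 2)).sub (i1.const_mul m)
      refine this.congr (.of_forall fun r => ?_)
      simp
      ring
    have hfin := integral_mono_ae ((hVint t ht).1.const_mul κ)
      (iv.sub (iq.const_mul (radialVelocity ω (P t) (R + m)))) hpt
    have e5 : ∫ r, ((r - R - m) * radialVelocity ω (P t) r -
        radialVelocity ω (P t) (R + m) * (r - R - m)) ∂(P t : Measure ℝ) =
        ∫ r, (r - R - m) * radialVelocity ω (P t) r ∂(P t : Measure ℝ) := by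
      rw [integral_sub iv (iq.const_mul _), integral_const_mul, q0, mul_zero, sub_zero]
    have e6 : ∫ r, κ * (r - R - F 1 t) ^ 2 ∂(P t : Measure ℝ) = κ * V t := by
      rw [integral_const_mul, ← (hVint t ht).2]
    rw [← hm] at e6
    have h7 : κ * V t ≤ ∫ r, (r - R - m) * radialVelocity ω (P t) r ∂(P t : Measure ℝ) := by
      rw [← e6, ← e5]
      exact hfin
    linarith
  have hVb : ∀ t, T ≤ t → V t ≤ ε ^ 2 := by
    intro t ht
    rw [(hVint t ht).2]
    have h1 : ∫ r, (r - R - F 1 t) ^ 2 ∂(P t : Measure ℝ) ≤ ∫ _r, ε ^ 2 ∂(P t : Measure ℝ) := by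
      refine integral_mono_ae (hVint t ht).1 (integrable_const _) ?_
      filter_upwards [hsupp t ht] with r hr
      have h2 := abs_le.1 (hmean t ht)
      have h3 := abs_le.1 hr
      exact sq_le_sq' (by linarith) (by linarith)
    simpa using h1
  have hVnn : ∀ t, T ≤ t → 0 ≤ V t := fun t ht => by
    rw [(hVint t ht).2]
    exact integral_nonneg fun r => sq_nonneg _
  have hgrow : ∀ t, T ≤ t → V T * Real.exp (2 * κ * (t - T)) ≤ V t := by
    have hcont : ∀ t, T ≤ t → HasDerivAt (fun t => V t * Real.exp (-(2 * κ * t)))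
        (deriv V t * Real.exp (-(2 * κ * t)) + V t * (Real.exp (-(2 * κ * t)) * -(2 * κ))) t := by
      intro t ht
      obtain ⟨V', hV', -⟩ := hVd t ht
      rw [hV'.deriv]
      refine hV'.mul ?_
      have := ((hasDerivAt_id t).const_mul (2 * κ)).neg.exp
      simpa using this
    have hm : MonotoneOn (fun t => V t * Real.exp (-(2 * κ * t))) (Ici T) := by
      refine monotoneOn_of_deriv_nonneg (convex_Ici _)
        (fun t ht => (hcont t ht).continuousAt.continuousWithinAt) ?_ ?_
      · rw [interior_Ici]
        exact fun t ht => (hcont t (le_of_lt ht)).differentiableAt.differentiableWithinAt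
      · rw [interior_Ici]
        intro t ht
        rw [(hcont t (le_of_lt ht)).deriv]
        obtain ⟨V', hV', hge⟩ := hVd t (le_of_lt ht)
        rw [hV'.deriv]
        have : 0 ≤ (V' - 2 * κ * V t) * Real.exp (-(2 * κ * t)) :=
          mul_nonneg (by linarith) (Real.exp_pos _).le
        linarith
    intro t ht
    have h1 := hm (mem_Ici.2 le_rfl) (mem_Ici.2 ht) ht
    simp only at h1
    have h2 := mul_le_mul_of_nonneg_right h1 (Real.exp_pos (2 * κ * t)).le
    have e1 : V T * Real.exp (-(2 * κ * T)) * Real.exp (2 * κ * t) =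
        V T * Real.exp (2 * κ * (t - T)) := by
      rw [mul_assoc, ← Real.exp_add]
      ring_nf
    have e2 : V t * Real.exp (-(2 * κ * t)) * Real.exp (2 * κ * t) = V t := by
      rw [mul_assoc, ← Real.exp_add]
      simp
    rwa [e1, e2] at h2
  have hVT : V T = 0 := by
    by_contra h
    have hpos : 0 < V T := lt_of_le_of_ne (hVnn T le_rfl) (Ne.symm h)
    have htend : Tendsto (fun t => V T * Real.exp (2 * κ * (t - T))) atTop atTop := by
      refine Tendsto.const_mul_atTop hpos (Real.tendsto_exp_atTop.comp ?_)
      exact (tendsto_id.atTop_add tendsto_const_nhds).const_mul_atTop (by positivity)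
    obtain ⟨t, ht1, ht2⟩ := ((htend.eventually (eventually_gt_atTop (ε ^ 2))).and
      (eventually_ge_atTop T)).exists
    linarith [hgrow t ht2, hVb t ht2]
  refine ⟨T, R + F 1 T, hT.le, ?_⟩
  have h0 := (integral_eq_zero_iff_of_nonneg_ae (.of_forall fun r => sq_nonneg _)
    (hVint T le_rfl).1).1 ((hVint T le_rfl).2 ▸ hVT)
  filter_upwards [h0] with r hr
  have : r - R - F 1 T = 0 := by
    simpa using hr
  linarith

end

end RadialShell

namespace RadialShell

noncomputable section

/-! ### Partial derivatives of `C¹` kernels -/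

theorem hasDerivAt_fst_of_contDiffOn {ω : ℝ → ℝ → ℝ}
    (hω : ContDiffOn ℝ 1 (Function.uncurry ω) quadrant) {r η : ℝ} (hr : 0 < r) (hη : 0 < η) :
    HasDerivAt (fun s => ω s η) (fderiv ℝ (Function.uncurry ω) (r, η) (1, 0)) r := by
  have hq : quadrant ∈ 𝓝 (r, η) := isOpen_quadrant.mem_nhds ⟨hr, hη⟩
  have hd := ((hω.contDiffAt hq).differentiableAt (by simp)).hasFDerivAt
  have hc : HasDerivAt (fun s : ℝ => (s, η)) ((1 : ℝ), (0 : ℝ)) r :=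
    (hasDerivAt_id r).prodMk (hasDerivAt_const r η)
  exact hd.comp_hasDerivAt r hc

theorem hasDerivAt_snd_of_contDiffOn {ω : ℝ → ℝ → ℝ}
    (hω : ContDiffOn ℝ 1 (Function.uncurry ω) quadrant) {r η : ℝ} (hr : 0 < r) (hη : 0 < η) :
    HasDerivAt (fun s => ω r s) (fderiv ℝ (Function.uncurry ω) (r, η) (0, 1)) η := by
  have hq : quadrant ∈ 𝓝 (r, η) := isOpen_quadrant.mem_nhds ⟨hr, hη⟩
  have hd := ((hω.contDiffAt hq).differentiableAt (by simp)).hasFDerivAt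
  have hc : HasDerivAt (fun s : ℝ => (r, s)) ((0 : ℝ), (1 : ℝ)) η :=
    (hasDerivAt_const η r).prodMk (hasDerivAt_id η)
  exact hd.comp_hasDerivAt η hc

theorem continuousAt_fderiv_of_contDiffOn {ω : ℝ → ℝ → ℝ}
    (hω : ContDiffOn ℝ 1 (Function.uncurry ω) quadrant) {r η : ℝ} (hr : 0 < r) (hη : 0 < η)
    (v : ℝ × ℝ) : ContinuousAt (fun q => fderiv ℝ (Function.uncurry ω) q v) (r, η) := by
  have hq : quadrant ∈ 𝓝 (r, η) := isOpen_quadrant.mem_nhds ⟨hr, hη⟩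
  have h := hω.continuousOn_fderiv_of_isOpen isOpen_quadrant le_rfl
  exact (h.continuousAt hq).clm_apply continuousAt_const

theorem continuousAt_partial₁ {ω : ℝ → ℝ → ℝ}
    (hω : ContDiffOn ℝ 1 (Function.uncurry ω) quadrant) {r η : ℝ} (hr : 0 < r) (hη : 0 < η) :
    ContinuousAt (fun q : ℝ × ℝ => partial₁ ω q.1 q.2) (r, η) := by
  refine (continuousAt_fderiv_of_contDiffOn hω hr hη (1, 0)).congr ?_
  filter_upwards [isOpen_quadrant.mem_nhds (show (r, η) ∈ quadrant from ⟨hr, hη⟩)] with q hq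
  exact (hasDerivAt_fst_of_contDiffOn hω hq.1 hq.2).deriv.symm

/-! ### Fattening instability of the shell -/

/-- A lower bound on `∂₁ω` off the diagonal makes the kernel expanding in its first variable. -/
theorem expanding_of_partial₁_ge {ω : ℝ → ℝ → ℝ} {l u κ : ℝ}
    (hc : ∀ η ∈ Icc l u, ContinuousOn (fun s => ω s η) (Icc l u))
    (hd : ∀ η ∈ Icc l u, ∀ r ∈ Icc l u, r ≠ η → DifferentiableAt ℝ (fun s => ω s η) r ∧
      κ ≤ partial₁ ω r η) :
    ∀ r₁ ∈ Icc l u, ∀ r₂ ∈ Icc l u, ∀ η ∈ Icc l u, r₁ ≤ r₂ →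
      κ * (r₂ - r₁) ≤ ω r₂ η - ω r₁ η := by
  intro r₁ h₁ r₂ h₂ η hη h12
  have key : ∀ x y, l ≤ x → x ≤ y → y ≤ u → (∀ s ∈ Ioo x y, s ≠ η) →
      κ * (y - x) ≤ ω y η - ω x η := by
    intro x y hx hxy hy hne
    have hsub : Icc x y ⊆ Icc l u := Icc_subset_Icc hx hy
    have hm : MonotoneOn (fun s => ω s η - κ * s) (Icc x y) := by
      have hd' : ∀ s ∈ Ioo x y, HasDerivAt (fun s => ω s η - κ * s) (partial₁ ω s η - κ) s := by
        intro s hs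
        have := (hd η hη s (hsub (Ioo_subset_Icc_self hs)) (hne s hs)).1.hasDerivAt.sub
          ((hasDerivAt_id s).const_mul κ)
        exact this.congr_deriv (by simp [partial₁])
      refine monotoneOn_of_deriv_nonneg (convex_Icc _ _)
        (((hc η hη).mono hsub).sub (by fun_prop)) ?_ ?_
      · rw [interior_Icc]
        exact fun s hs => (hd' s hs).differentiableAt.differentiableWithinAt
      · rw [interior_Icc]
        intro s hs
        rw [(hd' s hs).deriv]
        linarith [(hd η hη s (hsub (Ioo_subset_Icc_self hs)) (hne s hs)).2]
    have := hm ⟨le_rfl, hxy⟩ ⟨hxy, le_rfl⟩ hxy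
    simp only at this
    linarith
  rcases le_or_gt η r₁ with h | h
  · exact key r₁ r₂ h₁.1 h12 h₂.2 fun s hs => (h.trans_lt hs.1).ne'
  rcases le_or_gt r₂ η with h' | h'
  · exact key r₁ r₂ h₁.1 h12 h₂.2 fun s hs => (hs.2.trans_le h').ne
  have k1 := key r₁ η h₁.1 h.le hη.2 fun s hs => hs.2.ne
  have k2 := key η r₂ hη.1 h'.le h₂.2 fun s hs => hs.1.ne'
  linarith

theorem exists_expanding_pkernel {n : ℕ} {a b R : ℝ} (hb : -(n : ℝ) < b) (hab : b < a)
    (hR : 0 < R) {s : Set (ℝ × ℝ)} (hs : diagᶜ ⊆ s) {c : ℝ} (hc : 0 < c)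
    (hd : ∀ r η, 0 < r → 0 < η → r ≠ η → DifferentiableAt ℝ (fun s => pkernel n a b s η) r)
    (h : ∀ᶠ q : ℝ × ℝ in 𝓝[s] (R, R), c ≤ partial₁ (pkernel n a b) q.1 q.2) :
    ∃ ε κ, 0 < ε ∧ ε < R ∧ 0 < κ ∧ ∀ r₁ ∈ Icc (R - ε) (R + ε), ∀ r₂ ∈ Icc (R - ε) (R + ε),
      ∀ η ∈ Icc (R - ε) (R + ε), r₁ ≤ r₂ →
        κ * (r₂ - r₁) ≤ pkernel n a b r₂ η - pkernel n a b r₁ η := by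
  obtain ⟨δ, hδ, hδ'⟩ := Metric.eventually_nhds_iff.1 (eventually_nhdsWithin_iff.1 h)
  refine ⟨min (δ / 2) (R / 2), c, by positivity, ?_, hc, ?_⟩
  · exact (min_le_right _ _).trans_lt (half_lt_self hR)
  set ε := min (δ / 2) (R / 2) with hε
  have h1 : ε ≤ δ / 2 := min_le_left _ _
  have h2 : ε ≤ R / 2 := min_le_right _ _
  have hpos : ∀ x ∈ Icc (R - ε) (R + ε), 0 < x := fun x hx => by linarith [hx.1]
  have hdist : ∀ x ∈ Icc (R - ε) (R + ε), dist x R < δ := fun x hx => by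
    rw [Real.dist_eq, abs_lt]
    constructor <;> linarith [hx.1, hx.2]
  refine expanding_of_partial₁_ge (fun η hη => ?_) fun η hη r hr hne => ⟨?_, ?_⟩
  · refine (continuousOn_pkernel hb hab).comp (f := fun s : ℝ => (s, η)) (by fun_prop) fun s hs' => ?_
    exact ⟨hpos s hs', (hpos η hη).le⟩
  · exact hd r η (hpos r hr) (hpos η hη) hne
  · refine hδ' (y := (r, η)) ?_ (hs hne)
    rw [Prod.dist_eq]
    exact max_lt (hdist r hr) (hdist η hη)

theorem integral_radialPart {N : ℕ} (μ : Measure (EuclideanSpace ℝ (Fin N))) (g : ℝ →ᵇ ℝ) :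
    ∫ r, g r ∂(radialPart μ) = ∫ x, g ‖x‖ ∂μ :=
  integral_map continuous_norm.aemeasurable g.continuous.aestronglyMeasurable

theorem ae_radialPart {N : ℕ} {μ : Measure (EuclideanSpace ℝ (Fin N))} {s : Set ℝ}
    (hp : MeasurableSet s) : (∀ᵐ r ∂(radialPart μ), r ∈ s) ↔ ∀ᵐ x ∂μ, ‖x‖ ∈ s :=
  ae_map_iff continuous_norm.aemeasurable hp

theorem isUnstableShell_of_expanding {n : ℕ} {a b R ε κ : ℝ} (hb : -(n : ℝ) < b) (hab : b < a)
    (hRR : pkernel n a b R R = 0) (hε : 0 < ε) (hεR : ε < R) (hκ : 0 < κ)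
    (hmono : ∀ r₁ ∈ Icc (R - ε) (R + ε), ∀ r₂ ∈ Icc (R - ε) (R + ε),
      ∀ η ∈ Icc (R - ε) (R + ε), r₁ ≤ r₂ →
        κ * (r₂ - r₁) ≤ pkernel n a b r₂ η - pkernel n a b r₁ η) :
    IsUnstableShell (n + 2) (powerPotential (n + 2) a b) R := by
  intro p _ μ hμ hconv
  have hpr : ∀ t : ℝ, IsProbabilityMeasure (radialPart (μ (max t 0))) := fun t => by
    have := hμ.isProbabilityMeasure (max t 0) (le_max_right _ _)
    exact Measure.isProbabilityMeasure_map continuous_norm.aemeasurable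
  set P : ℝ → ProbabilityMeasure ℝ := fun t => ⟨radialPart (μ (max t 0)), hpr t⟩ with hPdef
  have hPt : ∀ t, (P t : Measure ℝ) = radialPart (μ (max t 0)) := fun t => rfl
  have hintegr : ∀ (g : ℝ →ᵇ ℝ) t, ∫ r, g r ∂(P t : Measure ℝ) =
      ∫ x, (g.compContinuous ⟨fun x => ‖x‖, continuous_norm⟩) x ∂(μ (max t 0)) := fun g t => by
    rw [hPt, integral_radialPart]
    rfl
  have hP : RadialFlow (pkernel n a b) P := by
    refine ⟨?_, ?_, ?_⟩
    · rw [continuous_iff_continuousAt]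
      intro t
      refine ProbabilityMeasure.tendsto_iff_forall_integral_tendsto.2 fun g => ?_
      simp only [hintegr]
      have h1 := hμ.continuous (g.compContinuous ⟨fun x => ‖x‖, continuous_norm⟩)
      exact (h1.comp_continuous (f := fun t : ℝ => max t 0) (by fun_prop)
        fun t => le_max_right t 0).continuousAt
    · intro T
      obtain ⟨M, hM⟩ := hμ.compactSupport (max T 1) (by positivity)
      refine ⟨M, fun t ht => ?_⟩
      rw [hPt, max_eq_left ht.1, ae_radialPart measurableSet_Icc]
      have h0 : ∀ᵐ x ∂(μ t), x ∈ Metric.closedBall 0 M :=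
        hM t ⟨ht.1, ht.2.trans (le_max_left _ _)⟩
      filter_upwards [h0] with x hx
      exact ⟨norm_nonneg x, by simpa using hx⟩
    · intro φ hφ hφc hφs
      refine Eq.trans (setIntegral_congr_fun measurableSet_Ioi fun t ht => ?_)
        (hμ.equation φ hφ hφc hφs)
      simp only [hPt, max_eq_left (le_of_lt (mem_Ioi.1 ht))]
  obtain ⟨K, hK, hneg⟩ := exists_pkernel_nonpos hb hab
  have hω := continuousOn_pkernel hb hab
  obtain ⟨L, hL⟩ := hP.support_uniform hω hK hneg
  have hR : 0 < R := hε.trans hεR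
  have := isProbabilityMeasure_shell n hR
  obtain ⟨t, m, ht, hm⟩ := hP.exists_atom hω hL hε hεR hκ hRR hmono fun g => by
    have h1 := hconv (g.compContinuous ⟨fun x => ‖x‖, continuous_norm⟩)
    have h2 : ∫ x, (g.compContinuous ⟨fun x => ‖x‖, continuous_norm⟩) x ∂(shell (n + 2) R) = g R := by
      have : ∫ x, (g.compContinuous ⟨fun x => ‖x‖, continuous_norm⟩) x ∂(shell (n + 2) R) =
          ∫ _x, g R ∂(shell (n + 2) R) := by
        refine integral_congr_ae ?_
        filter_upwards [ae_norm_shell hR] with x hx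
        simp [hx]
      rw [this]
      simp
    rw [h2] at h1
    refine h1.congr' ?_
    filter_upwards [eventually_ge_atTop 0] with t ht
    rw [hintegr, max_eq_left ht]
  rw [hPt, max_eq_left ht] at hm
  have hm' := (ae_radialPart (measurableSet_singleton m)).1 hm
  obtain ⟨ρ, -, -, hρ⟩ := hμ.density t ht
  have hac : μ t ≪ volume := hρ ▸ withDensity_absolutelyContinuous _ _
  have hnull : (volume : Measure (EuclideanSpace ℝ (Fin (n + 2)))) {x | ‖x‖ = m} = 0 := by
    have := Measure.addHaar_sphere (volume : Measure (EuclideanSpace ℝ (Fin (n + 2)))) 0 m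
    convert this using 2
    ext x
    simp
  have h0 : ∀ᵐ x ∂(μ t), ‖x‖ ≠ m := by
    have h3 : μ t {x | ‖x‖ = m} = 0 := hac hnull
    rw [ae_iff]
    simpa using h3
  have := hμ.isProbabilityMeasure t ht
  obtain ⟨x, hx1, hx2⟩ := (hm'.and h0).exists
  exact hx2 hx1

theorem isUnstableShell_shellRadius {n : ℕ} {a b : ℝ} (hb : -(n : ℝ) < b) (hab : b < a)
    (h : b ≤ 1 - n ∨ b < criticalExponent (n + 2) a) :
    IsUnstableShell (n + 2) (powerPotential (n + 2) a b) (shellRadius (n + 2) a b) := by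
  set R := shellRadius (n + 2) a b with hRdef
  have hR : 0 < R := shellRadius_pos hb hab
  have hRR : pkernel n a b R R = 0 := (pkernel_diag_eq_zero_iff hb hab hR).2 rfl
  obtain ⟨ε, κ, hε, hεR, hκ, hmono⟩ : ∃ ε κ, 0 < ε ∧ ε < R ∧ 0 < κ ∧
      ∀ r₁ ∈ Icc (R - ε) (R + ε), ∀ r₂ ∈ Icc (R - ε) (R + ε),
      ∀ η ∈ Icc (R - ε) (R + ε), r₁ ≤ r₂ →
        κ * (r₂ - r₁) ≤ pkernel n a b r₂ η - pkernel n a b r₁ η := by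
    rcases le_or_gt b (1 - n) with h1 | h1
    · refine exists_expanding_pkernel hb hab hR subset_rfl one_pos (fun r η hr hη hne => ?_)
        ((tendsto_partial₁_pkernel hR hb hab h1).eventually_ge_atTop 1)
      have hq : |r| ≠ |η| := by rwa [abs_of_pos hr, abs_of_pos hη]
      exact ((dominated_of_abs_ne hq).hasDerivAt_pkernel_left
        (dominated_of_abs_ne hq)).differentiableAt
    · have hc := contDiffOn_pkernel h1 hab
      have hpos := partial₁_shellRadius_pos h1 hab hRdef (h.resolve_left (not_le.2 h1))
      refine exists_expanding_pkernel hb hab hR (subset_univ _) (half_pos hpos)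
        (fun r η hr hη _ => (hasDerivAt_fst_of_contDiffOn hc hr hη).differentiableAt) ?_
      rw [nhdsWithin_univ]
      exact ((continuousAt_partial₁ hc hR hR).eventually
        (eventually_gt_nhds (half_lt_self hpos))).mono fun q hq => hq.le
  exact isUnstableShell_of_expanding hb hab hRR hε hεR hκ hmono

end

end RadialShell

namespace RadialShell

noncomputable section

/-! ### Differential inequalities for absolutely continuous functions -/

theorem SolvesODE.absolutelyContinuous {f F : ℝ → ℝ} (h : SolvesODE f F) {s t : ℝ} (hs : 0 ≤ s)
    (hst : s ≤ t) : AbsolutelyContinuousOnInterval f s t := by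
  refine (h.1 (t + 1) (by linarith)).mono ?_
  rw [uIcc_of_le hst, uIcc_of_le (by linarith)]
  exact Icc_subset_Icc hs (by linarith)

theorem SolvesODE.continuousOn {f F : ℝ → ℝ} (h : SolvesODE f F) {s t : ℝ} (hs : 0 ≤ s)
    (hst : s ≤ t) : ContinuousOn f (Icc s t) := by
  have := (h.absolutelyContinuous hs hst).continuousOn
  rwa [uIcc_of_le hst] at this

theorem SolvesODE.add {f F g G : ℝ → ℝ} (hf : SolvesODE f F) (hg : SolvesODE g G) :
    SolvesODE (fun t => f t + g t) (fun t => F t + G t) := by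
  refine ⟨fun T hT => (hf.1 T hT).fun_add (hg.1 T hT), ?_⟩
  filter_upwards [hf.2, hg.2] with t h1 h2 using h1.add h2

theorem SolvesODE.mul {f F g G : ℝ → ℝ} (hf : SolvesODE f F) (hg : SolvesODE g G) :
    SolvesODE (fun t => f t * g t) (fun t => F t * g t + f t * G t) := by
  refine ⟨fun T hT => (hf.1 T hT).fun_mul (hg.1 T hT), ?_⟩
  filter_upwards [hf.2, hg.2] with t h1 h2 using h1.mul h2

theorem SolvesODE.of_contDiff {f : ℝ → ℝ} (hf : ContDiff ℝ 1 f) : SolvesODE f (deriv f) :=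
  ⟨fun _ _ => hf.contDiffOn.absolutelyContinuousOnInterval,
    .of_forall fun t => (hf.differentiable (by simp) t).hasDerivAt⟩

theorem SolvesODE.congr {f F G : ℝ → ℝ} (hf : SolvesODE f F) (h : ∀ t, F t = G t) :
    SolvesODE f G := by
  rwa [← funext h]

theorem SolvesODE.const (c : ℝ) : SolvesODE (fun _ => c) (fun _ => 0) :=
  (SolvesODE.of_contDiff contDiff_const).congr fun t => by simp

theorem SolvesODE.const_mul {f F : ℝ → ℝ} (hf : SolvesODE f F) (c : ℝ) :
    SolvesODE (fun t => c * f t) (fun t => c * F t) :=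
  ((SolvesODE.const c).mul hf).congr fun t => by ring

theorem SolvesODE.neg {f F : ℝ → ℝ} (hf : SolvesODE f F) :
    SolvesODE (fun t => -f t) (fun t => -F t) := by
  have := hf.const_mul (-1)
  simpa using this

theorem SolvesODE.sub {f F g G : ℝ → ℝ} (hf : SolvesODE f F) (hg : SolvesODE g G) :
    SolvesODE (fun t => f t - g t) (fun t => F t - G t) := by
  have := hf.add hg.neg
  simpa [sub_eq_add_neg] using this

theorem SolvesODE.sq {f F : ℝ → ℝ} (hf : SolvesODE f F) :
    SolvesODE (fun t => f t ^ 2) (fun t => 2 * f t * F t) := by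
  have := (hf.mul hf).congr (G := fun t => 2 * f t * F t) fun t => by ring
  simpa [pow_two] using this

theorem SolvesODE.le_of_nonpos {f F : ℝ → ℝ} (hf : SolvesODE f F) {s t : ℝ} (hs : 0 ≤ s)
    (hst : s ≤ t) (hF : ∀ τ ∈ Ioo s t, F τ ≤ 0) : f t ≤ f s := by
  have h1 := (hf.absolutelyContinuous hs hst).integral_deriv_eq_sub
  have h2 : ∫ τ in s..t, deriv f τ ≤ 0 := by
    rw [intervalIntegral.integral_of_le hst, integral_Ioc_eq_integral_Ioo]
    refine integral_nonpos_of_ae ?_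
    have hsub : Ioo s t ⊆ Ioi (0 : ℝ) := fun x hx => hs.trans_lt hx.1
    filter_upwards [ae_restrict_of_ae_restrict_of_subset hsub hf.2,
      ae_restrict_mem measurableSet_Ioo] with τ h3 h4
    rw [h3.deriv]
    exact hF τ h4
  linarith

theorem SolvesODE.gronwall {f F : ℝ → ℝ} (hf : SolvesODE f F) {s t c d : ℝ} (hs : 0 ≤ s)
    (hst : s ≤ t) (hc : 0 < c) (hF : ∀ τ ∈ Ioo s t, F τ ≤ -c * f τ + d) :
    f t ≤ f s * Real.exp (-c * (t - s)) + d / c * (1 - Real.exp (-c * (t - s))) := by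
  have hexp : SolvesODE (fun t => Real.exp (c * t)) (fun t => c * Real.exp (c * t)) := by
    refine (SolvesODE.of_contDiff (by fun_prop)).congr fun t => ?_
    have := ((hasDerivAt_id t).const_mul c).exp
    simp only [id, mul_one] at this
    rw [this.deriv, mul_comm]
  have hg := (hf.sub (SolvesODE.const (d / c))).mul hexp
  have h1 := hg.le_of_nonpos hs hst fun τ hτ => by
    have h2 := hF τ hτ
    have h3 : (F τ - 0) * Real.exp (c * τ) + (f τ - d / c) * (c * Real.exp (c * τ)) =
        (F τ + c * f τ - d) * Real.exp (c * τ) := by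
      field_simp
      ring
    rw [h3]
    exact mul_nonpos_of_nonpos_of_nonneg (by linarith) (Real.exp_pos _).le
  have h4 := mul_le_mul_of_nonneg_right h1 (Real.exp_pos (-c * t)).le
  rw [mul_assoc, mul_assoc, ← Real.exp_add, ← Real.exp_add, show c * t + -c * t = 0 by ring,
    Real.exp_zero, show c * s + -c * t = -c * (t - s) by ring] at h4
  linarith

/-- A sublevel set in which the function is damped towards a lower level is never left. -/
theorem SolvesODE.lt_of_damped {f F : ℝ → ℝ} (hf : SolvesODE f F) {c d θ : ℝ} (hc : 0 < c)
    (h0 : f 0 < θ) (hd : d < c * θ) (hF : ∀ τ, 0 ≤ τ → f τ < θ → F τ ≤ -c * f τ + d) {t : ℝ}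
    (ht : 0 ≤ t) : f t < θ := by
  by_contra hcon
  have hclosed : IsCompact (Icc 0 t ∩ f ⁻¹' Ici θ) :=
    isCompact_Icc.of_isClosed_subset
      ((hf.continuousOn le_rfl ht).preimage_isClosed_of_isClosed isClosed_Icc isClosed_Ici)
      inter_subset_left
  obtain ⟨t₀, ⟨ht₀, hle⟩, hmin⟩ :=
    hclosed.exists_isLeast ⟨t, ⟨ht, le_rfl⟩, show θ ≤ f t from not_lt.1 hcon⟩
  have hlt : ∀ τ ∈ Ioo 0 t₀, f τ < θ := fun τ hτ => by
    by_contra h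
    exact absurd (hmin ⟨⟨hτ.1.le, hτ.2.le.trans ht₀.2⟩, not_lt.1 h⟩) (not_le.2 hτ.2)
  have hg := hf.gronwall le_rfl ht₀.1 hc fun τ hτ => hF τ hτ.1.le (hlt τ hτ)
  rw [sub_zero] at hg
  have hE : 0 < Real.exp (-c * t₀) := Real.exp_pos _
  have hE1 : Real.exp (-c * t₀) ≤ 1 := Real.exp_le_one_iff.2 (by nlinarith [ht₀.1])
  have hdc : d / c < θ := by rw [div_lt_iff₀ hc]; linarith
  have h1 : f 0 * Real.exp (-c * t₀) < θ * Real.exp (-c * t₀) := mul_lt_mul_of_pos_right h0 hE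
  have h2 : d / c * (1 - Real.exp (-c * t₀)) ≤ θ * (1 - Real.exp (-c * t₀)) :=
    mul_le_mul_of_nonneg_right hdc.le (by linarith)
  have h3 : θ ≤ f t₀ := hle
  linarith

theorem SolvesODE.le_max {f F : ℝ → ℝ} (hf : SolvesODE f F) {s t K : ℝ} (hs : 0 ≤ s)
    (hst : s ≤ t) (hF : ∀ τ ∈ Icc s t, K < f τ → F τ ≤ 0) : f t ≤ max (f s) K := by
  by_contra hcon
  have hcon' := not_le.1 hcon
  have hclosed : IsCompact (Icc s t ∩ f ⁻¹' Iic (max (f s) K)) :=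
    isCompact_Icc.of_isClosed_subset
      ((hf.continuousOn hs hst).preimage_isClosed_of_isClosed isClosed_Icc isClosed_Iic)
      inter_subset_left
  obtain ⟨t₀, ⟨ht₀, hle⟩, hmax⟩ :=
    hclosed.exists_isGreatest ⟨s, ⟨le_rfl, hst⟩, le_max_left (f s) K⟩
  have hlt : ∀ τ ∈ Ioo t₀ t, F τ ≤ 0 := fun τ hτ => by
    have hm : τ ∈ Icc s t := ⟨ht₀.1.trans hτ.1.le, hτ.2.le⟩
    refine hF τ hm ?_
    by_contra h
    exact absurd (hmax ⟨hm, (not_lt.1 h).trans (le_max_right _ _)⟩) (not_le.2 hτ.1)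
  have h1 := hf.le_of_nonpos (hs.trans ht₀.1) ht₀.2 hlt
  have h2 : f t₀ ≤ max (f s) K := hle
  linarith

theorem SolvesODE.eventually_le {f F : ℝ → ℝ} (hf : SolvesODE f F) {c U : ℝ} (hc : 0 < c)
    (hF : ∀ τ, 0 ≤ τ → U < f τ → F τ ≤ -c) : ∃ T, 0 ≤ T ∧ ∀ t, T ≤ t → f t ≤ U := by
  by_cases h : ∃ T, 0 ≤ T ∧ f T ≤ U
  · obtain ⟨T, hT, hTU⟩ := h
    refine ⟨T, hT, fun t ht => ?_⟩
    have := hf.le_max (K := U) hT ht fun τ hτ hU => by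
      linarith [hF τ (hT.trans hτ.1) hU]
    rwa [max_eq_right hTU] at this
  · exfalso
    push Not at h
    set t := (f 0 - U) / c with ht
    have ht0 : 0 < t := div_pos (by linarith [h 0 le_rfl]) hc
    have hg := hf.add ((SolvesODE.of_contDiff (f := fun t => c * t) (by fun_prop)).congr
      (G := fun _ => c) fun t => by simp)
    have h1 := hg.le_of_nonpos le_rfl ht0.le fun τ hτ => by
      linarith [hF τ hτ.1.le (h τ hτ.1.le)]
    have h2 : c * t = f 0 - U := by rw [ht]; field_simp
    have h3 := h t ht0.le
    linarith

end

end RadialShell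

namespace RadialShell

noncomputable section

/-! ### The linearised dynamics near the shell -/

/-- Linear approximation of `ω` by `A₁ (r - R) + A₂ (η - R)` on `[R - δ, R + δ]²`, up to Lipschitz
errors of size `κ`. -/
def NearlyLinear (ω : ℝ → ℝ → ℝ) (R δ κ A₁ A₂ : ℝ) : Prop :=
  ∀ r ∈ Icc (R - δ) (R + δ), ∀ η ∈ Icc (R - δ) (R + δ), ∀ r' ∈ Icc (R - δ) (R + δ),
    ∀ η' ∈ Icc (R - δ) (R + δ),
      |ω r η - ω r' η' - (A₁ * (r - r') + A₂ * (η - η'))| ≤ κ * max |r - r'| |η - η'|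

theorem exists_nearlyLinear {ω : ℝ → ℝ → ℝ} (hω : ContDiffOn ℝ 1 (Function.uncurry ω) quadrant)
    {R κ δ₀ : ℝ} (hR : 0 < R) (hκ : 0 < κ) (hδ₀ : 0 < δ₀) :
    ∃ δ, 0 < δ ∧ δ ≤ δ₀ ∧ NearlyLinear ω R δ κ (partial₁ ω R R) (partial₂ ω R R) := by
  have hq : quadrant ∈ 𝓝 (R, R) := isOpen_quadrant.mem_nhds ⟨hR, hR⟩
  have hs := (hω.contDiffAt hq).hasStrictFDerivAt (by simp)
  have h1 := hs.isLittleO.def hκ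
  rw [nhds_prod_eq] at h1
  obtain ⟨t, ht, h2⟩ := eventually_prod_self_iff'.1 h1
  obtain ⟨δ, hδ, hball⟩ := Metric.nhds_basis_closedBall.mem_iff.1 ht
  refine ⟨min δ δ₀, by positivity, min_le_right _ _, fun r hr η hη r' hr' η' hη' => ?_⟩
  have hmem : ∀ x ∈ Icc (R - min δ δ₀) (R + min δ δ₀), ∀ y ∈ Icc (R - min δ δ₀) (R + min δ δ₀),
      (x, y) ∈ t := fun x hx y hy => by
    refine hball ?_
    rw [← Real.closedBall_eq_Icc, Metric.mem_closedBall] at hx hy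
    rw [Metric.mem_closedBall, Prod.dist_eq]
    exact max_le (hx.trans (min_le_left _ _)) (hy.trans (min_le_left _ _))
  have h3 := h2 (r, η) (hmem r hr η hη) (r', η') (hmem r' hr' η' hη')
  have e1 : fderiv ℝ (Function.uncurry ω) (R, R) ((r, η) - (r', η')) =
      partial₁ ω R R * (r - r') + partial₂ ω R R * (η - η') := by
    have e2 : ((r, η) - (r', η') : ℝ × ℝ) = (r - r') • ((1 : ℝ), (0 : ℝ)) +
        (η - η') • ((0 : ℝ), (1 : ℝ)) := by
      ext <;> simp
    rw [e2, map_add, map_smul, map_smul, partial₁, partial₂,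
      (hasDerivAt_fst_of_contDiffOn hω hR hR).deriv,
      (hasDerivAt_snd_of_contDiffOn hω hR hR).deriv]
    simp [mul_comm]
  simp only [e1] at h3
  simpa [Prod.norm_def] using h3

/-- Bounds for integrals by a constant and the mass of a weight outside a set. -/
theorem integral_le_of_le_add_indicator {ν : Measure ℝ} [IsProbabilityMeasure ν] {f w : ℝ → ℝ}
    {J : Set ℝ} (hJ : MeasurableSet J) {c C Θ : ℝ} (hC : 0 ≤ C) (hw : Integrable w ν)
    (hf : Integrable f ν) (hΘ : ∫ η in Jᶜ, w η ∂ν ≤ Θ)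
    (h : ∀ᵐ η ∂ν, f η ≤ c + C * Jᶜ.indicator w η) : ∫ η, f η ∂ν ≤ c + C * Θ := by
  have hi : Integrable (Jᶜ.indicator w) ν := hw.indicator hJ.compl
  have h1 := integral_mono_ae hf ((integrable_const c).add (hi.const_mul C)) h
  have h2 : ∫ η, (c + C * Jᶜ.indicator w η) ∂ν = c + C * ∫ η in Jᶜ, w η ∂ν := by
    rw [integral_add (integrable_const c) (hi.const_mul C), integral_const_mul,
      integral_indicator hJ.compl]
    simp
  have h3 := mul_le_mul_of_nonneg_left hΘ hC
  calc _ ≤ _ := h1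
    _ = _ := h2
    _ ≤ _ := by linarith

theorem integrable_id_of_weight {ν : Measure ℝ} [IsProbabilityMeasure ν] {w : ℝ → ℝ} {R C₁ : ℝ}
    (hw : Integrable w ν) (hC : ∀ᵐ η ∂ν, |η - R| ≤ C₁ * w η) : Integrable (fun η : ℝ => η) ν := by
  have h1 : Integrable (fun η : ℝ => η - R) ν :=
    (hw.const_mul C₁).mono' (by fun_prop) hC
  have := h1.add (integrable_const R)
  refine this.congr (.of_forall fun η => ?_)
  simp

/-- Points between `r₁` and `r₂` are close to `R` when the interval is short, the mean radius is
close to `R` and little mass is outside. -/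
theorem abs_sub_le_of_mean {ν : Measure ℝ} [IsProbabilityMeasure ν] {w : ℝ → ℝ}
    {R C₁ r₁ r₂ Θ r : ℝ} (hw : Integrable w ν) (hw1 : ∀ᵐ η ∂ν, 1 ≤ w η) (hC₁ : 0 ≤ C₁)
    (hC : ∀ᵐ η ∂ν, |η - R| ≤ C₁ * w η) (hΘ : ∫ η in (Icc r₁ r₂)ᶜ, w η ∂ν ≤ Θ)
    (hr : r ∈ Icc r₁ r₂) :
    |r - R| ≤ (r₂ - r₁) + |(∫ η, η ∂ν) - R| + (|r - R| + C₁) * Θ := by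
  have hid := integrable_id_of_weight hw hC
  have h1 : ∫ η, |r - η| ∂ν ≤ (r₂ - r₁) + (|r - R| + C₁) * Θ := by
    refine integral_le_of_le_add_indicator (J := Icc r₁ r₂) measurableSet_Icc (by positivity) hw
      ((integrable_const r).sub hid).abs hΘ ?_
    filter_upwards [hw1, hC] with η h1 h2
    by_cases hη : η ∈ Icc r₁ r₂
    · rw [indicator_of_notMem (by simpa using hη), mul_zero, add_zero, abs_le]
      constructor <;> linarith [hr.1, hr.2, hη.1, hη.2]
    · rw [indicator_of_mem (by simpa using hη)]
      have h3 : |r - η| ≤ |r - R| + |η - R| := by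
        have := abs_sub (r - R) (η - R)
        simpa using this
      have h4 : 0 ≤ r₂ - r₁ := by linarith [hr.1, hr.2]
      have h5 : |r - R| ≤ |r - R| * w η := le_mul_of_one_le_right (abs_nonneg _) h1
      nlinarith
  have h2 : |r - ∫ η, η ∂ν| ≤ ∫ η, |r - η| ∂ν := by
    have e : r - ∫ η, η ∂ν = ∫ η, (r - η) ∂ν := by
      rw [integral_sub (integrable_const r) hid]
      simp
    rw [e]
    exact abs_integral_le_integral_abs
  have h3 := abs_add_le (r - ∫ η, η ∂ν) ((∫ η, η ∂ν) - R)
  rw [sub_add_sub_cancel] at h3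
  linarith

/-- Growth bounds for a kernel relative to a weight on a set `S` that carries the measures. -/
structure WeightBounds (ω : ℝ → ℝ → ℝ) (R : ℝ) (S : Set ℝ) (w : ℝ → ℝ) (C₀ C₁ : ℝ) : Prop where
  growth : ∀ r ∈ S, ∀ η ∈ S, |ω r η| ≤ C₀ * (w r * w η)
  one_le : ∀ r ∈ S, 1 ≤ w r
  dist_le : ∀ r ∈ S, |r - R| ≤ C₁ * w r
  nonneg₀ : 0 ≤ C₀
  nonneg₁ : 0 ≤ C₁

/-- A probability measure carried by `S` with finite weight and well-defined velocities. -/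
structure AdmissibleMeasure (ω : ℝ → ℝ → ℝ) (S : Set ℝ) (w : ℝ → ℝ) (ν : Measure ℝ) : Prop where
  ae_mem : ∀ᵐ r ∂ν, r ∈ S
  weight : Integrable w ν
  velocity : ∀ r ∈ S, Integrable (ω r) ν
  measurable : AEStronglyMeasurable (radialVelocity ω ν) ν

theorem velocity_sub_le {ω : ℝ → ℝ → ℝ} {R δ κ A₁ A₂ C₀ C₁ Wδ Θ r₁ r₂ : ℝ} {S : Set ℝ}
    {w : ℝ → ℝ} {ν : Measure ℝ} [IsProbabilityMeasure ν] (hlin : NearlyLinear ω R δ κ A₁ A₂)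
    (hw : WeightBounds ω R S w C₀ C₁) (hν : AdmissibleMeasure ω S w ν) (hκ : 0 ≤ κ)
    (hsub : Icc (R - δ) (R + δ) ⊆ S) (hWδ : ∀ r ∈ Icc (R - δ) (R + δ), w r ≤ Wδ)
    (h₁ : r₁ ∈ Icc (R - δ) (R + δ)) (h₂ : r₂ ∈ Icc (R - δ) (R + δ)) (h12 : r₁ ≤ r₂)
    (hΘ : ∫ η in (Icc r₁ r₂)ᶜ, w η ∂ν ≤ Θ) :
    radialVelocity ω ν r₂ - radialVelocity ω ν r₁ ≤
      (A₁ + κ) * (r₂ - r₁) + (2 * C₀ * Wδ + (|A₁| + κ) * (2 * δ)) * Θ := by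
  have hδ : 0 ≤ δ := by linarith [h₁.1, h₁.2]
  have hWδ1 : 1 ≤ Wδ := (hw.one_le r₁ (hsub h₁)).trans (hWδ r₁ h₁)
  have hC₀ := hw.nonneg₀
  rw [radialVelocity, radialVelocity, ← integral_sub (hν.velocity r₂ (hsub h₂))
    (hν.velocity r₁ (hsub h₁))]
  refine integral_le_of_le_add_indicator (J := Icc r₁ r₂) measurableSet_Icc (by positivity)
    hν.weight ((hν.velocity r₂ (hsub h₂)).sub (hν.velocity r₁ (hsub h₁))) hΘ ?_
  filter_upwards [hν.ae_mem] with η hηS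
  by_cases hη : η ∈ Icc r₁ r₂
  · rw [indicator_of_notMem (by simpa using hη), mul_zero, add_zero]
    have hηI : η ∈ Icc (R - δ) (R + δ) := ⟨h₁.1.trans hη.1, hη.2.trans h₂.2⟩
    have h3 := (abs_le.1 (hlin r₂ h₂ η hηI r₁ h₁ η hηI)).2
    have h4 : max |r₂ - r₁| |η - η| = r₂ - r₁ := by
      rw [sub_self, abs_zero, abs_of_nonneg (by linarith), max_eq_left (by linarith)]
    rw [h4] at h3
    linarith
  · rw [indicator_of_mem (by simpa using hη)]
    have hwη := hw.one_le η hηS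
    have h3 := (abs_le.1 (hw.growth r₂ (hsub h₂) η hηS)).2
    have h4 := (abs_le.1 (hw.growth r₁ (hsub h₁) η hηS)).1
    have h5 : C₀ * (w r₂ * w η) ≤ C₀ * (Wδ * w η) := by
      have := hWδ r₂ h₂
      gcongr
    have h6 : C₀ * (w r₁ * w η) ≤ C₀ * (Wδ * w η) := by
      have := hWδ r₁ h₁
      gcongr
    have h7 : -(A₁ + κ) * (r₂ - r₁) ≤ (|A₁| + κ) * (2 * δ) * w η := by
      have h8 : -(A₁ + κ) * (r₂ - r₁) ≤ (|A₁| + κ) * (r₂ - r₁) :=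
        mul_le_mul_of_nonneg_right (by linarith [neg_abs_le A₁]) (by linarith)
      have h9 : (|A₁| + κ) * (r₂ - r₁) ≤ (|A₁| + κ) * (2 * δ) :=
        mul_le_mul_of_nonneg_left (by linarith [h₁.1, h₂.2]) (by positivity)
      have h10 : (|A₁| + κ) * (2 * δ) ≤ (|A₁| + κ) * (2 * δ) * w η :=
        le_mul_of_one_le_right (by positivity) hwη
      linarith
    nlinarith

theorem abs_mean_velocity_sub_le {ω : ℝ → ℝ → ℝ} {R δ κ A₁ A₂ C₀ C₁ W Θ r₁ r₂ : ℝ} {S : Set ℝ}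
    {w : ℝ → ℝ} {ν : Measure ℝ} [IsProbabilityMeasure ν] (hlin : NearlyLinear ω R δ κ A₁ A₂)
    (hRR : ω R R = 0) (hw : WeightBounds ω R S w C₀ C₁) (hν : AdmissibleMeasure ω S w ν)
    (hκ : 0 ≤ κ) (hsub : Icc (R - δ) (R + δ) ⊆ S) (hW : ∫ η, w η ∂ν ≤ W)
    (h₁ : r₁ ∈ Icc (R - δ) (R + δ)) (h₂ : r₂ ∈ Icc (R - δ) (R + δ)) (h12 : r₁ ≤ r₂)
    (hΘ : ∫ η in (Icc r₁ r₂)ᶜ, w η ∂ν ≤ Θ) :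
    |(∫ r, radialVelocity ω ν r ∂ν) - (A₁ + A₂) * ((∫ r, r ∂ν) - R)| ≤
      κ * ((r₂ - r₁) + |(∫ η, η ∂ν) - R|) +
        (κ * (δ + C₁) + 2 * (C₀ + (|A₁| + |A₂|) * C₁) * W) * Θ := by
  have hδ : 0 ≤ δ := by linarith [h₁.1, h₁.2]
  have hC₀ := hw.nonneg₀
  have hC₁ := hw.nonneg₁
  have hw1 : ∀ᵐ η ∂ν, 1 ≤ w η := hν.ae_mem.mono fun η hη => hw.one_le η hη
  have hwd : ∀ᵐ η ∂ν, |η - R| ≤ C₁ * w η := hν.ae_mem.mono fun η hη => hw.dist_le η hη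
  have hid := integrable_id_of_weight hν.weight hwd
  have hW1 : 1 ≤ ∫ η, w η ∂ν := by
    have := integral_mono_ae (integrable_const (1 : ℝ)) hν.weight hw1
    simpa using this
  have hΘ0 : 0 ≤ Θ := by
    refine le_trans ?_ hΘ
    refine setIntegral_nonneg_of_ae_restrict (ae_restrict_of_ae ?_)
    filter_upwards [hw1] with η hη
    simp only [Pi.zero_apply]
    linarith
  set C₂ := C₀ + (|A₁| + |A₂|) * C₁ with hC₂
  have hC₂0 : 0 ≤ C₂ := by positivity
  set m := ∫ η, η ∂ν with hm
  set E := (r₂ - r₁) + |m - R| + (δ + C₁) * Θ with hE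
  have hRm : R ∈ Icc (R - δ) (R + δ) := ⟨by linarith, by linarith⟩
  have hJI : ∀ r ∈ Icc r₁ r₂, r ∈ Icc (R - δ) (R + δ) := fun r hr =>
    ⟨h₁.1.trans hr.1, hr.2.trans h₂.2⟩
  have hEJ : ∀ r ∈ Icc r₁ r₂, |r - R| ≤ E := by
    intro r hr
    have h3 := abs_sub_le_of_mean hν.weight hw1 hC₁ hwd hΘ hr
    have h4 : |r - R| ≤ δ := by
      rw [abs_le]
      constructor <;> linarith [(hJI r hr).1, (hJI r hr).2]
    have h5 : (|r - R| + C₁) * Θ ≤ (δ + C₁) * Θ := by gcongr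
    linarith
  have hE0 : 0 ≤ E := (abs_nonneg _).trans (hEJ r₁ ⟨le_rfl, h12⟩)
  -- the deviation of the kernel from its linearisation
  have hdev : ∀ r ∈ S, ∀ η ∈ S, |ω r η - (A₁ * (r - R) + A₂ * (η - R))| ≤ C₂ * (w r * w η) := by
    intro r hr η hη
    have w1 := hw.one_le r hr
    have w2 := hw.one_le η hη
    have h3 := abs_sub (ω r η) (A₁ * (r - R) + A₂ * (η - R))
    have h4 := abs_add_le (A₁ * (r - R)) (A₂ * (η - R))
    rw [abs_mul, abs_mul] at h4
    have h5 : |A₁| * |r - R| ≤ |A₁| * (C₁ * (w r * w η)) := by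
      have : C₁ * w r ≤ C₁ * (w r * w η) :=
        mul_le_mul_of_nonneg_left (le_mul_of_one_le_right (by linarith) w2) hC₁
      exact mul_le_mul_of_nonneg_left ((hw.dist_le r hr).trans this) (abs_nonneg _)
    have h6 : |A₂| * |η - R| ≤ |A₂| * (C₁ * (w r * w η)) := by
      have : C₁ * w η ≤ C₁ * (w r * w η) :=
        mul_le_mul_of_nonneg_left (le_mul_of_one_le_left (by linarith) w1) hC₁
      exact mul_le_mul_of_nonneg_left ((hw.dist_le η hη).trans this) (abs_nonneg _)
    have h7 := hw.growth r hr η hη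
    rw [hC₂]
    nlinarith
  have hdevJ : ∀ r ∈ Icc r₁ r₂, ∀ η ∈ Icc r₁ r₂,
      |ω r η - (A₁ * (r - R) + A₂ * (η - R))| ≤ κ * E := by
    intro r hr η hη
    have h3 := hlin r (hJI r hr) η (hJI η hη) R hRm R hRm
    rw [hRR, sub_zero] at h3
    exact h3.trans (mul_le_mul_of_nonneg_left (max_le (hEJ r hr) (hEJ η hη)) hκ)
  have hidR : Integrable (fun η => η - R) ν := hid.sub (integrable_const R)
  have hlinint : ∀ r, Integrable (fun η => A₁ * (r - R) + A₂ * (η - R)) ν := fun r =>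
    (integrable_const _).add ((hid.sub (integrable_const R)).const_mul A₂)
  have hlinval : ∀ r, ∫ η, (A₁ * (r - R) + A₂ * (η - R)) ∂ν = A₁ * (r - R) + A₂ * (m - R) := by
    intro r
    rw [integral_add (integrable_const _) (hidR.const_mul A₂), integral_const_mul A₂, integral_sub hid (integrable_const R)]
    simp [hm]
  have hvel : ∀ r ∈ S, |radialVelocity ω ν r - (A₁ * (r - R) + A₂ * (m - R))| ≤
      ∫ η, |ω r η - (A₁ * (r - R) + A₂ * (η - R))| ∂ν := by
    intro r hr
    rw [radialVelocity, ← hlinval r, ← integral_sub (hν.velocity r hr) (hlinint r)]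
    exact abs_integral_le_integral_abs
  have habsint : ∀ r ∈ S, Integrable (fun η => |ω r η - (A₁ * (r - R) + A₂ * (η - R))|) ν :=
    fun r hr => ((hν.velocity r hr).sub (hlinint r)).abs
  have hvelJ : ∀ r ∈ Icc r₁ r₂, |radialVelocity ω ν r - (A₁ * (r - R) + A₂ * (m - R))| ≤
      κ * E + C₂ * w r * Θ := by
    intro r hr
    have hrS := hsub (hJI r hr)
    have hwr := hw.one_le r hrS
    refine (hvel r hrS).trans (integral_le_of_le_add_indicator (J := Icc r₁ r₂)
      measurableSet_Icc (by positivity) hν.weight (habsint r hrS) hΘ ?_)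
    filter_upwards [hν.ae_mem] with η hηS
    by_cases hη : η ∈ Icc r₁ r₂
    · rw [indicator_of_notMem (by simpa using hη), mul_zero, add_zero]
      exact hdevJ r hr η hη
    · rw [indicator_of_mem (by simpa using hη)]
      have h3 := hdev r hrS η hηS
      have h4 : 0 ≤ κ * E := by positivity
      linarith
  have hvelS : ∀ r ∈ S, |radialVelocity ω ν r - (A₁ * (r - R) + A₂ * (m - R))| ≤
      C₂ * w r * W := by
    intro r hr
    have hwr := hw.one_le r hr
    have h3 : ∫ η, |ω r η - (A₁ * (r - R) + A₂ * (η - R))| ∂ν ≤ ∫ η, C₂ * w r * w η ∂ν := by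
      refine integral_mono_ae (habsint r hr) (hν.weight.const_mul _) ?_
      filter_upwards [hν.ae_mem] with η hη
      have := hdev r hr η hη
      linarith
    rw [integral_const_mul] at h3
    have h4 : C₂ * w r * ∫ η, w η ∂ν ≤ C₂ * w r * W := by gcongr
    exact (hvel r hr).trans (h3.trans h4)
  have hvint : Integrable (radialVelocity ω ν) ν := by
    have hi : Integrable (fun r => C₂ * w r * W + (|A₁| * (C₁ * w r) + |A₂ * (m - R)|)) ν :=
      ((hν.weight.const_mul C₂).mul_const W).add
        (((hν.weight.const_mul C₁).const_mul |A₁|).add (integrable_const _))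
    refine hi.mono' hν.measurable ?_
    filter_upwards [hν.ae_mem] with r hr
    have h3 := hvelS r hr
    have h4 := abs_add_le (A₁ * (r - R)) (A₂ * (m - R))
    rw [abs_mul A₁] at h4
    have h5 := mul_le_mul_of_nonneg_left (hw.dist_le r hr) (abs_nonneg A₁)
    have h6 := abs_sub_abs_le_abs_sub (radialVelocity ω ν r) (A₁ * (r - R) + A₂ * (m - R))
    rw [Real.norm_eq_abs]
    linarith
  have hlint' : Integrable (fun r => A₁ * (r - R) + A₂ * (m - R)) ν :=
    ((hid.sub (integrable_const R)).const_mul A₁).add (integrable_const _)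
  have hlval' : ∫ r, (A₁ * (r - R) + A₂ * (m - R)) ∂ν = (A₁ + A₂) * (m - R) := by
    rw [integral_add (hidR.const_mul A₁) (integrable_const _), integral_const_mul, integral_sub hid (integrable_const R)]
    simp [hm]
    ring
  rw [← hlval', ← integral_sub hvint hlint']
  refine (abs_integral_le_integral_abs).trans ?_
  have hfi : Integrable (fun r => |radialVelocity ω ν r - (A₁ * (r - R) + A₂ * (m - R))| -
      C₂ * Θ * w r) ν := (hvint.sub hlint').abs.sub (hν.weight.const_mul _)
  have h3 : ∫ r, (|radialVelocity ω ν r - (A₁ * (r - R) + A₂ * (m - R))| - C₂ * Θ * w r) ∂ν ≤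
      κ * E + (C₂ * W) * Θ := by
    refine integral_le_of_le_add_indicator (J := Icc r₁ r₂) measurableSet_Icc
      (by have : 0 ≤ W := by linarith
          positivity) hν.weight hfi hΘ ?_
    filter_upwards [hν.ae_mem] with r hrS
    have hwr := hw.one_le r hrS
    by_cases hr : r ∈ Icc r₁ r₂
    · rw [indicator_of_notMem (by simpa using hr), mul_zero, add_zero]
      have := hvelJ r hr
      linarith
    · rw [indicator_of_mem (by simpa using hr)]
      have h4 := hvelS r hrS
      have h5 : 0 ≤ κ * E := by positivity
      have h6 : 0 ≤ C₂ * Θ * w r := by positivity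
      linarith
  have habs : Integrable (fun r => |radialVelocity ω ν r - (A₁ * (r - R) + A₂ * (m - R))|) ν :=
    (hvint.sub hlint').abs
  rw [integral_sub habs (hν.weight.const_mul _), integral_const_mul] at h3
  have h4 : C₂ * Θ * ∫ r, w r ∂ν ≤ C₂ * Θ * W := by gcongr
  have h5 : κ * E = κ * ((r₂ - r₁) + |m - R|) + κ * (δ + C₁) * Θ := by rw [hE]; ring
  have h6 : ∫ r, |radialVelocity ω ν r - (A₁ * (r - R) + A₂ * (m - R))| ∂ν ≤
      κ * E + C₂ * W * Θ + C₂ * Θ * W := by linarith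
  refine h6.trans (le_of_eq ?_)
  rw [h5]
  ring

/-- The dissipation inequality for `(r₂ - r₁)² + (mean - R)²`. -/
theorem exists_dissipation {ω : ℝ → ℝ → ℝ} {R δ κ A₁ A₂ γ C₀ C₁ W : ℝ} {S : Set ℝ}
    {w : ℝ → ℝ} (hlin : NearlyLinear ω R δ κ A₁ A₂) (hRR : ω R R = 0)
    (hw : WeightBounds ω R S w C₀ C₁) (hκ : 0 ≤ κ) (hδ : 0 ≤ δ) (hsub : Icc (R - δ) (R + δ) ⊆ S)
    (hwδ : ∃ Wδ, ∀ r ∈ Icc (R - δ) (R + δ), w r ≤ Wδ) (hA₁ : A₁ ≤ -γ) (hA : A₁ + A₂ ≤ -γ) :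
    ∃ C, 0 ≤ C ∧ ∀ ν : Measure ℝ, IsProbabilityMeasure ν → AdmissibleMeasure ω S w ν →
      ∫ η, w η ∂ν ≤ W → ∀ r₁ ∈ Icc (R - δ) (R + δ), ∀ r₂ ∈ Icc (R - δ) (R + δ), r₁ ≤ r₂ →
      ∀ Θ, ∫ η in (Icc r₁ r₂)ᶜ, w η ∂ν ≤ Θ →
        2 * (r₂ - r₁) * (radialVelocity ω ν r₂ - radialVelocity ω ν r₁) +
          2 * ((∫ r, r ∂ν) - R) * (∫ r, radialVelocity ω ν r ∂ν) ≤
        -(2 * γ - 3 * κ) * ((r₂ - r₁) ^ 2 + ((∫ r, r ∂ν) - R) ^ 2) + C * Θ := by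
  obtain ⟨Wδ, hWδ⟩ := hwδ
  have hRm : R ∈ Icc (R - δ) (R + δ) := ⟨by linarith, by linarith⟩
  have hWδ1 : 1 ≤ Wδ := (hw.one_le R (hsub hRm)).trans (hWδ R hRm)
  have hC₀ := hw.nonneg₀
  have hC₁ := hw.nonneg₁
  set K₁ := 2 * C₀ * Wδ + (|A₁| + κ) * (2 * δ) with hK₁
  set K₂ := κ * (δ + C₁) + 2 * (C₀ + (|A₁| + |A₂|) * C₁) * max W 0 with hK₂
  have hK₁0 : 0 ≤ K₁ := by positivity
  have hK₂0 : 0 ≤ K₂ := by positivity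
  refine ⟨2 * (2 * δ) * K₁ + 2 * (C₁ * max W 0) * K₂, by positivity, ?_⟩
  intro ν _ hν hW r₁ h₁ r₂ h₂ h12 Θ hΘ
  have hW' : ∫ η, w η ∂ν ≤ max W 0 := hW.trans (le_max_left _ _)
  have hw1 : ∀ᵐ η ∂ν, 1 ≤ w η := hν.ae_mem.mono fun η hη => hw.one_le η hη
  have hwd : ∀ᵐ η ∂ν, |η - R| ≤ C₁ * w η := hν.ae_mem.mono fun η hη => hw.dist_le η hη
  have hid := integrable_id_of_weight hν.weight hwd
  have hΘ0 : 0 ≤ Θ := by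
    refine le_trans ?_ hΘ
    refine setIntegral_nonneg_of_ae_restrict (ae_restrict_of_ae ?_)
    filter_upwards [hw1] with η hη
    simp only [Pi.zero_apply]
    linarith
  have k1 := velocity_sub_le hlin hw hν hκ hsub hWδ h₁ h₂ h12 hΘ
  have k2 := abs_mean_velocity_sub_le hlin hRR hw hν hκ hsub hW' h₁ h₂ h12 hΘ
  rw [← hK₁] at k1
  rw [← hK₂] at k2
  have he : |(∫ r, r ∂ν) - R| ≤ C₁ * max W 0 := by
    have e1 : (∫ r, r ∂ν) - R = ∫ r, (r - R) ∂ν := by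
      rw [integral_sub hid (integrable_const R)]
      simp
    rw [e1]
    refine abs_integral_le_integral_abs.trans ?_
    refine (integral_mono_ae (hid.sub (integrable_const R)).abs (hν.weight.const_mul C₁)
      hwd).trans ?_
    rw [integral_const_mul]
    gcongr
  set D := r₂ - r₁ with hD
  set e := (∫ r, r ∂ν) - R with hedef
  set V := ∫ r, radialVelocity ω ν r ∂ν with hV
  have hD0 : 0 ≤ D := by linarith
  have hD2 : D ≤ 2 * δ := by linarith [h₁.1, h₂.2]
  have l1 : 2 * D * (radialVelocity ω ν r₂ - radialVelocity ω ν r₁) ≤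
      2 * (-γ + κ) * D ^ 2 + 2 * (2 * δ) * K₁ * Θ := by
    have m1 := mul_le_mul_of_nonneg_left k1 (show 0 ≤ 2 * D by linarith)
    have m2 : 2 * D * ((A₁ + κ) * D) ≤ 2 * (-γ + κ) * D ^ 2 := by
      have := mul_le_mul_of_nonneg_right hA₁ (sq_nonneg D)
      linarith
    have m3 : 2 * D * (K₁ * Θ) ≤ 2 * (2 * δ) * (K₁ * Θ) := by gcongr
    linarith
  have l2 : 2 * e * V ≤ -2 * γ * e ^ 2 + κ * (D ^ 2 + e ^ 2) + 2 * κ * e ^ 2 +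
      2 * (C₁ * max W 0) * K₂ * Θ := by
    have m1 : 2 * e * (V - (A₁ + A₂) * e) ≤ 2 * |e| * (κ * (D + |e|) + K₂ * Θ) := by
      calc 2 * e * (V - (A₁ + A₂) * e) ≤ |2 * e * (V - (A₁ + A₂) * e)| := le_abs_self _
        _ = 2 * |e| * |V - (A₁ + A₂) * e| := by rw [abs_mul, abs_mul, abs_two]
        _ ≤ _ := by gcongr
    have m2 : 2 * e * ((A₁ + A₂) * e) ≤ -2 * γ * e ^ 2 := by
      have := mul_le_mul_of_nonneg_right hA (sq_nonneg e)
      linarith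
    have m3 : 2 * |e| * (K₂ * Θ) ≤ 2 * (C₁ * max W 0) * (K₂ * Θ) := by gcongr
    have m4 : 2 * |e| * (κ * (D + |e|)) ≤ κ * (D ^ 2 + e ^ 2) + 2 * κ * e ^ 2 := by
      have : 2 * |e| * D ≤ D ^ 2 + e ^ 2 := by
        rw [← sq_abs e]
        linarith [sq_nonneg (|e| - D), sub_sq |e| D]
      calc 2 * |e| * (κ * (D + |e|)) = κ * (2 * |e| * D) + 2 * κ * |e| ^ 2 := by ring
        _ ≤ κ * (D ^ 2 + e ^ 2) + 2 * κ * e ^ 2 := by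
          rw [sq_abs]
          gcongr
    linarith
  have : 0 ≤ κ * D ^ 2 := by positivity
  have : 0 ≤ κ * e ^ 2 := by positivity
  linarith

end

end RadialShell

namespace RadialShell

noncomputable section

/-! ### Transport distance to a Dirac mass -/

theorem transportDist_dirac {p : ℝ} (ν : Measure ℝ) [IsProbabilityMeasure ν] (R : ℝ) :
    transportDist p ν (Measure.dirac R) = (∫⁻ r, edist r R ^ p ∂ν) ^ (1 / p) := by
  have hconst : ∀ π : {π : Measure (ℝ × ℝ) // π.map Prod.fst = ν ∧ π.map Prod.snd =
      Measure.dirac R}, ∫⁻ z, edist z.1 z.2 ^ p ∂π.1 = ∫⁻ r, edist r R ^ p ∂ν := by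
    rintro ⟨π, h1, h2⟩
    have hae : ∀ᵐ z ∂π, z.2 = R := by
      have : ∀ᵐ r ∂(π.map Prod.snd), r = R := by
        rw [h2]
        simp [ae_dirac_eq]
      exact ae_of_ae_map measurable_snd.aemeasurable this
    have hm : Measurable fun r : ℝ => edist r R ^ p :=
      (measurable_id.edist measurable_const).pow_const p
    have h3 : ∫⁻ r, edist r R ^ p ∂ν = ∫⁻ z, edist z.1 R ^ p ∂π := by
      rw [← h1, lintegral_map hm measurable_fst]
    rw [h3]
    refine lintegral_congr_ae ?_
    filter_upwards [hae] with z hz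
    rw [hz]
  have : Nonempty {π : Measure (ℝ × ℝ) // π.map Prod.fst = ν ∧ π.map Prod.snd =
      Measure.dirac R} :=
    ⟨ν.prod (Measure.dirac R), by simp [Measure.map_fst_prod], by simp [Measure.map_snd_prod]⟩
  rw [transportDist]
  simp only [hconst, iInf_const]

theorem transportDist_dirac_le {p : ℝ} (hp : 0 < p) {ν : Measure ℝ} [IsProbabilityMeasure ν]
    {R E : ℝ} (h : ∀ᵐ r ∂ν, |r - R| ≤ E) :
    transportDist p ν (Measure.dirac R) ≤ ENNReal.ofReal E := by
  rw [transportDist_dirac]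
  have h1 : ∫⁻ r, edist r R ^ p ∂ν ≤ ∫⁻ _r, ENNReal.ofReal E ^ p ∂ν := by
    refine lintegral_mono_ae ?_
    filter_upwards [h] with r hr
    rw [edist_dist, Real.dist_eq]
    exact ENNReal.rpow_le_rpow (ENNReal.ofReal_le_ofReal hr) hp.le
  rw [lintegral_const, measure_univ, mul_one] at h1
  refine (ENNReal.rpow_le_rpow h1 (by positivity)).trans ?_
  rw [← ENNReal.rpow_mul, mul_one_div_cancel hp.ne', ENNReal.rpow_one]

/-! ### Admissibility of radial parts -/

theorem isProbabilityMeasure_radialPart {N : ℕ} {μ : Measure (EuclideanSpace ℝ (Fin N))}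
    (h : IsProbabilityMeasure μ) : IsProbabilityMeasure (radialPart μ) :=
  Measure.isProbabilityMeasure_map continuous_norm.aemeasurable

theorem ae_nonneg_radialPart {N : ℕ} (μ : Measure (EuclideanSpace ℝ (Fin N))) :
    ∀ᵐ r ∂(radialPart μ), 0 ≤ r :=
  (ae_radialPart (s := Ici 0) measurableSet_Ici).2 (.of_forall fun x => norm_nonneg x)

theorem aestronglyMeasurable_radialVelocity {ω : ℝ → ℝ → ℝ}
    (hω : ContinuousOn (Function.uncurry ω) (Ioi 0 ×ˢ Ici 0)) (h0 : ∀ η, ω 0 η = 0)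
    {ν : Measure ℝ} [IsProbabilityMeasure ν] (hν : ∀ᵐ r ∂ν, 0 ≤ r) :
    AEStronglyMeasurable (radialVelocity ω ν) ν := by
  have hT : MeasurableSet (Ioi (0 : ℝ) ×ˢ Ici (0 : ℝ)) := measurableSet_Ioi.prod measurableSet_Ici
  have h1 : AEStronglyMeasurable ((Ioi (0 : ℝ) ×ˢ Ici (0 : ℝ)).indicator (Function.uncurry ω))
      (ν.prod ν) := (aestronglyMeasurable_indicator_iff hT).2 (hω.aestronglyMeasurable hT)
  refine h1.integral_prod_right'.congr ?_
  filter_upwards [hν] with r hr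
  refine integral_congr_ae ?_
  filter_upwards [hν] with η hη
  rcases hr.eq_or_lt with h | h
  · rw [indicator_of_notMem (fun hh => absurd (show (0 : ℝ) < r from hh.1) (by rw [← h]; simp)),
      ← h, h0]
  · rw [indicator_of_mem (show (r, η) ∈ Ioi (0 : ℝ) ×ˢ Ici (0 : ℝ) from ⟨h, hη⟩)]
    rfl

theorem extremes_of_isCompact_support {ν : Measure ℝ} [IsProbabilityMeasure ν]
    (h : IsCompact ν.support) : sInf ν.support ≤ sSup ν.support ∧ sInf ν.support ∈ ν.support ∧
      sSup ν.support ∈ ν.support ∧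
      ∀ᵐ r ∂ν, r ∈ Icc (sInf ν.support) (sSup ν.support) := by
  have hne : ν.support.Nonempty := Measure.nonempty_support (IsProbabilityMeasure.ne_zero ν)
  have hI := h.isLeast_sInf hne
  have hS := h.isGreatest_sSup hne
  refine ⟨hI.2 hS.1, hI.1, hS.1, ?_⟩
  filter_upwards [Measure.support_mem_ae (μ := ν)] with r hr using ⟨hI.2 hr, hS.2 hr⟩

end

end RadialShell

namespace RadialShell

noncomputable section

/-! ### Exponential stability for perturbations supported near the shell -/

variable {n : ℕ} {a b R : ℝ}

theorem pkernel_zero_left (n : ℕ) (a b η : ℝ) : pkernel n a b 0 η = 0 := kernel_zero_left n a b η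

theorem abs_sub_le_of_extremes {ν : Measure ℝ} [IsProbabilityMeasure ν] {r₁ r₂ R r : ℝ}
    (h : ∀ᵐ η ∂ν, η ∈ Icc r₁ r₂) (hr : r ∈ Icc r₁ r₂) :
    |r - R| ≤ (r₂ - r₁) + |(∫ η, η ∂ν) - R| := by
  have hΘ : ∫ η in (Icc r₁ r₂)ᶜ, (1 : ℝ) ∂ν ≤ 0 := by
    have h0 : ν (Icc r₁ r₂)ᶜ = 0 := h
    rw [Measure.restrict_eq_zero.2 h0]
    simp
  have := abs_sub_le_of_mean (ν := ν) (w := fun _ => (1 : ℝ)) (R := R)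
    (C₁ := |r₁ - R| + |r₂ - R|) (integrable_const _) (.of_forall fun _ => le_rfl) (by positivity)
    (by
      filter_upwards [h] with η hη
      rw [mul_one, abs_le]
      constructor
      · linarith [hη.1, neg_abs_le (r₁ - R), abs_nonneg (r₂ - R)]
      · linarith [hη.2, le_abs_self (r₂ - R), abs_nonneg (r₁ - R)]) hΘ hr
  simpa using this

/-- Dissipation at any rate below the critical one, for solutions supported near `∂B(0, R)`. -/
theorem exists_dissipation_extremes (hb : 1 - (n : ℝ) < b) (hab : b < a) (hR : 0 < R)
    (hRR : pkernel n a b R R = 0) {γ : ℝ}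
    (hγ : γ < -max (partial₁ (pkernel n a b) R R)
      (partial₁ (pkernel n a b) R R + partial₂ (pkernel n a b) R R)) :
    ∃ δ, 0 < δ ∧ ∀ μ : Measure (EuclideanSpace ℝ (Fin (n + 2))), IsProbabilityMeasure μ →
      (∀ r, 0 < r → Integrable (fun η => pkernel n a b r η) (radialPart μ)) →
      ∀ r₁ ∈ Icc (R - δ) (R + δ), ∀ r₂ ∈ Icc (R - δ) (R + δ), r₁ ≤ r₂ →
      (∀ᵐ r ∂(radialPart μ), r ∈ Icc r₁ r₂) →
        2 * (r₂ - r₁) * (radialVelocity (pkernel n a b) (radialPart μ) r₂ -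
          radialVelocity (pkernel n a b) (radialPart μ) r₁) +
          2 * ((∫ r, r ∂(radialPart μ)) - R) *
            (∫ r, radialVelocity (pkernel n a b) (radialPart μ) r ∂(radialPart μ)) ≤
        -(2 * γ) * ((r₂ - r₁) ^ 2 + ((∫ r, r ∂(radialPart μ)) - R) ^ 2) := by
  set ω := pkernel n a b with hω
  set A₁ := partial₁ ω R R with hA₁
  set A₂ := partial₂ ω R R with hA₂
  set γ₀ := -max A₁ (A₁ + A₂) with hγ₀
  have hb' : -(n : ℝ) < b := by linarith
  have hκ : 0 < (γ₀ - γ) * (2 / 3) := by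
    have : 0 < γ₀ - γ := by linarith
    positivity
  obtain ⟨δ, hδ, hδR, hlin⟩ :=
    exists_nearlyLinear (contDiffOn_pkernel hb hab) hR hκ (half_pos hR)
  have hpos : ∀ r ∈ Icc (R - δ) (R + δ), 0 < r := fun r hr => by linarith [hr.1]
  obtain ⟨C₀, hC₀⟩ := (isCompact_Icc.prod isCompact_Icc).exists_bound_of_continuousOn
    ((continuousOn_pkernel hb' hab).mono (prod_mono (fun r hr => hpos r hr)
      fun r hr => (hpos r hr).le) : ContinuousOn (Function.uncurry ω)
        (Icc (R - δ) (R + δ) ×ˢ Icc (R - δ) (R + δ)))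
  have hRm : R ∈ Icc (R - δ) (R + δ) := ⟨by linarith, by linarith⟩
  have hw : WeightBounds ω R (Icc (R - δ) (R + δ)) (fun _ => 1) C₀ δ := by
    refine ⟨fun r hr η hη => ?_, fun _ _ => le_rfl, fun r hr => ?_, ?_, hδ.le⟩
    · simpa using hC₀ (r, η) ⟨hr, hη⟩
    · rw [mul_one, abs_le]
      constructor <;> linarith [hr.1, hr.2]
    · exact (norm_nonneg _).trans (hC₀ (R, R) ⟨hRm, hRm⟩)
  obtain ⟨C, -, hC⟩ := exists_dissipation (W := 1) (γ := γ₀) hlin hRR hw hκ.le hδ.le subset_rfl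
    ⟨1, fun _ _ => le_rfl⟩ (by rw [hγ₀, neg_neg]; exact le_max_left _ _)
    (by rw [hγ₀, neg_neg]; exact le_max_right _ _)
  refine ⟨δ, hδ, fun μ hμ hv r₁ h₁ r₂ h₂ h12 hae => ?_⟩
  have := isProbabilityMeasure_radialPart hμ
  have hadm : AdmissibleMeasure ω (Icc (R - δ) (R + δ)) (fun _ => 1) (radialPart μ) := by
    refine ⟨?_, integrable_const _, fun r hr => hv r (hpos r hr), ?_⟩
    · filter_upwards [hae] with r hr using ⟨h₁.1.trans hr.1, hr.2.trans h₂.2⟩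
    · exact aestronglyMeasurable_radialVelocity (continuousOn_pkernel hb' hab)
        (pkernel_zero_left n a b) (ae_nonneg_radialPart μ)
  have hΘ : ∫ η in (Icc r₁ r₂)ᶜ, (1 : ℝ) ∂(radialPart μ) ≤ 0 := by
    have h0 : radialPart μ (Icc r₁ r₂)ᶜ = 0 := hae
    rw [Measure.restrict_eq_zero.2 h0]
    simp
  have h3 := hC _ this hadm (by simp) r₁ h₁ r₂ h₂ h12 0 hΘ
  have h4 : 2 * γ₀ - 3 * ((γ₀ - γ) * (2 / 3)) = 2 * γ := by ring
  rw [h4] at h3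
  linarith

theorem isExpStableShell_of_neg (hb : 1 - (n : ℝ) < b) (hab : b < a) (hR : 0 < R)
    (hRR : pkernel n a b R R = 0) (h₁ : partial₁ (pkernel n a b) R R < 0)
    (h₂ : partial₁ (pkernel n a b) R R + partial₂ (pkernel n a b) R R < 0) :
    IsExpStableShell (n + 2) (powerPotential (n + 2) a b) R := by
  set γ₀ := -max (partial₁ (pkernel n a b) R R)
      (partial₁ (pkernel n a b) R R + partial₂ (pkernel n a b) R R) with hγ₀
  have hγ₀pos : 0 < γ₀ := by
    rw [hγ₀, neg_pos]
    exact max_lt h₁ h₂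
  obtain ⟨δ, hδ, hdiss⟩ := exists_dissipation_extremes hb hab hR hRR
    (show γ₀ / 2 < γ₀ from half_lt_self hγ₀pos)
  refine ⟨δ / 6, by positivity, fun μ hμ hsupp γ hγ hγlt => ?_⟩
  have hcpt0 : IsCompact (radialPart (μ 0)).support :=
    isCompact_Icc.of_isClosed_subset Measure.isClosed_support hsupp
  obtain ⟨hcpt, hode₁, hode₂⟩ := hμ.extremes hcpt0
  set r₁ : ℝ → ℝ := fun t => sInf (radialPart (μ t)).support with hr₁
  set r₂ : ℝ → ℝ := fun t => sSup (radialPart (μ t)).support with hr₂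
  set m : ℝ → ℝ := fun t => ∫ r, r ∂(radialPart (μ t)) with hm
  set L : ℝ → ℝ := fun t => (r₂ t - r₁ t) ^ 2 + (m t - R) ^ 2 with hL
  have hode := (hode₂.sub hode₁).sq.add (hμ.mean.sub (SolvesODE.const R)).sq
  have hprob : ∀ t, 0 ≤ t → IsProbabilityMeasure (radialPart (μ t)) := fun t ht =>
    isProbabilityMeasure_radialPart (hμ.isProbabilityMeasure t ht)
  have hext : ∀ t, 0 ≤ t → r₁ t ≤ r₂ t ∧ r₁ t ∈ (radialPart (μ t)).support ∧
      r₂ t ∈ (radialPart (μ t)).support ∧ ∀ᵐ r ∂(radialPart (μ t)), r ∈ Icc (r₁ t) (r₂ t) :=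
    fun t ht => by
      have := hprob t ht
      exact extremes_of_isCompact_support (hcpt t ht)
  have hclose : ∀ t, 0 ≤ t → ∀ E, 0 ≤ E → L t ≤ (E / 2) ^ 2 → ∀ r ∈ Icc (r₁ t) (r₂ t),
      |r - R| ≤ E := by
    intro t ht E hE hLE r hr
    have := hprob t ht
    have h3 := abs_sub_le_of_extremes (R := R) (hext t ht).2.2.2 hr
    have h4 : r₂ t - r₁ t ≤ E / 2 := by
      refine le_of_sq_le_sq ?_ (by positivity)
      have := sq_nonneg (m t - R)
      simp only [hL] at hLE
      linarith
    have h5 : |m t - R| ≤ E / 2 := by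
      refine abs_le_of_sq_le_sq ?_ (by positivity)
      have := sq_nonneg (r₂ t - r₁ t)
      simp only [hL] at hLE
      linarith
    have h6 : |r - R| ≤ (r₂ t - r₁ t) + |m t - R| := h3
    linarith
  have hbound : ∀ γ' δ' : ℝ, 0 < δ' → (∀ μ : Measure (EuclideanSpace ℝ (Fin (n + 2))),
      IsProbabilityMeasure μ →
      (∀ r, 0 < r → Integrable (fun η => pkernel n a b r η) (radialPart μ)) →
      ∀ r₁ ∈ Icc (R - δ') (R + δ'), ∀ r₂ ∈ Icc (R - δ') (R + δ'), r₁ ≤ r₂ →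
      (∀ᵐ r ∂(radialPart μ), r ∈ Icc r₁ r₂) →
        2 * (r₂ - r₁) * (radialVelocity (pkernel n a b) (radialPart μ) r₂ -
          radialVelocity (pkernel n a b) (radialPart μ) r₁) +
          2 * ((∫ r, r ∂(radialPart μ)) - R) *
            (∫ r, radialVelocity (pkernel n a b) (radialPart μ) r ∂(radialPart μ)) ≤
        -(2 * γ') * ((r₂ - r₁) ^ 2 + ((∫ r, r ∂(radialPart μ)) - R) ^ 2)) →
      ∀ t, 0 ≤ t → L t < (δ' / 2) ^ 2 →
        2 * (r₂ t - r₁ t) * (radialVelocity (pkernel n a b) (radialPart (μ t)) (r₂ t) -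
          radialVelocity (pkernel n a b) (radialPart (μ t)) (r₁ t)) +
          2 * (m t - R) *
            ((∫ r, radialVelocity (pkernel n a b) (radialPart (μ t)) r ∂(radialPart (μ t))) - 0) ≤
        -(2 * γ') * L t + 0 := by
    intro γ' δ' hδ' hd t ht hLt
    have hc := hclose t ht δ' hδ'.le hLt.le
    have he := hext t ht
    have hmem : ∀ r ∈ Icc (r₁ t) (r₂ t), r ∈ Icc (R - δ') (R + δ') := fun r hr => by
      rw [← Real.closedBall_eq_Icc]; exact hc r hr
    have := hd (μ t) (hμ.isProbabilityMeasure t ht) (hμ.velocity_integrable t ht) (r₁ t)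
      (hmem _ ⟨le_rfl, he.1⟩) (r₂ t) (hmem _ ⟨he.1, le_rfl⟩) he.1 he.2.2.2
    rw [sub_zero, add_zero]
    exact this
  have hL0 : L 0 < (δ / 2) ^ 2 := by
    have he := hext 0 le_rfl
    have m1 := hsupp he.2.1
    have m2 := hsupp he.2.2.1
    have h3 : r₂ 0 - r₁ 0 ≤ 2 * (δ / 6) := by linarith [m1.1, m2.2]
    have := hprob 0 le_rfl
    have hmean : |m 0 - R| ≤ δ / 6 := by
      have hb1 : ∀ᵐ r ∂(radialPart (μ 0)), ‖r - R‖ ≤ δ / 6 := by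
        filter_upwards [he.2.2.2] with r hr
        rw [Real.norm_eq_abs, abs_le]
        constructor <;> linarith [m1.1, m2.2, hr.1, hr.2]
      have hi : Integrable (fun r : ℝ => r) (radialPart (μ 0)) := by
        refine integrable_id_of_weight (w := fun _ => 1) (R := R) (C₁ := δ / 6)
          (integrable_const _) ?_
        simpa using hb1
      have e1 : m 0 - R = ∫ r, (r - R) ∂(radialPart (μ 0)) := by
        rw [integral_sub hi (integrable_const R)]
        simp [hm]
      rw [e1]
      have := norm_integral_le_of_norm_le_const hb1
      simpa using this
    have h4 : (r₂ 0 - r₁ 0) ^ 2 ≤ (2 * (δ / 6)) ^ 2 := pow_le_pow_left₀ (by linarith [he.1]) h3 2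
    have h5 : (m 0 - R) ^ 2 ≤ (δ / 6) ^ 2 := sq_le_sq' (by linarith [(abs_le.1 hmean).1])
      (abs_le.1 hmean).2
    have h6 : 0 < δ ^ 2 := by positivity
    simp only [hL]
    nlinarith
  have hLt : ∀ t, 0 ≤ t → L t < (δ / 2) ^ 2 := fun t ht =>
    hode.lt_of_damped (c := 2 * (γ₀ / 2)) (d := 0) (by positivity) hL0 (by positivity)
      (fun τ hτ h => hbound (γ₀ / 2) δ hδ hdiss τ hτ h) ht
  have hdecay : ∀ t, 0 ≤ t → L t ≤ L 0 * Real.exp (-(2 * (γ₀ / 2)) * (t - 0)) := fun t ht => by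
    have := hode.gronwall (c := 2 * (γ₀ / 2)) (d := 0) le_rfl ht (by positivity)
      fun τ hτ => hbound (γ₀ / 2) δ hδ hdiss τ hτ.1.le (hLt τ hτ.1.le)
    simpa using this
  obtain ⟨δ', hδ', hdiss'⟩ := exists_dissipation_extremes hb hab hR hRR hγlt
  have htend : Tendsto (fun t => L 0 * Real.exp (-(2 * (γ₀ / 2)) * (t - 0))) atTop (𝓝 0) := by
    have h3 : Tendsto (fun t => Real.exp (-(2 * (γ₀ / 2)) * (t - 0))) atTop (𝓝 0) := by
      refine Real.tendsto_exp_atBot.comp ?_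
      simp only [sub_zero]
      exact tendsto_id.const_mul_atTop_of_neg (by linarith)
    simpa using h3.const_mul (L 0)
  obtain ⟨T, hT⟩ := eventually_atTop.1
    ((htend.eventually (gt_mem_nhds (show (0 : ℝ) < (δ' / 2) ^ 2 by positivity))).and
      (eventually_ge_atTop 0))
  have hT0 : 0 ≤ T := (hT T le_rfl).2
  have hfin : ∀ t, 0 ≤ t → L t ≤ (δ * Real.exp (γ * T) * Real.exp (-γ * t) / 2) ^ 2 := by
    have key : ∀ t, 0 ≤ t → L t ≤ (δ / 2) ^ 2 * Real.exp (-(2 * γ) * (t - T)) := by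
      intro t ht
      rcases le_total t T with h | h
      · have : 1 ≤ Real.exp (-(2 * γ) * (t - T)) := Real.one_le_exp (by nlinarith)
        have h3 := hLt t ht
        have : (δ / 2) ^ 2 ≤ (δ / 2) ^ 2 * Real.exp (-(2 * γ) * (t - T)) :=
          le_mul_of_one_le_right (by positivity) this
        linarith
      · have hg := hode.gronwall (c := 2 * γ) (d := 0) hT0 h (by positivity)
          fun τ hτ => hbound γ δ' hδ' hdiss' τ (hT0.trans hτ.1.le)
            ((hdecay τ (hT0.trans hτ.1.le)).trans_lt (hT τ hτ.1.le).1)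
        rw [zero_div, zero_mul, add_zero] at hg
        refine hg.trans ?_
        have := (hLt T hT0).le
        exact mul_le_mul_of_nonneg_right this (Real.exp_pos _).le
    intro t ht
    refine (key t ht).trans (le_of_eq ?_)
    have : Real.exp (-(2 * γ) * (t - T)) = (Real.exp (γ * T) * Real.exp (-γ * t)) ^ 2 := by
      rw [← Real.exp_add, ← Real.exp_nat_mul]
      congr 1
      push_cast
      ring
    rw [this]
    ring
  refine ⟨δ * Real.exp (γ * T), fun t ht => ?_⟩
  have := hprob t ht
  refine transportDist_dirac_le two_pos ?_
  filter_upwards [(hext t ht).2.2.2] with r hr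
  exact hclose t ht _ (by positivity) (hfin t ht) r hr

end

end RadialShell

namespace RadialShell

noncomputable section

/-! ### The pseudo-inverse of a distribution function -/

section PseudoInverse

variable {ν : Measure ℝ} [IsProbabilityMeasure ν]

theorem measure_Icc_zero (hν : ∀ᵐ r ∂ν, 0 ≤ r) (r : ℝ) :
    ν (Icc 0 r) = ENNReal.ofReal (ProbabilityTheory.cdf ν r) := by
  rw [ProbabilityTheory.ofReal_cdf]
  refine measure_congr ?_
  filter_upwards [hν] with x hx
  exact propext ⟨fun h => h.2, fun h => ⟨hx, h⟩⟩

theorem pseudoInverse_eq (hν : ∀ᵐ r ∂ν, 0 ≤ r) (ξ : ℝ) :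
    pseudoInverse ν ξ = sInf {r | 0 ≤ r ∧ ξ ≤ ProbabilityTheory.cdf ν r} := by
  rw [pseudoInverse]
  congr 1
  ext r
  simp only [mem_ofPred_eq, measure_Icc_zero hν,
    ENNReal.ofReal_le_ofReal_iff (ProbabilityTheory.cdf_nonneg ν r)]

theorem pseudoInverse_nonneg (ν : Measure ℝ) (ξ : ℝ) : 0 ≤ pseudoInverse ν ξ :=
  Real.sInf_nonneg fun _ hr => hr.1

theorem pseudoInverse_le_iff (hν : ∀ᵐ r ∂ν, 0 ≤ r) {ξ r : ℝ} (hξ : ξ < 1) (hr : 0 ≤ r) :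
    pseudoInverse ν ξ ≤ r ↔ ξ ≤ ProbabilityTheory.cdf ν r := by
  rw [pseudoInverse_eq hν]
  set A := {r | 0 ≤ r ∧ ξ ≤ ProbabilityTheory.cdf ν r} with hA
  have hbdd : BddBelow A := ⟨0, fun x hx => hx.1⟩
  refine ⟨fun h => ?_, fun h => csInf_le hbdd ⟨hr, h⟩⟩
  have hne : A.Nonempty := by
    have h1 := ((ProbabilityTheory.tendsto_cdf_atTop ν).eventually (lt_mem_nhds hξ)).and
      (eventually_ge_atTop 0)
    obtain ⟨x, hx1, hx2⟩ := h1.exists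
    exact ⟨x, hx2, hx1.le⟩
  have h2 : ∀ x, sInf A < x → ξ ≤ ProbabilityTheory.cdf ν x := by
    intro x hx
    obtain ⟨y, hy, hyx⟩ := exists_lt_of_csInf_lt hne hx
    exact hy.2.trans (ProbabilityTheory.monotone_cdf ν hyx.le)
  have h3 : Tendsto (ProbabilityTheory.cdf ν) (𝓝[>] r) (𝓝 (ProbabilityTheory.cdf ν r)) :=
    ((ProbabilityTheory.cdf ν).right_continuous r).mono_left
      (nhdsWithin_mono r Ioi_subset_Ici_self)
  refine ge_of_tendsto h3 ?_
  filter_upwards [self_mem_nhdsWithin] with x hx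
  exact h2 x (h.trans_lt hx)

theorem pseudoInverse_mono (hν : ∀ᵐ r ∂ν, 0 ≤ r) {ξ ξ' : ℝ} (h : ξ ≤ ξ') (hξ' : ξ' < 1) :
    pseudoInverse ν ξ ≤ pseudoInverse ν ξ' := by
  rw [pseudoInverse_le_iff hν (h.trans_lt hξ') (pseudoInverse_nonneg ν ξ')]
  exact h.trans ((pseudoInverse_le_iff hν hξ' (pseudoInverse_nonneg ν ξ')).1 le_rfl)

theorem pseudoInverse_pos (hν : ∀ᵐ r ∂ν, 0 ≤ r) (h0 : ν {0} = 0) {ξ : ℝ} (hξ : ξ ∈ Ioo (0 : ℝ) 1) :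
    0 < pseudoInverse ν ξ := by
  refine lt_of_le_of_ne (pseudoInverse_nonneg ν ξ) fun h => ?_
  have h1 := (pseudoInverse_le_iff hν hξ.2 le_rfl).1 h.symm.le
  have h2 := measure_Icc_zero hν 0
  rw [Icc_self, h0, eq_comm, ENNReal.ofReal_eq_zero] at h2
  linarith [hξ.1]

theorem aemeasurable_pseudoInverse (hν : ∀ᵐ r ∂ν, 0 ≤ r) :
    AEMeasurable (pseudoInverse ν) (volume.restrict (Ioo 0 1)) :=
  aemeasurable_restrict_of_monotoneOn measurableSet_Ioo
    fun _ _ _ hy hxy => pseudoInverse_mono hν hxy hy.2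

theorem map_pseudoInverse (hν : ∀ᵐ r ∂ν, 0 ≤ r) :
    (volume.restrict (Ioo (0 : ℝ) 1)).map (pseudoInverse ν) = ν := by
  have hm := aemeasurable_pseudoInverse hν
  have : IsFiniteMeasure ((volume.restrict (Ioo (0 : ℝ) 1)).map (pseudoInverse ν)) :=
    inferInstance
  refine Measure.ext_of_Iic _ _ fun r => ?_
  rw [Measure.map_apply_of_aemeasurable hm measurableSet_Iic]
  rcases lt_or_ge r 0 with hr | hr
  · have h1 : pseudoInverse ν ⁻¹' Iic r = ∅ := by
      ext ξ
      simp only [mem_preimage, mem_Iic, mem_empty_iff_false, iff_false, not_le]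
      exact hr.trans_le (pseudoInverse_nonneg ν ξ)
    have h2 : ν (Iic r) = 0 := by
      refine measure_mono_null (t := {x | ¬ 0 ≤ x}) (fun x hx => ?_) hν
      exact not_le.2 (lt_of_le_of_lt hx hr)
    rw [h1, h2, measure_empty]
  · rw [← ProbabilityTheory.ofReal_cdf ν r]
    set c := ProbabilityTheory.cdf ν r with hc
    have h1 : volume.restrict (Ioo (0 : ℝ) 1) (pseudoInverse ν ⁻¹' Iic r) =
        volume.restrict (Ioo (0 : ℝ) 1) (Iic c) := by
      refine measure_congr ?_
      filter_upwards [ae_restrict_mem measurableSet_Ioo] with ξ hξ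
      exact propext (pseudoInverse_le_iff hν hξ.2 hr)
    have hc0 : 0 ≤ c := ProbabilityTheory.cdf_nonneg ν r
    have hc1 : c ≤ 1 := ProbabilityTheory.cdf_le_one ν r
    rw [h1, Measure.restrict_congr_set Ioo_ae_eq_Ioc, Measure.restrict_apply measurableSet_Iic]
    have h2 : Iic c ∩ Ioc (0 : ℝ) 1 = Ioc 0 c := by
      ext x
      simp only [mem_inter_iff, mem_Iic, mem_Ioc]
      constructor
      · exact fun h => ⟨h.2.1, h.1⟩
      · exact fun h => ⟨h.2, h.1, h.2.trans hc1⟩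
    rw [h2, Real.volume_Ioc, sub_zero]

end PseudoInverse

/-! ### Velocity bounds under confinement -/

theorem exists_uniform_near {ω : ℝ → ℝ → ℝ}
    (hω : ContinuousOn (Function.uncurry ω) (Ioi 0 ×ˢ Ici 0)) {R x y ε : ℝ} (hR : 0 < R)
    (hx : 0 < x) (hε : 0 < ε) :
    ∃ δ, 0 < δ ∧ ∀ r ∈ Icc x y, ∀ η ∈ Icc (R - δ) (R + δ), |ω r η - ω r R| < ε := by
  have hsub : Icc x y ×ˢ Icc 0 (2 * R) ⊆ Ioi (0 : ℝ) ×ˢ Ici (0 : ℝ) :=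
    prod_mono (fun r hr => hx.trans_le hr.1) fun r hr => hr.1
  have huc := (isCompact_Icc.prod isCompact_Icc).uniformContinuousOn_of_continuous (hω.mono hsub)
  obtain ⟨δ, hδ, hδ'⟩ := Metric.uniformContinuousOn_iff.1 huc ε hε
  refine ⟨min (δ / 2) R, by positivity, fun r hr η hη => ?_⟩
  have h1 := min_le_left (δ / 2) R
  have h2 := min_le_right (δ / 2) R
  have := hδ' (r, η) ⟨hr, by linarith [hη.1], by linarith [hη.2]⟩ (r, R)
    ⟨hr, hR.le, by linarith⟩ (by
      rw [Prod.dist_eq, dist_self, Real.dist_eq, max_eq_right (abs_nonneg _), abs_lt]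
      constructor <;> linarith [hη.1, hη.2])
  rwa [Real.dist_eq] at this

variable {n : ℕ} {a b R : ℝ}

theorem exists_mul_le_pkernel (hb : -(n : ℝ) < b) (hab : b < a) (hR : 0 < R)
    (hin : ∀ r ∈ Ioo 0 R, 0 < pkernel n a b r R) (h0 : 0 < partial₁ (pkernel n a b) 0 R) {δ : ℝ}
    (hδ : 0 < δ) :
    ∃ c δ₀, 0 < c ∧ 0 < δ₀ ∧ ∀ r ∈ Icc 0 (R - δ), ∀ η ∈ Icc (R - δ₀) (R + δ₀),
      c * r ≤ pkernel n a b r η := by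
  set ω := pkernel n a b with hω
  have hne : |(0 : ℝ)| ≠ |R| := by rw [abs_zero, abs_of_pos hR]; exact hR.ne
  have hc : ContDiffAt ℝ 1 (Function.uncurry ω) (0, R) :=
    (dominated_of_abs_ne hne).contDiffAt_pkernel (dominated_of_abs_ne hne)
  have hs := hc.hasStrictFDerivAt (by simp)
  have hpart : fderiv ℝ (Function.uncurry ω) (0, R) (1, 0) = partial₁ ω 0 R := by
    have hcurve : HasDerivAt (fun s : ℝ => (s, R)) ((1 : ℝ), (0 : ℝ)) 0 :=
      (hasDerivAt_id 0).prodMk (hasDerivAt_const 0 R)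
    exact (hs.hasFDerivAt.comp_hasDerivAt 0 hcurve).deriv.symm
  set A := partial₁ ω 0 R with hA
  have h1 := hs.isLittleO.def (half_pos h0)
  rw [nhds_prod_eq] at h1
  obtain ⟨t, ht, h2⟩ := eventually_prod_self_iff'.1 h1
  obtain ⟨s, hspos, hball⟩ := Metric.nhds_basis_closedBall.mem_iff.1 ht
  have hnear : ∀ r ∈ Icc 0 s, ∀ η ∈ Icc (R - s) (R + s), A / 2 * r ≤ ω r η := by
    intro r hr η hη
    have hηs : |η - R| ≤ s := by
      rw [abs_le]
      constructor <;> linarith [hη.1, hη.2]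
    have h3 := h2 (r, η) (hball (by
      rw [Metric.mem_closedBall, Prod.dist_eq, Real.dist_eq, Real.dist_eq, sub_zero,
        abs_of_nonneg hr.1]
      exact max_le hr.2 hηs)) (0, η) (hball (by
      rw [Metric.mem_closedBall, Prod.dist_eq, Real.dist_eq, Real.dist_eq, sub_zero, abs_zero]
      exact max_le hspos.le hηs))
    have e1 : ((r, η) - (0, η) : ℝ × ℝ) = r • ((1 : ℝ), (0 : ℝ)) := by ext <;> simp
    have e2 : ‖r • ((1 : ℝ), (0 : ℝ))‖ = r := by
      simp [Prod.norm_def, abs_of_nonneg hr.1, hr.1]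
    simp only [e1, map_smul, hpart, e2] at h3
    have h4 : Function.uncurry ω (0, η) = 0 := pkernel_zero_left n a b η
    rw [h4, Real.norm_eq_abs] at h3
    have h5 := (abs_le.1 h3).1
    have h6 : Function.uncurry ω (r, η) = ω r η := rfl
    rw [h6, smul_eq_mul] at h5
    linarith
  rcases le_or_gt (R - δ) s with hle | hlt
  · refine ⟨A / 2, s, half_pos h0, hspos, fun r hr η hη => hnear r ⟨hr.1, hr.2.trans hle⟩ η hη⟩
  have hcont : ContinuousOn (fun r => ω r R) (Icc s (R - δ)) :=
    (continuousOn_pkernel hb hab).comp (f := fun r : ℝ => (r, R)) (by fun_prop)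
      fun r hr => ⟨hspos.trans_le hr.1, hR.le⟩
  obtain ⟨r₀, hr₀, hmin⟩ := isCompact_Icc.exists_isMinOn ⟨s, le_rfl, hlt.le⟩ hcont
  have hm : 0 < ω r₀ R := hin r₀ ⟨hspos.trans_le hr₀.1, by linarith [hr₀.2]⟩
  obtain ⟨δ₁, hδ₁, hunif⟩ := exists_uniform_near (continuousOn_pkernel hb hab) (y := R - δ) hR hspos
    (half_pos hm)
  refine ⟨min (A / 2) (ω r₀ R / 2 / R), min s δ₁, by positivity, by positivity,
    fun r hr η hη => ?_⟩
  have hη1 : η ∈ Icc (R - s) (R + s) :=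
    ⟨by linarith [hη.1, min_le_left s δ₁], by linarith [hη.2, min_le_left s δ₁]⟩
  have hη2 : η ∈ Icc (R - δ₁) (R + δ₁) :=
    ⟨by linarith [hη.1, min_le_right s δ₁], by linarith [hη.2, min_le_right s δ₁]⟩
  rcases le_or_gt r s with h | h
  · exact (mul_le_mul_of_nonneg_right (min_le_left _ _) hr.1).trans (hnear r ⟨hr.1, h⟩ η hη1)
  · have hrm : r ∈ Icc s (R - δ) := ⟨h.le, hr.2⟩
    have h3 := (abs_lt.1 (hunif r hrm η hη2)).1
    have h4 : ω r₀ R ≤ ω r R := hmin hrm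
    have h5 : min (A / 2) (ω r₀ R / 2 / R) * r ≤ ω r₀ R / 2 / R * R :=
      mul_le_mul (min_le_right _ _) (by linarith [hr.2]) hr.1 (by positivity)
    rw [div_mul_cancel₀ _ hR.ne'] at h5
    have h6 : ω r R - ω r₀ R / 2 < pkernel n a b r η := by linarith
    linarith

theorem exists_pkernel_le_neg (hb : -(n : ℝ) < b) (hab : b < a) (hR : 0 < R) {α lam : ℝ}
    (hα : 1 ≤ α) (hlam : 0 < lam) (hctl : ConfinementControls (pkernel n a b) R α lam) {δ : ℝ}
    (hδ : 0 < δ) :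
    ∃ c δ₀, 0 < c ∧ 0 < δ₀ ∧ ∀ r, R + δ ≤ r → ∀ η ∈ Icc (R - δ₀) (R + δ₀),
      pkernel n a b r η ≤ -c := by
  set ω := pkernel n a b with hω
  set K := max (R + δ) (max 1 ((1 / lam + 1) / lam)) with hK
  have hcont : ContinuousOn (fun r => ω r R) (Icc (R + δ) K) :=
    (continuousOn_pkernel hb hab).comp (f := fun r : ℝ => (r, R)) (by fun_prop)
      fun r hr => ⟨lt_of_lt_of_le (by linarith) hr.1, hR.le⟩
  obtain ⟨r₀, hr₀, hmax⟩ := isCompact_Icc.exists_isMaxOn ⟨R + δ, le_rfl, le_max_left _ _⟩ hcont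
  have hm : ω r₀ R < 0 := hctl.outside r₀ (show R < r₀ by linarith [hr₀.1])
  obtain ⟨δ₁, hδ₁, hunif⟩ := exists_uniform_near (continuousOn_pkernel hb hab) (x := R + δ) (y := K)
    hR (by linarith) (show 0 < -ω r₀ R / 2 by linarith)
  refine ⟨min 1 (-ω r₀ R / 2), min (min δ₁ lam) (R / 2), lt_min one_pos (by linarith),
    by positivity, fun r hr η hη => ?_⟩
  have m1 : min (min δ₁ lam) (R / 2) ≤ δ₁ := (min_le_left _ _).trans (min_le_left _ _)
  have m2 : min (min δ₁ lam) (R / 2) ≤ lam := (min_le_left _ _).trans (min_le_right _ _)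
  have m3 : min (min δ₁ lam) (R / 2) ≤ R / 2 := min_le_right _ _
  rcases le_or_gt r K with h | h
  · have hrm : r ∈ Icc (R + δ) K := ⟨hr, h⟩
    have h3 := (abs_lt.1 (hunif r hrm η ⟨by linarith [hη.1], by linarith [hη.2]⟩)).2
    have h4 : ω r R ≤ ω r₀ R := hmax hrm
    have h5 := min_le_right 1 (-ω r₀ R / 2)
    have h6 : pkernel n a b r η < ω r R + -ω r₀ R / 2 := by linarith
    linarith
  · have hr1 : 1 ≤ r := ((le_max_left _ _).trans (le_max_right _ _)).trans h.le
    have hr2 : (1 / lam + 1) / lam ≤ r := ((le_max_right _ _).trans (le_max_right _ _)).trans h.le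
    have h3 := hctl.upper r (by linarith) η (by linarith [hη.1])
      ⟨by linarith [hη.1], by linarith [hη.2]⟩
    have h4 : r ≤ r ^ α := by
      have := Real.rpow_le_rpow_of_exponent_le hr1 hα
      rwa [Real.rpow_one] at this
    rw [div_le_iff₀ hlam] at hr2
    have h5 := min_le_left 1 (-ω r₀ R / 2)
    have h6 : lam * r ≤ lam * r ^ α := mul_le_mul_of_nonneg_left h4 hlam.le
    have h7 : pkernel n a b r η ≤ 1 / lam - lam * r ^ α := h3
    linarith

theorem abs_le_weight_of_pos {ω : ℝ → ℝ → ℝ}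
    (hω : ContinuousOn (Function.uncurry ω) (Ioi 0 ×ˢ Ici 0)) {α B r : ℝ} (hα : 0 < α) (hr : 0 < r)
    (h : ∀ η, 0 < η → |ω r η| ≤ B * (1 + η ^ α)) {η : ℝ} (hη : 0 ≤ η) :
    |ω r η| ≤ B * (1 + η ^ α) := by
  rcases hη.eq_or_lt with h0 | h0
  · subst h0
    have h1 : ContinuousWithinAt (fun η => ω r η) (Ici 0) 0 :=
      (hω.comp (f := fun η : ℝ => (r, η)) (by fun_prop) (s := Ici 0)
        fun η hη => ⟨hr, hη⟩) 0 self_mem_Ici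
    have h2 : Tendsto (fun η => |ω r η|) (𝓝[>] 0) (𝓝 |ω r 0|) :=
      (h1.mono Ioi_subset_Ici_self).abs
    have h3 : Tendsto (fun η : ℝ => B * (1 + η ^ α)) (𝓝[>] 0) (𝓝 (B * (1 + 0 ^ α))) :=
      (((Real.continuousAt_rpow_const 0 α (Or.inr hα.le)).tendsto.const_add 1).const_mul
        B).mono_left nhdsWithin_le_nhds
    refine le_of_tendsto_of_tendsto h2 h3 ?_
    filter_upwards [self_mem_nhdsWithin] with η hη using h η hη
  · exact h η h0

theorem weightBounds_of_controls (hb : -(n : ℝ) < b) (hab : b < a) (hR : 0 < R) {α lam : ℝ}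
    (hα : 1 ≤ α) (hlam : 0 < lam) (hctl : ConfinementControls (pkernel n a b) R α lam) :
    WeightBounds (pkernel n a b) R (Ici 0) (fun r => 1 + r ^ α) (1 / lam) (1 + R) := by
  refine ⟨fun r hr η hη => ?_, fun r hr => ?_, fun r hr => ?_, by positivity, by positivity⟩
  · rw [← mul_assoc]
    rcases (show (0 : ℝ) ≤ r from hr).eq_or_lt with h | h
    · subst h
      rw [pkernel_zero_left, abs_zero]
      have : 0 ≤ η ^ α := Real.rpow_nonneg hη α
      have : (0 : ℝ) ≤ 0 ^ α := Real.rpow_nonneg le_rfl α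
      positivity
    · exact abs_le_weight_of_pos (continuousOn_pkernel hb hab) (by linarith) h
        (fun η hη => hctl.growth r h η hη) hη
  · have : 0 ≤ r ^ α := Real.rpow_nonneg hr α
    linarith
  · have hr0 : (0 : ℝ) ≤ r := hr
    have h1 : r ≤ 1 + r ^ α := by
      rcases le_total r 1 with h | h
      · have : 0 ≤ r ^ α := Real.rpow_nonneg hr α
        linarith
      · have := Real.rpow_le_rpow_of_exponent_le h hα
        rw [Real.rpow_one] at this
        linarith
    have h2 : 0 ≤ r ^ α := Real.rpow_nonneg hr α
    have h3 : 0 ≤ R * r ^ α := by positivity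
    rw [abs_le]
    constructor <;> linarith

theorem exists_abs_pkernel_le_mul (hb : 1 - (n : ℝ) < b) (hab : b < a) (hR : 0 < R) {α lam : ℝ}
    (hα : 1 ≤ α) (hlam : 0 < lam) (hctl : ConfinementControls (pkernel n a b) R α lam) :
    ∃ C, 0 ≤ C ∧ ∀ r ∈ Ioc 0 R, ∀ η, 0 ≤ η → |pkernel n a b r η| ≤ C * r * (1 + η ^ α) := by
  have hb' : -(n : ℝ) < b := by linarith
  set C := max (1 / lam) (1 / lam * (1 + R ^ α) / lam) with hC
  have hC0 : 0 ≤ C := le_max_of_le_left (by positivity)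
  refine ⟨C, hC0, fun r hr η hη => ?_⟩
  refine abs_le_weight_of_pos (continuousOn_pkernel hb' hab) (by linarith) hr.1 (fun η hη => ?_) hη
  have hw : 0 ≤ 1 + η ^ α := by positivity
  rcases le_or_gt r lam with h | h
  · have hne : |(0 : ℝ)| ≠ |η| := by rw [abs_zero, abs_of_pos hη]; exact hη.ne
    have hd : ∀ s, 0 ≤ s → DifferentiableAt ℝ (fun s => pkernel n a b s η) s := by
      intro s hs
      rcases hs.eq_or_lt with h0 | h0
      · subst h0
        exact ((dominated_of_abs_ne hne).hasDerivAt_pkernel_left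
          (dominated_of_abs_ne hne)).differentiableAt
      · exact (hasDerivAt_fst_of_contDiffOn (contDiffOn_pkernel hb hab) h0 hη).differentiableAt
    obtain ⟨s, hs, hs'⟩ := exists_deriv_eq_slope (fun s => pkernel n a b s η) hr.1
      (fun s hs => (hd s hs.1).continuousAt.continuousWithinAt)
      fun s hs => (hd s hs.1.le).differentiableWithinAt
    rw [pkernel_zero_left, sub_zero, sub_zero, eq_div_iff hr.1.ne'] at hs'
    have h1 := hctl.derivative s ⟨hs.1, hs.2.le.trans h⟩ η hη
    rw [partial₁] at h1
    rw [← hs', abs_mul, abs_of_pos hr.1]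
    calc _ ≤ 1 / lam * (1 + η ^ α) * r := mul_le_mul_of_nonneg_right h1 hr.1.le
      _ = 1 / lam * (r * (1 + η ^ α)) := by ring
      _ ≤ C * (r * (1 + η ^ α)) :=
        mul_le_mul_of_nonneg_right (le_max_left _ _) (mul_nonneg hr.1.le hw)
      _ = _ := by ring
  · have h1 := hctl.growth r hr.1 η hη
    refine h1.trans (mul_le_mul_of_nonneg_right ?_ hw)
    have h2 : r ^ α ≤ R ^ α := Real.rpow_le_rpow hr.1.le hr.2 (by linarith)
    have h3 : 1 ≤ r / lam := (one_le_div hlam).2 h.le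
    calc 1 / lam * (1 + r ^ α) ≤ 1 / lam * (1 + R ^ α) := by gcongr
      _ ≤ 1 / lam * (1 + R ^ α) * (r / lam) := by
        refine le_mul_of_one_le_right ?_ h3
        have : 0 ≤ R ^ α := Real.rpow_nonneg hR.le α
        positivity
      _ = 1 / lam * (1 + R ^ α) / lam * r := by ring
      _ ≤ C * r := mul_le_mul_of_nonneg_right (le_max_right _ _) hr.1.le

/-- Measures concentrated near `R` push particles towards `R`. -/
theorem exists_confining_velocity (hb : 1 - (n : ℝ) < b) (hab : b < a) (hR : 0 < R) {α lam : ℝ}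
    (hα : 1 ≤ α) (hlam : 0 < lam) (hctl : ConfinementControls (pkernel n a b) R α lam) {δ : ℝ}
    (hδ : 0 < δ) :
    ∃ c δ₀ Θ₀, 0 < c ∧ 0 < δ₀ ∧ 0 < Θ₀ ∧ ∀ ν : Measure ℝ, IsProbabilityMeasure ν →
      AdmissibleMeasure (pkernel n a b) (Ici 0) (fun r => 1 + r ^ α) ν →
      ∀ r₁ r₂, R - δ₀ ≤ r₁ → r₂ ≤ R + δ₀ → ∫ η in (Icc r₁ r₂)ᶜ, (1 + η ^ α) ∂ν ≤ Θ₀ →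
        (∀ r ∈ Icc 0 (R - δ), c * r ≤ radialVelocity (pkernel n a b) ν r) ∧
        ∀ r, R + δ ≤ r → radialVelocity (pkernel n a b) ν r ≤ -c := by
  have hb' : -(n : ℝ) < b := by linarith
  obtain ⟨c₁, δ₁, hc₁, hδ₁, hlow⟩ := exists_mul_le_pkernel hb' hab hR hctl.inside hctl.origin hδ
  obtain ⟨c₂, δ₂, hc₂, hδ₂, hupp⟩ := exists_pkernel_le_neg hb' hab hR hα hlam hctl hδ
  obtain ⟨C, hC, hlin⟩ := exists_abs_pkernel_le_mul hb hab hR hα hlam hctl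
  obtain ⟨K, hK, hneg⟩ := exists_pkernel_nonpos hb' hab
  have hw := weightBounds_of_controls hb' hab hR hα hlam hctl
  set C' := c₂ + 1 / lam * (1 + K ^ α) with hC'
  have hKα : 0 ≤ K ^ α := Real.rpow_nonneg hK.le α
  have hC'0 : 0 < C' := by positivity
  refine ⟨min (c₁ / 2) (c₂ / 2), min δ₁ δ₂, min (c₁ / (2 * (C + c₁))) (c₂ / (2 * C')),
    by positivity, by positivity, by positivity, ?_⟩
  intro ν _ hν r₁ r₂ h₁ h₂ hΘ
  have hJ₁ : ∀ η ∈ Icc r₁ r₂, η ∈ Icc (R - δ₁) (R + δ₁) := fun η hη =>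
    ⟨by linarith [hη.1, min_le_left δ₁ δ₂], by linarith [hη.2, min_le_left δ₁ δ₂]⟩
  have hJ₂ : ∀ η ∈ Icc r₁ r₂, η ∈ Icc (R - δ₂) (R + δ₂) := fun η hη =>
    ⟨by linarith [hη.1, min_le_right δ₁ δ₂], by linarith [hη.2, min_le_right δ₁ δ₂]⟩
  constructor
  · intro r hr
    rcases hr.1.eq_or_lt with h0 | h0
    · subst h0
      simp [radialVelocity, pkernel_zero_left]
    have h3 : ∫ η, -pkernel n a b r η ∂ν ≤ -(c₁ * r) + (C + c₁) * r * (c₁ / (2 * (C + c₁))) := by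
      refine integral_le_of_le_add_indicator (J := Icc r₁ r₂) measurableSet_Icc
        (mul_nonneg (by positivity) h0.le) hν.weight (hν.velocity r hr.1).neg
        (hΘ.trans (min_le_left _ _)) ?_
      filter_upwards [hν.ae_mem] with η hη
      by_cases hηJ : η ∈ Icc r₁ r₂
      · rw [indicator_of_notMem (by simpa using hηJ), mul_zero, add_zero]
        exact neg_le_neg (hlow r hr η (hJ₁ η hηJ))
      · rw [indicator_of_mem (by simpa using hηJ)]
        have h4 := (abs_le.1 (hlin r ⟨h0, by linarith [hr.2]⟩ η hη)).1
        have h5 : c₁ * r ≤ c₁ * r * (1 + η ^ α) :=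
          le_mul_of_one_le_right (by positivity) (hw.one_le η hη)
        linarith
    rw [integral_neg] at h3
    have h4 : (C + c₁) * r * (c₁ / (2 * (C + c₁))) = c₁ / 2 * r := by
      field_simp
    rw [h4] at h3
    have h5 := mul_le_mul_of_nonneg_right (min_le_left (c₁ / 2) (c₂ / 2)) h0.le
    have h6 : radialVelocity (pkernel n a b) ν r = ∫ η, pkernel n a b r η ∂ν := rfl
    rw [h6]
    linarith
  · intro r hr
    have hr0 : 0 < r := by linarith
    have h3 : ∫ η, pkernel n a b r η ∂ν ≤ -c₂ + C' * (c₂ / (2 * C')) := by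
      refine integral_le_of_le_add_indicator (J := Icc r₁ r₂) measurableSet_Icc hC'0.le hν.weight
        (hν.velocity r hr0.le) (hΘ.trans (min_le_right _ _)) ?_
      filter_upwards [hν.ae_mem] with η hη
      by_cases hηJ : η ∈ Icc r₁ r₂
      · rw [indicator_of_notMem (by simpa using hηJ), mul_zero, add_zero]
        exact hupp r hr η (hJ₂ η hηJ)
      · rw [indicator_of_mem (by simpa using hηJ)]
        have hwη : 1 ≤ 1 + η ^ α := hw.one_le η hη
        have h5 : c₂ ≤ c₂ * (1 + η ^ α) := le_mul_of_one_le_right hc₂.le hwη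
        have h6 : 0 ≤ 1 / lam * (1 + K ^ α) * (1 + η ^ α) := by positivity
        rcases le_total K r with h | h
        · have := hneg r h η hη
          rw [hC', add_mul]
          linarith
        · have h7 := (abs_le.1 (hw.growth r hr0.le η hη)).2
          have h8 : r ^ α ≤ K ^ α := Real.rpow_le_rpow hr0.le h (by linarith)
          have h9 : 1 / lam * ((1 + r ^ α) * (1 + η ^ α)) ≤
              1 / lam * ((1 + K ^ α) * (1 + η ^ α)) := by gcongr
          rw [hC', add_mul]
          linarith
    have h4 : C' * (c₂ / (2 * C')) = c₂ / 2 := by field_simp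
    rw [h4] at h3
    have h5 := min_le_right (c₁ / 2) (c₂ / 2)
    have h6 : radialVelocity (pkernel n a b) ν r = ∫ η, pkernel n a b r η ∂ν := rfl
    rw [h6]
    linarith

end

end RadialShell

namespace RadialShell

noncomputable section

/-! ### Stability for perturbations with tails -/

theorem measurable_weight (α : ℝ) : Measurable fun r : ℝ => 1 + r ^ α :=
  measurable_const.add (measurable_id.pow_const α)

theorem measurable_abs_sub_rpow (R α : ℝ) : Measurable fun r : ℝ => |r - R| ^ α :=
  (measurable_id.sub_const R).abs.pow_const α

theorem lintegral_edist_rpow {X : Type*} [MeasurableSpace X] (ν : Measure X) (f : X → ℝ)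
    {R α : ℝ} (hα : 0 ≤ α) :
    ∫⁻ x, edist (f x) R ^ α ∂ν = ∫⁻ x, ENNReal.ofReal (|f x - R| ^ α) ∂ν := by
  refine lintegral_congr fun r => ?_
  rw [edist_dist, Real.dist_eq, ENNReal.ofReal_rpow_of_nonneg (abs_nonneg _) hα]

theorem moment_lt_of_transportDist_lt {ν : Measure ℝ} [IsProbabilityMeasure ν] {R α ε : ℝ}
    (hα : 0 < α) (hε : 0 < ε)
    (h : transportDist α ν (Measure.dirac R) < ENNReal.ofReal (ε ^ (1 / α))) :
    Integrable (fun r => |r - R| ^ α) ν ∧ ∫ r, |r - R| ^ α ∂ν < ε := by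
  have h0 : ∀ r : ℝ, 0 ≤ |r - R| ^ α := fun r => Real.rpow_nonneg (abs_nonneg _) α
  rw [transportDist_dirac, ← ENNReal.ofReal_rpow_of_pos hε,
    ENNReal.rpow_lt_rpow_iff (by positivity), lintegral_edist_rpow ν (fun r => r) hα.le] at h
  have hm : AEStronglyMeasurable (fun r : ℝ => |r - R| ^ α) ν :=
    (measurable_abs_sub_rpow R α).aestronglyMeasurable
  refine ⟨⟨hm, ?_⟩, ?_⟩
  · rw [hasFiniteIntegral_iff_ofReal (.of_forall h0)]
    exact h.trans ENNReal.ofReal_lt_top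
  · rw [integral_eq_lintegral_of_nonneg_ae (.of_forall h0) hm]
    exact (ENNReal.lt_ofReal_iff_toReal_lt (h.trans ENNReal.ofReal_lt_top).ne).1 h

theorem weight_le_of_le_max {φ φ₀ K R α : ℝ} (hα : 0 ≤ α) (hφ : 0 ≤ φ)
    (hK : 2 * R ≤ K) (hK0 : 0 ≤ K) (h : φ ≤ max φ₀ K) :
    1 + φ ^ α ≤ (1 + K ^ α) + 2 ^ α * |φ₀ - R| ^ α := by
  have h1 : 0 ≤ 2 ^ α * |φ₀ - R| ^ α := by positivity
  rcases le_total φ₀ K with hc | hc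
  · rw [max_eq_right hc] at h
    have := Real.rpow_le_rpow hφ h hα
    linarith
  · rw [max_eq_left hc] at h
    have h2 : φ ≤ 2 * |φ₀ - R| := by linarith [le_abs_self (φ₀ - R)]
    have h3 := Real.rpow_le_rpow hφ h2 hα
    rw [Real.mul_rpow two_pos.le (abs_nonneg _)] at h3
    have h4 : 0 ≤ K ^ α := Real.rpow_nonneg hK0 α
    linarith

/-- Weighted mass of a measure, and of its tails, in terms of the pseudo-inverse. -/
theorem weight_of_pseudoInverse {ν : Measure ℝ} [IsProbabilityMeasure ν] (hν : ∀ᵐ r ∂ν, 0 ≤ r)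
    {α : ℝ} {g : ℝ → ℝ} (hgi : IntegrableOn g (Ioo 0 1))
    (hg : ∀ ξ ∈ Ioo (0 : ℝ) 1, 1 + pseudoInverse ν ξ ^ α ≤ g ξ) :
    Integrable (fun r => 1 + r ^ α) ν ∧ ∫ r, (1 + r ^ α) ∂ν ≤ ∫ ξ in Ioo (0 : ℝ) 1, g ξ ∧
      ∀ ρ ∈ Ioo (0 : ℝ) (1 / 2),
        ∫ r in (Icc (pseudoInverse ν ρ) (pseudoInverse ν (1 - ρ)))ᶜ, (1 + r ^ α) ∂ν ≤
          ∫ ξ in Ioo (0 : ℝ) 1 ∩ (Icc ρ (1 - ρ))ᶜ, g ξ := by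
  have hm := aemeasurable_pseudoInverse hν
  have hw0 : ∀ ξ, 0 ≤ 1 + pseudoInverse ν ξ ^ α := fun ξ => by
    have := Real.rpow_nonneg (pseudoInverse_nonneg ν ξ) α
    linarith
  have hwi : IntegrableOn (fun ξ => 1 + pseudoInverse ν ξ ^ α) (Ioo 0 1) := by
    refine Integrable.mono' hgi
      ((measurable_weight α).comp_aemeasurable hm).aestronglyMeasurable ?_
    filter_upwards [ae_restrict_mem measurableSet_Ioo] with ξ hξ
    rw [Real.norm_of_nonneg (hw0 ξ)]
    exact hg ξ hξ
  have hmap := map_pseudoInverse hν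
  have hval : ∀ f : ℝ → ℝ, Measurable f →
      ∫ r, f r ∂ν = ∫ ξ in Ioo (0 : ℝ) 1, f (pseudoInverse ν ξ) := by
    intro f hf
    conv_lhs => rw [← hmap]
    exact integral_map hm hf.aestronglyMeasurable
  refine ⟨?_, ?_, fun ρ hρ => ?_⟩
  · rw [← hmap]
    exact (integrable_map_measure (measurable_weight α).aestronglyMeasurable hm).2 hwi
  · rw [hval _ (measurable_weight α)]
    refine integral_mono_ae hwi hgi ?_
    filter_upwards [ae_restrict_mem measurableSet_Ioo] with ξ hξ using hg ξ hξ
  · have hind : ∀ (J : Set ℝ) (ξ : ℝ), 0 ≤ J.indicator (fun r => 1 + r ^ α) (pseudoInverse ν ξ) ∧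
        J.indicator (fun r => 1 + r ^ α) (pseudoInverse ν ξ) ≤ 1 + pseudoInverse ν ξ ^ α := by
      intro J ξ
      by_cases h : pseudoInverse ν ξ ∈ J
      · rw [indicator_of_mem h]
        exact ⟨hw0 ξ, le_rfl⟩
      · rw [indicator_of_notMem h]
        exact ⟨le_rfl, hw0 ξ⟩
    rw [← integral_indicator measurableSet_Icc.compl, hval _
      ((measurable_weight α).indicator measurableSet_Icc.compl),
      ← setIntegral_indicator measurableSet_Icc.compl]
    refine integral_mono_of_nonneg (.of_forall fun ξ => (hind _ ξ).1)
      (hgi.indicator measurableSet_Icc.compl) ?_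
    · filter_upwards [ae_restrict_mem measurableSet_Ioo] with ξ hξ
      by_cases h : ξ ∈ Icc ρ (1 - ρ)
      · have hmem : pseudoInverse ν ξ ∈ Icc (pseudoInverse ν ρ) (pseudoInverse ν (1 - ρ)) :=
          ⟨pseudoInverse_mono hν h.1 hξ.2, pseudoInverse_mono hν h.2 (by linarith [hρ.1])⟩
        rw [indicator_of_notMem (not_not.2 hmem), indicator_of_notMem (not_not.2 h)]
      · rw [indicator_of_mem (show ξ ∈ (Icc ρ (1 - ρ))ᶜ from h)]
        exact (hind _ ξ).2.trans (hg ξ hξ)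

theorem setIntegral_tail_le {f : ℝ → ℝ} (hfi : IntegrableOn f (Ioo 0 1)) (hf : ∀ ξ, 0 ≤ f ξ)
    {A B ρ : ℝ} (hA : 0 ≤ A) (hB : 0 ≤ B) (hρ : 0 ≤ ρ) :
    ∫ ξ in Ioo (0 : ℝ) 1 ∩ (Icc ρ (1 - ρ))ᶜ, (A + B * f ξ) ≤
      2 * ρ * A + B * ∫ ξ in Ioo (0 : ℝ) 1, f ξ := by
  set T := Ioo (0 : ℝ) 1 ∩ (Icc ρ (1 - ρ))ᶜ with hT
  have hTs : T ⊆ Ioo 0 1 := inter_subset_left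
  have hfT : IntegrableOn f T := hfi.mono_set hTs
  have hvT : volume T ≤ ENNReal.ofReal (2 * ρ) := by
    have hsub : T ⊆ Ico 0 ρ ∪ Ioc (1 - ρ) 1 := by
      rintro ξ ⟨h1, h2⟩
      by_cases h : ξ < ρ
      · exact Or.inl ⟨h1.1.le, h⟩
      · refine Or.inr ⟨?_, h1.2.le⟩
        by_contra hc
        exact h2 ⟨not_lt.1 h, not_lt.1 hc⟩
    refine (measure_mono hsub).trans ((measure_union_le _ _).trans ?_)
    rw [Real.volume_Ico, Real.volume_Ioc, ← ENNReal.ofReal_add (by linarith) (by linarith)]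
    exact ENNReal.ofReal_le_ofReal (by linarith)
  have hvr : volume.real T ≤ 2 * ρ := ENNReal.toReal_le_of_le_ofReal (by linarith) hvT
  have hconst : IntegrableOn (fun _ : ℝ => A) T :=
    integrableOn_const (hvT.trans_lt ENNReal.ofReal_lt_top).ne
  rw [integral_add hconst (hfT.const_mul B), integral_const_mul, setIntegral_const, smul_eq_mul]
  have h1 : ∫ ξ in T, f ξ ≤ ∫ ξ in Ioo (0 : ℝ) 1, f ξ :=
    setIntegral_mono_set hfi (.of_forall hf) hTs.eventuallyLE
  have h2 := mul_le_mul_of_nonneg_left h1 hB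
  have h3 := mul_le_mul_of_nonneg_right hvr hA
  linarith

theorem exists_tail_lt {g : ℝ → ℝ} (hg : IntegrableOn g (Ioo 0 1)) {s ρ₁ : ℝ} (hs : 0 < s)
    (hρ₁ : 0 < ρ₁) :
    ∃ ρ ∈ Ioo 0 ρ₁, ∫ ξ in Ioo (0 : ℝ) 1 ∩ (Icc ρ (1 - ρ))ᶜ, g ξ < s := by
  have hanti : Tendsto (fun k : ℕ => ∫ ξ in Ioo (0 : ℝ) 1 ∩
      (Icc (1 / ((k : ℝ) + 1)) (1 - 1 / ((k : ℝ) + 1)))ᶜ, g ξ) atTop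
      (𝓝 (∫ ξ in ⋂ k : ℕ, Ioo (0 : ℝ) 1 ∩
        (Icc (1 / ((k : ℝ) + 1)) (1 - 1 / ((k : ℝ) + 1)))ᶜ, g ξ)) := by
    refine tendsto_setIntegral_of_antitone
      (fun k => measurableSet_Ioo.inter measurableSet_Icc.compl) (fun i j hij => ?_)
      ⟨0, hg.mono_set inter_subset_left⟩
    refine inter_subset_inter_right _ (compl_subset_compl.2 (Icc_subset_Icc ?_ ?_))
    · exact Nat.one_div_le_one_div hij
    · have := Nat.one_div_le_one_div (α := ℝ) hij
      linarith
  have hempty : (⋂ k : ℕ, Ioo (0 : ℝ) 1 ∩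
      (Icc (1 / ((k : ℝ) + 1)) (1 - 1 / ((k : ℝ) + 1)))ᶜ) = ∅ := by
    refine eq_empty_of_forall_notMem fun ξ hξ => ?_
    rw [mem_iInter] at hξ
    have h0 := (hξ 0).1
    obtain ⟨k, hk⟩ := exists_nat_one_div_lt (show (0 : ℝ) < min ξ (1 - ξ) from
      lt_min h0.1 (by linarith [h0.2]))
    refine (hξ k).2 ⟨(hk.trans_le (min_le_left _ _)).le, ?_⟩
    linarith [hk.trans_le (min_le_right ξ (1 - ξ))]
  rw [hempty, setIntegral_empty] at hanti
  obtain ⟨k, h1, h2⟩ := ((hanti.eventually (gt_mem_nhds hs)).and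
    ((tendsto_one_div_add_atTop_nhds_zero_nat (𝕜 := ℝ)).eventually (gt_mem_nhds hρ₁))).exists
  exact ⟨1 / ((k : ℝ) + 1), ⟨by positivity, h2⟩, h1⟩

/-- Quantiles are close to `R` when the interquantile distance, the displacement of the mean and
the tails are small. -/
theorem abs_pseudoInverse_sub_le {ν : Measure ℝ} [IsProbabilityMeasure ν] (hν : ∀ᵐ r ∂ν, 0 ≤ r)
    {α R ρ ξ Θ E C₁ : ℝ} (hw : Integrable (fun r => 1 + r ^ α) ν) (hC₁ : 0 ≤ C₁)
    (hC : ∀ᵐ η ∂ν, |η - R| ≤ C₁ * (1 + η ^ α)) (hρ : ρ ∈ Ioo (0 : ℝ) (1 / 2))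
    (hξ : ξ ∈ Icc ρ (1 - ρ))
    (hΘ : ∫ r in (Icc (pseudoInverse ν ρ) (pseudoInverse ν (1 - ρ)))ᶜ, (1 + r ^ α) ∂ν ≤ Θ)
    (hΘ1 : Θ ≤ 1 / 2) (hΘE : C₁ * Θ ≤ E / 8) (hE : 0 ≤ E)
    (hL : (pseudoInverse ν (1 - ρ) - pseudoInverse ν ρ) ^ 2 + ((∫ r, r ∂ν) - R) ^ 2 ≤ (E / 8) ^ 2) :
    |pseudoInverse ν ξ - R| ≤ 3 / 4 * E := by
  have hmem : pseudoInverse ν ξ ∈ Icc (pseudoInverse ν ρ) (pseudoInverse ν (1 - ρ)) :=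
    ⟨pseudoInverse_mono hν hξ.1 (by linarith [hξ.2, hρ.1]),
      pseudoInverse_mono hν hξ.2 (by linarith [hρ.1])⟩
  have hw1 : ∀ᵐ η ∂ν, 1 ≤ 1 + η ^ α := by
    filter_upwards [hν] with η hη
    linarith [Real.rpow_nonneg hη α]
  have h1 := abs_sub_le_of_mean hw hw1 hC₁ hC hΘ hmem
  have h2 : pseudoInverse ν (1 - ρ) - pseudoInverse ν ρ ≤ E / 8 := by
    refine le_of_sq_le_sq ?_ (by positivity)
    linarith [sq_nonneg ((∫ r, r ∂ν) - R)]
  have h3 : |(∫ r, r ∂ν) - R| ≤ E / 8 := by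
    refine abs_le_of_sq_le_sq ?_ (by positivity)
    linarith [sq_nonneg (pseudoInverse ν (1 - ρ) - pseudoInverse ν ρ)]
  have h4 := mul_le_mul_of_nonneg_left hΘ1 (abs_nonneg (pseudoInverse ν ξ - R))
  rw [add_mul] at h1
  linarith

/-- Quantiles and mean of a measure with a small moment about `R`. -/
theorem initial_deviation {ν : Measure ℝ} [IsProbabilityMeasure ν] (hν : ∀ᵐ r ∂ν, 0 ≤ r)
    {α R ρ s : ℝ} (hα : 1 ≤ α) (hs : 0 < s) (hρ : ρ ∈ Ioo (0 : ℝ) (1 / 2))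
    (hi : Integrable (fun r => |r - R| ^ α) ν) (hM : ∫ r, |r - R| ^ α ∂ν < ρ * s ^ α) :
    pseudoInverse ν (1 - ρ) - pseudoInverse ν ρ ≤ 2 * s ∧ |(∫ r, r ∂ν) - R| ≤ 2 * s := by
  have hm := aemeasurable_pseudoInverse hν
  have hmap := map_pseudoInverse hν
  have hsα : 0 < s ^ α := Real.rpow_pos_of_pos hs α
  have h0 : ∀ r : ℝ, 0 ≤ |r - R| ^ α := fun r => Real.rpow_nonneg (abs_nonneg _) α
  have hfi : IntegrableOn (fun ξ => |pseudoInverse ν ξ - R| ^ α) (Ioo 0 1) := by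
    rw [← hmap] at hi
    exact (integrable_map_measure (measurable_abs_sub_rpow R α).aestronglyMeasurable hm).1 hi
  have hval : ∫ r, |r - R| ^ α ∂ν = ∫ ξ in Ioo (0 : ℝ) 1, |pseudoInverse ν ξ - R| ^ α := by
    conv_lhs => rw [← hmap]
    exact integral_map hm (measurable_abs_sub_rpow R α).aestronglyMeasurable
  have hsmall : ∀ T : Set ℝ, MeasurableSet T → T ⊆ Ioo 0 1 → volume T = ENNReal.ofReal ρ →
      (∀ ξ ∈ T, s ≤ |pseudoInverse ν ξ - R|) → False := by
    intro T hTm hTs hvT hT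
    have h1 : ∫ ξ in T, s ^ α ≤ ∫ ξ in T, |pseudoInverse ν ξ - R| ^ α := by
      refine setIntegral_mono_on (integrableOn_const (by rw [hvT]; exact ENNReal.ofReal_ne_top))
        (hfi.mono_set hTs) hTm fun ξ hξ => ?_
      exact Real.rpow_le_rpow hs.le (hT ξ hξ) (by linarith)
    have h2 : ∫ ξ in T, |pseudoInverse ν ξ - R| ^ α ≤
        ∫ ξ in Ioo (0 : ℝ) 1, |pseudoInverse ν ξ - R| ^ α :=
      setIntegral_mono_set hfi (.of_forall fun ξ => h0 _) hTs.eventuallyLE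
    rw [setIntegral_const, smul_eq_mul, measureReal_def, hvT,
      ENNReal.toReal_ofReal hρ.1.le] at h1
    linarith
  constructor
  · have hlow : R - s ≤ pseudoInverse ν ρ := by
      by_contra hc
      have hc := not_le.1 hc
      refine hsmall (Ioc 0 ρ) measurableSet_Ioc (fun ξ hξ => ⟨hξ.1, by linarith [hξ.2, hρ.2]⟩)
        (by rw [Real.volume_Ioc, sub_zero]) fun ξ hξ => ?_
      have := pseudoInverse_mono hν hξ.2 (by linarith [hρ.2])
      linarith [neg_abs_le (pseudoInverse ν ξ - R)]
    have hupp : pseudoInverse ν (1 - ρ) ≤ R + s := by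
      by_contra hc
      have hc := not_le.1 hc
      refine hsmall (Ico (1 - ρ) 1) measurableSet_Ico
        (fun ξ hξ => ⟨by linarith [hξ.1, hρ.2], hξ.2⟩)
        (by rw [Real.volume_Ico]; congr 1; ring) fun ξ hξ => ?_
      have := pseudoInverse_mono hν hξ.1 hξ.2
      linarith [le_abs_self (pseudoInverse ν ξ - R)]
    linarith
  · have hpt : ∀ r : ℝ, |r - R| ≤ s + s / s ^ α * |r - R| ^ α := by
      intro r
      have hnn := h0 r
      rcases le_total |r - R| s with h | h
      · have : 0 ≤ s / s ^ α * |r - R| ^ α := by positivity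
        linarith
      · have h1 : 1 ≤ |r - R| / s := (one_le_div hs).2 h
        have h2 := Real.rpow_le_rpow_of_exponent_le h1 hα
        rw [Real.rpow_one, Real.div_rpow (abs_nonneg _) hs.le] at h2
        have h3 : s / s ^ α * |r - R| ^ α = s * (|r - R| ^ α / s ^ α) := by ring
        have h4 : |r - R| = s * (|r - R| / s) := by field_simp
        rw [h3]
        have h5 := mul_le_mul_of_nonneg_left h2 hs.le
        linarith
    have hii : Integrable (fun r => s + s / s ^ α * |r - R| ^ α) ν :=
      (integrable_const s).add (hi.const_mul _)
    have hid : Integrable (fun r : ℝ => r) ν := integrable_id_of_weight (C₁ := 1) hii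
      (.of_forall fun r => by rw [one_mul]; exact hpt r)
    have e1 : (∫ r, r ∂ν) - R = ∫ r, (r - R) ∂ν := by
      rw [integral_sub hid (integrable_const R)]
      simp
    have h1 : ∫ r, |r - R| ∂ν ≤ ∫ r, (s + s / s ^ α * |r - R| ^ α) ∂ν :=
      integral_mono (hid.sub (integrable_const R)).abs hii hpt
    rw [integral_add (integrable_const s) (hi.const_mul _), integral_const_mul] at h1
    have h2 : s / s ^ α * ∫ r, |r - R| ^ α ∂ν ≤ s / s ^ α * (ρ * s ^ α) :=
      mul_le_mul_of_nonneg_left hM.le (by positivity)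
    have h3 : s / s ^ α * (ρ * s ^ α) = s * ρ := by field_simp
    have h4 : s * ρ ≤ s * 1 := mul_le_mul_of_nonneg_left (by linarith [hρ.2]) hs.le
    rw [e1]
    refine abs_integral_le_integral_abs.trans ?_
    simp only [integral_const, probReal_univ, smul_eq_mul, one_mul] at h1
    linarith

end

end RadialShell

namespace RadialShell

noncomputable section

theorem pseudoInverse_le_max {N : ℕ} {ω : ℝ → ℝ → ℝ} {μ : ℝ → Measure (EuclideanSpace ℝ (Fin N))}
    (hφ : PseudoInverseEquation ω μ) {K : ℝ} (hneg : ∀ r, K ≤ r → ∀ η, 0 ≤ η → ω r η ≤ 0)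
    {ξ t : ℝ} (hξ : ξ ∈ Ioo (0 : ℝ) 1) (ht : 0 ≤ t) :
    pseudoInverse (radialPart (μ t)) ξ ≤ max (pseudoInverse (radialPart (μ 0)) ξ) K := by
  refine (hφ ξ hξ).le_max le_rfl ht fun τ _ hτ => ?_
  refine integral_nonpos_of_ae ?_
  filter_upwards [ae_nonneg_radialPart (μ τ)] with η hη
  exact hneg _ hτ.le η hη

/-- Trajectories of a confining velocity field eventually stay in `[R - δ, R + δ]`. -/
theorem SolvesODE.eventually_mem_Icc {f : ℝ → ℝ} {V : ℝ → ℝ → ℝ}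
    (hf : SolvesODE f fun t => V t (f t)) {R δ c : ℝ} (hc : 0 < c) (hδ : δ < R) (hf0 : 0 < f 0)
    (hnn : ∀ t, 0 ≤ f t) (hlow : ∀ t, 0 ≤ t → ∀ r ∈ Icc 0 (R - δ), c * r ≤ V t r)
    (hupp : ∀ t, 0 ≤ t → ∀ r, R + δ ≤ r → V t r ≤ -c) :
    ∃ T, 0 ≤ T ∧ ∀ t, T ≤ t → f t ∈ Icc (R - δ) (R + δ) := by
  obtain ⟨T₁, hT₁, h₁⟩ := hf.eventually_le (U := R + δ) hc fun τ hτ h => hupp τ hτ _ h.le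
  set p := min (f 0) (R - δ) with hp
  have hp0 : 0 < p := lt_min hf0 (by linarith)
  have hge : ∀ t, 0 ≤ t → p ≤ f t := by
    intro t ht
    have h2 := hf.neg.le_max (K := -(R - δ)) le_rfl ht fun τ hτ h => by
      have h3 := hlow τ hτ.1 (f τ) ⟨hnn τ, by linarith⟩
      have : 0 ≤ c * f τ := mul_nonneg hc.le (hnn τ)
      linarith
    rw [max_neg_neg] at h2
    linarith
  obtain ⟨T₂, hT₂, h₂⟩ := hf.neg.eventually_le (c := c * p) (U := -(R - δ)) (by positivity)
    fun τ hτ h => by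
      have h3 := hlow τ hτ (f τ) ⟨hnn τ, by linarith⟩
      have h4 := mul_le_mul_of_nonneg_left (hge τ hτ) hc.le
      linarith
  refine ⟨max T₁ T₂, le_max_of_le_left hT₁, fun t ht => ⟨?_, h₁ t ((le_max_left _ _).trans ht)⟩⟩
  have := h₂ t ((le_max_right _ _).trans ht)
  linarith

/-- Pointwise convergence of the pseudo-inverses under a fixed integrable weight gives convergence
in transport distance. -/
theorem tendsto_transportDist_dirac {ν : ℝ → Measure ℝ} {α R : ℝ} (hα : 1 ≤ α) (hR : 0 ≤ R)
    (hprob : ∀ t, 0 ≤ t → IsProbabilityMeasure (ν t)) (hν : ∀ t, ∀ᵐ r ∂(ν t), 0 ≤ r)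
    {g : ℝ → ℝ} (hgi : IntegrableOn g (Ioo 0 1))
    (hg : ∀ t, 0 ≤ t → ∀ ξ ∈ Ioo (0 : ℝ) 1, 1 + pseudoInverse (ν t) ξ ^ α ≤ g ξ)
    (hlim : ∀ ξ ∈ Ioo (0 : ℝ) 1, Tendsto (fun t => pseudoInverse (ν t) ξ) atTop (𝓝 R)) :
    Tendsto (fun t => transportDist α (ν t) (Measure.dirac R)) atTop (𝓝 0) := by
  have hα0 : 0 < α := by linarith
  have hval : ∀ t, 0 ≤ t → transportDist α (ν t) (Measure.dirac R) =
      (∫⁻ ξ in Ioo (0 : ℝ) 1, ENNReal.ofReal (|pseudoInverse (ν t) ξ - R| ^ α)) ^ (1 / α) := by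
    intro t ht
    have := hprob t ht
    rw [transportDist_dirac, lintegral_edist_rpow _ (fun r => r) hα0.le]
    conv_lhs => rw [← map_pseudoInverse (hν t)]
    rw [lintegral_map' (measurable_abs_sub_rpow R α).ennreal_ofReal.aemeasurable
      (aemeasurable_pseudoInverse (hν t))]
  have hmain : Tendsto (fun t => ∫⁻ ξ in Ioo (0 : ℝ) 1,
      ENNReal.ofReal (|pseudoInverse (ν t) ξ - R| ^ α)) atTop (𝓝 0) := by
    have h0 : (0 : ℝ≥0∞) = ∫⁻ _ξ in Ioo (0 : ℝ) 1, 0 := by simp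
    rw [h0]
    have hgi' : IntegrableOn (fun ξ => g ξ + R ^ α) (Ioo 0 1) :=
      hgi.add (integrableOn_const (by simp))
    refine tendsto_lintegral_filter_of_dominated_convergence'
      (fun ξ => ENNReal.ofReal (g ξ + R ^ α)) ?_ ?_ ?_ ?_
    · filter_upwards [eventually_ge_atTop 0] with t ht
      have := hprob t ht
      exact (measurable_abs_sub_rpow R α).ennreal_ofReal.comp_aemeasurable
        (aemeasurable_pseudoInverse (hν t))
    · filter_upwards [eventually_ge_atTop 0] with t ht
      filter_upwards [ae_restrict_mem measurableSet_Ioo] with ξ hξ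
      refine ENNReal.ofReal_le_ofReal ?_
      have hφ := pseudoInverse_nonneg (ν t) ξ
      have hgξ := hg t ht ξ hξ
      have hRα : 0 ≤ R ^ α := Real.rpow_nonneg hR α
      have hφα : 0 ≤ pseudoInverse (ν t) ξ ^ α := Real.rpow_nonneg hφ α
      rcases le_total (pseudoInverse (ν t) ξ) R with h | h
      · have h1 : |pseudoInverse (ν t) ξ - R| ≤ R := by
          rw [abs_of_nonpos (by linarith)]
          linarith
        have := Real.rpow_le_rpow (abs_nonneg _) h1 hα0.le
        linarith
      · have h1 : |pseudoInverse (ν t) ξ - R| ≤ pseudoInverse (ν t) ξ := by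
          rw [abs_of_nonneg (by linarith)]
          linarith
        have := Real.rpow_le_rpow (abs_nonneg _) h1 hα0.le
        linarith
    · exact hgi'.lintegral_lt_top.ne
    · filter_upwards [ae_restrict_mem measurableSet_Ioo] with ξ hξ
      have h1 : Tendsto (fun t => |pseudoInverse (ν t) ξ - R| ^ α) atTop (𝓝 (|R - R| ^ α)) :=
        (((hlim ξ hξ).sub_const R).abs).rpow_const (Or.inr hα0.le)
      rw [sub_self, abs_zero, Real.zero_rpow hα0.ne'] at h1
      have := ENNReal.tendsto_ofReal h1
      rwa [ENNReal.ofReal_zero] at this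
  have hpow := (ENNReal.continuous_rpow_const (y := 1 / α)).tendsto 0
  rw [ENNReal.zero_rpow_of_pos (by positivity)] at hpow
  refine (hpow.comp hmain).congr' ?_
  filter_upwards [eventually_ge_atTop 0] with t ht
  exact (hval t ht).symm

variable {n : ℕ} {a b R : ℝ}

set_option maxHeartbeats 1600000 in
/-- Asymptotic stability of the shell in transport distance under the confinement controls. -/
theorem isStableShell_of_controls (hb : 1 - (n : ℝ) < b) (hab : b < a) (hR : 0 < R)
    (hRR : pkernel n a b R R = 0) (h₁ : partial₁ (pkernel n a b) R R < 0)
    (h₂ : partial₁ (pkernel n a b) R R + partial₂ (pkernel n a b) R R < 0) {α lam : ℝ}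
    (hα : 1 ≤ α) (hlam : 0 < lam) (hctl : ConfinementControls (pkernel n a b) R α lam) :
    IsStableShell (n + 2) (powerPotential (n + 2) a b) R α := by
  have hb' : -(n : ℝ) < b := by linarith
  have hα0 : 0 < α := by linarith
  set γ₀ := -max (partial₁ (pkernel n a b) R R)
      (partial₁ (pkernel n a b) R R + partial₂ (pkernel n a b) R R) with hγ₀
  have hγ₀pos : 0 < γ₀ := by
    rw [hγ₀, neg_pos]
    exact max_lt h₁ h₂
  obtain ⟨δ, hδ, hδR, hlin⟩ := exists_nearlyLinear (contDiffOn_pkernel hb hab) hR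
    (show 0 < γ₀ / 3 by positivity) (half_pos hR)
  obtain ⟨K₀, hK₀, hneg₀⟩ := exists_pkernel_nonpos hb' hab
  set K := max K₀ (2 * R) with hKdef
  have hK : 0 < K := hK₀.trans_le (le_max_left _ _)
  have hneg : ∀ r, K ≤ r → ∀ η, 0 ≤ η → pkernel n a b r η ≤ 0 := fun r hr =>
    hneg₀ r ((le_max_left _ _).trans hr)
  have hw := weightBounds_of_controls hb' hab hR hα hlam hctl
  have hIpos : ∀ r ∈ Icc (R - δ) (R + δ), 0 < r := fun r hr => by linarith [hr.1]
  have h2α : (0 : ℝ) < 2 ^ α := Real.rpow_pos_of_pos two_pos α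
  have hKα : 0 ≤ K ^ α := Real.rpow_nonneg hK.le α
  obtain ⟨C, hC, hdiss⟩ := exists_dissipation (W := 1 + K ^ α + 2 ^ α) (γ := γ₀) hlin hRR hw
    (by positivity) hδ.le (fun r hr => (hIpos r hr).le)
    ⟨1 + (R + δ) ^ α, fun r hr => by
      have := Real.rpow_le_rpow (hIpos r hr).le hr.2 hα0.le
      linarith⟩ (by rw [hγ₀, neg_neg]; exact le_max_left _ _)
    (by rw [hγ₀, neg_neg]; exact le_max_right _ _)
  have hrate : 2 * γ₀ - 3 * (γ₀ / 3) = γ₀ := by ring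
  rw [hrate] at hdiss
  obtain ⟨c, δ₀, Θ₀, hc, hδ₀, hΘ₀, hconf⟩ := exists_confining_velocity hb hab hR hα hlam hctl hδ
  set δ₁ := min δ₀ δ with hδ₁def
  have hδ₁ : 0 < δ₁ := lt_min hδ₀ hδ
  set θ := (δ₁ / 8) ^ 2 with hθ
  have hθ0 : 0 < θ := by positivity
  set Θ₁ := min (min (1 / 2) Θ₀) (min (δ₁ / (8 * (1 + R))) (γ₀ * θ / (2 * (C + 1)))) with hΘ₁def
  have hΘ₁ : 0 < Θ₁ := by positivity
  have hΘ₁a : Θ₁ ≤ 1 / 2 := (min_le_left _ _).trans (min_le_left _ _)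
  have hΘ₁b : Θ₁ ≤ Θ₀ := (min_le_left _ _).trans (min_le_right _ _)
  have hΘ₁c : (1 + R) * Θ₁ ≤ δ₁ / 8 := by
    have : Θ₁ ≤ δ₁ / (8 * (1 + R)) := (min_le_right _ _).trans (min_le_left _ _)
    rw [le_div_iff₀ (by positivity)] at this
    linarith
  have hΘ₁d : C * Θ₁ < γ₀ * θ := by
    have : Θ₁ ≤ γ₀ * θ / (2 * (C + 1)) := (min_le_right _ _).trans (min_le_right _ _)
    rw [le_div_iff₀ (by positivity)] at this
    have : 0 < γ₀ * θ := by positivity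
    nlinarith
  set ρ₀ := min (1 / 4) (Θ₁ / (4 * (1 + K ^ α))) with hρ₀def
  have hρ₀ : ρ₀ ∈ Ioo (0 : ℝ) (1 / 2) :=
    ⟨by positivity, (min_le_left _ _).trans_lt (by norm_num)⟩
  have hρ₀K : 2 * ρ₀ * (1 + K ^ α) ≤ Θ₁ / 2 := by
    have : ρ₀ ≤ Θ₁ / (4 * (1 + K ^ α)) := min_le_right _ _
    rw [le_div_iff₀ (by positivity)] at this
    linarith
  set ε₁ := min (min 1 (Θ₁ / (2 * 2 ^ α))) (ρ₀ * (δ₁ / 32) ^ α) with hε₁def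
  have hε₁ : 0 < ε₁ := by
    have := hρ₀.1
    positivity
  refine ⟨ε₁ ^ (1 / α), Real.rpow_pos_of_pos hε₁ _, ?_⟩
  intro μ hμ hφeq hzero hdist
  have hprob : ∀ t, 0 ≤ t → IsProbabilityMeasure (radialPart (μ t)) := fun t ht =>
    isProbabilityMeasure_radialPart (hμ.isProbabilityMeasure t ht)
  have hνnn : ∀ t, ∀ᵐ r ∂(radialPart (μ t)), 0 ≤ r := fun t => ae_nonneg_radialPart (μ t)
  set φ : ℝ → ℝ → ℝ := fun t ξ => pseudoInverse (radialPart (μ t)) ξ with hφdef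
  have hφnn : ∀ t ξ, 0 ≤ φ t ξ := fun t ξ => pseudoInverse_nonneg _ _
  have hprob0 := hprob 0 le_rfl
  obtain ⟨hMi, hM⟩ := moment_lt_of_transportDist_lt hα0 hε₁ hdist
  have hM1 : ∫ r, |r - R| ^ α ∂(radialPart (μ 0)) < 1 :=
    hM.trans_le ((min_le_left _ _).trans (min_le_left _ _))
  have hM2 : 2 ^ α * ∫ r, |r - R| ^ α ∂(radialPart (μ 0)) ≤ Θ₁ / 2 := by
    have h3 : ∫ r, |r - R| ^ α ∂(radialPart (μ 0)) ≤ Θ₁ / (2 * 2 ^ α) :=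
      hM.le.trans ((min_le_left _ _).trans (min_le_right _ _))
    rw [le_div_iff₀ (by positivity)] at h3
    linarith
  have hM3 : ∫ r, |r - R| ^ α ∂(radialPart (μ 0)) < ρ₀ * (δ₁ / 32) ^ α :=
    hM.trans_le (min_le_right _ _)
  set f : ℝ → ℝ := fun ξ => |φ 0 ξ - R| ^ α with hf
  have hf0 : ∀ ξ, 0 ≤ f ξ := fun ξ => Real.rpow_nonneg (abs_nonneg _) α
  have hfi : IntegrableOn f (Ioo 0 1) := by
    rw [← map_pseudoInverse (hνnn 0)] at hMi
    exact (integrable_map_measure (measurable_abs_sub_rpow R α).aestronglyMeasurable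
      (aemeasurable_pseudoInverse (hνnn 0))).1 hMi
  have hfval : ∫ ξ in Ioo (0 : ℝ) 1, f ξ = ∫ r, |r - R| ^ α ∂(radialPart (μ 0)) := by
    conv_rhs => rw [← map_pseudoInverse (hνnn 0)]
    exact (integral_map (aemeasurable_pseudoInverse (hνnn 0))
      (measurable_abs_sub_rpow R α).aestronglyMeasurable).symm
  set g : ℝ → ℝ := fun ξ => (1 + K ^ α) + 2 ^ α * f ξ with hg
  have hgi : IntegrableOn g (Ioo 0 1) :=
    (integrableOn_const (by simp)).add (hfi.const_mul _)
  have hgint : ∫ ξ in Ioo (0 : ℝ) 1, g ξ ≤ 1 + K ^ α + 2 ^ α := by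
    have e1 : ∫ ξ in Ioo (0 : ℝ) 1, g ξ = (1 + K ^ α) + 2 ^ α * ∫ ξ in Ioo (0 : ℝ) 1, f ξ := by
      have hc₁ : Integrable (fun _ : ℝ => 1 + K ^ α) (volume.restrict (Ioo (0 : ℝ) 1)) :=
        integrable_const _
      have hc₂ : Integrable (fun ξ => 2 ^ α * f ξ) (volume.restrict (Ioo (0 : ℝ) 1)) :=
        hfi.const_mul _
      rw [hg, integral_add hc₁ hc₂, integral_const_mul]
      simp
    rw [e1, hfval]
    have := mul_le_mul_of_nonneg_left hM1.le h2α.le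
    linarith
  have hwg : ∀ t, 0 ≤ t → ∀ ξ ∈ Ioo (0 : ℝ) 1, 1 + φ t ξ ^ α ≤ g ξ := fun t ht ξ hξ =>
    weight_le_of_le_max hα0.le (hφnn t ξ) (le_max_right _ _) hK.le
      (pseudoInverse_le_max hφeq hneg hξ ht)
  set Θ : ℝ → ℝ := fun ρ => ∫ ξ in Ioo (0 : ℝ) 1 ∩ (Icc ρ (1 - ρ))ᶜ, g ξ with hΘ
  have hΘρ₀ : Θ ρ₀ ≤ Θ₁ := by
    have h3 := setIntegral_tail_le hfi hf0 (A := 1 + K ^ α) (by positivity) h2α.le hρ₀.1.le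
    rw [hfval] at h3
    have h4 : Θ ρ₀ ≤ 2 * ρ₀ * (1 + K ^ α) +
      2 ^ α * ∫ r, |r - R| ^ α ∂(radialPart (μ 0)) := h3
    linarith
  have hwt : ∀ t, 0 ≤ t → Integrable (fun r => 1 + r ^ α) (radialPart (μ t)) ∧
      ∫ r, (1 + r ^ α) ∂(radialPart (μ t)) ≤ ∫ ξ in Ioo (0 : ℝ) 1, g ξ ∧
      ∀ ρ ∈ Ioo (0 : ℝ) (1 / 2), ∫ r in (Icc (φ t ρ) (φ t (1 - ρ)))ᶜ, (1 + r ^ α)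
        ∂(radialPart (μ t)) ≤ Θ ρ := fun t ht => by
    have := hprob t ht
    exact weight_of_pseudoInverse (hνnn t) hgi (hwg t ht)
  have hadm : ∀ t, 0 ≤ t → AdmissibleMeasure (pkernel n a b) (Ici 0) (fun r => 1 + r ^ α)
      (radialPart (μ t)) := fun t ht => by
    have := hprob t ht
    refine ⟨hνnn t, (hwt t ht).1, fun r hr => ?_, ?_⟩
    · rcases (show (0 : ℝ) ≤ r from hr).eq_or_lt with h | h
      · subst h
        have e : pkernel n a b 0 = fun _ => 0 := funext (pkernel_zero_left n a b)
        rw [e]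
        exact integrable_const 0
      · exact hμ.velocity_integrable t ht r h
    · exact aestronglyMeasurable_radialVelocity (continuousOn_pkernel hb' hab)
        (pkernel_zero_left n a b) (hνnn t)
  have hdistw : ∀ t, ∀ᵐ η ∂(radialPart (μ t)), |η - R| ≤ (1 + R) * (1 + η ^ α) := fun t =>
    (hνnn t).mono fun η hη => hw.dist_le η hη
  set m : ℝ → ℝ := fun t => ∫ r, r ∂(radialPart (μ t)) with hm
  set L : ℝ → ℝ → ℝ := fun ρ t => (φ t (1 - ρ) - φ t ρ) ^ 2 + (m t - R) ^ 2 with hL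
  have hρmem : ∀ ρ ∈ Ioo (0 : ℝ) (1 / 2), ρ ∈ Ioo (0 : ℝ) 1 ∧ 1 - ρ ∈ Ioo (0 : ℝ) 1 := fun ρ hρ =>
    ⟨⟨hρ.1, by linarith [hρ.2]⟩, by linarith [hρ.2], by linarith [hρ.1]⟩
  have hode : ∀ ρ ∈ Ioo (0 : ℝ) (1 / 2), SolvesODE (L ρ) fun t =>
      2 * (φ t (1 - ρ) - φ t ρ) * (radialVelocity (pkernel n a b) (radialPart (μ t)) (φ t (1 - ρ)) -
        radialVelocity (pkernel n a b) (radialPart (μ t)) (φ t ρ)) +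
      2 * (m t - R) * ((∫ r, radialVelocity (pkernel n a b) (radialPart (μ t)) r
        ∂(radialPart (μ t))) - 0) := fun ρ hρ =>
    ((hφeq _ (hρmem ρ hρ).2).sub (hφeq _ (hρmem ρ hρ).1)).sq.add
      (hμ.mean.sub (SolvesODE.const R)).sq
  have hbound : ∀ ρ ∈ Ioo (0 : ℝ) (1 / 2), ∀ Θ', Θ ρ ≤ Θ' → ∀ t, 0 ≤ t →
      φ t ρ ∈ Icc (R - δ) (R + δ) →
      φ t (1 - ρ) ∈ Icc (R - δ) (R + δ) →
      2 * (φ t (1 - ρ) - φ t ρ) * (radialVelocity (pkernel n a b) (radialPart (μ t)) (φ t (1 - ρ)) -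
        radialVelocity (pkernel n a b) (radialPart (μ t)) (φ t ρ)) +
      2 * (m t - R) * ((∫ r, radialVelocity (pkernel n a b) (radialPart (μ t)) r
        ∂(radialPart (μ t))) - 0) ≤ -γ₀ * L ρ t + C * Θ' := by
    intro ρ hρ Θ' hΘ' t ht m1 m2
    have := hprob t ht
    rw [sub_zero]
    exact hdiss _ (hprob t ht) (hadm t ht) ((hwt t ht).2.1.trans hgint) _ m1 _ m2
      (pseudoInverse_mono (hνnn t) (by linarith [hρ.2]) (by linarith [hρ.1])) Θ'
      (((hwt t ht).2.2 ρ hρ).trans hΘ')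
  have hclose : ∀ ρ ∈ Ioo (0 : ℝ) (1 / 2), ∀ ξ ∈ Icc ρ (1 - ρ), ∀ E, 0 ≤ E → Θ ρ ≤ 1 / 2 →
      (1 + R) * Θ ρ ≤ E / 8 → ∀ t, 0 ≤ t → L ρ t ≤ (E / 8) ^ 2 → |φ t ξ - R| ≤ 3 / 4 * E := by
    intro ρ hρ ξ hξ E hE hΘ1 hΘE t ht hLE
    have := hprob t ht
    exact abs_pseudoInverse_sub_le (hνnn t) (hwt t ht).1 (by positivity) (hdistw t) hρ hξ
      ((hwt t ht).2.2 ρ hρ) hΘ1 hΘE hE hLE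
  -- the core `[ρ₀, 1 - ρ₀]` stays close to `R`
  have hΘR : (1 + R) * Θ ρ₀ ≤ δ₁ / 8 :=
    (mul_le_mul_of_nonneg_left hΘρ₀ (by positivity)).trans hΘ₁c
  have hcore : ∀ t, 0 ≤ t → L ρ₀ t < θ → ∀ ξ ∈ Icc ρ₀ (1 - ρ₀), |φ t ξ - R| ≤ δ₁ := by
    intro t ht hLt ξ hξ
    have := hclose ρ₀ hρ₀ ξ hξ δ₁ hδ₁.le (hΘρ₀.trans hΘ₁a) hΘR t ht hLt.le
    linarith
  have hL0 : L ρ₀ 0 < θ := by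
    obtain ⟨d1, d2⟩ := initial_deviation (hνnn 0) hα (show 0 < δ₁ / 32 by positivity) hρ₀ hMi hM3
    have h3 : 0 ≤ φ 0 (1 - ρ₀) - φ 0 ρ₀ := by
      have := pseudoInverse_mono (hνnn 0) (show ρ₀ ≤ 1 - ρ₀ by linarith [hρ₀.2])
        (show 1 - ρ₀ < 1 by linarith [hρ₀.1])
      simp only [hφdef]
      linarith
    have h4 : (φ 0 (1 - ρ₀) - φ 0 ρ₀) ^ 2 ≤ (2 * (δ₁ / 32)) ^ 2 := pow_le_pow_left₀ h3 d1 2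
    have h5 : (m 0 - R) ^ 2 ≤ (2 * (δ₁ / 32)) ^ 2 :=
      sq_le_sq' (abs_le.1 d2).1 (abs_le.1 d2).2
    have h6 : 0 < δ₁ ^ 2 := by positivity
    have h7 : L ρ₀ 0 ≤ (2 * (δ₁ / 32)) ^ 2 + (2 * (δ₁ / 32)) ^ 2 := add_le_add h4 h5
    refine h7.trans_lt ?_
    rw [hθ]
    ring_nf
    linarith
  have hIcc : ∀ x d : ℝ, |x - R| ≤ d → x ∈ Icc (R - d) (R + d) := fun x d h => by
    rw [← Real.closedBall_eq_Icc]; exact h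
  have hLt : ∀ t, 0 ≤ t → L ρ₀ t < θ := fun t ht =>
    (hode ρ₀ hρ₀).lt_of_damped hγ₀pos hL0 hΘ₁d (fun τ hτ h => by
      have k := hcore τ hτ h
      have hρle : ρ₀ ≤ 1 - ρ₀ := by linarith [hρ₀.2]
      exact hbound ρ₀ hρ₀ Θ₁ hΘρ₀ τ hτ
        (hIcc _ _ ((k ρ₀ ⟨le_rfl, hρle⟩).trans (min_le_right _ _)))
        (hIcc _ _ ((k (1 - ρ₀) ⟨hρle, le_rfl⟩).trans (min_le_right _ _)))) ht
  have hvel : ∀ t, 0 ≤ t →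
      (∀ r ∈ Icc 0 (R - δ), c * r ≤ radialVelocity (pkernel n a b) (radialPart (μ t)) r) ∧
      ∀ r, R + δ ≤ r → radialVelocity (pkernel n a b) (radialPart (μ t)) r ≤ -c := by
    intro t ht
    have k := hcore t ht (hLt t ht)
    have hρle : ρ₀ ≤ 1 - ρ₀ := by linarith [hρ₀.2]
    exact hconf _ (hprob t ht) (hadm t ht) (φ t ρ₀) (φ t (1 - ρ₀))
      (hIcc _ _ ((k ρ₀ ⟨le_rfl, hρle⟩).trans (min_le_left _ _))).1
      (hIcc _ _ ((k (1 - ρ₀) ⟨hρle, le_rfl⟩).trans (min_le_left _ _))).2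
      (((hwt t ht).2.2 ρ₀ hρ₀).trans (hΘρ₀.trans hΘ₁b))
  have henter : ∀ ξ ∈ Ioo (0 : ℝ) 1, ∃ T, 0 ≤ T ∧ ∀ t, T ≤ t → φ t ξ ∈ Icc (R - δ) (R + δ) :=
    fun ξ hξ => (hφeq ξ hξ).eventually_mem_Icc
      (V := fun t => radialVelocity (pkernel n a b) (radialPart (μ t))) hc (by linarith)
      (pseudoInverse_pos (hνnn 0) hzero hξ) (fun t => hφnn t ξ) (fun t ht => (hvel t ht).1)
      fun t ht => (hvel t ht).2
  refine tendsto_transportDist_dirac hα hR.le hprob hνnn hgi hwg fun ξ hξ => ?_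
  rw [Metric.tendsto_atTop]
  intro s hs
  set Θs := min (1 / 2) (min (s / (8 * (1 + R))) (γ₀ * (s / 8) ^ 2 / (2 * (C + 1)))) with hΘs
  have hΘs0 : 0 < Θs := by positivity
  obtain ⟨ρ, hρ, hΘρ⟩ := exists_tail_lt hgi hΘs0 (show 0 < min (1 / 2) (min ξ (1 - ξ)) from
    lt_min (by norm_num) (lt_min hξ.1 (by linarith [hξ.2])))
  have hΘρ : Θ ρ < Θs := hΘρ
  have hρ2 : ρ ∈ Ioo (0 : ℝ) (1 / 2) := ⟨hρ.1, hρ.2.trans_le (min_le_left _ _)⟩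
  have hξρ : ξ ∈ Icc ρ (1 - ρ) := by
    have h3 : ρ < ξ := hρ.2.trans_le ((min_le_right _ _).trans (min_le_left _ _))
    have h4 : ρ < 1 - ξ := hρ.2.trans_le ((min_le_right _ _).trans (min_le_right _ _))
    exact ⟨h3.le, by linarith⟩
  have hs1 : Θ ρ ≤ 1 / 2 := hΘρ.le.trans (min_le_left _ _)
  have hs2 : (1 + R) * Θ ρ ≤ s / 8 := by
    have : Θ ρ ≤ s / (8 * (1 + R)) := hΘρ.le.trans ((min_le_right _ _).trans (min_le_left _ _))
    rw [le_div_iff₀ (by positivity)] at this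
    linarith
  have hs3 : C * Θs / γ₀ < (s / 8) ^ 2 := by
    have h3 : Θs ≤ γ₀ * (s / 8) ^ 2 / (2 * (C + 1)) := (min_le_right _ _).trans (min_le_right _ _)
    rw [le_div_iff₀ (by positivity)] at h3
    have h4 : 0 < γ₀ * (s / 8) ^ 2 := by positivity
    rw [div_lt_iff₀ hγ₀pos]
    nlinarith
  obtain ⟨T₁, hT₁, he₁⟩ := henter ρ (hρmem ρ hρ2).1
  obtain ⟨T₂, hT₂, he₂⟩ := henter (1 - ρ) (hρmem ρ hρ2).2
  set T := max T₁ T₂ with hT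
  have hT0 : 0 ≤ T := le_max_of_le_left hT₁
  have hgron : ∀ t, T ≤ t → L ρ t ≤ L ρ T * Real.exp (-γ₀ * (t - T)) +
      C * Θs / γ₀ * (1 - Real.exp (-γ₀ * (t - T))) := fun t ht =>
    (hode ρ hρ2).gronwall hT0 ht hγ₀pos fun τ hτ =>
      hbound ρ hρ2 Θs hΘρ.le τ (hT0.trans hτ.1.le) (he₁ τ ((le_max_left _ _).trans hτ.1.le))
        (he₂ τ ((le_max_right _ _).trans hτ.1.le))
  have hlimE : Tendsto (fun t => Real.exp (-γ₀ * (t - T))) atTop (𝓝 0) := by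
    refine Real.tendsto_exp_atBot.comp ?_
    exact (tendsto_atTop_add_const_right _ (-T) tendsto_id).const_mul_atTop_of_neg (by linarith)
  have hlimL : Tendsto (fun t => L ρ T * Real.exp (-γ₀ * (t - T)) +
      C * Θs / γ₀ * (1 - Real.exp (-γ₀ * (t - T)))) atTop (𝓝 (C * Θs / γ₀)) := by
    have := (hlimE.const_mul (L ρ T)).add ((hlimE.const_sub 1).const_mul (C * Θs / γ₀))
    simpa using this
  obtain ⟨T', hT'⟩ := eventually_atTop.1 (hlimL.eventually (gt_mem_nhds hs3))
  refine ⟨max T T', fun t ht => ?_⟩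
  have htT : T ≤ t := (le_max_left _ _).trans ht
  have h3 := (hgron t htT).trans (hT' t ((le_max_right _ _).trans ht)).le
  have h4 := hclose ρ hρ2 ξ hξρ s hs.le hs1 hs2 t (hT0.trans htT) h3
  rw [Real.dist_eq]
  exact lt_of_le_of_lt h4 (by linarith)

end

end RadialShell

theorem theorem6p2 (N : ℕ) (hN : 2 ≤ N) (a b : ℝ) (hb : 2 - (N : ℝ) < b) (hab : b < a)
    (W : EuclideanSpace ℝ (Fin N) → ℝ) (hW : W = RadialShell.powerPotential N a b)
    (ω : ℝ → ℝ → ℝ) (hω : ω = RadialShell.kernel N W)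
    (Rab : ℝ) (hR : Rab = RadialShell.shellRadius N a b)
    (bStar : ℝ) (hbStar : bStar = RadialShell.criticalExponent N a) :
    -- existence, uniqueness and value of the radius of the shell steady state
    0 < Rab ∧
    (∀ R : ℝ, 0 < R → (RadialShell.IsSteadyState W (RadialShell.shell N R) ↔ R = Rab)) ∧
    -- strongly singular repulsion: blow-up at the diagonal
    (b ≤ 3 - N →
      ContinuousOn (Function.uncurry ω) RadialShell.quadrant ∧
      ContDiffOn ℝ 1 (Function.uncurry ω) (RadialShell.quadrant \ RadialShell.diag) ∧
      ∀ R : ℝ, 0 < R →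
        Tendsto (fun q : ℝ × ℝ => RadialShell.partial₁ ω q.1 q.2)
          (𝓝[RadialShell.diagᶜ] (R, R)) atTop) ∧
    -- fattening instability condition
    (3 - N < b → b < bStar →
      ContDiffOn ℝ 1 (Function.uncurry ω) RadialShell.quadrant ∧
      0 < RadialShell.partial₁ ω Rab Rab) ∧
    -- strict stability conditions
    (3 - N < a → bStar < b →
      ContDiffOn ℝ 1 (Function.uncurry ω) RadialShell.quadrant ∧
      RadialShell.partial₁ ω Rab Rab < 0 ∧
      RadialShell.partial₁ ω Rab Rab + RadialShell.partial₂ ω Rab Rab < 0) ∧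
    -- dynamical instability
    (b ≤ 3 - N ∨ b < bStar → RadialShell.IsUnstableShell N W Rab) ∧
    -- dynamical stability
    (3 - N < a → bStar < b →
      RadialShell.IsExpStableShell N W Rab ∧
      ∀ α lam : ℝ, 1 ≤ α → 0 < lam → RadialShell.ConfinementControls ω Rab α lam →
        RadialShell.IsStableShell N W Rab α) := by
  subst hW hω hR hbStar
  obtain ⟨n, rfl⟩ : ∃ n, N = n + 2 := ⟨N - 2, by omega⟩
  have h2 : (2 : ℝ) - ((n + 2 : ℕ) : ℝ) = -n := by push_cast; ring
  have h3 : (3 : ℝ) - ((n + 2 : ℕ) : ℝ) = 1 - n := by push_cast; ring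
  rw [h2] at hb
  rw [h3]
  refine ⟨RadialShell.shellRadius_pos hb hab, fun R hR =>
    RadialShell.isSteadyState_shell_iff hb hab hR, fun h => ⟨?_, ?_, fun R hR => ?_⟩,
    fun h h' => ⟨?_, ?_⟩, fun h h' => ?_, fun h => ?_, fun h h' => ?_⟩
  · exact (RadialShell.continuousOn_pkernel hb hab).mono
      (Set.prod_mono subset_rfl Set.Ioi_subset_Ici_self)
  · exact RadialShell.contDiffOn_pkernel_off_diag n a b
  · exact RadialShell.tendsto_partial₁_pkernel hR hb hab h
  · exact RadialShell.contDiffOn_pkernel h hab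
  · exact RadialShell.partial₁_shellRadius_pos h hab rfl h'
  · have hb' := RadialShell.lt_of_criticalExponent_lt h h'
    exact ⟨RadialShell.contDiffOn_pkernel hb' hab,
      RadialShell.partial₁_shellRadius_neg hb' hab rfl h',
      RadialShell.partial_sum_shellRadius_neg hb' hab rfl⟩
  · exact RadialShell.isUnstableShell_shellRadius hb hab h
  · have hb' := RadialShell.lt_of_criticalExponent_lt h h'
    have hR := RadialShell.shellRadius_pos hb hab
    have hRR := (RadialShell.pkernel_diag_eq_zero_iff hb hab hR).2 rfl
    have k₁ := RadialShell.partial₁_shellRadius_neg hb' hab rfl h'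
    have k₂ := RadialShell.partial_sum_shellRadius_neg hb' hab rfl
    exact ⟨RadialShell.isExpStableShell_of_neg hb' hab hR hRR k₁ k₂, fun α lam hα hlam hctl =>
      RadialShell.isStableShell_of_controls hb' hab hR hRR k₁ k₂ hα hlam hctl⟩
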